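/- **Theorem (square-root formula for $H$, irreducible first level).** Let $\Gamma^A$ be coordinates of parity $\epsilon_A$ on a superdomain of dimension $N|N$ with body an open set $U\subseteq\mathbb R^N$. Let $E^{AB}$ be a non-degenerate antisymplectic bi-vector of parity $\epsilon_A+\epsilon_B+1$ with $E^{BA}=-(-1)^{(\epsilon_A+1)(\epsilon_B+1)}E^{AB}$, with antibracket $(f,g)=(f\overleftarrow{\partial}_A)E^{AB}(\overrightarrow{\partial}_B g)$ satisfying the graded Jacobi identity. Let $\rho$ be an invertible even density, and $\Delta=\frac{(-1)^{\epsilon_A}}{2\rho}\overrightarrow\partial_A\,\rho E^{AB}\overrightarrow\partial_B$. For parities $\epsilon_\alpha$, $\alpha=1,\dots,N$, introduce Lagrange multipliers $\lambda^\alpha$ of parity $\epsilon_\alpha$ and antifields $\lambda^*_\alpha$ of parity $\epsilon_\alpha+1$, and put $\Delta_{[1]}=\Delta+(-1)^{\epsilon_\alpha}\frac{\partial}{\partial\lambda^\alpha}\frac{\partial}{\partial\lambda^*_\alpha}$. Let $X=\sum_{k\ge0}(i\hbar)^kX_k$ be an even formal power series in $\hbar,\lambda,\lambda^*$, whose coefficients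 are smooth complex superfunctions of $\Gamma$, such that * $X$ has Planck number $1$, where $\hbar,\lambda^\alpha,\lambda^*_\alpha$ have Planck numbers $1,1,-1$, and $X$ satisfies the Quantum Master Equation $\Delta_{[1]}\exp(\frac i\hbar X)=0$; * $X=G_\alpha\lambda^\alpha+i\hbar H+\lambda^*_\alpha\big(\tfrac12U^\alpha_{\beta\gamma}\lambda^\gamma\lambda^\beta(-1)^{\epsilon_\beta+1}+i\hbar V^\alpha{}_\beta\lambda^\beta+(i\hbar)^2\tilde G^\alpha\big)+O((\lambda^*)^2)$. (The Quantum Master Equation contains the involution $(G_\alpha,G_\beta)=G_\gamma U^\gamma_{\alpha\beta}$, if $U^\gamma_{\alpha\beta}$ is taken with the graded symmetry in $\alpha,\beta$ of the antibracket.) Let $F^\alpha$ be superfunctions of parity $\epsilon_\alpha+1$ such that $\bar\Gamma=\{F^\alpha;G_\alpha\}$ is a coordinate system on the superdomain, and let $J=\mathrm{sdet}(\partial\bar\Gamma^A/\partial\Gamma^B)$. In $\mathrm{sdet}(F^\alpha,G_\beta)$ the index $\alpha$ has parity $\epsilon_\alpha$. Then: 1. If the body of the constrained surface $G_\alpha=0$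 is connected, then on some neighbourhood of it the matrix $(F^\alpha,G_\beta)$ is invertible and, for some branch of the logarithm of the square root, some constant $c\in\mathbb C$ and some superfunctions $A^\alpha$, $$H=-\ln\sqrt{\frac{J\,\mathrm{sdet}(F^\alpha,G_\beta)}{\rho}}+G_\alpha A^\alpha+c .$$ The constant may be discarded: for every constant $c'$, replacing $H$ by $H+c'$ in $X$ gives again a solution of the Quantum Master Equation. 2. (Abelian case.) Suppose that $U^\gamma_{\alpha\beta}=0$ and that the image of the body of the superdomain under the coordinates $(F;G)$ contains with $(F;G)$ also $(tF;G)$ for $0\le t\le1$. Then $(F^\alpha,G_\beta)$ is invertible everywhere and, for every branch of $\ln\sqrt{J\,\mathrm{sdet}(F^\alpha,G_\beta)/\rho}$ on the superdomain, $$H=H_0+k(G),\qquad H_0=-\ln\sqrt{\frac{J\,\mathrm{sdet}(F^\alpha,G_\beta)}{\rho}}-G_\alpha\int_0^1V^\alpha{}_\beta\,\big((F,G)^{-1}\big)^\beta{}_\gamma\Big|_{(F;G)\to(tF;G)}dt\,F^\gamma ,$$ where the integration constant $k(G)$ is a superfunction of the coordinates $(F;G)$ that does not depend on the $F^\alpha$.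 Moreover $H_0$ itself solves the equation $(\Delta G_\beta)-(H_0,G_\beta)=G_\alpha V^\alpha{}_\beta$, which is the equation that the Quantum Master Equation imposes on $H$. -/

import Mathlib

open scoped ContDiff

namespace SuperBV

noncomputable section

/-! ### Smooth complex valued functions on an open set -/

/-- Extension by zero of a function on an open set. -/
def extendZero {N : ℕ} {U : TopologicalSpace.Opens (Fin N → ℝ)} (f : U → ℂ) :
    (Fin N → ℝ) → ℂ :=
  open Classical in fun x => if h : x ∈ U then f ⟨x, h⟩ else 0

theorem extendZero_apply {N : ℕ} {U : TopologicalSpace.Opens (Fin N → ℝ)} (f : U → ℂ)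
    {x : Fin N → ℝ} (hx : x ∈ U) : extendZero f x = f ⟨x, hx⟩ := by
  simp [extendZero, hx]

/-- A function on the open set `U` is smooth. -/
def IsSmooth {N : ℕ} {U : TopologicalSpace.Opens (Fin N → ℝ)} (f : U → ℂ) : Prop :=
  ContDiffOn ℝ ∞ (extendZero f) (U : Set (Fin N → ℝ))

/-- If `g` is smooth on `U`, so is its restriction, as a function on the type `U`. -/
theorem isSmooth_of_contDiffOn {N : ℕ} {U : TopologicalSpace.Opens (Fin N → ℝ)} {f : U → ℂ}
    {g : (Fin N → ℝ) → ℂ} (hg : ContDiffOn ℝ ∞ g (U : Set (Fin N → ℝ)))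
    (h : ∀ x : U, f x = g x) : IsSmooth f :=
  hg.congr fun x hx => by rw [extendZero_apply f hx]; exact h ⟨x, hx⟩

/-- The algebra `C^∞(U; ℂ)`. -/
def Smooth {N : ℕ} (U : TopologicalSpace.Opens (Fin N → ℝ)) : Subalgebra ℂ (U → ℂ) where
  carrier := {f | IsSmooth f}
  mul_mem' {f g} hf hg := isSmooth_of_contDiffOn (ContDiffOn.mul hf hg) fun x => by
    simp [extendZero_apply _ x.2]
  add_mem' {f g} hf hg := isSmooth_of_contDiffOn (ContDiffOn.add hf hg) fun x => by
    simp [extendZero_apply _ x.2]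
  algebraMap_mem' c := isSmooth_of_contDiffOn (g := fun _ => c) contDiffOn_const fun _ => rfl

/-- Bundle a function as a smooth function; the junk value `0` is used if it is not smooth. -/
def mkSmooth {N : ℕ} {U : TopologicalSpace.Opens (Fin N → ℝ)} (f : U → ℂ) : Smooth U :=
  open Classical in if h : IsSmooth f then ⟨f, h⟩ else 0

/-- The partial derivative `∂f/∂xⁱ`. -/
def Smooth.pd {N : ℕ} {U : TopologicalSpace.Opens (Fin N → ℝ)} (i : Fin N) (f : Smooth U) :
    Smooth U :=
  ⟨fun x => fderiv ℝ (extendZero f.1) x (Pi.single i 1),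
    isSmooth_of_contDiffOn
      (((show ContDiffOn ℝ ∞ (extendZero f.1) (U : Set (Fin N → ℝ)) from
        f.2).fderiv_of_isOpen U.isOpen (by simp)).clm_apply contDiffOn_const) fun _ => rfl⟩

/-- The pointwise exponential. -/
def Smooth.exp {N : ℕ} {U : TopologicalSpace.Opens (Fin N → ℝ)} (f : Smooth U) : Smooth U :=
  ⟨fun x => Complex.exp (f.1 x),
    isSmooth_of_contDiffOn
      (ContDiffOn.cexp (show ContDiffOn ℝ ∞ (extendZero f.1) (U : Set (Fin N → ℝ)) from f.2))
      fun x => by simp [extendZero_apply _ x.2]⟩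

/-- Restriction to a smaller open set. -/
def Smooth.restrict {N : ℕ} {U W : TopologicalSpace.Opens (Fin N → ℝ)} (h : W ≤ U)
    (f : Smooth U) : Smooth W :=
  ⟨fun x => f.1 ⟨x, h x.2⟩,
    isSmooth_of_contDiffOn
      ((show ContDiffOn ℝ ∞ (extendZero f.1) (U : Set (Fin N → ℝ)) from f.2).mono h)
      fun x => by rw [extendZero_apply _ (h x.2)]⟩

/-! ### Grassmann algebras -/

/-- The Grassmann algebra over `R` on anticommuting generators `θ_o`, `o : O`: the element `f`
is `∑_S f.coeff(S) θ^S`, with `θ^S` the product of the `θ_o`, `o ∈ S`, in increasing order. -/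
@[ext] structure Grassmann (O R : Type*) where
  /-- The coefficients. -/
  coeff : Finset O → R

namespace Grassmann

theorem coeff_injective {O R : Type*} :
    Function.Injective (coeff : Grassmann O R → Finset O → R) :=
  fun _ _ h => Grassmann.ext h

section Linear

variable {O R : Type*} [CommRing R]

instance : Zero (Grassmann O R) := ⟨⟨fun _ => 0⟩⟩

instance : Add (Grassmann O R) := ⟨fun f g => ⟨fun S => f.coeff S + g.coeff S⟩⟩

instance : Neg (Grassmann O R) := ⟨fun f => ⟨fun S => -f.coeff S⟩⟩

instance : Sub (Grassmann O R) := ⟨fun f g => ⟨fun S => f.coeff S - g.coeff S⟩⟩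

instance {K : Type*} [SMul K R] : SMul K (Grassmann O R) := ⟨fun c f => ⟨fun S => c • f.coeff S⟩⟩

instance : AddCommGroup (Grassmann O R) :=
  coeff_injective.addCommGroup _ rfl (fun _ _ => rfl) (fun _ => rfl) (fun _ _ => rfl)
    (fun _ _ => rfl) (fun _ _ => rfl)

/-- Taking coefficients, as an additive map. -/
def coeffHom (O R : Type*) [CommRing R] : Grassmann O R →+ (Finset O → R) where
  toFun := coeff
  map_zero' := rfl
  map_add' _ _ := rfl

instance {K : Type*} [Semiring K] [Module K R] : Module K (Grassmann O R) :=
  coeff_injective.module K (coeffHom O R) fun _ _ => rfl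

theorem zero_coeff (S : Finset O) : (0 : Grassmann O R).coeff S = 0 := rfl

theorem add_coeff (f g : Grassmann O R) (S : Finset O) :
    (f + g).coeff S = f.coeff S + g.coeff S := rfl

theorem neg_coeff (f : Grassmann O R) (S : Finset O) : (-f).coeff S = -f.coeff S := rfl

end Linear

variable {O R : Type*} [LinearOrder O] [CommRing R]

/-- The number of inversions in the concatenation of `S` and `T`. -/
def inv (S T : Finset O) : ℕ := ((S ×ˢ T).filter fun p => p.2 < p.1).card

/-- The sign in `θ^S θ^T = ± θ^(S ∪ T)` for disjoint `S` and `T`. -/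
def sgn (R : Type*) [CommRing R] (S T : Finset O) : R := (-1) ^ inv S T

instance : Mul (Grassmann O R) :=
  ⟨fun f g => ⟨fun S => ∑ T ∈ S.powerset, sgn R T (S \ T) * (f.coeff T * g.coeff (S \ T))⟩⟩

instance : One (Grassmann O R) := ⟨⟨fun S => if S = ∅ then 1 else 0⟩⟩

theorem mul_coeff (f g : Grassmann O R) (S : Finset O) :
    (f * g).coeff S = ∑ T ∈ S.powerset, sgn R T (S \ T) * (f.coeff T * g.coeff (S \ T)) := rfl

theorem one_coeff (S : Finset O) : (1 : Grassmann O R).coeff S = if S = ∅ then 1 else 0 := rfl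

theorem inv_union_left {S T : Finset O} (P : Finset O) (h : Disjoint S T) :
    inv (S ∪ T) P = inv S P + inv T P := by
  unfold inv
  rw [Finset.union_product, Finset.filter_union, Finset.card_union_of_disjoint]
  exact Finset.disjoint_filter_filter (Finset.disjoint_product.2 (Or.inl h))

theorem inv_union_right {S T : Finset O} (P : Finset O) (h : Disjoint S T) :
    inv P (S ∪ T) = inv P S + inv P T := by
  unfold inv
  rw [Finset.product_union, Finset.filter_union, Finset.card_union_of_disjoint]
  exact Finset.disjoint_filter_filter (Finset.disjoint_product.2 (Or.inr h))

theorem inv_add_inv {S T : Finset O} (h : Disjoint S T) :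
    inv S T + inv T S = S.card * T.card := by
  have h2 : inv T S = ((S ×ˢ T).filter fun p => ¬ p.2 < p.1).card := by
    unfold inv
    refine Finset.card_bij' (fun p _ => (p.2, p.1)) (fun p _ => (p.2, p.1)) ?_ ?_ ?_ ?_
    · rintro ⟨a, b⟩ hp
      simp only [Finset.mem_filter, Finset.mem_product, not_lt] at hp ⊢
      exact ⟨⟨hp.1.2, hp.1.1⟩, hp.2.le⟩
    · rintro ⟨a, b⟩ hp
      simp only [Finset.mem_filter, Finset.mem_product, not_lt] at hp ⊢
      refine ⟨⟨hp.1.2, hp.1.1⟩, lt_of_le_of_ne hp.2 ?_⟩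
      rintro rfl
      exact Finset.disjoint_left.1 h hp.1.1 hp.1.2
    · intros; rfl
    · intros; rfl
  rw [h2]
  unfold inv
  rw [Finset.card_filter_add_card_filter_not, Finset.card_product]

theorem mul_assoc' (f g h : Grassmann O R) : f * g * h = f * (g * h) := by
  ext S
  simp only [mul_coeff, Finset.sum_mul, Finset.mul_sum]
  rw [Finset.sum_sigma', Finset.sum_sigma']
  refine Finset.sum_bij' (fun p _ => ⟨p.2, p.1 \ p.2⟩) (fun p _ => ⟨p.1 ∪ p.2, p.1⟩)
    ?_ ?_ ?_ ?_ ?_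
  · rintro ⟨T, P⟩ hp
    simp only [Finset.mem_sigma, Finset.mem_powerset] at hp ⊢
    exact ⟨hp.2.trans hp.1, Finset.sdiff_subset_sdiff hp.1 le_rfl⟩
  · rintro ⟨P, Q⟩ hp
    simp only [Finset.mem_sigma, Finset.mem_powerset] at hp ⊢
    exact ⟨Finset.union_subset hp.1 (hp.2.trans Finset.sdiff_subset), Finset.subset_union_left⟩
  · rintro ⟨T, P⟩ hp
    simp only [Finset.mem_sigma, Finset.mem_powerset] at hp
    simp [Finset.union_sdiff_of_subset hp.2]
  · rintro ⟨P, Q⟩ hp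
    simp only [Finset.mem_sigma, Finset.mem_powerset] at hp
    have hd : Disjoint P Q := Finset.disjoint_of_subset_right hp.2 Finset.disjoint_sdiff
    simp [Finset.union_sdiff_cancel_left hd]
  · rintro ⟨T, P⟩ hp
    simp only [Finset.mem_sigma, Finset.mem_powerset] at hp
    obtain ⟨hT, hP⟩ := hp
    have e1 : (S \ P) \ (T \ P) = S \ T := by
      ext a; simp only [Finset.mem_sdiff]; have := @hP a; have := @hT a; tauto
    have e2 : S \ P = (T \ P) ∪ (S \ T) := by
      ext a; simp only [Finset.mem_sdiff, Finset.mem_union]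
      have := @hP a; have := @hT a; tauto
    have e3 : P ∪ (T \ P) = T := Finset.union_sdiff_of_subset hP
    have d1 : Disjoint (T \ P) (S \ T) :=
      Finset.disjoint_of_subset_left Finset.sdiff_subset Finset.disjoint_sdiff
    have key : sgn R T (S \ T) * sgn R P (T \ P) =
        sgn R P (S \ P) * sgn R (T \ P) (S \ T) := by
      have a1 : inv T (S \ T) = inv P (S \ T) + inv (T \ P) (S \ T) := by
        have d0 : Disjoint P (T \ P) := Finset.disjoint_sdiff
        rw [← inv_union_left (S \ T) d0, e3]
      have a2 : inv P (S \ P) = inv P (T \ P) + inv P (S \ T) := by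
        rw [e2]; exact inv_union_right _ d1
      unfold sgn
      rw [a1, a2]
      ring
    simp only [e1]
    linear_combination (f.coeff P * g.coeff (T \ P) * h.coeff (S \ T)) * key

instance : Ring (Grassmann O R) :=
  { (inferInstance : AddCommGroup (Grassmann O R)),
    (inferInstance : Mul (Grassmann O R)),
    (inferInstance : One (Grassmann O R)) with
    left_distrib := fun f g h => by
      ext S
      simp only [mul_coeff, add_coeff, mul_add, Finset.sum_add_distrib]
    right_distrib := fun f g h => by
      ext S
      simp only [mul_coeff, add_coeff, add_mul, mul_add, Finset.sum_add_distrib]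
    zero_mul := fun f => by ext S; simp [mul_coeff, zero_coeff]
    mul_zero := fun f => by ext S; simp [mul_coeff, zero_coeff]
    mul_assoc := mul_assoc'
    one_mul := fun f => by
      ext S
      rw [mul_coeff, Finset.sum_eq_single ∅]
      · simp [one_coeff, sgn, inv]
      · intro T _ hT; simp [one_coeff, hT]
      · simp
    mul_one := fun f => by
      ext S
      rw [mul_coeff, Finset.sum_eq_single S]
      · simp [one_coeff, sgn, inv]
      · intro T hT hne
        have : S \ T ≠ ∅ := fun h => hne
          (Finset.Subset.antisymm (Finset.mem_powerset.1 hT) (Finset.sdiff_eq_empty_iff_subset.1 h))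
        simp [one_coeff, this]
      · simp }

/-- Elements of the coefficient ring. -/
def const (r : R) : Grassmann O R := ⟨fun S => if S = ∅ then r else 0⟩

/-- The generators `θ_o`. -/
def gen (o : O) : Grassmann O R := ⟨fun S => if S = {o} then 1 else 0⟩

/-- The body: the coefficient of `θ^∅ = 1`. -/
def body (f : Grassmann O R) : R := f.coeff ∅

/-- The element has the given Grassmann parity. -/
def HasParity (p : ZMod 2) (f : Grassmann O R) : Prop :=
  ∀ S, (S.card : ZMod 2) ≠ p → f.coeff S = 0

/-- The left derivative `∂f/∂θ_o`. -/
def leftD (o : O) (f : Grassmann O R) : Grassmann O R := ⟨fun S =>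
  if o ∈ S then 0 else (-1) ^ (S.filter (· < o)).card * f.coeff (insert o S)⟩

/-- The right derivative of `f` with respect to `θ_o`. -/
def rightD (o : O) (f : Grassmann O R) : Grassmann O R := ⟨fun S =>
  if o ∈ S then 0 else (-1) ^ (S.filter (o < ·)).card * f.coeff (insert o S)⟩

/-- Apply a map to all coefficients. -/
def mapCoeff {O R R' : Type*} (φ : R → R') (f : Grassmann O R) : Grassmann O R' :=
  ⟨fun S => φ (f.coeff S)⟩

theorem mul_coeff_eq_zero {f g : Grassmann O R} {S : Finset O}
    (h : ∀ T ⊆ S, f.coeff T = 0 ∨ g.coeff (S \ T) = 0) : (f * g).coeff S = 0 := by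
  rw [mul_coeff]
  refine Finset.sum_eq_zero fun T hT => ?_
  rcases h T (Finset.mem_powerset.1 hT) with h | h <;> simp [h]

/-- The subring of even elements. -/
def evenSubring (O R : Type*) [LinearOrder O] [CommRing R] : Subring (Grassmann O R) where
  carrier := {f | ∀ S : Finset O, Odd S.card → f.coeff S = 0}
  mul_mem' {f g} hf hg S hS := by
    refine mul_coeff_eq_zero fun T hT => ?_
    rcases Nat.even_or_odd T.card with h | h
    · refine Or.inr (hg _ ?_)
      have := Finset.card_sdiff_add_card_eq_card hT
      rw [← this] at hS
      rcases Nat.even_or_odd (S \ T).card with h' | h'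
      · exact absurd (h'.add h) (Nat.not_even_iff_odd.2 hS)
      · exact h'
    · exact Or.inl (hf _ h)
  one_mem' S hS := by
    rw [one_coeff, if_neg]
    rintro rfl
    simp at hS
  add_mem' {f g} hf hg S hS := by rw [add_coeff, hf S hS, hg S hS, add_zero]
  zero_mem' S _ := rfl
  neg_mem' {f} hf S hS := by rw [neg_coeff, hf S hS, neg_zero]

instance : CommRing (evenSubring O R) :=
  { (inferInstance : Ring (evenSubring O R)) with
    mul_comm := by
      rintro ⟨f, hf⟩ ⟨g, hg⟩
      apply Subtype.ext
      change f * g = g * f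
      ext S
      rw [mul_coeff, mul_coeff]
      refine Finset.sum_bij' (fun T _ => S \ T) (fun T _ => S \ T) ?_ ?_ ?_ ?_ ?_
      · intro T _; simp
      · intro T _; simp
      · intro T hT; exact Finset.sdiff_sdiff_eq_self (Finset.mem_powerset.1 hT)
      · intro T hT; exact Finset.sdiff_sdiff_eq_self (Finset.mem_powerset.1 hT)
      · intro T hT
        rw [Finset.sdiff_sdiff_eq_self (Finset.mem_powerset.1 hT)]
        rcases Nat.even_or_odd T.card with h | h
        · have hi := inv_add_inv (S := T) (T := S \ T) Finset.disjoint_sdiff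
          have he : Even (inv T (S \ T) + inv (S \ T) T) := by rw [hi]; exact h.mul_right _
          have : sgn R T (S \ T) = sgn R (S \ T) T := by
            unfold sgn
            rcases Nat.even_or_odd (inv T (S \ T)) with h1 | h1
            · rw [h1.neg_one_pow, ((Nat.even_add.1 he).1 h1).neg_one_pow]
            · have h2 : Odd (inv (S \ T) T) := by
                rcases Nat.even_or_odd (inv (S \ T) T) with h2 | h2
                · exact absurd ((Nat.even_add.1 he).2 h2) (Nat.not_even_iff_odd.2 h1)
                · exact h2
              rw [h1.neg_one_pow, h2.neg_one_pow]
          rw [this, mul_comm (f.coeff T)]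
        · rw [hf T h]; simp }

/-- The even part of an element. -/
def evenPart (f : Grassmann O R) : evenSubring O R :=
  ⟨⟨fun S => if Odd S.card then 0 else f.coeff S⟩, fun _ hS => if_pos hS⟩

/-- The superdeterminant (Berezinian) `det(A - B D⁻¹ C) / det D` of an even supermatrix
`((A, B), (C, D))`, where the index `i` has parity `p i` and the block `A` belongs to the even
indices. The entries whose determinants are taken are even for an even supermatrix, and live
in the commutative ring of even elements. -/
def sdet {ι : Type*} [Fintype ι] [DecidableEq ι] (p : ι → ZMod 2)
    (M : Matrix ι ι (Grassmann O R)) : Grassmann O R :=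
  let a : {i // p i = 0} → ι := Subtype.val
  let b : {i // p i = 1} → ι := Subtype.val
  let D : Matrix {i // p i = 1} {i // p i = 1} (evenSubring O R) :=
    (M.submatrix b b).map evenPart
  let Dinv : Matrix {i // p i = 1} {i // p i = 1} (Grassmann O R) := D⁻¹.map Subtype.val
  let S : Matrix {i // p i = 0} {i // p i = 0} (evenSubring O R) :=
    (M.submatrix a a - M.submatrix a b * Dinv * M.submatrix b a).map evenPart
  ((S.det * Ring.inverse D.det : evenSubring O R) : Grassmann O R)

end Grassmann

open Grassmann

/-! ### Superfunctions on a superdomain of dimension `N|N` -/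

/-- Superfunctions `f(x, θ)` on the superdomain of dimension `N|N` with body `U`. -/
abbrev SuperFun {N : ℕ} (U : TopologicalSpace.Opens (Fin N → ℝ)) : Type :=
  Grassmann (Fin N) (Smooth U)

/-- The index `A` of the coordinates `Γ^A`: `inl i` is the even coordinate `xⁱ`, and `inr i` is
the odd coordinate `θⁱ`. -/
abbrev Idx (N : ℕ) : Type := Fin N ⊕ Fin N

/-- The Grassmann parity `ε_A` of the coordinate `Γ^A`. -/
def par {N : ℕ} : Idx N → ZMod 2 := Sum.elim (fun _ => 0) (fun _ => 1)

/-- The sign `(-1)^p`. -/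
def sg (p : ZMod 2) : ℤ := if p = 0 then 1 else -1

section Zeroth

variable {N : ℕ} {U : TopologicalSpace.Opens (Fin N → ℝ)}

/-- The left derivative `∂f/∂Γ^A`. -/
def dl (A : Idx N) (f : SuperFun U) : SuperFun U :=
  Sum.elim (fun i => mapCoeff (Smooth.pd i) f) (fun i => leftD i f) A

/-- The right derivative of `f` with respect to `Γ^A`. -/
def dr (A : Idx N) (f : SuperFun U) : SuperFun U :=
  Sum.elim (fun i => mapCoeff (Smooth.pd i) f) (fun i => rightD i f) A

/-- The antibracket `(f, g) = (f ∂/∂Γ^A) E^{AB} (∂/∂Γ^B g)`. -/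
def antibracket (E : Matrix (Idx N) (Idx N) (SuperFun U)) (f g : SuperFun U) : SuperFun U :=
  ∑ A, ∑ B, dr A f * E A B * dl B g

/-- `E` is a non-degenerate antisymplectic bi-vector. -/
structure IsAntisymplectic (E : Matrix (Idx N) (Idx N) (SuperFun U)) : Prop where
  parity : ∀ A B, HasParity (par A + par B + 1) (E A B)
  skew : ∀ A B, E B A = -(sg ((par A + 1) * (par B + 1)) • E A B)
  jacobi : ∀ (a b c : ZMod 2) (f g h : SuperFun U),
    HasParity a f → HasParity b g → HasParity c h →
      sg ((a + 1) * (c + 1)) • antibracket E f (antibracket E g h) +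
      sg ((b + 1) * (a + 1)) • antibracket E g (antibracket E h f) +
      sg ((c + 1) * (b + 1)) • antibracket E h (antibracket E f g) = 0
  nondegenerate : IsUnit E

/-- The odd Laplacian `Δ_ρ = ((-1)^{ε_A} / 2ρ) ∂/∂Γ^A ρ E^{AB} ∂/∂Γ^B`, acting on an algebra `𝓐`
that contains the superfunctions through `emb`, with left derivatives `∂/∂Γ^A` given by `d`. -/
def oddLaplacian {𝓐 : Type*} [Ring 𝓐] [Module ℂ 𝓐] (emb : SuperFun U → 𝓐) (d : Idx N → 𝓐 → 𝓐)
    (E : Matrix (Idx N) (Idx N) (SuperFun U)) (ρ : SuperFun U) (f : 𝓐) : 𝓐 :=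
  (2⁻¹ : ℂ) • ∑ A, ∑ B, sg (par A) • (emb (Ring.inverse ρ) * d A (emb (ρ * E A B) * d B f))

/-- The exponential of an even superfunction: `e^{body} ∑ₙ (f - body)ⁿ / n!`, where the sum is
finite because `f - body` is nilpotent. -/
def superExp (f : SuperFun U) : SuperFun U :=
  const (Smooth.exp (body f)) *
    ∑ n ∈ Finset.range (N + 1), ((n.factorial : ℂ)⁻¹) • (f - const (body f)) ^ n

/-- Restriction of superfunctions to a smaller open set. -/
def restrict {W : TopologicalSpace.Opens (Fin N → ℝ)} (h : W ≤ U) (f : SuperFun U) : SuperFun W :=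
  mapCoeff (Smooth.restrict h) f

/-! ### The coordinates `{F^α; G_α}` -/

/-- The coordinate functions `{F^α; G_α}`, ordered by parity. Since `G_α` has parity `ε_α` and
`F^α` has parity `ε_α + 1`, exactly one of the two is even: it is the even coordinate number `α`,
and the other one is the odd coordinate number `α`. -/
def barGamma (ε : Fin N → ZMod 2) (F G : Fin N → SuperFun U) : Idx N → SuperFun U :=
  Sum.elim (fun α => if ε α = 0 then G α else F α) (fun α => if ε α = 0 then F α else G α)

/-- The position of `F^α` among the coordinates `{F^α; G_α}`. -/
def idxF (ε : Fin N → ZMod 2) (α : Fin N) : Idx N := if ε α = 0 then Sum.inr α else Sum.inl α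

/-- The matrix of right derivatives `∂Γ̄^A/∂Γ^B`. -/
def jacobianMatrix (Γ' : Idx N → SuperFun U) : Matrix (Idx N) (Idx N) (SuperFun U) :=
  Matrix.of fun A B => dr B (Γ' A)

/-- The real body of the even coordinate functions, as a map `U → ℝᴺ`. -/
def bodyMap (Γ' : Idx N → SuperFun U) (x : U) : Fin N → ℝ :=
  fun i => ((body (Γ' (Sum.inl i))).1 x).re

/-- The functions `Γ̄^A` (of parity `ε_A`) form a coordinate system on the superdomain: the even
ones have real bodies which separate the points, and the Jacobian matrix is invertible. -/
structure IsCoordinateSystem (Γ' : Idx N → SuperFun U) : Prop where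
  parity : ∀ A, HasParity (par A) (Γ' A)
  real : ∀ i x, ((body (Γ' (Sum.inl i))).1 x).im = 0
  injective : Function.Injective (bodyMap Γ')
  jacobian : IsUnit (jacobianMatrix Γ')

/-- Iterated partial derivative `∂₁^{k₁} ⋯ ∂_N^{k_N}`. -/
def iterPd {V : TopologicalSpace.Opens (Fin N → ℝ)} (k : Fin N → ℕ) (f : Smooth V) : Smooth V :=
  (List.finRange N).foldr (fun i g => (Smooth.pd i)^[k i] g) f

/-- The substitution `f(Γ̄)` of coordinate functions `Γ̄ = (y, η)` into a superfunction `f(y, η)`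
on a superdomain whose body `V` contains the image of the body map: Taylor expansion around the
body of `y`, all terms of order more than `N` in one variable being zero. -/
def pullback {V : TopologicalSpace.Opens (Fin N → ℝ)} (Γ' : Idx N → SuperFun U)
    (f : SuperFun V) : SuperFun U :=
  ∑ S : Finset (Fin N), ∑ k : Fin N → Fin (N + 1),
    (((∏ i, (k i).1.factorial : ℕ) : ℂ)⁻¹) •
      (const (mkSmooth fun x => extendZero (iterPd (fun i => (k i).1) (f.coeff S)).1 (bodyMap Γ' x)) *
        ((List.finRange N).map fun i =>
          (Γ' (Sum.inl i) - const (body (Γ' (Sum.inl i)))) ^ (k i).1).prod *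
        ((S.sort (· ≤ ·)).map fun j => Γ' (Sum.inr j)).prod)

/-- For a superfunction `f(F; G)` of the coordinates `{F^α; G_α}`, the superfunction
`∫₀¹ f(tF; G) dt` of the same coordinates. -/
def integralScaleF {V : TopologicalSpace.Opens (Fin N → ℝ)} (ε : Fin N → ZMod 2)
    (f : SuperFun V) : SuperFun V := ⟨fun S =>
  mkSmooth fun y => ∫ t in (0 : ℝ)..1,
    ((t : ℂ) ^ (S.filter fun α => ε α = 0).card) *
      extendZero (f.coeff S).1
        (fun α => if ε α = 0 then (y : Fin N → ℝ) α else t * (y : Fin N → ℝ) α)⟩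

/-- The body of the constrained surface `G_α = 0`; odd functions impose no condition on it. -/
def constraintSurface (ε : Fin N → ZMod 2) (G : Fin N → SuperFun U) : Set (Fin N → ℝ) :=
  {x | ∃ h : x ∈ U, ∀ α, ε α = 0 → (body (G α)).1 ⟨x, h⟩ = 0}

/-- The matrix `Λ^α_β = (F^α, G_β)`. -/
def lambdaMatrix (E : Matrix (Idx N) (Idx N) (SuperFun U)) (F G : Fin N → SuperFun U) :
    Matrix (Fin N) (Fin N) (SuperFun U) :=
  Matrix.of fun α β => antibracket E (F α) (G β)

/-- The quantity `J sdet(F^α, G_β) / ρ` under the square root, with `J = sdet(∂Γ̄/∂Γ)`. -/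
def radicand (ε : Fin N → ZMod 2) (E : Matrix (Idx N) (Idx N) (SuperFun U)) (ρ : SuperFun U)
    (F G : Fin N → SuperFun U) : SuperFun U :=
  sdet par (jacobianMatrix (barGamma ε F G)) * sdet ε (lambdaMatrix E F G) * Ring.inverse ρ

/-- `L` is a branch of `ln √Q`. -/
def IsLogSqrt (L Q : SuperFun U) : Prop := HasParity 0 L ∧ superExp ((2 : ℂ) • L) = Q

end Zeroth

/-! ### The first level -/

/-- Functions of `Γ^A, λ^α, λ*_α`: formal power series in the even ones of the `λ^α, λ*_α`, with
coefficients in the Grassmann algebra generated by the `θⁱ` and by the odd ones of the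
`λ^α, λ*_α`, over the smooth functions on `U`. Since `λ^α` has parity `ε_α` and `λ*_α` has
parity `ε_α + 1`, there are one even and one odd variable for each `α`. -/
abbrev FirstLevel {N : ℕ} (U : TopologicalSpace.Opens (Fin N → ℝ)) : Type :=
  MvPowerSeries (Fin N) (Grassmann (Fin N ⊕ₗ Fin N) (Smooth U))

section First

variable {N : ℕ} {U : TopologicalSpace.Opens (Fin N → ℝ)}

/-- The inclusion of the functions of `Γ^A`. -/
def emb (f : SuperFun U) : FirstLevel U :=
  MvPowerSeries.C (σ := Fin N)
    (⟨fun T => ∑ S : Finset (Fin N), if T = S.image Sum.inlₗ then f.coeff S else 0⟩ :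
      Grassmann (Fin N ⊕ₗ Fin N) (Smooth U))

/-- The left derivatives `∂/∂Γ^A`. -/
def dl₁ (A : Idx N) (f : FirstLevel U) : FirstLevel U := fun m =>
  Sum.elim (fun i => mapCoeff (Smooth.pd i) (MvPowerSeries.coeff m f))
    (fun i => leftD (Sum.inlₗ i) (MvPowerSeries.coeff m f)) A

/-- The derivative with respect to the even variable number `α`. -/
def dEven (α : Fin N) (f : FirstLevel U) : FirstLevel U := fun m =>
  (m α + 1) • MvPowerSeries.coeff (m + Finsupp.single α 1) f

/-- The left derivative with respect to the odd variable number `α`. -/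
def dOdd (α : Fin N) (f : FirstLevel U) : FirstLevel U := fun m =>
  leftD (Sum.inrₗ α) (MvPowerSeries.coeff m f)

/-- The variable `λ^α`, of parity `ε_α`. -/
def lam (ε : Fin N → ZMod 2) (α : Fin N) : FirstLevel U :=
  if ε α = 0 then MvPowerSeries.X α else MvPowerSeries.C (σ := Fin N) (gen (Sum.inrₗ α))

/-- The variable `λ*_α`, of parity `ε_α + 1`. -/
def lamStar (ε : Fin N → ZMod 2) (α : Fin N) : FirstLevel U :=
  if ε α = 0 then MvPowerSeries.C (σ := Fin N) (gen (Sum.inrₗ α)) else MvPowerSeries.X α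

/-- The left derivative `∂/∂λ^α`. -/
def dLam (ε : Fin N → ZMod 2) (α : Fin N) (f : FirstLevel U) : FirstLevel U :=
  if ε α = 0 then dEven α f else dOdd α f

/-- The left derivative `∂/∂λ*_α`. -/
def dLamStar (ε : Fin N → ZMod 2) (α : Fin N) (f : FirstLevel U) : FirstLevel U :=
  if ε α = 0 then dOdd α f else dEven α f

/-- The degree in the `λ^α` of the monomial with even exponents `m` and odd factors `T`. -/
def lamDeg (ε : Fin N → ZMod 2) (m : Fin N →₀ ℕ) (T : Finset (Fin N ⊕ₗ Fin N)) : ℕ :=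
  ∑ α, if ε α = 0 then m α else if Sum.inrₗ α ∈ T then 1 else 0

/-- The degree in the `λ*_α` of the monomial with even exponents `m` and odd factors `T`. -/
def lamStarDeg (ε : Fin N → ZMod 2) (m : Fin N →₀ ℕ) (T : Finset (Fin N ⊕ₗ Fin N)) : ℕ :=
  ∑ α, if ε α = 0 then (if Sum.inrₗ α ∈ T then 1 else 0) else m α

/-- The first level odd Laplacian `Δ_[1] = Δ_ρ + (-1)^{ε_α} ∂/∂λ^α ∂/∂λ*_α`. -/
def laplacian₁ (ε : Fin N → ZMod 2) (E : Matrix (Idx N) (Idx N) (SuperFun U)) (ρ : SuperFun U)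
    (f : FirstLevel U) : FirstLevel U :=
  oddLaplacian emb dl₁ E ρ f + ∑ α, sg (ε α) • dLam ε α (dLamStar ε α f)

/-- The coefficient of the monomial `1`, a smooth function on `U`. -/
def body₁ (f : FirstLevel U) : Smooth U := body (MvPowerSeries.coeff 0 f)

/-- The exponential of an even element: `e^{body} ∑ₙ (f - body)ⁿ / n!`. For each exponent `m` only
the terms with `n ≤ |m| + 2N` can contribute, as there are `2N` odd variables. -/
def exp₁ (f : FirstLevel U) : FirstLevel U := fun m =>
  ∑ n ∈ Finset.range (m.degree + 2 * N + 1), ((n.factorial : ℂ)⁻¹) •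
    (const (Smooth.exp (body₁ f)) *
      MvPowerSeries.coeff m ((f - MvPowerSeries.C (σ := Fin N) (const (body₁ f))) ^ n))

/-- A gauge-fixing action `X = ∑ₖ (iħ)^k X_k` is given by its coefficients
`X_0 = Ω, X_1 = Ξ, X_2 = Ω̃, …`. All of them are even. -/
def IsEvenAction (X : ℕ → FirstLevel U) : Prop :=
  ∀ k m, HasParity 0 (MvPowerSeries.coeff m (X k))

/-- Planck number conservation `Pl(X) = 1`, where `Pl(ħ) = Pl(λ^α) = -Pl(λ*_α) = 1`. -/
def PlanckConserving (ε : Fin N → ZMod 2) (X : ℕ → FirstLevel U) : Prop :=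
  ∀ (k : ℕ) (m : Fin N →₀ ℕ) (T : Finset (Fin N ⊕ₗ Fin N)),
    k + lamDeg ε m T ≠ lamStarDeg ε m T + 1 → (MvPowerSeries.coeff m (X k)).coeff T = 0

/-- The action `∑ₖ (iħ)^k X_k` for a number `ħ`. Planck number conservation allows for each
monomial in `λ, λ*` only one `k`, which is at most its degree in the `λ*` plus one; this makes the
sum finite. -/
def action (ε : Fin N → ZMod 2) (X : ℕ → FirstLevel U) (ħ : ℝ) : FirstLevel U := fun m =>
  ⟨fun T => ∑ k ∈ Finset.range (lamStarDeg ε m T + 2),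
    ((Complex.I * (ħ : ℂ)) ^ k) • (MvPowerSeries.coeff m (X k)).coeff T⟩

/-- The Quantum Master Equation `Δ_[1] exp(i X / ħ) = 0`. By Planck number conservation each
coefficient is a Laurent monomial in `ħ`, so that it is the same to require the equation for the
formal parameter `ħ` or for all numbers `ħ ≠ 0`. -/
def QuantumMasterEquation (ε : Fin N → ZMod 2) (E : Matrix (Idx N) (Idx N) (SuperFun U))
    (ρ : SuperFun U) (X : ℕ → FirstLevel U) : Prop :=
  ∀ ħ : ℝ, ħ ≠ 0 → laplacian₁ ε E ρ (exp₁ ((Complex.I / (ħ : ℂ)) • action ε X ħ)) = 0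

/-- The lowest order terms of the action in the `λ*`,
`X = G_α λ^α + iħ H + λ*_α (½ U^α_{βγ} λ^γ λ^β (-1)^{ε_β + 1} + iħ V^α_β λ^β + (iħ)² G̃^α)`
plus terms of order two in the `λ*`. Here `Us α β γ` stands for `U^α_{βγ}`, and `Vs α β` for
`V^α_β`. -/
def HasExpansion (ε : Fin N → ZMod 2) (X : ℕ → FirstLevel U) (G : Fin N → SuperFun U)
    (H : SuperFun U) (Us : Fin N → Fin N → Fin N → SuperFun U) (Vs : Fin N → Fin N → SuperFun U)
    (Gt : Fin N → SuperFun U) : Prop :=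
  ∀ (ħ : ℝ) m T, lamStarDeg ε m T ≤ 1 →
    (MvPowerSeries.coeff m (action ε X ħ)).coeff T =
      (MvPowerSeries.coeff m
        (∑ α, emb (G α) * lam ε α + (Complex.I * (ħ : ℂ)) • emb H +
          ∑ α, lamStar ε α *
            ((2⁻¹ : ℂ) • ∑ β, ∑ γ, sg (ε β + 1) • (emb (Us α β γ) * lam ε γ * lam ε β) +
              (Complex.I * (ħ : ℂ)) • ∑ β, emb (Vs α β) * lam ε β +
              ((Complex.I * (ħ : ℂ)) ^ 2) • emb (Gt α)))).coeff T

/-- The action with `H` replaced by `H + c` for a constant `c`. -/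
def shiftH (X : ℕ → FirstLevel U) (c : ℂ) : ℕ → FirstLevel U :=
  fun k => X k + if k = 1 then c • (1 : FirstLevel U) else 0

end First

end

end SuperBV

open SuperBV

set_option linter.unusedSectionVars false
namespace SuperBV
noncomputable section

/-! ### Signs -/

/-! Write `Λ = (F, G)` for the matrix of brackets and `Q = J sdet Λ / ρ` for the quantity under the
square root. The proof compares two logarithmic derivatives along the Hamiltonian vector fields of
the `G_β`: that of `Q`, computed from geometry, and that of `e^{-2H}`, dictated by the Quantum
Master Equation.

The Master Equation is applied to the exponential of `f = iX` at `ħ = 1` and expanded to second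
order in `λ` at `λ = λ* = 0`. The exponential factors out of every order and can be cancelled. First
order gives the equation for `(H, G_β)`, and second order gives the involution `(G_α, G_β) = G_γ
Y^γ_{αβ}`, where `Y` is defined by second `λ` derivatives of the part of the action linear in `λ*`.
In particular `Y` vanishes when `U` does. This is the content of `IsExpData.involution`,
`Series.master_equation` and `first_level`.

The bracket with `G_β` is a right derivation, and a right derivation takes a superdeterminant to
itself times a supertrace (`IsRightDer.map_sdet`). For `J` this supertrace is the divergence of the
Hamiltonian field in the coordinates `{F; G}` minus its divergence in the original ones
(`bracket_jacobian`). For `Λ` the Jacobi identity yields the supertrace of `Y` minus the `F` part of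
the new divergence (`trace_lambda_mem`). The `G` part of the new divergence is again the supertrace
of `Y`. The old divergence and the density combine to `2 Δ G_β`. Hence `(Q, G_β) = Q (2 str Y_β - 2
Δ G_β)` modulo the ideal of the `G_α` (`bracket_radicand_mem`). Together with the equation for `H`
this places `(Q e^{2H}, G_β)` in the ideal. Where `Λ` is invertible, the derivatives `∂/∂F` are,
modulo the ideal, combinations of brackets with the `G_β`, so the derivatives of `Q e^{2H}` along
the `F` lie in the ideal as well.

On shell, the segments from `(F; G)` to `(F; 0)` carry this to a statement about functions. A
superfunction whose `F` derivatives lie in the ideal is locally constant at `G = 0`, hence constant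
there if the surface is connected, and the integral form of the remainder shows that it differs from
the constant by an element of the ideal (`IsCoordinateSystem.exists_const_add_ideal`). This is used
twice: for `Q e^{2H}`, which makes its body a nonzero constant on the surface and so provides a
logarithm nearby, and then for that logarithm.

In the Abelian case the same computation runs with the zero ideal and gives `∂(H + L)/∂F` exactly,
for `L` a branch of `ln √Q`. Integrating along `(tF; G)` gives the formula, with integration
constant the value at `F = 0`. This constant has vanishing bracket with every `G_β`, so that
removing it from `H` preserves the equation (`IsGaugeSystem.abelian`).

Both integrations need superfunctions to be rewritten as superfunctions of `{F; G}`. The Taylor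
substitution `pullback` is therefore shown to be a ring isomorphism that intertwines derivatives.
Identities for it are proved by comparing bodies and odd derivatives (`eq_zero_of_leftD_mem_span`),
surjectivity by successive approximation, and the inverse function theorem takes care of the body.
-/

theorem sg_zero : sg 0 = 1 := rfl

theorem sg_one : sg 1 = -1 := rfl

theorem sg_add (p q : ZMod 2) : sg (p + q) = sg p * sg q := by revert p q; decide

theorem sg_mul_self (p : ZMod 2) : sg p * sg p = 1 := by revert p; decide

theorem sg_natCast (n : ℕ) : sg (n : ZMod 2) = (-1) ^ n := by
  induction n with
  | zero => rfl
  | succ n ih => rw [Nat.cast_succ, sg_add, ih, pow_succ, sg_one]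

theorem zmod_two_cases (p : ZMod 2) : p = 0 ∨ p = 1 := by revert p; decide

/-! ### Grassmann algebras: parity, commutation signs and odd derivatives -/

namespace Grassmann

variable {O R : Type*}

section Basic

variable [LinearOrder O] [CommRing R]

theorem sub_coeff (f g : Grassmann O R) (S : Finset O) :
    (f - g).coeff S = f.coeff S - g.coeff S := rfl

theorem smul_coeff {K : Type*} [SMul K R] (c : K) (f : Grassmann O R) (S : Finset O) :
    (c • f).coeff S = c • f.coeff S := rfl

theorem sum_coeff {ι : Type*} (s : Finset ι) (f : ι → Grassmann O R) (S : Finset O) :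
    (∑ i ∈ s, f i).coeff S = ∑ i ∈ s, (f i).coeff S := by
  have h := map_sum (coeffHom O R) f s
  exact (congrFun h S).trans (Finset.sum_apply S s _)

theorem zsmul_coeff (c : ℤ) (f : Grassmann O R) (S : Finset O) :
    (c • f).coeff S = c • f.coeff S := by
  have h := map_zsmul (coeffHom O R) c f
  exact congrFun h S

instance {K : Type*} [Semiring K] [Module K R] [IsScalarTower K R R] [SMulCommClass K R R] :
    IsScalarTower K (Grassmann O R) (Grassmann O R) := ⟨fun c f g => by
  ext S
  simp only [smul_eq_mul, smul_coeff, mul_coeff, Finset.smul_sum]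
  refine Finset.sum_congr rfl fun T _ => ?_
  rw [smul_mul_assoc, mul_smul_comm]⟩

instance {K : Type*} [Semiring K] [Module K R] [IsScalarTower K R R] [SMulCommClass K R R] :
    SMulCommClass K (Grassmann O R) (Grassmann O R) := ⟨fun c f g => by
  ext S
  simp only [smul_eq_mul, smul_coeff, mul_coeff, Finset.smul_sum]
  refine Finset.sum_congr rfl fun T _ => ?_
  rw [mul_smul_comm, mul_smul_comm]⟩

theorem const_mul_coeff (r : R) (f : Grassmann O R) (S : Finset O) :
    (const r * f).coeff S = r * f.coeff S := by
  rw [mul_coeff, Finset.sum_eq_single ∅]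
  · simp [const, sgn, inv]
  · intro T _ hT; simp [const, hT]
  · simp

theorem mul_const_coeff (r : R) (f : Grassmann O R) (S : Finset O) :
    (f * const r).coeff S = f.coeff S * r := by
  rw [mul_coeff, Finset.sum_eq_single S]
  · simp [const, sgn, inv]
  · intro T hT hne
    have : S \ T ≠ ∅ := fun h => hne
      (Finset.Subset.antisymm (Finset.mem_powerset.1 hT) (Finset.sdiff_eq_empty_iff_subset.1 h))
    simp [const, this]
  · simp

theorem const_mul_comm (r : R) (f : Grassmann O R) : const r * f = f * const r := by
  ext S; rw [const_mul_coeff, mul_const_coeff, mul_comm]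

/-- Elements of the coefficient ring, as a ring homomorphism. -/
def constHom (O R : Type*) [LinearOrder O] [CommRing R] : R →+* Grassmann O R where
  toFun := const
  map_one' := rfl
  map_zero' := by ext S; simp [const, zero_coeff]
  map_add' a b := by ext S; by_cases h : S = ∅ <;> simp [const, add_coeff, h]
  map_mul' a b := by
    ext S; rw [const_mul_coeff]; by_cases h : S = ∅ <;> simp [const, h]

theorem const_one : (const 1 : Grassmann O R) = 1 := map_one (constHom O R)

theorem const_zero : (const 0 : Grassmann O R) = 0 := map_zero (constHom O R)

theorem const_add (a b : R) : (const (a + b) : Grassmann O R) = const a + const b :=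
  map_add (constHom O R) a b

theorem const_mul (a b : R) : (const (a * b) : Grassmann O R) = const a * const b :=
  map_mul (constHom O R) a b

theorem const_sum {ι : Type*} (s : Finset ι) (f : ι → R) :
    (const (∑ i ∈ s, f i) : Grassmann O R) = ∑ i ∈ s, const (f i) :=
  map_sum (constHom O R) f s

/-- The body, as a ring homomorphism. -/
def bodyHom (O R : Type*) [LinearOrder O] [CommRing R] : Grassmann O R →+* R where
  toFun := body
  map_one' := rfl
  map_zero' := rfl
  map_add' _ _ := rfl
  map_mul' f g := by simp [body, mul_coeff, sgn, inv]

theorem body_mul (f g : Grassmann O R) : body (f * g) = body f * body g :=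
  map_mul (bodyHom O R) f g

theorem body_sum {ι : Type*} (s : Finset ι) (f : ι → Grassmann O R) :
    body (∑ i ∈ s, f i) = ∑ i ∈ s, body (f i) := map_sum (bodyHom O R) f s

theorem body_const (r : R) : body (const r : Grassmann O R) = r := by
  simp [body, const]

theorem body_gen (o : O) : body (gen o : Grassmann O R) = 0 := by
  simp [body, gen, (Finset.singleton_ne_empty o).symm]

theorem inv_singleton_left (o : O) (S : Finset O) :
    inv {o} S = (S.filter (· < o)).card := by
  unfold inv
  rw [Finset.singleton_product, Finset.filter_map, Finset.card_map]
  rfl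

theorem inv_singleton_right (o : O) (S : Finset O) :
    inv S {o} = (S.filter (o < ·)).card := by
  unfold inv
  rw [Finset.product_singleton, Finset.filter_map, Finset.card_map]
  rfl

theorem gen_mul_coeff (o : O) (f : Grassmann O R) (S : Finset O) :
    (gen o * f).coeff S =
      if o ∈ S then (-1) ^ (S.filter (· < o)).card * f.coeff (S.erase o) else 0 := by
  rw [mul_coeff]
  split_ifs with h
  · rw [Finset.sum_eq_single {o}]
    · rw [sgn, inv_singleton_left, Finset.sdiff_singleton_eq_erase]
      have : (S.erase o).filter (· < o) = S.filter (· < o) := by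
        ext a; simp only [Finset.mem_filter, Finset.mem_erase]
        exact ⟨fun h => ⟨h.1.2, h.2⟩, fun h => ⟨⟨h.2.ne, h.1⟩, h.2⟩⟩
      simp [gen, this]
    · intro T _ hT; simp [gen, hT]
    · simp [h]
  · refine Finset.sum_eq_zero fun T hT => ?_
    have : T ≠ {o} := by
      rintro rfl; exact h (Finset.mem_powerset.1 hT (Finset.mem_singleton_self o))
    simp [gen, this]

theorem mul_gen_coeff (o : O) (f : Grassmann O R) (S : Finset O) :
    (f * gen o).coeff S =
      if o ∈ S then (-1) ^ (S.filter (o < ·)).card * f.coeff (S.erase o) else 0 := by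
  rw [mul_coeff]
  split_ifs with h
  · rw [Finset.sum_eq_single (S.erase o)]
    · have e : S \ S.erase o = {o} := by
        ext a; simp only [Finset.mem_sdiff, Finset.mem_erase, Finset.mem_singleton]
        constructor
        · rintro ⟨h1, h2⟩; by_contra h3; exact h2 ⟨h3, h1⟩
        · rintro rfl; exact ⟨h, by simp⟩
      rw [sgn, e, inv_singleton_right]
      have : (S.erase o).filter (o < ·) = S.filter (o < ·) := by
        ext a; simp only [Finset.mem_filter, Finset.mem_erase]
        exact ⟨fun h => ⟨h.1.2, h.2⟩, fun h => ⟨⟨h.2.ne', h.1⟩, h.2⟩⟩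
      simp [gen, this]
    · intro T hT hne
      have : S \ T ≠ {o} := by
        intro e
        apply hne
        rw [← Finset.sdiff_singleton_eq_erase, ← e,
          Finset.sdiff_sdiff_eq_self (Finset.mem_powerset.1 hT)]
      simp [gen, this]
    · intro h'; exact absurd (Finset.mem_powerset.2 (Finset.erase_subset o S)) h'
  · refine Finset.sum_eq_zero fun T hT => ?_
    have : S \ T ≠ {o} := by
      intro e
      have : o ∈ S \ T := by rw [e]; exact Finset.mem_singleton_self o
      exact h (Finset.mem_sdiff.1 this).1
    simp [gen, this]

/-- The parity involution. -/
def tau : Grassmann O R →+* Grassmann O R where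
  toFun f := ⟨fun S => (-1) ^ S.card * f.coeff S⟩
  map_one' := by ext S; by_cases h : S = ∅ <;> simp [one_coeff, h]
  map_zero' := by ext S; simp [zero_coeff]
  map_add' f g := by ext S; simp [add_coeff, mul_add]
  map_mul' f g := by
    ext S
    simp only [mul_coeff, Finset.mul_sum]
    refine Finset.sum_congr rfl fun T hT => ?_
    rw [← Finset.card_sdiff_add_card_eq_card (Finset.mem_powerset.1 hT), pow_add]
    ring

theorem tau_coeff (f : Grassmann O R) (S : Finset O) :
    (tau f).coeff S = (-1) ^ S.card * f.coeff S := rfl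

theorem tau_tau (f : Grassmann O R) : tau (tau f) = f := by
  ext S; rw [tau_coeff, tau_coeff, ← mul_assoc, ← mul_pow]; simp

theorem tau_const (r : R) : tau (const r : Grassmann O R) = const r := by
  ext S; rw [tau_coeff]; by_cases h : S = ∅ <;> simp [const, h]

theorem tau_gen (o : O) : tau (gen o : Grassmann O R) = -gen o := by
  ext S; rw [tau_coeff, neg_coeff]; by_cases h : S = {o} <;> simp [gen, h]

theorem body_tau (f : Grassmann O R) : body (tau f) = body f := by
  simp [body, tau_coeff]

/-- The power `p` of the parity involution. -/
def sig (p : ZMod 2) : Grassmann O R →+* Grassmann O R :=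
  if p = 0 then RingHom.id _ else tau

theorem sig_zero (f : Grassmann O R) : sig 0 f = f := rfl

theorem sig_one (f : Grassmann O R) : sig 1 f = tau f := rfl

theorem sig_const (p : ZMod 2) (r : R) : sig p (const r : Grassmann O R) = const r := by
  rcases zmod_two_cases p with rfl | rfl
  · rfl
  · exact tau_const r

theorem body_sig (p : ZMod 2) (f : Grassmann O R) : body (sig p f) = body f := by
  rcases zmod_two_cases p with rfl | rfl
  · rfl
  · exact body_tau f

theorem HasParity.sig {p : ZMod 2} {f : Grassmann O R} (h : HasParity p f) (q : ZMod 2) :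
    Grassmann.sig q f = sg (q * p) • f := by
  rcases zmod_two_cases q with rfl | rfl
  · simp [sig_zero, sg_zero]
  · rw [sig_one, one_mul]
    ext S
    rw [tau_coeff, zsmul_coeff]
    by_cases hS : (S.card : ZMod 2) = p
    · rw [← hS, sg_natCast, zsmul_eq_mul]; push_cast; rfl
    · rw [h S hS]; simp

theorem HasParity.mul {p q : ZMod 2} {f g : Grassmann O R} (hf : HasParity p f)
    (hg : HasParity q g) : HasParity (p + q) (f * g) := by
  intro S hS
  refine mul_coeff_eq_zero fun T hT => ?_
  by_cases h : (T.card : ZMod 2) = p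
  · refine Or.inr (hg _ fun h' => hS ?_)
    rw [← Finset.card_sdiff_add_card_eq_card hT, Nat.cast_add, h, h', add_comm]
  · exact Or.inl (hf _ h)

theorem HasParity.add {p : ZMod 2} {f g : Grassmann O R} (hf : HasParity p f)
    (hg : HasParity p g) : HasParity p (f + g) := fun S hS => by
  rw [add_coeff, hf S hS, hg S hS, add_zero]

theorem HasParity.zero (p : ZMod 2) : HasParity p (0 : Grassmann O R) := fun _ _ => rfl

theorem HasParity.neg {p : ZMod 2} {f : Grassmann O R} (hf : HasParity p f) :
    HasParity p (-f) := fun S hS => by rw [neg_coeff, hf S hS, neg_zero]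

theorem HasParity.sub {p : ZMod 2} {f g : Grassmann O R} (hf : HasParity p f)
    (hg : HasParity p g) : HasParity p (f - g) := by
  rw [sub_eq_add_neg]; exact hf.add hg.neg

theorem HasParity.zsmul {p : ZMod 2} {f : Grassmann O R} (hf : HasParity p f) (c : ℤ) :
    HasParity p (c • f) := fun S hS => by rw [zsmul_coeff, hf S hS, smul_zero]

theorem HasParity.smul {K : Type*} [Semiring K] [Module K R] {p : ZMod 2} {f : Grassmann O R}
    (hf : HasParity p f) (c : K) :
    HasParity p (c • f) := fun S hS => by rw [smul_coeff, hf S hS, smul_zero]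

theorem HasParity.sum {ι : Type*} {p : ZMod 2} {s : Finset ι} {f : ι → Grassmann O R}
    (h : ∀ i ∈ s, HasParity p (f i)) : HasParity p (∑ i ∈ s, f i) := fun S hS => by
  rw [sum_coeff]; exact Finset.sum_eq_zero fun i hi => h i hi S hS

theorem HasParity.const (r : R) : HasParity 0 (Grassmann.const r : Grassmann O R) :=
  fun S hS => if_neg (by rintro rfl; exact hS rfl)

theorem HasParity.one : HasParity 0 (1 : Grassmann O R) := HasParity.const 1

theorem HasParity.gen (o : O) : HasParity 1 (Grassmann.gen o : Grassmann O R) :=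
  fun S hS => if_neg (by rintro rfl; exact hS (by simp))

theorem HasParity.body_eq_zero {f : Grassmann O R} (hf : HasParity 1 f) : body f = 0 :=
  hf ∅ (by simp)

theorem HasParity.pow {f : Grassmann O R} (hf : HasParity 0 f) (n : ℕ) :
    HasParity 0 (f ^ n) := by
  induction n with
  | zero => rw [pow_zero]; exact HasParity.one
  | succ n ih => rw [pow_succ]; simpa using ih.mul hf

/-- Homogeneous elements commute up to the sign rule. -/
theorem HasParity.mul_comm {p q : ZMod 2} {f g : Grassmann O R} (hf : HasParity p f)
    (hg : HasParity q g) : f * g = sg (p * q) • (g * f) := by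
  ext S
  rw [zsmul_coeff, mul_coeff, mul_coeff, Finset.smul_sum]
  refine Finset.sum_bij' (fun T _ => S \ T) (fun T _ => S \ T) ?_ ?_ ?_ ?_ ?_
  · intro T _; simp
  · intro T _; simp
  · intro T hT; exact Finset.sdiff_sdiff_eq_self (Finset.mem_powerset.1 hT)
  · intro T hT; exact Finset.sdiff_sdiff_eq_self (Finset.mem_powerset.1 hT)
  · intro T hT
    rw [Finset.sdiff_sdiff_eq_self (Finset.mem_powerset.1 hT)]
    by_cases h1 : (T.card : ZMod 2) = p
    · by_cases h2 : ((S \ T).card : ZMod 2) = q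
      · have hi := inv_add_inv (S := T) (T := S \ T) Finset.disjoint_sdiff
        have : sgn R T (S \ T) = ((sg (p * q) : ℤ) : R) * sgn R (S \ T) T := by
          rw [← h1, ← h2, ← Nat.cast_mul, sg_natCast, ← hi]
          unfold sgn
          push_cast
          rw [pow_add, mul_assoc, ← mul_pow]
          simp
        rw [this, zsmul_eq_mul]; ring
      · rw [hg _ h2]; simp
    · rw [hf _ h1]; simp

theorem HasParity.commute {f : Grassmann O R} (hf : HasParity 0 f) (g : Grassmann O R) :
    f * g = g * f := by
  ext S
  have h0 : ∀ q : ZMod 2, HasParity q (⟨fun T => if (T.card : ZMod 2) = q then g.coeff T else 0⟩ :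
      Grassmann O R) := fun q T hT => if_neg hT
  have : g = ⟨fun T => if (T.card : ZMod 2) = 0 then g.coeff T else 0⟩ +
      ⟨fun T => if (T.card : ZMod 2) = 1 then g.coeff T else 0⟩ := by
    ext T
    rw [add_coeff]
    rcases zmod_two_cases (T.card : ZMod 2) with h | h <;> simp [h]
  rw [this, mul_add, add_mul, hf.mul_comm (h0 0), hf.mul_comm (h0 1)]
  simp [sg_zero]

/-- The decomposition into even and odd parts. -/
theorem exists_parity_decomposition (f : Grassmann O R) :
    ∃ f₀ f₁, HasParity 0 f₀ ∧ HasParity 1 f₁ ∧ f = f₀ + f₁ :=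
  ⟨⟨fun T => if (T.card : ZMod 2) = 0 then f.coeff T else 0⟩,
    ⟨fun T => if (T.card : ZMod 2) = 1 then f.coeff T else 0⟩,
    fun _ hT => if_neg hT, fun _ hT => if_neg hT, by
      ext T
      rw [add_coeff]
      rcases zmod_two_cases (T.card : ZMod 2) with h | h <;> simp [h]⟩

/-- An element of parity `p` can be moved through any element with the help of the parity
involution. -/
theorem HasParity.mul_eq_sig_mul {p : ZMod 2} {f : Grassmann O R} (hf : HasParity p f)
    (g : Grassmann O R) : f * g = Grassmann.sig p g * f := by
  obtain ⟨g₀, g₁, h0, h1, rfl⟩ := exists_parity_decomposition g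
  rw [map_add, h0.sig, h1.sig, mul_add, add_mul, hf.mul_comm h0, hf.mul_comm h1,
    smul_mul_assoc, smul_mul_assoc]

theorem HasParity.mul_eq_mul_sig {p : ZMod 2} {f : Grassmann O R} (hf : HasParity p f)
    (g : Grassmann O R) : g * f = f * Grassmann.sig p g := by
  obtain ⟨g₀, g₁, h0, h1, rfl⟩ := exists_parity_decomposition g
  rw [map_add, h0.sig, h1.sig, mul_add, add_mul,
    mul_smul_comm, mul_smul_comm, hf.mul_comm h0, hf.mul_comm h1, smul_smul, smul_smul,
    sg_mul_self, sg_mul_self, one_smul, one_smul]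

end Basic

section Induction

variable [LinearOrder O] [Fintype O] [CommRing R]

/-- A single monomial. -/
def mono (S : Finset O) (r : R) : Grassmann O R := ⟨fun T => if T = S then r else 0⟩

/-- No sign arises, because `a` precedes every index of `S` and is already in its ordered position.
Building monomials through their smallest index thus needs only left multiplication by generators.
-/
theorem mono_insert {a : O} {S : Finset O} (h : ∀ x ∈ S, a < x) (r : R) :
    mono (insert a S) r = gen a * mono S r := by
  have ha : a ∉ S := fun h' => lt_irrefl _ (h a h')
  ext T
  rw [gen_mul_coeff]
  by_cases hT : T = insert a S
  · subst hT
    have : (insert a S).filter (· < a) = ∅ := by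
      ext x
      simp only [Finset.mem_filter, Finset.mem_insert, Finset.notMem_empty, iff_false]
      rintro ⟨rfl | hx, h'⟩
      · exact lt_irrefl _ h'
      · exact lt_asymm h' (h x hx)
    simp [mono, this, Finset.erase_insert ha]
  · rw [mono]
    simp only [hT, if_false]
    split_ifs with h1
    · have : T.erase a ≠ S := by rintro rfl; exact hT (Finset.insert_erase h1).symm
      simp [mono, this]
    · rfl

theorem eq_sum_mono (f : Grassmann O R) : f = ∑ S, mono S (f.coeff S) := by
  ext T; rw [sum_coeff]; simp [mono]

-- Every element is a sum of ordered monomials, and `mono_insert` builds a monomial from a constant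
-- by multiplying with generators from the left. Identities such as the Leibniz rule then need
-- checking only on constants and under a single left factor.
@[elab_as_elim]
theorem induction {P : Grassmann O R → Prop} (hc : ∀ r, P (const r))
    (ha : ∀ f g, P f → P g → P (f + g)) (hg : ∀ o f, P f → P (gen o * f)) (f : Grassmann O R) :
    P f := by
  have hm : ∀ (S : Finset O) (r : R), P (mono S r) := by
    intro S r
    induction S using Finset.induction_on_min with
    | empty => exact hc r
    | insert a s h ih => rw [mono_insert h]; exact hg a _ ih
  rw [eq_sum_mono f]
  refine Finset.sum_induction _ P ha ?_ fun S _ => hm S _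
  rw [← const_zero]; exact hc 0

end Induction

section Derivatives

variable [LinearOrder O] [CommRing R]

theorem leftD_add (o : O) (f g : Grassmann O R) : leftD o (f + g) = leftD o f + leftD o g := by
  ext S; simp only [leftD, add_coeff]; split_ifs <;> ring

theorem leftD_const (o : O) (r : R) : leftD o (const r : Grassmann O R) = 0 := by
  ext S; simp [leftD, const, zero_coeff]

theorem leftD_const_mul (o : O) (r : R) (f : Grassmann O R) :
    leftD o (const r * f) = const r * leftD o f := by
  ext S; rw [const_mul_coeff]; simp only [leftD, const_mul_coeff]; split_ifs <;> ring

/-- The Clifford-type relation between derivatives and generators. For `a ≠ o` the sign comes from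
the one transposition of `a` and `o`: depending on their order, either the count below `a` or the
count below `o` changes by one. Together with the value on constants this relation determines the
left derivative. -/
theorem leftD_gen_mul (o a : O) (f : Grassmann O R) :
    leftD o (gen a * f) = (if a = o then f else 0) - gen a * leftD o f := by
  ext S
  rw [sub_coeff, gen_mul_coeff]
  simp only [leftD]
  by_cases hao : a = o
  · subst hao
    rw [gen_mul_coeff]
    by_cases ha : a ∈ S
    · have e : ((S.erase a).filter (· < a)) = S.filter (· < a) := by
        ext x; simp only [Finset.mem_filter, Finset.mem_erase]
        exact ⟨fun h => ⟨h.1.2, h.2⟩, fun h => ⟨⟨h.2.ne, h.1⟩, h.2⟩⟩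
      simp only [ha, if_true, Finset.notMem_erase, if_false, e, Finset.insert_erase ha]
      rw [← mul_assoc, ← mul_pow]; simp
    · have e : ((insert a S).filter (· < a)) = S.filter (· < a) := by
        ext x; simp only [Finset.mem_filter, Finset.mem_insert]
        exact ⟨fun h => ⟨h.1.resolve_left h.2.ne, h.2⟩, fun h => ⟨Or.inr h.1, h.2⟩⟩
      simp only [ha, if_false, if_true, Finset.mem_insert, true_or, e, Finset.erase_insert ha]
      rw [← mul_assoc, ← mul_pow]; simp
  · simp only [hao, if_false, zero_coeff, zero_sub]
    rw [gen_mul_coeff]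
    by_cases ho : o ∈ S
    · simp [ho, Finset.mem_erase, Ne.symm hao]
    · by_cases ha : a ∈ S
      · have h1 : o ∉ S.erase a := fun h => ho (Finset.mem_of_mem_erase h)
        have h2 : a ∈ insert o S := Finset.mem_insert_of_mem ha
        have h3 : (insert o S).erase a = insert o (S.erase a) :=
          Finset.erase_insert_of_ne (Ne.symm hao)
        simp only [ho, ha, h1, h2, if_false, if_true, h3]
        rcases lt_or_gt_of_ne hao with hlt | hgt
        · have e1 : (insert o S).filter (· < a) = S.filter (· < a) := by
            rw [Finset.filter_insert, if_neg hlt.not_gt]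
          have e2 : (S.filter (· < o)).card = ((S.erase a).filter (· < o)).card + 1 := by
            rw [← Finset.card_erase_add_one (s := S.filter (· < o)) (a := a)
              (Finset.mem_filter.2 ⟨ha, hlt⟩), Finset.filter_erase]
          rw [e1, e2]; ring
        · have e1 : ((insert o S).filter (· < a)).card = (S.filter (· < a)).card + 1 := by
            rw [Finset.filter_insert, if_pos hgt, Finset.card_insert_of_notMem]
            simp [ho]
          have e2 : (S.filter (· < o)) = ((S.erase a).filter (· < o)) := by
            rw [Finset.filter_erase, Finset.erase_eq_of_notMem]
            simp [hgt.not_gt]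
          rw [e1, e2]; ring
      · have h2 : a ∉ insert o S := by simp [hao, ha]
        simp [ho, ha, h2]

theorem leftD_zero (o : O) : leftD o (0 : Grassmann O R) = 0 := by
  ext S; simp [leftD, zero_coeff]

theorem leftD_neg (o : O) (f : Grassmann O R) : leftD o (-f) = -leftD o f := by
  ext S; simp only [leftD, neg_coeff]; split_ifs <;> simp

theorem leftD_sub (o : O) (f g : Grassmann O R) : leftD o (f - g) = leftD o f - leftD o g := by
  rw [sub_eq_add_neg, leftD_add, leftD_neg, sub_eq_add_neg]

theorem leftD_smul {K : Type*} [Semiring K] [Module K R] [SMulCommClass K R R] (o : O) (c : K)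
    (f : Grassmann O R) : leftD o (c • f) = c • leftD o f := by
  ext S; simp only [leftD, smul_coeff]; split_ifs
  · simp
  · rw [mul_smul_comm]

theorem leftD_mul [Fintype O] (o : O) (f g : Grassmann O R) :
    leftD o (f * g) = leftD o f * g + tau f * leftD o g := by
  induction f using Grassmann.induction with
  | hc r => rw [leftD_const_mul, leftD_const, tau_const, zero_mul, zero_add]
  | ha f₁ f₂ h1 h2 => rw [add_mul, leftD_add, h1, h2, leftD_add, map_add]; noncomm_ring
  | hg a f ih =>
    rw [mul_assoc, leftD_gen_mul, leftD_gen_mul, ih, map_mul, tau_gen]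
    split_ifs <;> noncomm_ring

/-- The signs of the two derivatives count the remaining factors above and below `o`. Together these
are all the remaining factors, and their number is the exponent in `tau`. -/
theorem rightD_eq (o : O) (f : Grassmann O R) : rightD o f = tau (leftD o f) := by
  ext S
  rw [tau_coeff]
  simp only [rightD, leftD]
  split_ifs with h
  · simp
  · have : S.card = (S.filter (· < o)).card + (S.filter (o < ·)).card := by
      rw [← Finset.card_filter_add_card_filter_not (· < o)]
      congr 2
      ext x
      simp only [Finset.mem_filter, not_lt]
      refine and_congr_right fun hx => ⟨fun h' => lt_of_le_of_ne h' ?_, le_of_lt⟩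
      rintro rfl; exact h hx
    rw [this, pow_add]
    have h1 : ((-1 : R) ^ (S.filter (· < o)).card) * (-1) ^ (S.filter (· < o)).card = 1 := by
      rw [← mul_pow]; simp
    linear_combination (-(-1 : R) ^ (S.filter (o < ·)).card * f.coeff (insert o S)) * h1

theorem HasParity.leftD {p : ZMod 2} {f : Grassmann O R} (hf : HasParity p f) (o : O) :
    HasParity (p + 1) (Grassmann.leftD o f) := fun S hS => by
  simp only [Grassmann.leftD]
  split_ifs with h
  · rfl
  · rw [hf, mul_zero]
    rw [Finset.card_insert_of_notMem h]
    push_cast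
    intro h'
    apply hS
    rw [← h', add_assoc]
    simp [show (1 : ZMod 2) + 1 = 0 from rfl]

theorem leftD_tau (o : O) (f : Grassmann O R) : leftD o (tau f) = -tau (leftD o f) := by
  ext S
  rw [neg_coeff, tau_coeff]
  simp only [leftD, tau_coeff]
  split_ifs with h
  · simp
  · rw [Finset.card_insert_of_notMem h]; ring

theorem leftD_leftD [Fintype O] (o a : O) (f : Grassmann O R) :
    leftD o (leftD a f) = -leftD a (leftD o f) := by
  induction f using Grassmann.induction with
  | hc r => simp only [leftD_const, leftD_zero, neg_zero]
  | ha f₁ f₂ h1 h2 => simp only [leftD_add, h1, h2]; abel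
  | hg b f ih =>
    rw [leftD_gen_mul, leftD_gen_mul, leftD_sub, leftD_sub, leftD_gen_mul, leftD_gen_mul, ih]
    split_ifs <;> simp [leftD_zero] <;> abel

end Derivatives

section MapCoeff

variable {R' : Type*} [LinearOrder O] [CommRing R] [CommRing R']

/-- The ring homomorphism of Grassmann algebras induced by one of the coefficients. -/
def mapHom (φ : R →+* R') : Grassmann O R →+* Grassmann O R' where
  toFun := mapCoeff φ
  map_one' := by ext S; by_cases h : S = ∅ <;> simp [mapCoeff, one_coeff, h]
  map_zero' := by ext S; simp [mapCoeff, zero_coeff]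
  map_add' f g := by ext S; simp [mapCoeff, add_coeff]
  map_mul' f g := by
    ext S
    simp only [mapCoeff, mul_coeff, map_sum, map_mul]
    refine Finset.sum_congr rfl fun T _ => ?_
    simp [sgn]

/-- A derivation of the coefficients gives a derivation of the Grassmann algebra. -/
theorem mapCoeff_mul (δ : R → R) (h0 : δ 0 = 0) (ha : ∀ a b, δ (a + b) = δ a + δ b)
    (hm : ∀ a b, δ (a * b) = δ a * b + a * δ b) (f g : Grassmann O R) :
    mapCoeff δ (f * g) = mapCoeff δ f * g + f * mapCoeff δ g := by
  have hn : ∀ a, δ (-a) = -δ a := fun a => by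
    have := ha a (-a); rw [add_neg_cancel, h0] at this; exact (neg_eq_of_add_eq_zero_right this.symm).symm
  ext S
  rw [add_coeff]
  simp only [mapCoeff, mul_coeff]
  rw [show δ (∑ T ∈ S.powerset, sgn R T (S \ T) * (f.coeff T * g.coeff (S \ T))) =
    ∑ T ∈ S.powerset, δ (sgn R T (S \ T) * (f.coeff T * g.coeff (S \ T))) from
    map_sum (⟨⟨δ, h0⟩, ha⟩ : R →+ R) _ _, ← Finset.sum_add_distrib]
  refine Finset.sum_congr rfl fun T _ => ?_
  rw [← mul_add]
  unfold sgn
  rcases Nat.even_or_odd (inv T (S \ T)) with h | h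
  · rw [h.neg_one_pow, one_mul, one_mul, hm]
  · rw [h.neg_one_pow, neg_one_mul, neg_one_mul, hn, hm]

end MapCoeff

end Grassmann
end
end SuperBV

set_option linter.unusedSectionVars false
namespace SuperBV
noncomputable section

/-! ### Smooth functions -/

section SmoothFunctions

variable {N : ℕ} {U : TopologicalSpace.Opens (Fin N → ℝ)}

namespace Smooth

theorem contDiffAt (f : Smooth U) (x : U) : ContDiffAt ℝ ∞ (extendZero f.1) (x : Fin N → ℝ) :=
  (show ContDiffOn ℝ ∞ (extendZero f.1) (U : Set (Fin N → ℝ)) from f.2).contDiffAt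
    (U.isOpen.mem_nhds x.2)

theorem differentiableAt (f : Smooth U) (x : U) :
    DifferentiableAt ℝ (extendZero f.1) (x : Fin N → ℝ) :=
  (Smooth.contDiffAt f x).differentiableAt (by simp)

@[ext] theorem ext {f g : Smooth U} (h : ∀ x, f.1 x = g.1 x) : f = g :=
  Subtype.ext (funext h)

theorem add_apply (f g : Smooth U) (x : U) : (f + g).1 x = f.1 x + g.1 x := rfl

theorem mul_apply (f g : Smooth U) (x : U) : (f * g).1 x = f.1 x * g.1 x := rfl

theorem zero_apply (x : U) : (0 : Smooth U).1 x = 0 := rfl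

theorem one_apply (x : U) : (1 : Smooth U).1 x = 1 := rfl

/-- Evaluation at a point. -/
def evalHom (x : U) : Smooth U →+* ℂ where
  toFun f := f.1 x
  map_one' := rfl
  map_zero' := rfl
  map_add' _ _ := rfl
  map_mul' _ _ := rfl

theorem sum_apply {ι : Type*} (s : Finset ι) (f : ι → Smooth U) (x : U) :
    (∑ i ∈ s, f i).1 x = ∑ i ∈ s, (f i).1 x := map_sum (evalHom x) f s

theorem extendZero_apply' (f : Smooth U) (x : U) : extendZero f.1 x = f.1 x :=
  extendZero_apply f.1 x.2

theorem pd_apply (i : Fin N) (f : Smooth U) (x : U) :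
    (pd i f).1 x = fderiv ℝ (extendZero f.1) x (Pi.single i 1) := rfl

/-- A derivative sees only a neighbourhood of `x`, and `U` is one. The extension by zero can
therefore be replaced by any formula that is correct on `U`. -/
theorem pd_eq_of_eventuallyEq {i : Fin N} {f : Smooth U} {g : (Fin N → ℝ) → ℂ} {x : U}
    (h : ∀ y : U, f.1 y = g y) : (pd i f).1 x = fderiv ℝ g x (Pi.single i 1) := by
  rw [pd_apply]
  congr 1
  refine Filter.EventuallyEq.fderiv_eq ?_
  filter_upwards [U.isOpen.mem_nhds x.2] with y hy
  rw [extendZero_apply _ hy]; exact h ⟨y, hy⟩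

theorem pd_add (i : Fin N) (f g : Smooth U) : pd i (f + g) = pd i f + pd i g := by
  ext x
  rw [pd_eq_of_eventuallyEq (g := extendZero f.1 + extendZero g.1)
    (fun y => by simp [add_apply, extendZero_apply']),
    fderiv_add (Smooth.differentiableAt f x) (Smooth.differentiableAt g x)]
  rfl

theorem pd_mul (i : Fin N) (f g : Smooth U) : pd i (f * g) = pd i f * g + f * pd i g := by
  ext x
  rw [pd_eq_of_eventuallyEq (g := extendZero f.1 * extendZero g.1)
    (fun y => by simp [mul_apply, extendZero_apply']),
    fderiv_mul (Smooth.differentiableAt f x) (Smooth.differentiableAt g x)]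
  simp only [add_apply, mul_apply, pd_apply, extendZero_apply', _root_.add_apply,
    _root_.smul_apply, smul_eq_mul]
  ring

theorem pd_algebraMap (i : Fin N) (c : ℂ) : pd i (algebraMap ℂ (Smooth U) c) = 0 := by
  ext x
  rw [pd_eq_of_eventuallyEq (g := fun _ => c) (fun y => rfl)]
  simp [zero_apply]

theorem pd_smul (i : Fin N) (c : ℂ) (f : Smooth U) : pd i (c • f) = c • pd i f := by
  rw [Algebra.smul_def, pd_mul, pd_algebraMap, zero_mul, zero_add, Algebra.smul_def]

theorem pd_zero (i : Fin N) : pd i (0 : Smooth U) = 0 := by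
  simpa using pd_smul i 0 (0 : Smooth U)

theorem pd_one (i : Fin N) : pd i (1 : Smooth U) = 0 := by
  simpa using pd_algebraMap (U := U) i 1

theorem pd_comm (i j : Fin N) (f : Smooth U) : pd i (pd j f) = pd j (pd i f) := by
  have h2 : ∀ (i j : Fin N) (x : U), (pd i (pd j f)).1 x =
      fderiv ℝ (fderiv ℝ (extendZero f.1)) x (Pi.single i 1) (Pi.single j 1) := by
    intro i j x
    rw [pd_eq_of_eventuallyEq (g := fun y => fderiv ℝ (extendZero f.1) y (Pi.single j 1))
      (fun y => rfl)]
    have hd : DifferentiableAt ℝ (fderiv ℝ (extendZero f.1)) (x : Fin N → ℝ) :=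
      ((Smooth.contDiffAt f x).fderiv_right (m := ∞) (by simp)).differentiableAt (by simp)
    rw [fderiv_clm_apply hd (differentiableAt_const _)]
    simp
  ext x
  rw [h2, h2]
  have hs : IsSymmSndFDerivAt ℝ (extendZero f.1) (x : Fin N → ℝ) :=
    (Smooth.contDiffAt f x).isSymmSndFDerivAt (by simp only [minSmoothness_of_isRCLikeNormedField]; exact WithTop.coe_le_coe.2 (le_top : (2 : ℕ∞) ≤ ⊤))
  exact hs _ _

theorem pd_exp (i : Fin N) (f : Smooth U) : pd i (exp f) = pd i f * exp f := by
  ext x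
  rw [pd_eq_of_eventuallyEq (g := fun y => Complex.exp (extendZero f.1 y))
    (fun y => by simp [exp, extendZero_apply']), ((Smooth.differentiableAt f x).hasFDerivAt.cexp).fderiv]
  simp only [mul_apply, pd_apply, exp, _root_.smul_apply, extendZero_apply',
    smul_eq_mul]
  ring

theorem exp_add (f g : Smooth U) : exp (f + g) = exp f * exp g := by
  ext x; simp [exp, add_apply, mul_apply, Complex.exp_add]

theorem exp_zero : exp (0 : Smooth U) = 1 := by
  ext x; simp [exp, zero_apply, one_apply]

theorem isUnit_of_ne_zero {f : Smooth U} (h : ∀ x, f.1 x ≠ 0) : IsUnit f := by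
  have hs : IsSmooth (fun x => (f.1 x)⁻¹) := by
    refine isSmooth_of_contDiffOn (g := fun x => (extendZero f.1 x)⁻¹) ?_
      fun x => by rw [extendZero_apply']
    refine ContDiffOn.inv f.2 fun x hx => ?_
    rw [extendZero_apply _ hx]; exact h _
  refine IsUnit.of_mul_eq_one (⟨_, hs⟩ : Smooth U) ?_
  ext x; exact mul_inv_cancel₀ (h x)

/-- Restriction to a smaller open set, as a ring homomorphism. -/
def restrictHom {W : TopologicalSpace.Opens (Fin N → ℝ)} (h : W ≤ U) : Smooth U →+* Smooth W where
  toFun := restrict h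
  map_one' := rfl
  map_zero' := rfl
  map_add' _ _ := rfl
  map_mul' _ _ := rfl

theorem pd_restrict {W : TopologicalSpace.Opens (Fin N → ℝ)} (h : W ≤ U) (i : Fin N)
    (f : Smooth U) : pd i (restrict h f) = restrict h (pd i f) := by
  ext x
  rw [pd_eq_of_eventuallyEq (g := extendZero f.1)
    (fun y => by rw [extendZero_apply _ (h y.2)]; rfl)]
  rfl

end Smooth

end SmoothFunctions

/-! ### The filtration by the degree in the odd generators -/

namespace Grassmann

variable {O R : Type*} [LinearOrder O] [CommRing R]

theorem body_sub (f g : Grassmann O R) : body (f - g) = body f - body g := rfl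

theorem body_one : body (1 : Grassmann O R) = 1 := rfl

/-- All monomials of `f` have degree at least `d`. -/
def HasOrder (d : ℕ) (f : Grassmann O R) : Prop := ∀ S, S.card < d → f.coeff S = 0

theorem HasOrder.mul {d e : ℕ} {f g : Grassmann O R} (hf : HasOrder d f) (hg : HasOrder e g) :
    HasOrder (d + e) (f * g) := fun S hS => by
  refine mul_coeff_eq_zero fun T hT => ?_
  rcases lt_or_ge T.card d with h | h
  · exact Or.inl (hf T h)
  · refine Or.inr (hg _ ?_)
    have := Finset.card_sdiff_add_card_eq_card hT
    omega

theorem HasOrder.add {d : ℕ} {f g : Grassmann O R} (hf : HasOrder d f) (hg : HasOrder d g) :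
    HasOrder d (f + g) := fun S hS => by rw [add_coeff, hf S hS, hg S hS, add_zero]

theorem HasOrder.neg {d : ℕ} {f : Grassmann O R} (hf : HasOrder d f) :
    HasOrder d (-f) := fun S hS => by rw [neg_coeff, hf S hS, neg_zero]

theorem HasOrder.sub {d : ℕ} {f g : Grassmann O R} (hf : HasOrder d f) (hg : HasOrder d g) :
    HasOrder d (f - g) := by rw [sub_eq_add_neg]; exact hf.add hg.neg

theorem HasOrder.sum {ι : Type*} {d : ℕ} {s : Finset ι} {f : ι → Grassmann O R}
    (h : ∀ i ∈ s, HasOrder d (f i)) : HasOrder d (∑ i ∈ s, f i) := fun S hS => by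
  rw [sum_coeff]; exact Finset.sum_eq_zero fun i hi => h i hi S hS

theorem HasOrder.smul {K : Type*} [Semiring K] [Module K R] {d : ℕ} {f : Grassmann O R}
    (hf : HasOrder d f) (c : K) : HasOrder d (c • f) := fun S hS => by
  rw [smul_coeff, hf S hS, smul_zero]

theorem HasOrder.mono {d e : ℕ} {f : Grassmann O R} (hf : HasOrder d f) (h : e ≤ d) :
    HasOrder e f := fun S hS => hf S (hS.trans_le h)

theorem hasOrder_zero (f : Grassmann O R) : HasOrder 0 f := fun _ h => absurd h (Nat.not_lt_zero _)

theorem HasOrder.mul_left {d : ℕ} {f : Grassmann O R} (hf : HasOrder d f) (g : Grassmann O R) :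
    HasOrder d (g * f) := by simpa using (hasOrder_zero g).mul hf

theorem HasOrder.mul_right {d : ℕ} {f : Grassmann O R} (hf : HasOrder d f) (g : Grassmann O R) :
    HasOrder d (f * g) := by simpa using hf.mul (hasOrder_zero g)

theorem HasOrder.pow {d : ℕ} {f : Grassmann O R} (hf : HasOrder d f) (n : ℕ) :
    HasOrder (n * d) (f ^ n) := by
  induction n with
  | zero => rw [zero_mul]; exact hasOrder_zero _
  | succ n ih => rw [pow_succ, add_mul, one_mul]; exact ih.mul hf

theorem hasOrder_one_iff {f : Grassmann O R} : HasOrder 1 f ↔ body f = 0 := by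
  refine ⟨fun h => h ∅ (by simp), fun h S hS => ?_⟩
  rw [Nat.lt_one_iff, Finset.card_eq_zero] at hS
  rw [hS]; exact h

theorem HasOrder.eq_zero [Fintype O] {d : ℕ} {f : Grassmann O R} (hf : HasOrder d f)
    (h : Fintype.card O < d) : f = 0 := by
  ext S; exact hf S ((Finset.card_le_univ S).trans_lt h)

theorem hasOrder_sub_const (f : Grassmann O R) : HasOrder 1 (f - const (body f)) := by
  rw [hasOrder_one_iff]
  rw [body_sub, body_const, sub_self]

theorem pow_eq_zero_of_body_eq_zero [Fintype O] {f : Grassmann O R} (h : body f = 0) {n : ℕ}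
    (hn : Fintype.card O < n) : f ^ n = 0 :=
  ((hasOrder_one_iff.2 h).pow n).eq_zero (by simpa using hn)

/-- The entries do not commute, so determinants are not available. An inverse of the body is lifted
by constants to `C`. Both `C * M` and `M * C` then have body `1`, and a matrix without body is
nilpotent: its powers gain order in the generators until the order exceeds their number. -/
theorem isUnit_matrix_of_body [Fintype O] {ι : Type*} [Fintype ι] [DecidableEq ι]
    {M : Matrix ι ι (Grassmann O R)} (h : IsUnit (M.map body)) : IsUnit M := by
  obtain ⟨P, hP, hP'⟩ := isUnit_iff_exists.1 h
  set C : Matrix ι ι (Grassmann O R) := P.map (constHom O R) with hC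
  have hb : ∀ X : Matrix ι ι (Grassmann O R), X.map body = (bodyHom O R).mapMatrix X :=
    fun X => rfl
  have hCb : C.map body = P := by ext i j; exact body_const (O := O) (P i j)
  have hnil : ∀ X : Matrix ι ι (Grassmann O R), X.map body = 0 → IsNilpotent X := by
    intro X hX
    have ho : ∀ (n : ℕ) i j, HasOrder n ((X ^ n) i j) := by
      intro n
      induction n with
      | zero => intro i j; exact hasOrder_zero _
      | succ n ih =>
        intro i j
        rw [pow_succ, Matrix.mul_apply]
        exact HasOrder.sum fun k _ => (ih i k).mul (hasOrder_one_iff.2 (congrFun (congrFun hX k) j))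
    exact ⟨Fintype.card O + 1, Matrix.ext fun i j => (ho _ i j).eq_zero (Nat.lt_succ_self _)⟩
  have key : ∀ X : Matrix ι ι (Grassmann O R), X.map body = 1 → IsUnit X := by
    intro X hX
    have : IsNilpotent (X - 1) := hnil _ (by rw [hb, map_sub, map_one, ← hb, hX, sub_self])
    simpa using this.isUnit_add_one
  have h1 : IsUnit (C * M) := key _ (by rw [hb, map_mul, ← hb, ← hb, hCb, hP'])
  have h2 : IsUnit (M * C) := key _ (by rw [hb, map_mul, ← hb, ← hb, hCb, hP])
  obtain ⟨u, hu⟩ := isUnit_iff_exists.1 h1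
  obtain ⟨v, hv⟩ := isUnit_iff_exists.1 h2
  have e1 : (u * C) * M = 1 := by rw [mul_assoc]; exact hu.2
  have e2 : M * (C * v) = 1 := by rw [← mul_assoc]; exact hv.1
  exact isUnit_iff_exists.2 ⟨u * C, by rw [left_inv_eq_right_inv e1 e2]; exact e2, e1⟩

theorem isUnit_of_body [Fintype O] {f : Grassmann O R} (h : IsUnit (body f)) : IsUnit f := by
  obtain ⟨r, hr⟩ := isUnit_iff_exists.1 h
  have : IsNilpotent (const r * f - 1) :=
    ⟨Fintype.card O + 1, pow_eq_zero_of_body_eq_zero (by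
      rw [body_sub, body_mul, body_const, hr.2, body_one, sub_self]) (Nat.lt_succ_self _)⟩
  have h1 : IsUnit (const r * f) := by simpa using this.isUnit_add_one
  have h2 : IsUnit (const (body f) : Grassmann O R) := h.map (constHom O R)
  have h3 : const (body f) * (const r * f) = f := by
    rw [← mul_assoc, ← const_mul, hr.1, const_one, one_mul]
  rw [← h3]; exact h2.mul h1

theorem mem_evenSubring_iff {f : Grassmann O R} : f ∈ evenSubring O R ↔ HasParity 0 f := by
  constructor
  · intro h S hS
    refine h S ?_
    rcases Nat.even_or_odd S.card with h' | h'
    · exact absurd ((ZMod.natCast_eq_zero_iff_even).2 h') hS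
    · exact h'
  · intro h S hS
    refine h S fun h' => ?_
    rw [ZMod.natCast_eq_zero_iff_even] at h'
    exact (Nat.not_even_iff_odd.2 hS) h'

theorem evenPart_coe {f : Grassmann O R} (h : HasParity 0 f) :
    (evenPart f : Grassmann O R) = f := by
  ext S
  change (if Odd S.card then 0 else f.coeff S) = f.coeff S
  split_ifs with h'
  · exact (mem_evenSubring_iff.2 h S h').symm
  · rfl

theorem hasParity_coe (f : evenSubring O R) : HasParity 0 (f : Grassmann O R) :=
  mem_evenSubring_iff.1 f.2

theorem isUnit_evenSubring_of_body [Fintype O] {f : evenSubring O R}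
    (h : IsUnit (body (f : Grassmann O R))) : IsUnit f := by
  obtain ⟨r, hr⟩ := isUnit_iff_exists.1 h
  let c : R → evenSubring O R := fun r => ⟨const r, mem_evenSubring_iff.2 (HasParity.const r)⟩
  have : IsNilpotent (c r * f - 1) := by
    refine ⟨Fintype.card O + 1, Subtype.ext ?_⟩
    exact pow_eq_zero_of_body_eq_zero (f := (const r : Grassmann O R) * (f : Grassmann O R) - 1) (by
      rw [body_sub, body_mul, body_const, hr.2, body_one, sub_self]) (Nat.lt_succ_self _)
  have h1 : IsUnit (c r * f) := by simpa using this.isUnit_add_one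
  exact isUnit_of_mul_isUnit_right h1

end Grassmann

open Grassmann

/-! ### Derivatives of superfunctions -/

section Deriv

variable {O : Type*} [LinearOrder O] {N : ℕ} {U : TopologicalSpace.Opens (Fin N → ℝ)}

theorem mapCoeff_pd_mul (i : Fin N) (f g : Grassmann O (Smooth U)) :
    mapCoeff (Smooth.pd i) (f * g) =
      mapCoeff (Smooth.pd i) f * g + f * mapCoeff (Smooth.pd i) g :=
  mapCoeff_mul _ (Smooth.pd_zero i) (Smooth.pd_add i) (Smooth.pd_mul i) f g

theorem pd_neg_one_pow_mul (i : Fin N) (n : ℕ) (f : Smooth U) :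
    Smooth.pd i ((-1) ^ n * f) = (-1) ^ n * Smooth.pd i f := by
  have : ((-1 : Smooth U) ^ n) = algebraMap ℂ (Smooth U) ((-1) ^ n) := by simp
  rw [this, Smooth.pd_mul, Smooth.pd_algebraMap, zero_mul, zero_add]

theorem mapCoeff_pd_leftD (i : Fin N) (o : O) (f : Grassmann O (Smooth U)) :
    mapCoeff (Smooth.pd i) (leftD o f) = leftD o (mapCoeff (Smooth.pd i) f) := by
  ext S : 2
  change Smooth.pd i (if o ∈ S then 0 else (-1) ^ (S.filter (· < o)).card * f.coeff (insert o S)) =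
    if o ∈ S then 0 else (-1) ^ (S.filter (· < o)).card * Smooth.pd i (f.coeff (insert o S))
  split_ifs
  · exact Smooth.pd_zero i
  · exact pd_neg_one_pow_mul i _ _

theorem mapCoeff_pd_tau (i : Fin N) (f : Grassmann O (Smooth U)) :
    mapCoeff (Smooth.pd i) (tau f) = tau (mapCoeff (Smooth.pd i) f) := by
  ext S : 2
  exact pd_neg_one_pow_mul i _ _

theorem mapCoeff_pd_add (i : Fin N) (f g : Grassmann O (Smooth U)) :
    mapCoeff (Smooth.pd i) (f + g) = mapCoeff (Smooth.pd i) f + mapCoeff (Smooth.pd i) g := by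
  ext S : 2; exact Smooth.pd_add i _ _

theorem mapCoeff_pd_smul (i : Fin N) (c : ℂ) (f : Grassmann O (Smooth U)) :
    mapCoeff (Smooth.pd i) (c • f) = c • mapCoeff (Smooth.pd i) f := by
  ext S : 2; exact Smooth.pd_smul i _ _

theorem mapCoeff_pd_comm (i j : Fin N) (f : Grassmann O (Smooth U)) :
    mapCoeff (Smooth.pd i) (mapCoeff (Smooth.pd j) f) =
      mapCoeff (Smooth.pd j) (mapCoeff (Smooth.pd i) f) := by
  ext S : 2; exact Smooth.pd_comm i j _

theorem mapCoeff_pd_const (i : Fin N) (r : Smooth U) :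
    mapCoeff (Smooth.pd i) (const r : Grassmann O (Smooth U)) = const (Smooth.pd i r) := by
  ext S : 2
  change Smooth.pd i (if S = ∅ then r else 0) = if S = ∅ then Smooth.pd i r else 0
  split_ifs
  · rfl
  · exact Smooth.pd_zero i

theorem hasParity_mapCoeff_pd {p : ZMod 2} {f : Grassmann O (Smooth U)} (hf : HasParity p f)
    (i : Fin N) : HasParity p (mapCoeff (Smooth.pd i) f) := fun S hS => by
  simp only [mapCoeff, hf S hS]; exact Smooth.pd_zero i

theorem sig_smul {R K : Type*} [CommRing R] [Semiring K] [Module K R] [SMulCommClass K R R]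
    (p : ZMod 2) (c : K) (f : Grassmann O R) : sig p (c • f) = c • sig p f := by
  rcases zmod_two_cases p with rfl | rfl
  · rfl
  · ext S; rw [sig_one, sig_one, tau_coeff, smul_coeff, smul_coeff, tau_coeff, mul_smul_comm]

theorem sig_sig {R : Type*} [CommRing R] (p : ZMod 2) (f : Grassmann O R) :
    sig p (sig p f) = f := by
  rcases zmod_two_cases p with rfl | rfl
  · rfl
  · exact tau_tau f

theorem sig_add' {R : Type*} [CommRing R] (p q : ZMod 2) (f : Grassmann O R) :
    sig (p + q) f = sig p (sig q f) := by
  rcases zmod_two_cases p with rfl | rfl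
  · rw [zero_add]; rfl
  · rcases zmod_two_cases q with rfl | rfl
    · rfl
    · exact (tau_tau f).symm

end Deriv

section SuperDeriv

variable {N : ℕ} {U : TopologicalSpace.Opens (Fin N → ℝ)}

theorem dl_inl (i : Fin N) (f : SuperFun U) : dl (Sum.inl i) f = mapCoeff (Smooth.pd i) f := rfl

theorem dl_inr (i : Fin N) (f : SuperFun U) : dl (Sum.inr i) f = leftD i f := rfl

theorem par_inl (i : Fin N) : par (Sum.inl i : Idx N) = 0 := rfl

theorem par_inr (i : Fin N) : par (Sum.inr i : Idx N) = 1 := rfl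

theorem dl_mul (A : Idx N) (f g : SuperFun U) :
    dl A (f * g) = dl A f * g + sig (par A) f * dl A g := by
  rcases A with i | i
  · exact mapCoeff_pd_mul i f g
  · exact leftD_mul i f g

theorem dl_add (A : Idx N) (f g : SuperFun U) : dl A (f + g) = dl A f + dl A g := by
  rcases A with i | i
  · exact mapCoeff_pd_add i f g
  · exact leftD_add i f g

theorem dl_smul (A : Idx N) (c : ℂ) (f : SuperFun U) : dl A (c • f) = c • dl A f := by
  rcases A with i | i
  · exact mapCoeff_pd_smul i c f
  · exact leftD_smul i c f

theorem dl_zero (A : Idx N) : dl A (0 : SuperFun U) = 0 := by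
  have := dl_smul A 0 (0 : SuperFun U)
  exact (congrArg (dl A) (zero_smul ℂ (0 : SuperFun U)).symm).trans (this.trans (zero_smul ℂ (dl A (0 : SuperFun U))))

/-- The left derivative as an additive homomorphism. -/
def dlHom (A : Idx N) : SuperFun U →+ SuperFun U := ⟨⟨dl A, dl_zero A⟩, dl_add A⟩

theorem dl_neg (A : Idx N) (f : SuperFun U) : dl A (-f) = -dl A f := map_neg (dlHom A) f

theorem dl_sub (A : Idx N) (f g : SuperFun U) : dl A (f - g) = dl A f - dl A g :=
  map_sub (dlHom A) f g

theorem dl_sum {ι : Type*} (A : Idx N) (s : Finset ι) (f : ι → SuperFun U) :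
    dl A (∑ i ∈ s, f i) = ∑ i ∈ s, dl A (f i) := map_sum (dlHom A) f s

theorem dl_one (A : Idx N) : dl A (1 : SuperFun U) = 0 := by
  have := dl_mul A (1 : SuperFun U) 1
  rw [mul_one, mul_one, map_one, one_mul] at this
  exact left_eq_add.1 this

theorem _root_.SuperBV.Grassmann.HasParity.dl {p : ZMod 2} {f : SuperFun U} (hf : HasParity p f)
    (A : Idx N) : HasParity (p + par A) (SuperBV.dl A f) := by
  rcases A with i | i
  · rw [par_inl, add_zero]; exact hasParity_mapCoeff_pd hf i
  · exact hf.leftD i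

theorem dl_comm (A B : Idx N) (f : SuperFun U) :
    dl A (dl B f) = sg (par A * par B) • dl B (dl A f) := by
  rcases A with i | i <;> rcases B with j | j
  · simp only [par_inl, mul_zero, sg_zero, one_smul]; exact mapCoeff_pd_comm i j f
  · simp only [par_inl, zero_mul, sg_zero, one_smul]; exact mapCoeff_pd_leftD i j f
  · simp only [par_inl, mul_zero, sg_zero, one_smul]; exact (mapCoeff_pd_leftD j i f).symm
  · simp only [par_inr, mul_one, sg_one, neg_smul, one_smul]; exact leftD_leftD i j f

theorem dl_sig (A : Idx N) (p : ZMod 2) (f : SuperFun U) :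
    dl A (sig p f) = sg (par A * p) • sig p (dl A f) := by
  rcases zmod_two_cases p with rfl | rfl
  · simp [sig_zero, sg_zero]
  · rcases A with i | i
    · rw [par_inl, zero_mul, sg_zero, one_smul]; exact mapCoeff_pd_tau i f
    · rw [par_inr, one_mul, sg_one, neg_smul, one_smul]; exact leftD_tau i f

theorem dr_eq (A : Idx N) (f : SuperFun U) : dr A f = sig (par A) (dl A f) := by
  rcases A with i | i
  · rfl
  · exact rightD_eq i f

theorem _root_.SuperBV.Grassmann.HasParity.dr_eq {p : ZMod 2} {f : SuperFun U}
    (hf : HasParity p f) (A : Idx N) : SuperBV.dr A f = sg (par A * (p + 1)) • SuperBV.dl A f := by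
  rw [SuperBV.dr_eq, (hf.dl A).sig]
  congr 2
  generalize par A = a
  clear hf
  revert a p; decide

theorem _root_.SuperBV.Grassmann.HasParity.dr {p : ZMod 2} {f : SuperFun U} (hf : HasParity p f)
    (A : Idx N) : HasParity (p + par A) (SuperBV.dr A f) := by
  rw [hf.dr_eq]; exact (hf.dl A).zsmul _

end SuperDeriv

end
end SuperBV

set_option linter.unusedSectionVars false
namespace SuperBV
noncomputable section

/-! ### The logarithmic derivative of determinants and superdeterminants -/

section DetDerivation

variable {C M : Type*} [CommRing C] [AddCommGroup M] [Module C M]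

theorem derivation_prod {ι : Type*} [DecidableEq ι] (δ : C →+ M)
    (hδ : ∀ a b, δ (a * b) = a • δ b + b • δ a) (s : Finset ι) (f : ι → C) :
    δ (∏ i ∈ s, f i) = ∑ i ∈ s, (∏ j ∈ s.erase i, f j) • δ (f i) := by
  have h1 : δ 1 = 0 := by
    have := hδ 1 1
    rw [mul_one, one_smul] at this
    exact left_eq_add.1 this
  induction s using Finset.induction_on with
  | empty => simpa using h1
  | insert a s ha ih =>
    rw [Finset.prod_insert ha, hδ, ih, Finset.sum_insert ha, Finset.erase_insert ha, add_comm,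
      Finset.smul_sum]
    congr 1
    refine Finset.sum_congr rfl fun i hi => ?_
    rw [Finset.erase_insert_of_ne (fun h => ha (by rw [h]; exact hi)),
      Finset.prod_insert (fun h => ha (Finset.mem_of_mem_erase h)), smul_smul]

/-- Jacobi's formula for the derivative of a determinant. -/
theorem derivation_det {n : Type*} [Fintype n] [DecidableEq n] (δ : C →+ M)
    (hδ : ∀ a b, δ (a * b) = a • δ b + b • δ a) (T : Matrix n n C) :
    δ T.det = ∑ i, ∑ j, T.adjugate i j • δ (T j i) := by
  -- The entry `(i, j)` of the adjugate collects the permutations with `σ i = j`, with the factor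
  -- from column `i` left out. Jacobi's formula becomes the product rule applied to the permutation
  -- expansion.
  have hadj : ∀ i j, T.adjugate i j = ∑ σ : Equiv.Perm n,
      if σ i = j then (Equiv.Perm.sign σ : ℤ) • ∏ k ∈ Finset.univ.erase i, T (σ k) k else 0 := by
    intro i j
    rw [Matrix.adjugate_apply, Matrix.det_apply]
    refine Finset.sum_congr rfl fun σ _ => ?_
    by_cases h : σ i = j
    · rw [if_pos h, ← Finset.mul_prod_erase _ _ (Finset.mem_univ i), h, Matrix.updateRow_self,
        Pi.single_eq_same, one_mul, Units.smul_def]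
      congr 1
      refine Finset.prod_congr rfl fun k hk => ?_
      rw [Matrix.updateRow_ne]
      rw [← h]
      exact fun h' => Finset.ne_of_mem_erase hk (σ.injective h')
    · rw [if_neg h, Finset.prod_eq_zero (Finset.mem_univ (σ.symm j)), smul_zero]
      rw [Equiv.apply_symm_apply, Matrix.updateRow_self, Pi.single_eq_of_ne]
      rintro rfl; exact h (Equiv.apply_symm_apply σ j)
  rw [Matrix.det_apply, map_sum]
  simp only [hadj, Finset.sum_smul]
  have : ∀ σ : Equiv.Perm n, δ (Equiv.Perm.sign σ • ∏ i, T (σ i) i) =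
      ∑ i, ∑ j, (if σ i = j then (Equiv.Perm.sign σ : ℤ) • ∏ k ∈ Finset.univ.erase i, T (σ k) k
        else 0) • δ (T j i) := by
    intro σ
    rw [Units.smul_def, map_zsmul, derivation_prod δ hδ, Finset.smul_sum]
    refine Finset.sum_congr rfl fun i _ => ?_
    rw [Finset.sum_eq_single (σ i)]
    · rw [if_pos rfl, smul_assoc]
    · intro j _ hj; rw [if_neg (Ne.symm hj), zero_smul]
    · simp
  rw [Finset.sum_congr rfl fun σ _ => this σ, Finset.sum_comm]
  refine Finset.sum_congr rfl fun i _ => ?_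
  rw [Finset.sum_comm]

end DetDerivation

namespace Grassmann

variable {O R : Type*} [LinearOrder O] [CommRing R]

/-- `D` is a right derivation of parity `p`. -/
structure IsRightDer (p : ZMod 2) (D : Grassmann O R → Grassmann O R) : Prop where
  add : ∀ f g, D (f + g) = D f + D g
  mul : ∀ f g, D (f * g) = f * D g + D f * sig p g
  parity : ∀ q f, HasParity q f → HasParity (q + p) (D f)

namespace IsRightDer

variable {p : ZMod 2} {D : Grassmann O R → Grassmann O R}

theorem zero (h : IsRightDer p D) : D 0 = 0 := by
  have := h.add 0 0
  rw [add_zero] at this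
  exact left_eq_add.1 this

/-- A right derivation as an additive homomorphism. -/
def hom (h : IsRightDer p D) : Grassmann O R →+ Grassmann O R := ⟨⟨D, h.zero⟩, h.add⟩

theorem sum (h : IsRightDer p D) {ι : Type*} (s : Finset ι) (f : ι → Grassmann O R) :
    D (∑ i ∈ s, f i) = ∑ i ∈ s, D (f i) := map_sum h.hom f s

theorem sub (h : IsRightDer p D) (f g : Grassmann O R) : D (f - g) = D f - D g :=
  map_sub h.hom f g

theorem one (h : IsRightDer p D) : D 1 = 0 := by
  have := h.mul 1 1
  rw [mul_one, map_one, one_mul, mul_one] at this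
  exact left_eq_add.1 this

theorem mul_even (h : IsRightDer p D) (a b : evenSubring O R) :
    D ((a * b : evenSubring O R) : Grassmann O R) = a • D b + b • D a := by
  rw [Subring.smul_def, Subring.smul_def, Subring.coe_mul, h.mul, (hasParity_coe b).sig, mul_zero,
    sg_zero, one_smul, smul_eq_mul, smul_eq_mul, (hasParity_coe b).commute (D a)]

/-- The restriction to the even elements. -/
def evenHom (h : IsRightDer p D) : evenSubring O R →+ Grassmann O R :=
  h.hom.comp (evenSubring O R).subtype.toAddMonoidHom

theorem matrix_mul (h : IsRightDer p D) {l m n : Type*} [Fintype m]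
    (X : Matrix l m (Grassmann O R)) (Y : Matrix m n (Grassmann O R)) :
    (X * Y).map D = X * Y.map D + X.map D * Y.map (sig p) := by
  ext i j : 1
  simp only [Matrix.map_apply, Matrix.mul_apply, Matrix.add_apply, h.sum, h.mul,
    Finset.sum_add_distrib]

end IsRightDer

/-- Cyclicity holds up to the Koszul sign of exchanging the two factors. It is what moves the odd
off-diagonal blocks around inside the supertrace in `IsRightDer.map_sdet`. -/
theorem trace_mul_super {m n : Type*} [Fintype m] [Fintype n] {s t : ZMod 2}
    {X : Matrix m n (Grassmann O R)} {Y : Matrix n m (Grassmann O R)}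
    (hX : ∀ i j, HasParity s (X i j)) (hY : ∀ i j, HasParity t (Y i j)) :
    (X * Y).trace = sg (s * t) • (Y * X).trace := by
  simp only [Matrix.trace, Matrix.diag_apply, Matrix.mul_apply]
  rw [Finset.sum_comm, Finset.smul_sum]
  refine Finset.sum_congr rfl fun j _ => ?_
  rw [Finset.smul_sum]
  exact Finset.sum_congr rfl fun i _ => (hX i j).mul_comm (hY j i)

theorem hasParity_matrix_mul {l m n : Type*} [Fintype m] {s t : ZMod 2}
    {X : Matrix l m (Grassmann O R)} {Y : Matrix m n (Grassmann O R)}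
    (hX : ∀ i j, HasParity s (X i j)) (hY : ∀ i j, HasParity t (Y i j)) (i : l) (j : n) :
    HasParity (s + t) ((X * Y) i j) := by
  rw [Matrix.mul_apply]
  exact HasParity.sum fun k _ => (hX i k).mul (hY k j)

/-- The logarithmic derivative of the determinant of a matrix with even entries. -/
theorem IsRightDer.map_det {p : ZMod 2} {D : Grassmann O R → Grassmann O R} (h : IsRightDer p D)
    {n : Type*} [Fintype n] [DecidableEq n] (T : Matrix n n (evenSubring O R))
    (hT : IsUnit T.det) :
    D (T.det : evenSubring O R) = (T.det : Grassmann O R) *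
      (T⁻¹.map Subtype.val * (T.map Subtype.val).map D).trace := by
  have h1 := derivation_det h.evenHom (fun a b => h.mul_even a b) T
  have h2 : T.adjugate = T.det • T⁻¹ := by
    rw [Matrix.inv_def, smul_smul, Ring.mul_inverse_cancel _ hT, one_smul]
  refine h1.trans ?_
  rw [h2, Matrix.trace, Finset.mul_sum]
  refine Finset.sum_congr rfl fun i _ => ?_
  rw [Matrix.diag_apply, Matrix.mul_apply, Finset.mul_sum]
  refine Finset.sum_congr rfl fun j _ => ?_
  rw [Subring.smul_def, Matrix.smul_apply, smul_eq_mul, smul_eq_mul, Subring.coe_mul, mul_assoc]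
  rfl

theorem IsRightDer.map_inverse {p : ZMod 2} {D : Grassmann O R → Grassmann O R} (h : IsRightDer p D)
    {d : evenSubring O R} (hd : IsUnit d) :
    D (Ring.inverse d : evenSubring O R) =
      -((Ring.inverse d : evenSubring O R) : Grassmann O R) * D d *
        ((Ring.inverse d : evenSubring O R) : Grassmann O R) := by
  have e : D ((Ring.inverse d * d : evenSubring O R) : Grassmann O R) = 0 := by
    rw [Ring.inverse_mul_cancel _ hd]; exact h.one
  rw [h.mul_even, Subring.smul_def, Subring.smul_def, smul_eq_mul, smul_eq_mul] at e
  have e2 : ((Ring.inverse d : evenSubring O R) : Grassmann O R) * (d : Grassmann O R) = 1 := by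
    rw [← Subring.coe_mul, Ring.inverse_mul_cancel _ hd]; rfl
  have e3 := congrArg (fun z => ((Ring.inverse d : evenSubring O R) : Grassmann O R) * z) e
  simp only [mul_add, ← mul_assoc, e2, one_mul, mul_zero] at e3
  rw [mul_assoc, ← (hasParity_coe (Ring.inverse d)).commute (D (d : Grassmann O R)), neg_mul,
    ← mul_assoc]
  exact eq_neg_of_add_eq_zero_right (by
    exact e3)

section Berezinian

variable [Fintype O] {ι : Type*} [Fintype ι] [DecidableEq ι] (p : ι → ZMod 2)

theorem ne_zero_iff_eq_one {a : ZMod 2} : ¬ a = 0 ↔ a = 1 := by revert a; decide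

/-- The even indices followed by the odd indices. -/
def parityEquiv : {i // p i = 0} ⊕ {i // p i = 1} ≃ ι :=
  (Equiv.sumCongr (Equiv.refl _) (Equiv.subtypeEquivRight fun _ => ne_zero_iff_eq_one.symm)).trans
    (Equiv.sumCompl fun i => p i = 0)

theorem sum_parity {M : Type*} [AddCommMonoid M] (f : ι → M) :
    ∑ i, f i = ∑ i : {i // p i = 0}, f i + ∑ i : {i // p i = 1}, f i := by
  rw [← (parityEquiv p).sum_comp, Fintype.sum_sum_type]
  rfl

variable {p} {M : Matrix ι ι (Grassmann O R)}

/-- The blocks of an invertible even supermatrix that enter the superdeterminant. -/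
theorem isUnit_odd_block (hM : ∀ i j, HasParity (p i + p j) (M i j)) (hu : IsUnit M) :
    IsUnit ((M.submatrix (Subtype.val : {i // p i = 1} → ι) Subtype.val).map evenPart).det := by
  apply isUnit_evenSubring_of_body
  obtain ⟨X, hX, -⟩ := isUnit_iff_exists.1 hu
  set b : {i // p i = 1} → ι := Subtype.val
  have hdet : ∀ Y : Matrix {i // p i = 1} {i // p i = 1} (evenSubring O R),
      body (Y.det : Grassmann O R) = (Y.map fun y => body (y : Grassmann O R)).det :=
    fun Y => RingHom.map_det ((bodyHom O R).comp (evenSubring O R).subtype) Y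
  rw [hdet]
  refine IsUnit.of_mul_eq_one ((X.submatrix b b).map body).det ?_
  rw [← Matrix.det_mul]
  convert Matrix.det_one (n := {i // p i = 1}) (R := R)
  ext i j
  -- The off-diagonal blocks of `M` are odd and have no body. In the body of `M * X = 1` only the
  -- odd-odd block of `M` survives in these rows, so the body of that block is invertible.
  have h1 := congrArg body (congrFun (congrFun hX i) j)
  rw [Matrix.mul_apply, body_sum, sum_parity p] at h1
  rw [Finset.sum_eq_zero, zero_add] at h1
  · rw [Matrix.mul_apply]
    simp only [Matrix.map_apply, Matrix.submatrix_apply]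
    have e1 : body ((1 : Matrix ι ι (Grassmann O R)) i j) =
        (1 : Matrix {i // p i = 1} {i // p i = 1} R) i j := by
      by_cases h : i = j
      · subst h; rw [Matrix.one_apply_eq, Matrix.one_apply_eq]; rfl
      · rw [Matrix.one_apply_ne h, Matrix.one_apply_ne (fun h' => h (Subtype.ext h'))]; rfl
    rw [← e1, ← h1]
    refine Finset.sum_congr rfl fun k _ => ?_
    rw [body_mul, evenPart_coe]
    have := hM (b i) (b k)
    rwa [i.2, k.2] at this
  · intro k _
    rw [body_mul, HasParity.body_eq_zero, zero_mul]
    have := hM i k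
    rwa [i.2, k.2] at this

theorem mul_submatrix_parity {l r : Type*} (X Y : Matrix ι ι (Grassmann O R)) (f : l → ι)
    (g : r → ι) : (X * Y).submatrix f g =
      X.submatrix f (Subtype.val : {i // p i = 0} → ι) * Y.submatrix Subtype.val g +
        X.submatrix f (Subtype.val : {i // p i = 1} → ι) * Y.submatrix Subtype.val g := by
  ext i j : 1
  rw [Matrix.submatrix_apply, Matrix.mul_apply, sum_parity p]
  rfl

theorem map_evenPart_coe {m n : Type*} {X : Matrix m n (Grassmann O R)}
    (hX : ∀ i j, HasParity 0 (X i j)) : (X.map evenPart).map Subtype.val = X := by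
  ext i j : 1; exact evenPart_coe (hX i j)

theorem map_coe_mul {n : Type*} [Fintype n] (X Y : Matrix n n (evenSubring O R)) :
    (X * Y).map Subtype.val = X.map Subtype.val * Y.map Subtype.val :=
  Matrix.map_mul (f := (evenSubring O R).subtype)

theorem map_coe_one {n : Type*} [DecidableEq n] :
    (1 : Matrix n n (evenSubring O R)).map Subtype.val = (1 : Matrix n n (Grassmann O R)) :=
  Matrix.map_one _ rfl rfl

theorem hasParity_inv {n : Type*} [Fintype n] [DecidableEq n] (X : Matrix n n (evenSubring O R))
    (i j : n) : HasParity 0 (X⁻¹.map Subtype.val i j) :=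
  hasParity_coe (X⁻¹ i j)

theorem isUnit_det_of_mul_eq_one {n : Type*} [Fintype n] [DecidableEq n]
    {X Y : Matrix n n (Grassmann O R)} (hX : ∀ i j, HasParity 0 (X i j)) (h : X * Y = 1) :
    IsUnit (X.map evenPart).det := by
  apply isUnit_evenSubring_of_body
  have hdet : ∀ Y : Matrix n n (evenSubring O R),
      body (Y.det : Grassmann O R) = (Y.map fun y => body (y : Grassmann O R)).det :=
    fun Y => RingHom.map_det ((bodyHom O R).comp (evenSubring O R).subtype) Y
  rw [hdet]
  refine IsUnit.of_mul_eq_one (Y.map body).det ?_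
  rw [← Matrix.det_mul, ← Matrix.det_one (n := n) (R := R)]
  congr 1
  have e1 : ((X.map evenPart).map fun y => body (y : Grassmann O R)) = X.map body := by
    ext i j
    rw [Matrix.map_apply, Matrix.map_apply, evenPart_coe (hX i j)]
    rfl
  rw [e1]
  have e2 := congrArg (bodyHom O R).mapMatrix h
  rw [map_mul, map_one] at e2
  exact e2

/-- The blocks of the inverse of an even supermatrix `((A, B), (C, Q))`. -/
theorem inverse_blocks (hM : ∀ i j, HasParity (p i + p j) (M i j)) (hu : IsUnit M) :
    let a : {i // p i = 0} → ι := Subtype.val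
    let b : {i // p i = 1} → ι := Subtype.val
    let A := M.submatrix a a
    let B := M.submatrix a b
    let C := M.submatrix b a
    let Q := M.submatrix b b
    let Qi := (Q.map evenPart)⁻¹.map Subtype.val
    let S := A - B * Qi * C
    let Si := (S.map evenPart)⁻¹.map Subtype.val
    let X := Ring.inverse M
    (∀ i j, HasParity 0 (S i j)) ∧ (∀ i j, HasParity 0 (Q i j)) ∧
    IsUnit (S.map evenPart).det ∧ IsUnit (Q.map evenPart).det ∧
    X.submatrix a a = Si ∧ X.submatrix a b = -(Si * B * Qi) ∧ X.submatrix b a = -(Qi * C * Si) ∧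
      X.submatrix b b = Qi + Qi * C * Si * B * Qi := by
  intro a b A B C Q Qi S Si X
  have pA : ∀ i j, HasParity 0 (A i j) := fun i j => by
    have := hM i j; rwa [i.2, j.2] at this
  have pB : ∀ i j, HasParity 1 (B i j) := fun i j => by
    have := hM i j; rwa [i.2, j.2] at this
  have pC : ∀ i j, HasParity 1 (C i j) := fun i j => by
    have := hM i j; rwa [i.2, j.2] at this
  have pQ : ∀ i j, HasParity 0 (Q i j) := fun i j => by
    have := hM i j; rwa [i.2, j.2] at this
  have pQi : ∀ i j, HasParity 0 (Qi i j) := hasParity_inv _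
  have pS : ∀ i j, HasParity 0 (S i j) := fun i j => (pA i j).sub
    (hasParity_matrix_mul (hasParity_matrix_mul pB pQi) pC i j)
  have uQ : IsUnit (Q.map evenPart).det := isUnit_odd_block hM hu
  have hXM : X * M = 1 := Ring.inverse_mul_cancel M hu
  have hMX : M * X = 1 := Ring.mul_inverse_cancel M hu
  have hQ : Q * Qi = 1 := by
    rw [← map_evenPart_coe pQ, ← map_coe_mul, Matrix.mul_nonsing_inv _ uQ, map_coe_one]
  have hQ' : Qi * Q = 1 := by
    rw [← map_evenPart_coe pQ, ← map_coe_mul, Matrix.nonsing_inv_mul _ uQ, map_coe_one]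
  have haa : (1 : Matrix ι ι (Grassmann O R)).submatrix a a = 1 :=
    Matrix.submatrix_one _ Subtype.val_injective
  have hbb : (1 : Matrix ι ι (Grassmann O R)).submatrix b b = 1 :=
    Matrix.submatrix_one _ Subtype.val_injective
  have hba : (1 : Matrix ι ι (Grassmann O R)).submatrix b a = 0 := by
    ext i j : 1
    refine Matrix.one_apply_ne fun h => ?_
    have h1 := i.2
    rw [show (i : ι) = j from h, j.2] at h1
    exact zero_ne_one h1
  have hab : (1 : Matrix ι ι (Grassmann O R)).submatrix a b = 0 := by
    ext i j : 1
    refine Matrix.one_apply_ne fun h => ?_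
    have h1 := i.2
    rw [show (i : ι) = j from h, j.2] at h1
    exact one_ne_zero h1
  have e1 : A * X.submatrix a a + B * X.submatrix b a = 1 := by
    rw [← haa, ← hMX]; exact (mul_submatrix_parity M X a a).symm
  have e2 : C * X.submatrix a a + Q * X.submatrix b a = 0 := by
    rw [← hba, ← hMX]; exact (mul_submatrix_parity M X b a).symm
  have f1 : X.submatrix a a * A + X.submatrix a b * C = 1 := by
    rw [← haa, ← hXM]; exact (mul_submatrix_parity X M a a).symm
  have f2 : X.submatrix a a * B + X.submatrix a b * Q = 0 := by
    rw [← hab, ← hXM]; exact (mul_submatrix_parity X M a b).symm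
  have f3 : X.submatrix b a * A + X.submatrix b b * C = 0 := by
    rw [← hba, ← hXM]; exact (mul_submatrix_parity X M b a).symm
  have f4 : X.submatrix b a * B + X.submatrix b b * Q = 1 := by
    rw [← hbb, ← hXM]; exact (mul_submatrix_parity X M b b).symm
  have e3 : X.submatrix b a = -(Qi * C * X.submatrix a a) := by
    have := congrArg (fun Z => Qi * Z) e2
    simp only [Matrix.mul_add, ← Matrix.mul_assoc, hQ', Matrix.one_mul, Matrix.mul_zero] at this
    exact eq_neg_of_add_eq_zero_right this
  -- Eliminating the lower left block of `X` from the first block column of `M * X = 1` leaves the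
  -- Schur complement `S`, and exhibits its right inverse.
  have e4 : S * X.submatrix a a = 1 := by
    rw [← e1, e3, Matrix.sub_mul, Matrix.mul_neg, sub_eq_add_neg]
    simp only [Matrix.mul_assoc]
  have uS : IsUnit (S.map evenPart).det := isUnit_det_of_mul_eq_one pS e4
  have hS' : Si * S = 1 := by
    rw [← map_evenPart_coe pS, ← map_coe_mul, Matrix.nonsing_inv_mul _ uS, map_coe_one]
  have g1 : X.submatrix a a = Si := (left_inv_eq_right_inv hS' e4).symm
  have g2 : X.submatrix a b = -(Si * B * Qi) := by
    have := congrArg (fun Z => Z * Qi) f2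
    simp only [Matrix.add_mul, Matrix.mul_assoc, hQ, Matrix.mul_one, Matrix.zero_mul] at this
    rw [← g1, Matrix.mul_assoc]
    exact eq_neg_of_add_eq_zero_right this
  have g3 : X.submatrix b a = -(Qi * C * Si) := by rw [e3, g1]
  refine ⟨pS, pQ, uS, uQ, g1, g2, g3, ?_⟩
  have := congrArg (fun Z => Z * Qi) f4
  simp only [Matrix.add_mul, Matrix.mul_assoc, hQ, Matrix.mul_one, Matrix.one_mul] at this
  rw [g3] at this
  rw [Matrix.neg_mul] at this
  have e := eq_add_of_sub_eq' ((sub_eq_neg_add _ _).trans this)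
  simp only [Matrix.mul_assoc] at e ⊢
  rw [e, add_comm]

theorem isUnit_sdet (hM : ∀ i j, HasParity (p i + p j) (M i j)) (hu : IsUnit M) :
    IsUnit (sdet p M) := by
  obtain ⟨-, -, uS, uQ, -⟩ := inverse_blocks hM hu
  exact (uS.mul uQ.ringInverse).map (evenSubring O R).subtype

theorem hasParity_sdet (M : Matrix ι ι (Grassmann O R)) : HasParity 0 (sdet p M) :=
  hasParity_coe _

/-- The logarithmic derivative of the superdeterminant is the supertrace of the logarithmic
derivative of the matrix. -/
theorem IsRightDer.map_sdet {q : ZMod 2} {D : Grassmann O R → Grassmann O R} (h : IsRightDer q D)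
    (hM : ∀ i j, HasParity (p i + p j) (M i j)) (hu : IsUnit M) :
    D (sdet p M) =
      sdet p M * ∑ i, ∑ j, sg (p i) • (Ring.inverse M i j * D (M j i)) := by
  obtain ⟨pS, pQ, uS, uQ, g1, g2, g3, g4⟩ := inverse_blocks hM hu
  set a : {i // p i = 0} → ι := Subtype.val
  set b : {i // p i = 1} → ι := Subtype.val
  set A := M.submatrix a a with hA
  set B := M.submatrix a b with hB
  set C := M.submatrix b a with hC
  set Q := M.submatrix b b with hQdef
  set Qi : Matrix {i // p i = 1} {i // p i = 1} (Grassmann O R) :=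
    (Q.map evenPart)⁻¹.map Subtype.val with hQi
  set S := A - B * Qi * C with hSdef
  set Si : Matrix {i // p i = 0} {i // p i = 0} (Grassmann O R) :=
    (S.map evenPart)⁻¹.map Subtype.val with hSi
  set X := Ring.inverse M
  have pB : ∀ i j, HasParity 1 (B i j) := fun i j => by
    have := hM i j; rwa [i.2, j.2] at this
  have pC : ∀ i j, HasParity 1 (C i j) := fun i j => by
    have := hM i j; rwa [i.2, j.2] at this
  have pQi : ∀ i j, HasParity 0 (Qi i j) := hasParity_inv _
  have pSi : ∀ i j, HasParity 0 (Si i j) := hasParity_inv _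
  have pD : ∀ {m n : Type _} {s : ZMod 2} {Y : Matrix m n (Grassmann O R)},
      (∀ i j, HasParity s (Y i j)) → ∀ i j, HasParity (s + q) (Y.map D i j) :=
    fun hY i j => h.parity _ _ (hY i j)
  have hQ : Q * Qi = 1 := by
    rw [← map_evenPart_coe pQ, hQi, ← map_coe_mul, Matrix.mul_nonsing_inv _ uQ, map_coe_one]
  have hQ' : Qi * Q = 1 := by
    rw [← map_evenPart_coe pQ, hQi, ← map_coe_mul, Matrix.nonsing_inv_mul _ uQ, map_coe_one]
  have hsig : ∀ {m n : Type _} {s : ZMod 2} {Y : Matrix m n (Grassmann O R)},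
      (∀ i j, HasParity s (Y i j)) → Y.map (sig q) = sg (q * s) • Y := by
    intro m n s Y hY
    ext i j : 1
    rw [Matrix.map_apply, (hY i j).sig]; rfl
  have hDQi : Qi.map D = -(Qi * Q.map D * Qi) := by
    have e : (Q * Qi).map D = 0 := by
      rw [hQ]; ext i j : 1
      rw [Matrix.map_apply]
      by_cases hij : i = j
      · rw [hij, Matrix.one_apply_eq, h.one]; rfl
      · rw [Matrix.one_apply_ne hij, h.zero]; rfl
    rw [h.matrix_mul, hsig pQi, mul_zero, sg_zero, one_smul] at e
    have e' := congrArg (fun Z => Qi * Z) e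
    simp only [Matrix.mul_add, ← Matrix.mul_assoc, hQ', Matrix.one_mul, Matrix.mul_zero] at e'
    exact eq_neg_of_add_eq_zero_left e'
  have hDS : S.map D = A.map D - B * Qi * C.map D +
      sg q • (B * Qi * Q.map D * Qi * C) - sg q • (B.map D * Qi * C) := by
    have e0 : S.map D = A.map D - (B * Qi * C).map D := by
      ext i j : 1; exact h.sub _ _
    rw [e0, h.matrix_mul, h.matrix_mul, hsig pQi, hsig pC, hDQi, mul_zero, sg_zero, one_smul,
      mul_one]
    simp only [Matrix.mul_smul, Matrix.add_mul, Matrix.mul_neg, Matrix.neg_mul, smul_add, smul_neg,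
      Matrix.mul_assoc]
    abel
  have hdet : sdet p M = ((S.map evenPart).det : Grassmann O R) *
      ((Ring.inverse (Q.map evenPart).det : evenSubring O R) : Grassmann O R) := rfl
  -- The supertrace is brought to the form dictated by `ln sdet = ln det S - ln det Q`. After the
  -- blocks of the inverse and the derivative of the Schur complement are inserted, the remaining
  -- terms match once the odd factor `Qi * C` is cycled through the trace. The partner it passes has
  -- parity `1 + q`, which gives the sign in `t1` and `t2`.
  have hsum : ∑ i, ∑ j, sg (p i) • (X i j * D (M j i)) =
      (Si * S.map D).trace - (Qi * Q.map D).trace := by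
    have hblock : ∑ i, ∑ j, sg (p i) • (X i j * D (M j i)) =
        ((X.submatrix a a * A.map D).trace + (X.submatrix a b * C.map D).trace) -
        ((X.submatrix b a * B.map D).trace + (X.submatrix b b * Q.map D).trace) := by
      have hs0 : ∀ i : {i // p i = 0}, sg (p i) = 1 := fun i => by rw [i.2, sg_zero]
      have hs1 : ∀ i : {i // p i = 1}, sg (p i) = -1 := fun i => by rw [i.2, sg_one]
      have hrow : ∀ i, ∑ j, sg (p i) • (X i j * D (M j i)) =
          ∑ j : {j // p j = 0}, sg (p i) • (X i j * D (M j i)) +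
            ∑ j : {j // p j = 1}, sg (p i) • (X i j * D (M j i)) := fun i => sum_parity p _
      rw [sum_parity p]
      simp only [hrow]
      simp only [hs0, hs1, one_smul, neg_smul,
        Finset.sum_add_distrib, Finset.sum_neg_distrib, Matrix.trace, Matrix.diag_apply,
        Matrix.mul_apply, Matrix.map_apply, Matrix.submatrix_apply, hA, hB, hC, hQdef, a, b]
      abel
    rw [hblock, g1, g2, g3, g4, hDS]
    have t1 : (Si * (B.map D * Qi * C)).trace = sg (1 + q) • (Qi * C * Si * B.map D).trace := by
      have := trace_mul_super (X := Si * B.map D) (Y := Qi * C) (s := 1 + q) (t := 1)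
        (fun i j => by simpa using hasParity_matrix_mul pSi (pD pB) i j)
        (fun i j => by simpa using hasParity_matrix_mul pQi pC i j)
      rw [mul_one] at this
      rw [← Matrix.mul_assoc] at this
      simpa only [Matrix.mul_assoc] using this
    have t2 : (Si * (B * Qi * Q.map D * Qi * C)).trace =
        sg (1 + q) • (Qi * C * Si * B * Qi * Q.map D).trace := by
      have := trace_mul_super (X := Si * B * Qi * Q.map D) (Y := Qi * C) (s := 1 + q) (t := 1)
        (fun i j => by
          simpa using hasParity_matrix_mul
            (hasParity_matrix_mul (hasParity_matrix_mul pSi pB) pQi) (pD pQ) i j)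
        (fun i j => by simpa using hasParity_matrix_mul pQi pC i j)
      rw [mul_one] at this
      simpa only [Matrix.mul_assoc] using this
    have hsg : sg q * sg (1 + q) = -1 := by
      rw [sg_add, sg_one, mul_left_comm, sg_mul_self, mul_one]
    simp only [Matrix.mul_add, Matrix.mul_sub, Matrix.mul_smul, Matrix.trace_add, Matrix.trace_sub,
      Matrix.trace_smul, t1, t2, smul_smul, hsg, Matrix.neg_mul, Matrix.add_mul, Matrix.trace_neg,
      neg_smul, one_smul]
    simp only [Matrix.mul_assoc]
    abel
  have hevS : HasParity 0 ((S.map evenPart).det : Grassmann O R) := hasParity_coe _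
  have hevQ := hasParity_coe (Ring.inverse (Q.map evenPart).det)
  have hQQ : ((Ring.inverse (Q.map evenPart).det : evenSubring O R) : Grassmann O R) *
      ((Q.map evenPart).det : Grassmann O R) = 1 := by
    rw [← Subring.coe_mul, Ring.inverse_mul_cancel _ uQ]; rfl
  -- What remains is the product rule for `det S` times the inverse of `det Q`. Both factors are
  -- even and commute with the traces, whatever the parity of `D`.
  rw [hsum, hdet, h.mul, hevQ.sig, mul_zero, sg_zero, one_smul, h.map_inverse uQ, h.map_det _ uS,
    h.map_det _ uQ, map_evenPart_coe pS, map_evenPart_coe pQ, ← hSi, ← hQi]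
  set dS : Grassmann O R := ((S.map evenPart).det : Grassmann O R)
  set iQ : Grassmann O R := ((Ring.inverse (Q.map evenPart).det : evenSubring O R) : Grassmann O R)
  set dQ : Grassmann O R := ((Q.map evenPart).det : Grassmann O R)
  set tS := (Si * S.map D).trace
  set tQ := (Qi * Q.map D).trace
  rw [← mul_assoc (-iQ), neg_mul, hQQ, neg_one_mul, neg_mul, ← hevQ.commute tQ, mul_assoc dS tS,
    ← hevQ.commute tS]
  noncomm_ring

end Berezinian

end Grassmann
end
end SuperBV

set_option linter.unusedSectionVars false
namespace SuperBV
noncomputable section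
open Grassmann

theorem Grassmann.HasParity.inverse {O R : Type*} [LinearOrder O] [CommRing R] [Fintype O]
    {ι : Type*} [Fintype ι] [DecidableEq ι] {p : ι → ZMod 2} {M : Matrix ι ι (Grassmann O R)}
    (hM : ∀ i j, HasParity (p i + p j) (M i j)) (hu : IsUnit M) (i j : ι) :
    HasParity (p i + p j) (Ring.inverse M i j) := by
  obtain ⟨-, -, -, -, g1, g2, g3, g4⟩ := inverse_blocks hM hu
  have pB : ∀ (i : {i // p i = 0}) (j : {i // p i = 1}), HasParity 1 (M i j) := fun i j => by
    have := hM i j; rwa [i.2, j.2] at this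
  have pC : ∀ (i : {i // p i = 1}) (j : {i // p i = 0}), HasParity 1 (M i j) := fun i j => by
    have := hM i j; rwa [i.2, j.2] at this
  rcases zmod_two_cases (p i) with hi | hi <;> rcases zmod_two_cases (p j) with hj | hj <;>
    rw [hi, hj]
  · rw [show Ring.inverse M i j = _ from congrFun (congrFun g1 ⟨i, hi⟩) ⟨j, hj⟩]
    exact hasParity_inv _ _ _
  · rw [show Ring.inverse M i j = _ from congrFun (congrFun g2 ⟨i, hi⟩) ⟨j, hj⟩]
    exact (hasParity_matrix_mul (hasParity_matrix_mul (hasParity_inv _) pB) (hasParity_inv _)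
      _ _).neg
  · rw [show Ring.inverse M i j = _ from congrFun (congrFun g3 ⟨i, hi⟩) ⟨j, hj⟩]
    exact (hasParity_matrix_mul (hasParity_matrix_mul (hasParity_inv _) pC) (hasParity_inv _)
      _ _).neg
  · rw [show Ring.inverse M i j = _ from congrFun (congrFun g4 ⟨i, hi⟩) ⟨j, hj⟩]
    refine HasParity.add (hasParity_inv _ _ _) ?_
    exact hasParity_matrix_mul (hasParity_matrix_mul (hasParity_matrix_mul (hasParity_matrix_mul
      (hasParity_inv _) pC) (hasParity_inv _)) pB) (hasParity_inv _) _ _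

theorem Grassmann.HasParity.mul_mul_comm {O R : Type*} [LinearOrder O] [CommRing R]
    {p q r : ZMod 2} {f g h : Grassmann O R} (hf : HasParity p f) (hg : HasParity q g)
    (hh : HasParity r h) : f * g * h = sg (p * q + p * r + q * r) • (h * g * f) := by
  rw [hf.mul_comm hg, smul_mul_assoc, mul_assoc, hf.mul_comm hh, mul_smul_comm, ← mul_assoc,
    hg.mul_comm hh, smul_mul_assoc, smul_smul, smul_smul, ← sg_add, ← sg_add, add_assoc]

/-! ### Graded derivations and antibrackets -/

section GradedDerivations

variable {O R ι : Type*} [LinearOrder O] [CommRing R]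

/-- The maps `d A` are graded commuting left derivations of parity `π A`. -/
structure IsSuperDer (π : ι → ZMod 2) (d : ι → Grassmann O R → Grassmann O R) : Prop where
  add : ∀ A f g, d A (f + g) = d A f + d A g
  mul : ∀ A f g, d A (f * g) = d A f * g + sig (π A) f * d A g
  parity : ∀ A p f, HasParity p f → HasParity (p + π A) (d A f)
  comm : ∀ A B f, d A (d B f) = sg (π A * π B) • d B (d A f)
  map_sig : ∀ A p f, d A (sig p f) = sg (π A * p) • sig p (d A f)

/-- The right derivation belonging to a left derivation. -/
def rd (π : ι → ZMod 2) (d : ι → Grassmann O R → Grassmann O R) (A : ι) (f : Grassmann O R) :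
    Grassmann O R := sig (π A) (d A f)

namespace IsSuperDer

variable {π : ι → ZMod 2} {d : ι → Grassmann O R → Grassmann O R} (hd : IsSuperDer π d)

include hd

theorem zero (A : ι) : d A 0 = 0 := by
  have := hd.add A 0 0
  rw [add_zero] at this
  exact left_eq_add.1 this

/-- A left derivation as an additive homomorphism. -/
def hom (A : ι) : Grassmann O R →+ Grassmann O R := ⟨⟨d A, hd.zero A⟩, hd.add A⟩

theorem neg (A : ι) (f : Grassmann O R) : d A (-f) = -d A f := map_neg (hd.hom A) f

theorem sum {κ : Type*} (A : ι) (s : Finset κ) (f : κ → Grassmann O R) :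
    d A (∑ i ∈ s, f i) = ∑ i ∈ s, d A (f i) := map_sum (hd.hom A) f s

theorem zsmul (A : ι) (c : ℤ) (f : Grassmann O R) : d A (c • f) = c • d A f :=
  map_zsmul (hd.hom A) c f

theorem rd_add (A : ι) (f g : Grassmann O R) : rd π d A (f + g) = rd π d A f + rd π d A g := by
  simp only [rd, hd.add, map_add]

theorem rd_sum {κ : Type*} (A : ι) (s : Finset κ) (f : κ → Grassmann O R) :
    rd π d A (∑ i ∈ s, f i) = ∑ i ∈ s, rd π d A (f i) := by
  simp only [rd, hd.sum, map_sum]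

theorem rd_mul (A : ι) (f g : Grassmann O R) :
    rd π d A (f * g) = f * rd π d A g + rd π d A f * sig (π A) g := by
  simp only [rd, hd.mul, map_add, map_mul, sig_sig]
  exact add_comm _ _

theorem rd_eq {p : ZMod 2} {f : Grassmann O R} (hf : HasParity p f) (A : ι) :
    rd π d A f = sg (π A * (p + 1)) • d A f := by
  rw [rd, (hd.parity A p f hf).sig]
  congr 2
  generalize π A = a
  clear hf
  revert a p; decide

theorem rd_parity {p : ZMod 2} {f : Grassmann O R} (hf : HasParity p f) (A : ι) :
    HasParity (p + π A) (rd π d A f) := by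
  rw [hd.rd_eq hf]; exact (hd.parity A p f hf).zsmul _

theorem rd_comm (A B : ι) (f : Grassmann O R) :
    rd π d A (rd π d B f) = sg (π A * π B) • rd π d B (rd π d A f) := by
  simp only [rd, hd.map_sig]
  rw [hd.comm A B, map_zsmul, map_zsmul, map_zsmul]
  rcases zmod_two_cases (π A) with h | h <;> rcases zmod_two_cases (π B) with h' | h' <;>
    simp [h, h', sg_zero, sg_one, sig_zero, sig_one]

end IsSuperDer

/-- The bracket `(f, g) = (f ∂/∂Γ^A) E^{AB} (∂/∂Γ^B g)` for given derivations. -/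
def bracket [Fintype ι] (π : ι → ZMod 2) (d : ι → Grassmann O R → Grassmann O R)
    (E : Matrix ι ι (Grassmann O R)) (f g : Grassmann O R) : Grassmann O R :=
  ∑ A, ∑ B, rd π d A f * E A B * d B g

/-- The matrix of right derivatives. -/
def jacobian (π : ι → ZMod 2) (d : ι → Grassmann O R → Grassmann O R)
    (Γ' : ι → Grassmann O R) : Matrix ι ι (Grassmann O R) :=
  Matrix.of fun A B => rd π d B (Γ' A)

/-- The odd Laplacian for given derivations. -/
def laplacian [Fintype ι] [Module ℂ R] (π : ι → ZMod 2) (d : ι → Grassmann O R → Grassmann O R)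
    (E : Matrix ι ι (Grassmann O R)) (ρ f : Grassmann O R) : Grassmann O R :=
  (2⁻¹ : ℂ) • ∑ A, ∑ B, sg (π A) • (Ring.inverse ρ * d A (ρ * E A B * d B f))

end GradedDerivations

section Antibracket

variable {O R ι : Type*} [LinearOrder O] [CommRing R] [Fintype ι] [DecidableEq ι]
  {π : ι → ZMod 2} {d : ι → Grassmann O R → Grassmann O R} (hd : IsSuperDer π d)
  {E : Matrix ι ι (Grassmann O R)}

/-- The components of the Hamiltonian vector field `(Γ^A, g)`. -/
def hamiltonian (d : ι → Grassmann O R → Grassmann O R) (E : Matrix ι ι (Grassmann O R))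
    (g : Grassmann O R) (A : ι) :
    Grassmann O R := ∑ B, E A B * d B g

theorem bracket_eq (E : Matrix ι ι (Grassmann O R)) (f g : Grassmann O R) :
    bracket π d E f g = ∑ A, rd π d A f * hamiltonian d E g A := by
  simp only [bracket, hamiltonian, Finset.mul_sum, mul_assoc]

include hd

theorem hasParity_hamiltonian (hE : ∀ A B, HasParity (π A + π B + 1) (E A B)) {q : ZMod 2}
    {g : Grassmann O R} (hg : HasParity q g) (A : ι) :
    HasParity (π A + q + 1) (hamiltonian d E g A) := by
  refine HasParity.sum fun B _ => ?_
  have h := (hE A B).mul (hd.parity B _ _ hg)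
  have key : ∀ a b q : ZMod 2, a + b + 1 + (q + b) = a + q + 1 := by decide
  rwa [key] at h

theorem hasParity_bracket (hE : ∀ A B, HasParity (π A + π B + 1) (E A B)) {p q : ZMod 2}
    {f g : Grassmann O R} (hf : HasParity p f) (hg : HasParity q g) :
    HasParity (p + q + 1) (bracket π d E f g) := by
  rw [bracket_eq]
  refine HasParity.sum fun A _ => ?_
  have h := (hd.rd_parity hf A).mul (hasParity_hamiltonian hd hE hg A)
  have key : ∀ a p q : ZMod 2, p + a + (a + q + 1) = p + q + 1 := by decide
  rwa [key] at h

theorem bracket_skew (hE : ∀ A B, HasParity (π A + π B + 1) (E A B))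
    (hs : ∀ A B, E B A = -(sg ((π A + 1) * (π B + 1)) • E A B)) {p q : ZMod 2}
    {f g : Grassmann O R} (hf : HasParity p f) (hg : HasParity q g) :
    bracket π d E f g = -(sg ((p + 1) * (q + 1)) • bracket π d E g f) := by
  unfold bracket
  rw [Finset.sum_comm, Finset.smul_sum, ← Finset.sum_neg_distrib]
  refine Finset.sum_congr rfl fun B _ => ?_
  rw [Finset.smul_sum, ← Finset.sum_neg_distrib]
  refine Finset.sum_congr rfl fun A _ => ?_
  rw [hd.rd_eq hf, hd.rd_eq hg, hs B A, smul_mul_assoc, smul_mul_assoc, smul_mul_assoc, smul_mul_assoc,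
    mul_neg, neg_mul, mul_smul_comm, smul_mul_assoc, (hd.parity A _ _ hf).mul_mul_comm (hE B A) (hd.parity B _ _ hg)]
  rw [smul_neg, smul_smul, smul_smul, smul_smul, ← sg_add, ← sg_add, ← sg_add]
  congr 3
  generalize π A = a
  generalize π B = b
  clear hf hg
  revert p q a b
  decide

theorem bracket_add_left (f f' g : Grassmann O R) :
    bracket π d E (f + f') g = bracket π d E f g + bracket π d E f' g := by
  simp only [bracket_eq, hd.rd_add, add_mul, Finset.sum_add_distrib]

/-- For fixed `g` the bracket contracts the right derivatives of `f` with the Hamiltonian vector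
field of `g`. The components of that field have parity `π A + q + 1`, and moving a second factor
past them turns the sign of index `A` into the uniform sign `q + 1`. This makes
`IsRightDer.map_sdet` applicable to brackets. -/
theorem isRightDer_bracket (hE : ∀ A B, HasParity (π A + π B + 1) (E A B)) {q : ZMod 2}
    {g : Grassmann O R} (hg : HasParity q g) : IsRightDer (q + 1) (fun f => bracket π d E f g) where
  add f f' := bracket_add_left hd f f' g
  mul f f' := by
    simp only [bracket_eq, hd.rd_mul, add_mul, Finset.sum_add_distrib, Finset.mul_sum,
      Finset.sum_mul, mul_assoc]
    congr 1
    refine Finset.sum_congr rfl fun A _ => ?_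
    congr 1
    rw [(hasParity_hamiltonian hd hE hg A).mul_eq_mul_sig, add_assoc, sig_add', ← sig_add' _ (π A),
      add_comm (q + 1), sig_add', sig_sig]
  parity p f hf := by simpa [add_assoc] using hasParity_bracket hd hE hf hg

theorem bracket_mul_right (hE : ∀ A B, HasParity (π A + π B + 1) (E A B)) {p q : ZMod 2}
    {f g : Grassmann O R} (hf : HasParity p f) (hg : HasParity q g) (h : Grassmann O R) :
    bracket π d E f (g * h) =
      bracket π d E f g * h + sg ((p + 1) * q) • (g * bracket π d E f h) := by
  have key : ∀ A B, rd π d A f * E A B * d B (g * h) =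
      rd π d A f * E A B * d B g * h +
        sg ((p + 1) * q) • (g * (rd π d A f * E A B * d B h)) := by
    intro A B
    rw [hd.mul, mul_add, hg.sig, smul_mul_assoc, mul_smul_comm, ← mul_assoc, ← mul_assoc _ g,
      ((hd.rd_parity hf A).mul (hE A B)).mul_comm hg, smul_mul_assoc, smul_smul, ← sg_add,
      mul_assoc g]
    congr 3
    generalize π A = a
    generalize π B = b
    clear hf hg
    revert p q a b
    decide
  simp only [bracket, key, Finset.sum_add_distrib, ← Finset.smul_sum, ← Finset.mul_sum,
    ← Finset.sum_mul]

theorem bracket_sum_right {κ : Type*} (f : Grassmann O R) (s : Finset κ) (g : κ → Grassmann O R) :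
    bracket π d E f (∑ i ∈ s, g i) = ∑ i ∈ s, bracket π d E f (g i) := by
  simp only [bracket, hd.sum, Finset.mul_sum]
  rw [Finset.sum_comm (s := s)]
  refine Finset.sum_congr rfl fun A _ => ?_
  rw [Finset.sum_comm]

/-- The Jacobi identity as a Leibniz rule. -/
theorem bracket_bracket (hE : ∀ A B, HasParity (π A + π B + 1) (E A B))
    (hs : ∀ A B, E B A = -(sg ((π A + 1) * (π B + 1)) • E A B))
    (hJ : ∀ (a b c : ZMod 2) (f g h : Grassmann O R),
      HasParity a f → HasParity b g → HasParity c h →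
        sg ((a + 1) * (c + 1)) • bracket π d E f (bracket π d E g h) +
        sg ((b + 1) * (a + 1)) • bracket π d E g (bracket π d E h f) +
        sg ((c + 1) * (b + 1)) • bracket π d E h (bracket π d E f g) = 0) {a b c : ZMod 2} {f g h : Grassmann O R}
    (hf : HasParity a f) (hg : HasParity b g) (hh : HasParity c h) :
    bracket π d E (bracket π d E f g) h = bracket π d E f (bracket π d E g h) +
      sg ((b + 1) * (c + 1)) • bracket π d E (bracket π d E f h) g := by
  have hneg : ∀ x y : Grassmann O R, bracket π d E x (-y) = -bracket π d E x y := fun x y => by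
    simp only [bracket, hd.neg, mul_neg, Finset.sum_neg_distrib]
  have hz : ∀ (x y : Grassmann O R) (n : ℤ), bracket π d E x (n • y) = n • bracket π d E x y :=
    fun x y n => by
      simp only [bracket, hd.zsmul, mul_smul_comm, Finset.smul_sum]
  have j := hJ a b c f g h hf hg hh
  rw [bracket_skew hd hE hs hh hf, hneg, hz,
    bracket_skew hd hE hs hg (hasParity_bracket hd hE hf hh),
    bracket_skew hd hE hs hh (hasParity_bracket hd hE hf hg)] at j
  simp only [smul_neg, neg_neg, smul_smul, ← sg_add] at j
  have h1 := congrArg (fun z => sg ((a + 1) * (c + 1)) • z) j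
  rw [smul_zero] at h1
  simp only [smul_add, smul_neg, smul_smul, ← sg_add] at h1
  have k1 : ∀ a c : ZMod 2, (a + 1) * (c + 1) + (a + 1) * (c + 1) = 0 := by decide
  have k2 : ∀ a b c : ZMod 2, (a + 1) * (c + 1) + ((b + 1) * (a + 1) +
      ((c + 1) * (a + 1) + (b + 1) * (a + c + 1 + 1))) = (b + 1) * (c + 1) := by decide
  have k3 : ∀ a b c : ZMod 2, (a + 1) * (c + 1) + ((c + 1) * (b + 1) +
      (c + 1) * (a + b + 1 + 1)) = 0 := by decide
  rw [k1, k2, k3, sg_zero, one_smul, one_smul] at h1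
  exact (sub_eq_zero.1 ((sub_eq_add_neg _ _).trans h1)).symm

end Antibracket

/-! ### Derivatives with respect to new coordinates -/

section NewCoordinates

variable {O R ι : Type*} [LinearOrder O] [CommRing R] [Fintype O] [Fintype ι] [DecidableEq ι]
  {π : ι → ZMod 2} {d : ι → Grassmann O R → Grassmann O R} (hd : IsSuperDer π d)
  {E : Matrix ι ι (Grassmann O R)} {Γ' : ι → Grassmann O R}

/-- The right derivative of `g` with respect to the coordinate `Γ'^A`. -/
def drNew (π : ι → ZMod 2) (d : ι → Grassmann O R → Grassmann O R)
    (Γ' : ι → Grassmann O R) (A : ι) (g : Grassmann O R) : Grassmann O R :=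
  ∑ B, rd π d B g * Ring.inverse (jacobian π d Γ') B A

include hd

theorem hasParity_jacobian (hp : ∀ A, HasParity (π A) (Γ' A)) (A B : ι) :
    HasParity (π A + π B) (jacobian π d Γ' A B) := hd.rd_parity (hp A) B

theorem drNew_self (hu : IsUnit (jacobian π d Γ')) (A B : ι) :
    drNew π d Γ' B (Γ' A) = if A = B then 1 else 0 := by
  have := congrFun (congrFun (Ring.mul_inverse_cancel (jacobian π d Γ') hu) A) B
  rw [Matrix.mul_apply, Matrix.one_apply] at this
  exact this

/-- The chain rule holds by construction: the new derivatives are the old ones multiplied by the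
inverse Jacobian matrix, and the Jacobian matrix undoes this. -/
theorem dr_eq_sum_drNew (hu : IsUnit (jacobian π d Γ')) (B : ι) (g : Grassmann O R) :
    rd π d B g = ∑ A, drNew π d Γ' A g * rd π d B (Γ' A) := by
  simp only [drNew, Finset.sum_mul, mul_assoc]
  rw [Finset.sum_comm]
  have : ∀ C, ∑ A, rd π d C g * (Ring.inverse (jacobian π d Γ') C A * rd π d B (Γ' A)) =
      rd π d C g * (1 : Matrix ι ι (Grassmann O R)) C B := fun C => by
    rw [← Finset.mul_sum, ← Ring.inverse_mul_cancel _ hu, Matrix.mul_apply]; rfl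
  simp [this, Matrix.one_apply]

theorem bracket_eq_sum_drNew (hu : IsUnit (jacobian π d Γ')) (f g : Grassmann O R) :
    bracket π d E f g = ∑ A, drNew π d Γ' A f * bracket π d E (Γ' A) g := by
  simp only [bracket_eq, Finset.mul_sum]
  rw [Finset.sum_comm]
  refine Finset.sum_congr rfl fun B _ => ?_
  rw [dr_eq_sum_drNew hd hu, Finset.sum_mul]
  simp only [mul_assoc]

/-- The inverse Jacobian entry with indices `B`, `A` has parity `π B + π A`. Moving the second
factor of a product past it converts the sign of the old index `B` into that of the new index `A`,
so the new derivatives obey the same graded Leibniz rule. -/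
theorem isRightDer_drNew (hp : ∀ A, HasParity (π A) (Γ' A)) (hu : IsUnit (jacobian π d Γ'))
    (A : ι) : IsRightDer (π A) (drNew π d Γ' A) where
  add f g := by simp only [drNew, hd.rd_add, add_mul, Finset.sum_add_distrib]
  mul f g := by
    simp only [drNew, hd.rd_mul, add_mul, Finset.sum_add_distrib, Finset.mul_sum, Finset.sum_mul,
      mul_assoc]
    congr 1
    refine Finset.sum_congr rfl fun B _ => ?_
    congr 1
    rw [(HasParity.inverse (hasParity_jacobian hd hp) hu B A).mul_eq_mul_sig, ← sig_add',
      add_comm (π B), add_assoc]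
    have k : ∀ b : ZMod 2, b + b = 0 := by decide
    rw [k, add_zero]
  parity p f hf := HasParity.sum fun B _ => by
    have h := (hd.rd_parity hf B).mul (HasParity.inverse (hasParity_jacobian hd hp) hu B A)
    have k : ∀ a b p : ZMod 2, p + b + (b + a) = p + a := by decide
    rwa [k] at h

/-- The odd Laplacian as half the divergence of the Hamiltonian vector field. -/
theorem two_smul_laplacian [Module ℂ R] (hE : ∀ A B, HasParity (π A + π B + 1) (E A B)) {q : ZMod 2}
    {g ρ : Grassmann O R} (hg : HasParity q g) (hρ : HasParity 0 ρ) (hu : IsUnit ρ) :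
    (2 : ℂ) • laplacian π d E ρ g =
      ∑ A, sg (π A * q) • rd π d A (hamiltonian d E g A) + Ring.inverse ρ * bracket π d E ρ g := by
  rw [laplacian, smul_smul, mul_inv_cancel₀ two_ne_zero, one_smul, bracket_eq,
    Finset.mul_sum, ← Finset.sum_add_distrib]
  refine Finset.sum_congr rfl fun A _ => ?_
  have h1 : ∑ B, sg (π A) • (Ring.inverse ρ * d A (ρ * E A B * d B g)) =
      sg (π A) • (Ring.inverse ρ * d A (ρ * hamiltonian d E g A)) := by
    simp only [hamiltonian, Finset.mul_sum, hd.sum, Finset.smul_sum, mul_assoc]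
  rw [h1, hd.mul, hρ.sig, mul_zero, sg_zero, one_smul, mul_add, ← mul_assoc (Ring.inverse ρ) ρ,
    Ring.inverse_mul_cancel _ hu, one_mul, smul_add, add_comm]
  congr 1
  · rw [hd.rd_eq (hasParity_hamiltonian hd hE hg A), smul_smul, ← sg_add]
    congr 2
    generalize π A = a
    clear hg hρ
    revert a q; decide
  · rw [hd.rd_eq hρ, smul_mul_assoc, mul_smul_comm, zero_add, mul_one]

/-- The commutator of a coordinate derivative with a Hamiltonian vector field. Differentiating the
contraction that defines `(f, g)` produces second derivatives of `f`, which reassemble to the left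
side since right derivatives commute in the graded sense, and derivatives of the field, which are
subtracted. -/
theorem bracket_rd (hE : ∀ A B, HasParity (π A + π B + 1) (E A B)) {q : ZMod 2}
    {g : Grassmann O R} (hg : HasParity q g) (B : ι) (f : Grassmann O R) :
    bracket π d E (rd π d B f) g = sg (π B * (q + 1)) •
      (rd π d B (bracket π d E f g) - ∑ C, rd π d C f * rd π d B (hamiltonian d E g C)) := by
  simp only [bracket_eq, hd.rd_sum, hd.rd_mul, Finset.sum_add_distrib]
  rw [add_sub_cancel_left, Finset.smul_sum]
  refine Finset.sum_congr rfl fun C _ => ?_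
  rw [hd.rd_comm B C, (hasParity_hamiltonian hd hE hg C).sig, smul_mul_assoc, mul_smul_comm, smul_smul,
    smul_smul, ← sg_add, ← sg_add]
  have k : ∀ b c q : ZMod 2, b * (q + 1) + b * c + b * (c + q + 1) = 0 := by decide
  rw [k, sg_zero, one_smul]

/-- The change of the divergence of a Hamiltonian vector field under the change of coordinates is
the logarithmic derivative of the Jacobian superdeterminant. -/
theorem bracket_jacobian (hE : ∀ A B, HasParity (π A + π B + 1) (E A B)) {q : ZMod 2}
    {g : Grassmann O R} (hg : HasParity q g) (hp : ∀ A, HasParity (π A) (Γ' A))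
    (hu : IsUnit (jacobian π d Γ')) :
    bracket π d E (sdet π (jacobian π d Γ')) g = sdet π (jacobian π d Γ') *
      (∑ A, sg (π A * q) • drNew π d Γ' A (bracket π d E (Γ' A) g) -
        ∑ A, sg (π A * q) • rd π d A (hamiltonian d E g A)) := by
  have hM := hasParity_jacobian hd hp
  have hI := HasParity.inverse hM hu
  rw [(isRightDer_bracket hd hE hg).map_sdet hM hu]
  congr 1
  have h1 : ∀ B A, sg (π B) • (Ring.inverse (jacobian π d Γ') B A *
      bracket π d E (jacobian π d Γ' A B) g) =
      sg (π A * q) • (rd π d B (bracket π d E (Γ' A) g) * Ring.inverse (jacobian π d Γ') B A) -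
      sg (π B * q) • ∑ C, (Ring.inverse (jacobian π d Γ') B A * jacobian π d Γ' A C) *
        rd π d B (hamiltonian d E g C) := by
    intro B A
    rw [show jacobian π d Γ' A B = rd π d B (Γ' A) from rfl, bracket_rd hd hE hg, mul_smul_comm,
      smul_smul, ← sg_add, mul_sub, smul_sub, Finset.mul_sum]
    congr 1
    · rw [(hI B A).mul_comm (hd.rd_parity (hasParity_bracket hd hE (hp A) hg) B), smul_smul, ← sg_add]
      congr 2
      generalize π A = a
      generalize π B = b
      clear hg hI hM hu hE
      revert a b q; decide
    · simp only [mul_assoc]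
      congr 2
      generalize π B = b
      clear hg
      revert b q; decide
  simp only [h1, Finset.sum_sub_distrib]
  congr 1
  · rw [Finset.sum_comm]
    refine Finset.sum_congr rfl fun A _ => ?_
    rw [drNew, Finset.smul_sum]
  · refine Finset.sum_congr rfl fun B _ => ?_
    rw [← Finset.smul_sum, Finset.sum_comm]
    congr 1
    have h2 : ∀ C, ∑ A, Ring.inverse (jacobian π d Γ') B A * jacobian π d Γ' A C *
        rd π d B (hamiltonian d E g C) =
        (1 : Matrix ι ι (Grassmann O R)) B C * rd π d B (hamiltonian d E g C) := fun C => by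
      rw [← Finset.sum_mul, ← Ring.inverse_mul_cancel _ hu, Matrix.mul_apply]
    simp [h2, Matrix.one_apply]

end NewCoordinates

end
end SuperBV

set_option linter.unusedSectionVars false
namespace SuperBV
noncomputable section
open Grassmann

theorem Grassmann.HasParity.ringInverse {O R : Type*} [LinearOrder O] [CommRing R] [Fintype O]
    {ρ : Grassmann O R} (hρ : HasParity 0 ρ) (hu : IsUnit ρ) : HasParity 0 (Ring.inverse ρ) := by
  obtain ⟨v, hv⟩ := isUnit_evenSubring_of_body
    (f := (⟨ρ, mem_evenSubring_iff.2 hρ⟩ : evenSubring O R)) (hu.map (bodyHom O R))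
  have h1 : ((↑v⁻¹ : evenSubring O R) : Grassmann O R) * ρ = 1 := by
    have h2 : (↑v⁻¹ : evenSubring O R) * (⟨ρ, mem_evenSubring_iff.2 hρ⟩ : evenSubring O R) = 1 := by
      rw [← hv, v.inv_mul]
    exact congrArg Subtype.val h2
  have h3 : Ring.inverse ρ = ((↑v⁻¹ : evenSubring O R) : Grassmann O R) :=
    (left_inv_eq_right_inv h1 (Ring.mul_inverse_cancel _ hu)).symm
  rw [h3]
  exact hasParity_coe _

/-! ### Brackets of the radicand with the constraints -/

section Radicand

variable {O R ι κ : Type*} [LinearOrder O] [CommRing R] [Fintype O] [Fintype ι] [DecidableEq ι]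
  [Fintype κ] [DecidableEq κ] {π : ι → ZMod 2} {d : ι → Grassmann O R → Grassmann O R}
  {E : Matrix ι ι (Grassmann O R)} {Γ' : ι → Grassmann O R} {ε : κ → ZMod 2}
  {F G : κ → Grassmann O R} {Y : κ → κ → κ → Grassmann O R} {J : AddSubgroup (Grassmann O R)}

/-- The data of the coordinates `{F; G}` and of an involution `(G_α, G_β) = G_γ Y^γ_{αβ}`, and a
two-sided ideal `J` that contains the `G_α` unless `Y` vanishes. -/
structure IsInvolutive (π : ι → ZMod 2) (d : ι → Grassmann O R → Grassmann O R)
    (E : Matrix ι ι (Grassmann O R)) (Γ' : ι → Grassmann O R) (ε : κ → ZMod 2)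
    (F G : κ → Grassmann O R) (Y : κ → κ → κ → Grassmann O R) (e : κ ⊕ κ ≃ ι)
    (J : AddSubgroup (Grassmann O R)) : Prop where
  der : IsSuperDer π d
  parityE : ∀ A B, HasParity (π A + π B + 1) (E A B)
  parity : ∀ A, HasParity (π A) (Γ' A)
  isUnit : IsUnit (jacobian π d Γ')
  π_inl : ∀ α, π (e (Sum.inl α)) = ε α + 1
  π_inr : ∀ α, π (e (Sum.inr α)) = ε α
  eq_F : ∀ α, Γ' (e (Sum.inl α)) = F α
  eq_G : ∀ α, Γ' (e (Sum.inr α)) = G α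
  involution : ∀ α β, bracket π d E (G α) (G β) = ∑ γ, G γ * Y γ α β
  parityY : ∀ γ α β, HasParity (ε γ + ε α + ε β + 1) (Y γ α β)
  jacobi : ∀ α γ β, bracket π d E (bracket π d E (F α) (G γ)) (G β) =
    bracket π d E (F α) (bracket π d E (G γ) (G β)) +
      sg ((ε γ + 1) * (ε β + 1)) • bracket π d E (bracket π d E (F α) (G β)) (G γ)
  mul_left_mem : ∀ x, ∀ y ∈ J, x * y ∈ J
  mul_right_mem : ∀ x, ∀ y ∈ J, y * x ∈ J
  mem : (∀ α, G α ∈ J) ∨ ∀ γ α β, Y γ α β = 0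

namespace IsInvolutive

variable {e : κ ⊕ κ ≃ ι} (h : IsInvolutive π d E Γ' ε F G Y e J)

include h

theorem parityF (α : κ) : HasParity (ε α + 1) (F α) := by
  rw [← h.eq_F, ← h.π_inl]; exact h.parity _

theorem parityG (α : κ) : HasParity (ε α) (G α) := by
  have := h.parity (e (Sum.inr α))
  rwa [h.eq_G, h.π_inr] at this

theorem parityΛ (α β : κ) : HasParity (ε α + ε β) (bracket π d E (F α) (G β)) := by
  have := hasParity_bracket h.der h.parityE (h.parityF α) (h.parityG β)
  have k : ∀ a b : ZMod 2, a + 1 + b + 1 = a + b := by decide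
  rwa [k] at this

theorem bracket_mem (α β : κ) : bracket π d E (G α) (G β) ∈ J := by
  rw [h.involution]
  refine J.sum_mem fun γ _ => ?_
  rcases h.mem with hm | hm
  · exact h.mul_right_mem _ _ (hm γ)
  · rw [hm, mul_zero]; exact J.zero_mem

theorem sum_coord {M : Type*} [AddCommMonoid M] (f : ι → M) :
    ∑ A, f A = ∑ α, f (e (Sum.inl α)) + ∑ α, f (e (Sum.inr α)) := by
  rw [← e.sum_comp, Fintype.sum_sum_type]

theorem drNew_G (A : ι) (α : κ) : drNew π d Γ' A (G α) = if e (Sum.inr α) = A then 1 else 0 := by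
  rw [← h.eq_G]; exact drNew_self h.der h.isUnit _ _

/-- In the derivative of `G_γ Y^γ_{αβ}` with respect to `G_α`, the terms that differentiate `Y` keep
a factor `G_γ` and belong to `J`, while those that differentiate `G_γ` select `γ = α`. The `G` part
of the new divergence is therefore the supertrace of `Y`. -/
theorem trace_bracket_mem (β : κ) :
    ∑ α, sg (ε α * ε β) • drNew π d Γ' (e (Sum.inr α)) (bracket π d E (G α) (G β)) -
      ∑ α, sg (ε α) • Y α α β ∈ J := by
  rw [← Finset.sum_sub_distrib]
  refine J.sum_mem fun α _ => ?_
  have hD := isRightDer_drNew h.der h.parity h.isUnit (e (Sum.inr α))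
  have h1 : drNew π d Γ' (e (Sum.inr α)) (bracket π d E (G α) (G β)) =
      ∑ γ, G γ * drNew π d Γ' (e (Sum.inr α)) (Y γ α β) + sg (ε α * (ε β + 1)) • Y α α β := by
    rw [h.involution, hD.sum]
    simp only [hD.mul, h.drNew_G, Finset.sum_add_distrib]
    congr 1
    rw [Finset.sum_eq_single α]
    · rw [if_pos rfl, one_mul, h.π_inr, (h.parityY α α β).sig]
      congr 2
      generalize ε α = a
      generalize ε β = b
      clear hD
      revert a b; decide
    · intro γ _ hγ
      rw [if_neg (fun h' => hγ (Sum.inr_injective (e.injective h'))), zero_mul]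
    · simp
  rw [h1, smul_add, smul_smul, ← sg_add]
  have k : ∀ a b : ZMod 2, a * b + a * (b + 1) = a := by decide
  rw [k, add_sub_cancel_right]
  refine J.zsmul_mem (J.sum_mem fun γ _ => ?_) _
  rcases h.mem with hm | hm
  · exact h.mul_right_mem _ _ (hm γ)
  · rw [hm, hD.zero, mul_zero]; exact J.zero_mem

/-- By the product rule for `(F^α, G_δ Y^δ_{γβ})`: the terms in which `Y` is bracketed keep a factor
`G_δ`, and all of them vanish when `Y` does. -/
theorem bracket_bracket_mem (α γ β : κ) :
    bracket π d E (F α) (bracket π d E (G γ) (G β)) -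
      ∑ δ, bracket π d E (F α) (G δ) * Y δ γ β ∈ J := by
  rw [h.involution, bracket_sum_right h.der, ← Finset.sum_sub_distrib]
  refine J.sum_mem fun δ _ => ?_
  rw [bracket_mul_right h.der h.parityE (h.parityF α) (h.parityG δ), add_sub_cancel_left]
  refine J.zsmul_mem ?_ _
  rcases h.mem with hm | hm
  · exact h.mul_right_mem _ _ (hm δ)
  · rw [hm]
    have : bracket π d E (F α) 0 = 0 := by simp [bracket, h.der.zero]
    rw [this, mul_zero]; exact J.zero_mem

/-- The chain rule in the coordinates `{F; G}`. The terms along the `G_δ` carry the factor `(G_δ,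
G_γ)`, which the involution places in `J`. -/
theorem bracket_sub_mem (f : Grassmann O R) (γ : κ) :
    bracket π d E f (G γ) -
      ∑ δ, drNew π d Γ' (e (Sum.inl δ)) f * bracket π d E (F δ) (G γ) ∈ J := by
  rw [bracket_eq_sum_drNew h.der h.isUnit, h.sum_coord]
  simp only [h.eq_F, h.eq_G]
  rw [add_sub_cancel_left]
  exact J.sum_mem fun δ _ => h.mul_left_mem _ _ (h.bracket_mem δ γ)

variable (hΛ : IsUnit (Matrix.of fun α β => bracket π d E (F α) (G β)))

include hΛ

/-- The Jacobi identity turns `((F^α, G_γ), G_β)` into `(F^α, (G_γ, G_β))` and a signed `((F^α,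
G_β), G_γ)`. Modulo `J` the former is `Λ` times `Y`, and contraction with `Λ⁻¹` leaves the
supertrace of `Y`. The latter is expanded along the `F^δ`, where `Λ⁻¹` cancels `(F^δ, G_γ)` and
leaves minus the `F` part of the divergence in the new coordinates. -/
theorem trace_lambda_mem (β : κ) :
    ∑ γ, ∑ α, sg (ε γ) • (Ring.inverse (Matrix.of fun α β => bracket π d E (F α) (G β)) γ α *
        bracket π d E (bracket π d E (F α) (G γ)) (G β)) -
      (∑ α, sg (ε α) • Y α α β - ∑ α, sg ((ε α + 1) * ε β) •
        drNew π d Γ' (e (Sum.inl α)) (bracket π d E (F α) (G β))) ∈ J := by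
  set Λ : Matrix κ κ (Grassmann O R) := Matrix.of fun α β => bracket π d E (F α) (G β) with hΛdef
  have hΛ1 : ∀ γ δ, ∑ α, Ring.inverse Λ γ α * bracket π d E (F α) (G δ) =
      if γ = δ then 1 else 0 := fun γ δ => by
    have := congrFun (congrFun (Ring.inverse_mul_cancel Λ hΛ) γ) δ
    rwa [Matrix.mul_apply, Matrix.one_apply] at this
  have hΛ2 : ∀ δ α, ∑ γ, bracket π d E (F δ) (G γ) * Ring.inverse Λ γ α =
      if δ = α then 1 else 0 := fun δ α => by
    have := congrFun (congrFun (Ring.mul_inverse_cancel Λ hΛ) δ) α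
    rwa [Matrix.mul_apply, Matrix.one_apply] at this
  have hI := HasParity.inverse (p := ε) (M := Λ) (fun i j => h.parityΛ i j) hΛ
  have e1 : ∑ α, sg (ε α) • Y α α β = ∑ γ, ∑ α, sg (ε γ) • (Ring.inverse Λ γ α *
      ∑ δ, bracket π d E (F α) (G δ) * Y δ γ β) := by
    refine Finset.sum_congr rfl fun γ _ => ?_
    simp only [Finset.mul_sum, ← Finset.smul_sum, ← mul_assoc]
    rw [Finset.sum_comm]
    simp only [← Finset.sum_mul, hΛ1]
    simp
  have e2 : ∑ α, sg ((ε α + 1) * ε β) •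
        drNew π d Γ' (e (Sum.inl α)) (bracket π d E (F α) (G β)) =
      -∑ γ, ∑ α, sg (ε γ) • (Ring.inverse Λ γ α * (sg ((ε γ + 1) * (ε β + 1)) •
        ∑ δ, drNew π d Γ' (e (Sum.inl δ)) (bracket π d E (F α) (G β)) *
          bracket π d E (F δ) (G γ))) := by
    have hmove : ∀ γ α, sg (ε γ) • (Ring.inverse Λ γ α * (sg ((ε γ + 1) * (ε β + 1)) •
        ∑ δ, drNew π d Γ' (e (Sum.inl δ)) (bracket π d E (F α) (G β)) *
          bracket π d E (F δ) (G γ))) =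
        ∑ δ, -(sg ((ε α + 1) * ε β) •
          (drNew π d Γ' (e (Sum.inl δ)) (bracket π d E (F α) (G β)) *
          (bracket π d E (F δ) (G γ) * Ring.inverse Λ γ α))) := by
      intro γ α
      simp only [mul_smul_comm, Finset.mul_sum, Finset.smul_sum]
      refine Finset.sum_congr rfl fun δ _ => ?_
      have hp := (isRightDer_drNew h.der h.parity h.isUnit (e (Sum.inl δ))).parity _ _
        (h.parityΛ α β)
      rw [h.π_inl] at hp
      rw [(hI γ α).mul_comm (hp.mul (h.parityΛ δ γ)), smul_smul, smul_smul, ← sg_add, ← sg_add,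
        mul_assoc, ← neg_smul]
      congr 1
      generalize ε α = a
      generalize ε β = b
      generalize ε γ = c
      generalize ε δ = f
      clear hp hI hΛ1 hΛ2
      revert a b c f
      decide
    simp only [hmove, Finset.sum_neg_distrib, neg_neg]
    rw [Finset.sum_comm]
    refine Finset.sum_congr rfl fun α _ => ?_
    rw [Finset.sum_comm]
    simp only [← Finset.smul_sum, ← Finset.mul_sum, hΛ2]
    simp
  rw [e1, e2, sub_neg_eq_add, ← Finset.sum_add_distrib, ← Finset.sum_sub_distrib]
  refine J.sum_mem fun γ _ => ?_
  rw [← Finset.sum_add_distrib, ← Finset.sum_sub_distrib]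
  refine J.sum_mem fun α _ => ?_
  rw [← smul_add, ← smul_sub, ← mul_add, ← mul_sub]
  refine J.zsmul_mem (h.mul_left_mem _ _ ?_) _
  rw [h.jacobi, add_sub_add_comm, ← smul_sub]
  exact J.add_mem (h.bracket_bracket_mem α γ β) (J.zsmul_mem (h.bracket_sub_mem _ γ) _)

/-- The bracket of the radicand of the square root formula with the `G_β`. -/
theorem bracket_radicand_mem [Module ℂ R] {ρ : Grassmann O R} (hρ : HasParity 0 ρ)
    (hu : IsUnit ρ) (β : κ) :
    bracket π d E (sdet π (jacobian π d Γ') *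
        sdet ε (Matrix.of fun α β => bracket π d E (F α) (G β)) * Ring.inverse ρ) (G β) -
      sdet π (jacobian π d Γ') *
        sdet ε (Matrix.of fun α β => bracket π d E (F α) (G β)) * Ring.inverse ρ *
      ((2 : ℤ) • ∑ α, sg (ε α) • Y α α β - (2 : ℂ) • laplacian π d E ρ (G β)) ∈ J := by
  have hD := isRightDer_bracket h.der h.parityE (h.parityG β)
  have hJac := bracket_jacobian h.der h.parityE (h.parityG β) h.parity h.isUnit
  have hlam := hD.map_sdet (p := ε)
    (M := Matrix.of fun α β => bracket π d E (F α) (G β)) (fun i j => h.parityΛ i j) hΛ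
  have hm := h.trace_lambda_mem hΛ β
  have ht := h.trace_bracket_mem β
  rw [two_smul_laplacian h.der h.parityE (h.parityG β) hρ hu]
  rw [h.sum_coord (fun A => sg (π A * ε β) • drNew π d Γ' A (bracket π d E (Γ' A) (G β)))] at hJac
  simp only [h.eq_F, h.eq_G, h.π_inl, h.π_inr] at hJac
  simp only [Matrix.of_apply] at hlam
  set a := sdet π (jacobian π d Γ')
  set Λ : Matrix κ κ (Grassmann O R) := Matrix.of fun α β => bracket π d E (F α) (G β)
  set b := sdet ε Λ
  set r := Ring.inverse ρ
  set y := ∑ γ, ∑ α, sg (ε γ) • (Ring.inverse Λ γ α *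
        bracket π d E (bracket π d E (F α) (G γ)) (G β))
  set tr := ∑ α, sg (ε α) • Y α α β
  set dv := ∑ A, sg (π A * ε β) • rd π d A (hamiltonian d E (G β) A)
  set fF := ∑ α, sg ((ε α + 1) * ε β) •
        drNew π d Γ' (e (Sum.inl α)) (bracket π d E (F α) (G β))
  set fG := ∑ α, sg (ε α * ε β) • drNew π d Γ' (e (Sum.inr α)) (bracket π d E (G α) (G β))
  set Dρ := bracket π d E ρ (G β)
  have pa : HasParity 0 a := hasParity_sdet _
  have pb : HasParity 0 b := hasParity_sdet _
  have hρr : ρ * r = 1 := Ring.mul_inverse_cancel _ hu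
  have hrρ : r * ρ = 1 := Ring.inverse_mul_cancel _ hu
  have pr : HasParity 0 r := hρ.ringInverse hu
  have hDr : bracket π d E r (G β) = -(r * (r * Dρ)) := by
    have e0 : bracket π d E (r * ρ) (G β) = 0 := by rw [hrρ]; exact hD.one
    rw [show bracket π d E (r * ρ) (G β) = _ from hD.mul r ρ, hρ.sig, mul_zero, sg_zero,
      one_smul] at e0
    have e1 := congrArg (fun z => z * r) e0
    simp only [add_mul, zero_mul, mul_assoc, hρr, mul_one] at e1
    rw [← pr.commute Dρ] at e1
    exact eq_neg_of_add_eq_zero_right e1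
  -- The logarithmic derivatives of the three even factors add up: the change of divergence from the
  -- Jacobian, the supertrace `y` from `Λ`, and the contribution of `1/ρ`.
  have hprod : bracket π d E (a * b * r) (G β) = a * b * r * (fF + fG - dv + y - r * Dρ) := by
    have c1 := pb.commute (fF + fG - dv)
    have c2 := pr.commute (fF + fG - dv)
    have c3 := pr.commute y
    rw [show bracket π d E (a * b * r) (G β) = _ from hD.mul (a * b) r,
      show bracket π d E (a * b) (G β) = _ from hD.mul a b, pr.sig, pb.sig, mul_zero, sg_zero,
      one_smul, one_smul, hDr, hJac, hlam]
    generalize fF + fG - dv = w at c1 c2 ⊢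
    have c1 : b * w = w * b := c1
    have c2 : r * w = w * r := c2
    have c3 : r * y = y * r := c3
    have e1 : a * w * b * r = a * b * r * w := by
      rw [mul_assoc a w b, ← c1, mul_assoc, mul_assoc b, ← c2]; simp only [mul_assoc]
    have e2 : a * (b * y) * r = a * b * r * y := by
      rw [← mul_assoc, mul_assoc, ← c3]; simp only [mul_assoc]
    rw [add_mul, e1, e2, mul_neg, mul_sub, mul_add]
    simp only [mul_assoc]
    abel
  -- The terms `dv + r * Dρ` are twice the Laplacian of `G_β`. The `F` part `fF` of the divergence
  -- cancels against the one contained in `y`, so only two copies of the supertrace of `Y` remain,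
  -- one from `fG` and one from `y`, each modulo `J`.
  have hfin : bracket π d E (a * b * r) (G β) - a * b * r * ((2 : ℤ) • tr - (dv + r * Dρ)) =
      a * b * r * ((fG - tr) + (y - (tr - fF))) := by
    rw [hprod, ← mul_sub]
    congr 1
    abel
  rw [hfin]
  exact h.mul_left_mem _ _ (J.add_mem ht hm)

end IsInvolutive

end Radicand
end
end SuperBV

set_option linter.unusedSectionVars false
namespace SuperBV
noncomputable section
open Grassmann

/-! ### The odd Laplacian of a product -/

section LaplacianProduct

variable {O R ι : Type*} [LinearOrder O] [CommRing R] [Algebra ℂ R] [Fintype ι] [DecidableEq ι]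
  {π : ι → ZMod 2} {d : ι → Grassmann O R → Grassmann O R} (hd : IsSuperDer π d)
  {E : Matrix ι ι (Grassmann O R)}

include hd

theorem laplacian_zsmul (ρ f : Grassmann O R) (n : ℤ) :
    laplacian π d E ρ (n • f) = n • laplacian π d E ρ f := by
  rw [laplacian, laplacian, smul_comm n]
  refine congrArg _ ?_
  rw [Finset.smul_sum]
  refine Finset.sum_congr rfl fun A _ => ?_
  rw [Finset.smul_sum]
  refine Finset.sum_congr rfl fun B _ => ?_
  rw [hd.zsmul, mul_smul_comm, hd.zsmul, mul_smul_comm, smul_comm]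

/-- The bracket measures the failure of the odd Laplacian to be a derivation. -/
theorem laplacian_mul (hE : ∀ A B, HasParity (π A + π B + 1) (E A B))
    (hs : ∀ A B, E B A = -(sg ((π A + 1) * (π B + 1)) • E A B)) {p : ZMod 2}
    {f g ρ : Grassmann O R} (hf : HasParity p f) (hρ : HasParity 0 ρ) (hr : HasParity 0 (Ring.inverse ρ))
    (hu : Ring.inverse ρ * ρ = 1) :
    laplacian π d E ρ (f * g) = laplacian π d E ρ f * g + sg p • (f * laplacian π d E ρ g) +
      sg p • bracket π d E f g := by
  have h1 : ∀ A B, sg (π A) • (Ring.inverse ρ * d A (ρ * E A B * d B (f * g))) =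
      sg (π A) • (Ring.inverse ρ * d A (ρ * E A B * d B f)) * g +
      sg (π A + π A * p) • (E A B * d B f * d A g) +
      (sg p • (f * (sg (π A) • (Ring.inverse ρ * d A (ρ * E A B * d B g)))) +
      sg p • (rd π d A f * E A B * d B g)) := by
    intro A B
    have hX : HasParity (π A + p + 1) (ρ * E A B * d B f) := by
      have := (hρ.mul (hE A B)).mul (hd.parity B _ _ hf)
      have k : ∀ a b p : ZMod 2, 0 + (a + b + 1) + (p + b) = a + p + 1 := by decide
      rwa [k] at this
    have hc : (ρ * E A B) * (f * d B g) = sg (p * (π A + π B + 1)) • (f * (ρ * E A B * d B g)) := by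
      rw [← mul_assoc, (hρ.mul (hE A B)).mul_comm hf, smul_mul_assoc, mul_assoc]
      congr 2
      generalize π A = a
      generalize π B = b
      clear hf hX
      revert a b p; decide
    have hcf : ∀ z, Ring.inverse ρ * (f * z) = f * (Ring.inverse ρ * z) := fun z => by
      have : Ring.inverse ρ * f = f * Ring.inverse ρ := hr.commute f
      rw [← mul_assoc, this, mul_assoc]
    have hcd : ∀ y z, Ring.inverse ρ * (y * (ρ * z)) = y * z := fun y z => by
      have : Ring.inverse ρ * y = y * Ring.inverse ρ := hr.commute y
      rw [← mul_assoc, this, mul_assoc, ← mul_assoc (Ring.inverse ρ) ρ, hu, one_mul]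
    have hcx : ∀ y, Ring.inverse ρ * (ρ * y) = y := fun y => by
      rw [← mul_assoc, hu, one_mul]
    rw [hd.mul B, hf.sig, mul_add, smul_mul_assoc, mul_smul_comm, hc, ← mul_assoc, smul_smul,
      ← sg_add, hd.add, hd.zsmul, hd.mul A, hX.sig, hd.mul A f, hf.sig, hd.rd_eq hf]
    simp only [mul_add, smul_add, mul_smul_comm, smul_mul_assoc, smul_smul, ← sg_add, hcf, hcd, hcx,
      mul_assoc]
    have k1 : ∀ a p : ZMod 2, a + (a * a + a * p + a * 1) = a + a * p := by decide
    have k2 : ∀ a b p : ZMod 2, a + (b * p + (p * a + p * b + p * 1)) = p + (a * p + a * 1) := by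
      decide
    have k3 : ∀ a b p : ZMod 2, a + (b * p + (p * a + p * b + p * 1) + a * p) = p + a := by decide
    rw [k1, k2, k3]
    abel
  -- The graded antisymmetry of `E` makes this cross term a second copy of the bracket. The two
  -- copies compensate the factor one half in the Laplacian.
  have h2 : ∑ A, ∑ B, sg (π A + π A * p) • (E A B * d B f * d A g) = sg p • bracket π d E f g := by
    rw [bracket, Finset.sum_comm, Finset.smul_sum]
    refine Finset.sum_congr rfl fun B _ => ?_
    rw [Finset.smul_sum]
    refine Finset.sum_congr rfl fun A _ => ?_
    rw [hs B A, hd.rd_eq hf, neg_mul, smul_mul_assoc, (hE B A).mul_comm (hd.parity B _ _ hf)]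
    simp only [smul_mul_assoc, neg_mul, smul_neg, smul_smul, ← sg_add]
    rw [← neg_smul]
    congr 1
    generalize π A = a
    generalize π B = b
    clear hf h1
    revert a b p; decide
  have h3 : ∑ A, ∑ B, sg p • (rd π d A f * E A B * d B g) = sg p • bracket π d E f g := by
    simp only [bracket, Finset.smul_sum]
  have h4 : ∑ A, ∑ B, sg (π A) • (Ring.inverse ρ * d A (ρ * E A B * d B (f * g))) =
      (∑ A, ∑ B, sg (π A) • (Ring.inverse ρ * d A (ρ * E A B * d B f))) * g +
      sg p • bracket π d E f g +
      (sg p • (f * ∑ A, ∑ B, sg (π A) • (Ring.inverse ρ * d A (ρ * E A B * d B g))) +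
        sg p • bracket π d E f g) := by
    simp only [h1, Finset.sum_add_distrib, h2, h3, Finset.sum_mul, Finset.mul_sum]
    simp only [Finset.smul_sum]
  simp only [laplacian, h4, smul_mul_assoc, mul_smul_comm]
  module

end LaplacianProduct
end
end SuperBV

set_option linter.unusedSectionVars false
namespace SuperBV
noncomputable section
open Grassmann

/-! ### The master equation through second order in the multipliers -/

section MasterEquation

variable {O R ι κ : Type*} [LinearOrder O] [CommRing R] [Algebra ℂ R] [Fintype ι] [DecidableEq ι]
  [Fintype κ]
  {π : ι → ZMod 2} {d : ι → Grassmann O R → Grassmann O R} (hd : IsSuperDer π d)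
  {E : Matrix ι ι (Grassmann O R)} {ε : κ → ZMod 2} {ρ h e : Grassmann O R}
  {f T : κ → Grassmann O R} {T₀ : Grassmann O R} {T₂ : κ → κ → Grassmann O R}

/-- The data of the master equation around `λ = λ* = 0`: the Laplacian, and an exponential `e` of
the even element `-h`. -/
structure IsExpData (π : ι → ZMod 2) (d : ι → Grassmann O R → Grassmann O R)
    (E : Matrix ι ι (Grassmann O R)) (ρ h e : Grassmann O R) : Prop where
  der : IsSuperDer π d
  parityE : ∀ A B, HasParity (π A + π B + 1) (E A B)
  skew : ∀ A B, E B A = -(sg ((π A + 1) * (π B + 1)) • E A B)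
  parity_ρ : HasParity 0 ρ
  parity_inv : HasParity 0 (Ring.inverse ρ)
  inverse_mul : Ring.inverse ρ * ρ = 1
  parity_h : HasParity 0 h
  d_e : ∀ A, d A e = -(d A h) * e
  isUnit : IsUnit e

namespace IsExpData

variable (D : IsExpData π d E ρ h e)

include D

theorem bracket_e (x : Grassmann O R) : bracket π d E x e = -bracket π d E x h * e := by
  simp only [bracket, D.d_e, Finset.sum_mul, ← Finset.sum_neg_distrib, mul_neg, neg_mul, mul_assoc]

/-- The order zero equation replaces the Laplacian of `e` by `-T₀ e`, and the bracket with `e` is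
`-(x, h) e`. Thus `e` factors out on the right, and being a unit it can be cancelled from every
order. -/
theorem laplacian_mul_e {p : ZMod 2} {x : Grassmann O R} (hx : HasParity p x)
    (eq0 : laplacian π d E ρ e + T₀ * e = 0) :
    laplacian π d E ρ (x * e) = (laplacian π d E ρ x - sg p • (x * T₀) - sg p • bracket π d E x h) * e := by
  rw [laplacian_mul D.der D.parityE D.skew hx D.parity_ρ D.parity_inv D.inverse_mul,
    eq_neg_of_add_eq_zero_left eq0, D.bracket_e, sub_mul, sub_mul, smul_mul_assoc, smul_mul_assoc,
    mul_neg, neg_mul, smul_neg, smul_neg, mul_assoc]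
  abel

theorem cancel {x : Grassmann O R} (hx : x * e = 0) : x = 0 := D.isUnit.mul_left_eq_zero.1 hx

/-- The hypothesis `eq1` is the derivative of the master equation with respect to `λ^β` at the
origin. Once `e` is cancelled, the two occurrences of the odd element `T₀` cancel by graded
commutation with `f β`. -/
theorem first_order (hf : ∀ β, HasParity (ε β) (f β)) (hT₀ : HasParity 1 T₀)
    (eq0 : laplacian π d E ρ e + T₀ * e = 0) {β : κ}
    (eq1 : sg (ε β) • laplacian π d E ρ (f β * e) + (T β + sg (ε β) • (T₀ * f β)) * e = 0) :
    sg (ε β) • laplacian π d E ρ (f β) - bracket π d E (f β) h + T β = 0 := by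
  rw [D.laplacian_mul_e (hf β) eq0, ← smul_mul_assoc, ← add_mul] at eq1
  have := D.cancel eq1
  rw [smul_sub, smul_sub, smul_smul, smul_smul, sg_mul_self, one_smul, one_smul,
    (hf β).mul_comm hT₀, mul_one] at this
  rw [← this]
  abel

/-- The Laplacian of `f β * f γ` consists of the Laplacians of the factors and the bracket. The
first order equations eliminate the former, and with them all terms with `h`, `T` and `T₀`. Only the
bracket and the second derivative `T₂` are left. -/
theorem second_order (hf : ∀ β, HasParity (ε β) (f β)) (hT₀ : HasParity 1 T₀)
    (hT : ∀ β, HasParity (ε β + 1) (T β))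
    (eq0 : laplacian π d E ρ e + T₀ * e = 0)
    (eq1 : ∀ β, sg (ε β) • laplacian π d E ρ (f β * e) + (T β + sg (ε β) • (T₀ * f β)) * e = 0)
    {β γ : κ}
    (eq2 : sg (ε γ + ε β + ε γ * ε β) • laplacian π d E ρ (f β * f γ * e) +
      (T₂ γ β + sg ((ε β + 1) * ε γ) • (T β * f γ) + sg (ε β) • (T γ * f β) +
        sg (ε γ + ε β + ε γ * ε β) • (T₀ * (f β * f γ))) * e = 0) :
    sg (ε γ + ε β * ε γ) • bracket π d E (f β) (f γ) + T₂ γ β = 0 := by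
  have h1 : ∀ β, laplacian π d E ρ (f β) = sg (ε β) • bracket π d E (f β) h - sg (ε β) • T β := by
    intro β
    have := congrArg (fun z => sg (ε β) • z) (D.first_order hf hT₀ eq0 (eq1 β))
    simp only [smul_add, smul_sub, smul_smul, sg_mul_self, one_smul, smul_zero] at this
    rw [← sub_eq_zero, ← this]; abel
  have hT₀f : f β * f γ * T₀ = sg (ε β + ε γ) • (T₀ * (f β * f γ)) := by
    rw [((hf β).mul (hf γ)).mul_comm hT₀, mul_one]
  have hfT : f β * T γ = sg (ε β * (ε γ + 1)) • (T γ * f β) := (hf β).mul_comm (hT γ)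
  have hbr : bracket π d E (f β * f γ) h =
      f β * bracket π d E (f γ) h + sg (ε γ) • (bracket π d E (f β) h * f γ) := by
    rw [show bracket π d E (f β * f γ) h = _ from
      (isRightDer_bracket D.der D.parityE D.parity_h).mul (f β) (f γ), (hf γ).sig, mul_smul_comm,
      zero_add, one_mul]
  rw [D.laplacian_mul_e ((hf β).mul (hf γ)) eq0, ← smul_mul_assoc, ← add_mul] at eq2
  have eq := D.cancel eq2
  rw [laplacian_mul D.der D.parityE D.skew (hf β) D.parity_ρ D.parity_inv D.inverse_mul, h1, h1,
    hbr, hT₀f] at eq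
  simp only [sub_mul, mul_sub, smul_mul_assoc, mul_smul_comm, hfT, smul_sub, smul_add, smul_smul,
    ← sg_add] at eq
  rw [← eq]
  clear eq eq2 hf hT h1 hT₀f hfT eq1
  have k : (1 : ZMod 2) + 1 = 0 := rfl
  rcases zmod_two_cases (ε β) with hb | hb <;> rcases zmod_two_cases (ε γ) with hc | hc <;>
    simp only [hb, hc, add_zero, zero_add, mul_zero, mul_one, k, sg_zero,
      sg_one, one_smul, neg_smul] <;> abel

omit D

/-- The involution relation and the equation on `H` contained in the master equation. -/
theorem involution (D : IsExpData π d E ρ h e) (hsmul : ∀ A (c : ℂ) x, d A (c • x) = c • d A x)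
    {G : κ → Grassmann O R} (hG : ∀ β, HasParity (ε β) (G β))
    (hf : ∀ β, f β = (Complex.I * (sg (ε β) : ℂ)) • G β) (hT₀ : HasParity 1 T₀)
    {B : κ → κ → κ → Grassmann O R} {V C : κ → κ → Grassmann O R}
    (hB : ∀ α β γ, HasParity (ε α + ε β + ε γ + 1) (B α β γ))
    (hC : ∀ α β, HasParity (ε α + 1 + ε β) (C α β)) (hV : ∀ α β, C α β = -sig (ε β) (V α β))
    (eq0 : laplacian π d E ρ e + T₀ * e = 0)
    (hT : ∀ β, T β = ∑ α, sg (ε α) • (B α β α + C α β * f α))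
    (hT₂ : ∀ γ β, T₂ γ β = ∑ α, sg (ε α) • (B α γ β * f α))
    (eq1 : ∀ β, sg (ε β) • laplacian π d E ρ (f β * e) + (T β + sg (ε β) • (T₀ * f β)) * e = 0)
    (eq2 : ∀ β γ, sg (ε γ + ε β + ε γ * ε β) • laplacian π d E ρ (f β * f γ * e) +
      (T₂ γ β + sg ((ε β + 1) * ε γ) • (T β * f γ) + sg (ε β) • (T γ * f β) +
        sg (ε γ + ε β + ε γ * ε β) • (T₀ * (f β * f γ))) * e = 0)
    {Y : κ → κ → κ → Grassmann O R}
    (hY : ∀ γ α β, Y γ α β = (Complex.I * (sg (ε α + ε α * ε β + ε γ * (ε α + ε β)) : ℂ)) • B γ β α) :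
    (∀ α β, bracket π d E (G α) (G β) = ∑ γ, G γ * Y γ α β) ∧
    (∀ β, laplacian π d E ρ (G β) - bracket π d E h (G β) - ∑ α, sg (ε α) • Y α α β =
      ∑ α, G α * V α β) ∧
    ∀ α β, HasParity (ε α + 1 + ε β) (V α β) := by
  have hVp : ∀ α β, HasParity (ε α + 1 + ε β) (V α β) := fun α β => by
    have : V α β = -sig (ε β) (C α β) := by rw [hV, map_neg, sig_sig, neg_neg]
    rw [this]; exact ((hC α β).sig _ ▸ (hC α β).zsmul _).neg
  have hfp : ∀ β, HasParity (ε β) (f β) := fun β => by rw [hf]; exact (hG β).smul _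
  have hTp : ∀ β, HasParity (ε β + 1) (T β) := fun β => by
    rw [hT]
    refine HasParity.sum fun α _ => (HasParity.add ?_ ?_).zsmul _
    · have := hB α β α
      have k : ∀ a b : ZMod 2, a + b + a + 1 = b + 1 := by decide
      rwa [k] at this
    · have := (hC α β).mul (hfp α)
      have k : ∀ a b : ZMod 2, a + 1 + b + a = b + 1 := by decide
      rwa [k] at this
  have hz : ∀ (n : ℤ) (x : Grassmann O R), n • x = (n : ℂ) • x := fun n x =>
    (Int.cast_smul_eq_zsmul ℂ n x).symm
  have hbl : ∀ (c : ℂ) x y, bracket π d E (c • x) y = c • bracket π d E x y := fun c x y => by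
    simp only [bracket, rd, hsmul, sig_smul, smul_mul_assoc, Finset.smul_sum]
  have hbr : ∀ (c : ℂ) x y, bracket π d E x (c • y) = c • bracket π d E x y := fun c x y => by
    simp only [bracket, hsmul, mul_smul_comm, Finset.smul_sum]
  have hl : ∀ (c : ℂ) x, laplacian π d E ρ (c • x) = c • laplacian π d E ρ x := fun c x => by
    simp only [laplacian, hsmul, mul_smul_comm]
    rw [smul_comm c]
    refine congrArg _ ?_
    rw [Finset.smul_sum]
    refine Finset.sum_congr rfl fun A _ => ?_
    rw [Finset.smul_sum]
    exact Finset.sum_congr rfl fun B _ => smul_comm _ _ _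
  refine ⟨?_, ?_, hVp⟩
  · intro α β
    have := D.second_order hfp hT₀ hTp eq0 eq1 (eq2 α β)
    rw [hT₂, hf α, hf β, hbl, hbr] at this
    -- The sign in the definition of `Y` is chosen so that reordering `G γ` and `B` in the second
    -- order equation gives exactly this contraction. The two factors of `i`, from `f` and from `Y`,
    -- supply the overall minus sign.
    have h2 : ∑ γ, G γ * Y γ α β = (-(sg (ε α + ε α * ε β) : ℂ)) • -∑ γ, sg (ε γ) • (B γ β α * f γ) := by
      rw [smul_neg, neg_smul, neg_neg, Finset.smul_sum]
      refine Finset.sum_congr rfl fun γ _ => ?_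
      rw [hY, hf, mul_smul_comm, mul_smul_comm, (hG γ).mul_comm (hB γ β α), hz, hz, smul_smul,
        smul_smul, smul_smul]
      congr 1
      generalize ε α = a
      generalize ε β = b
      generalize ε γ = c
      rcases zmod_two_cases a with rfl | rfl <;> rcases zmod_two_cases b with rfl | rfl <;>
        rcases zmod_two_cases c with rfl | rfl <;>
        simp [sg, show (1 : ZMod 2) + 1 = 0 from rfl]
    rw [h2, ← eq_neg_of_add_eq_zero_left this, hz, smul_smul, smul_smul, smul_smul]
    refine ((one_smul ℂ _).symm.trans ?_)
    congr 1
    generalize ε α = a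
    generalize ε β = b
    have hI : Complex.I * Complex.I = -1 := Complex.I_mul_I
    rcases zmod_two_cases a with rfl | rfl <;> rcases zmod_two_cases b with rfl | rfl <;>
      simp [sg, show (1 : ZMod 2) + 1 = 0 from rfl]
  · intro β
    have := D.first_order hfp hT₀ eq0 (eq1 β)
    have h2 : bracket π d E (G β) h = sg (ε β) • bracket π d E h (G β) := by
      rw [bracket_skew D.der D.parityE D.skew (hG β) D.parity_h, ← neg_smul]
      congr 1
      generalize ε β = b
      revert b; decide
    -- The source `T β` has two parts, a second derivative with contracted indices and a first
    -- derivative times `f α`. Up to the factor `i` they are the supertrace of `Y` and the term with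
    -- `V`.
    have h3 : ∑ α, sg (ε α) • Y α α β + ∑ α, G α * V α β = Complex.I • T β := by
      rw [← Finset.sum_add_distrib, hT, Finset.smul_sum]
      refine Finset.sum_congr rfl fun α _ => ?_
      rw [hY, hV, (hVp α β).sig, hf, (hG α).mul_comm (hVp α β), hz, hz, hz, hz, smul_add, smul_add,
        mul_smul_comm, neg_mul, smul_mul_assoc, smul_neg, smul_neg, smul_neg, smul_smul, smul_smul,
        smul_smul, smul_smul, smul_smul, ← neg_smul]
      congr 2
      · generalize ε α = a
        generalize ε β = b
        rcases zmod_two_cases a with rfl | rfl <;> rcases zmod_two_cases b with rfl | rfl <;>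
          simp [sg, show (1 : ZMod 2) + 1 = 0 from rfl]
      · generalize ε α = a
        generalize ε β = b
        rcases zmod_two_cases a with rfl | rfl <;> rcases zmod_two_cases b with rfl | rfl <;>
          simp [sg, show (1 : ZMod 2) + 1 = 0 from rfl]
    rw [hf, hl, hbl, h2, hz, hz, smul_smul, smul_smul] at this
    have h4 : (Complex.I : ℂ) • (Complex.I • laplacian π d E ρ (G β) -
        Complex.I • bracket π d E h (G β) + T β) = 0 := by
      rw [← smul_zero (Complex.I : ℂ), ← this]
      congr 4
      all_goals
        generalize ε β = b
        rcases zmod_two_cases b with rfl | rfl <;> simp [sg]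
    rw [smul_add, smul_sub, smul_smul, smul_smul, Complex.I_mul_I, ← h3, neg_smul, neg_smul,
      one_smul, one_smul] at h4
    rw [← sub_eq_zero, ← neg_eq_zero, ← h4]
    abel

end IsExpData
end MasterEquation
end
end SuperBV

set_option linter.unusedSectionVars false
namespace SuperBV
noncomputable section
open SuperBV.Grassmann hiding coeff

/-! ### Power series over a Grassmann algebra -/

namespace Series

open MvPowerSeries

section Basic

variable {σ O R : Type*} [LinearOrder O] [CommRing R]

/-- The powers of the parity involution of a power series. -/
def sigS (p : ZMod 2) : MvPowerSeries σ (Grassmann O R) →+* MvPowerSeries σ (Grassmann O R) :=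
  MvPowerSeries.map (sig p)

/-- All coefficients have the given parity. -/
def HasParityS (p : ZMod 2) (f : MvPowerSeries σ (Grassmann O R)) : Prop :=
  ∀ m, HasParity p (coeff m f)

theorem coeff_add (m : σ →₀ ℕ) (f g : MvPowerSeries σ (Grassmann O R)) :
    coeff m (f + g) = coeff m f + coeff m g := rfl

theorem coeff_sub (m : σ →₀ ℕ) (f g : MvPowerSeries σ (Grassmann O R)) :
    coeff m (f - g) = coeff m f - coeff m g := map_sub (coeff m) f g

theorem coeff_smul' {K : Type*} [Semiring K] [Module K R] (c : K) (m : σ →₀ ℕ)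
    (f : MvPowerSeries σ (Grassmann O R)) : coeff m (c • f) = c • coeff m f := rfl

theorem coeff_zsmul (c : ℤ) (m : σ →₀ ℕ)
    (f : MvPowerSeries σ (Grassmann O R)) : coeff m (c • f) = c • coeff m f :=
  map_zsmul (coeff m).toAddMonoidHom c f

theorem coeff_sum {ι : Type*} (s : Finset ι) (m : σ →₀ ℕ)
    (f : ι → MvPowerSeries σ (Grassmann O R)) : coeff m (∑ i ∈ s, f i) = ∑ i ∈ s, coeff m (f i) :=
  map_sum (coeff m) f s

instance {K : Type*} [CommSemiring K] [Algebra K R] :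
    IsScalarTower K (MvPowerSeries σ (Grassmann O R)) (MvPowerSeries σ (Grassmann O R)) where
  smul_assoc c f g := by
    classical
    ext1 m
    rw [smul_eq_mul, smul_eq_mul, coeff_smul', coeff_mul, coeff_mul, Finset.smul_sum]
    exact Finset.sum_congr rfl fun p _ => smul_mul_assoc c (coeff p.1 f) (coeff p.2 g)

instance {K : Type*} [CommSemiring K] [Algebra K R] :
    SMulCommClass K (MvPowerSeries σ (Grassmann O R)) (MvPowerSeries σ (Grassmann O R)) where
  smul_comm c f g := by
    classical
    ext1 m
    rw [smul_eq_mul, smul_eq_mul, coeff_smul', coeff_mul, coeff_mul, Finset.smul_sum]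
    exact Finset.sum_congr rfl fun p _ => (mul_smul_comm c (coeff p.1 f) (coeff p.2 g)).symm

namespace HasParityS

variable {p q : ZMod 2} {f g : MvPowerSeries σ (Grassmann O R)}

theorem mul (hf : HasParityS p f) (hg : HasParityS q g) : HasParityS (p + q) (f * g) := fun m => by
  classical
  rw [coeff_mul]
  exact HasParity.sum fun a _ => (hf a.1).mul (hg a.2)

theorem add (hf : HasParityS p f) (hg : HasParityS p g) : HasParityS p (f + g) :=
  fun m => (hf m).add (hg m)

theorem sub (hf : HasParityS p f) (hg : HasParityS p g) : HasParityS p (f - g) := fun m => by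
  rw [coeff_sub]; exact (hf m).sub (hg m)

theorem smul {K : Type*} [Semiring K] [Module K R] (hf : HasParityS p f) (c : K) :
    HasParityS p (c • f) := fun m => (hf m).smul c

theorem zsmul (hf : HasParityS p f) (c : ℤ) : HasParityS p (c • f) := fun m => by
  rw [coeff_zsmul]; exact (hf m).zsmul c

theorem sum {ι : Type*} {s : Finset ι} {f : ι → MvPowerSeries σ (Grassmann O R)}
    (hf : ∀ i ∈ s, HasParityS p (f i)) : HasParityS p (∑ i ∈ s, f i) := fun m => by
  rw [coeff_sum]; exact HasParity.sum fun i hi => hf i hi m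

theorem C {x : Grassmann O R} (hx : HasParity p x) :
    HasParityS p (MvPowerSeries.C (σ := σ) x) := fun m => by
  classical
  rw [coeff_C]
  split
  · exact hx
  · exact HasParity.zero p

theorem one : HasParityS 0 (1 : MvPowerSeries σ (Grassmann O R)) := by
  rw [← map_one (MvPowerSeries.C (σ := σ))]
  exact HasParityS.C HasParity.one

theorem pow (hf : HasParityS 0 f) (n : ℕ) : HasParityS 0 (f ^ n) := by
  induction n with
  | zero => rw [pow_zero]; exact one
  | succ n ih => rw [pow_succ]; exact ih.mul hf

theorem sigS (hf : HasParityS p f) (q : ZMod 2) : Series.sigS q f = sg (q * p) • f := by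
  ext1 m
  rw [coeff_zsmul, Series.sigS, coeff_map, (hf m).sig]

end HasParityS

theorem HasParityS.commute {f : MvPowerSeries σ (Grassmann O R)} (hf : HasParityS 0 f)
    (g : MvPowerSeries σ (Grassmann O R)) : Commute f g := by
  classical
  change f * g = g * f
  ext1 m
  rw [coeff_mul, coeff_mul]
  conv_lhs => rw [← Finset.HasAntidiagonal.map_swap_antidiagonal, Finset.sum_map]
  exact Finset.sum_congr rfl fun a _ => (hf _).commute _

theorem sigS_C (p : ZMod 2) (x : Grassmann O R) :
    sigS p (C (σ := σ) x) = C (σ := σ) (sig p x) := by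
  rw [sigS, map_C]

/-- All coefficients of degree at most `d` vanish. -/
def VanishTo (d : ℕ) (f : MvPowerSeries σ (Grassmann O R)) : Prop :=
  ∀ m : σ →₀ ℕ, m.degree ≤ d → coeff m f = 0

theorem VanishTo.mul_left {d : ℕ} {f : MvPowerSeries σ (Grassmann O R)} (hf : VanishTo d f)
    (g : MvPowerSeries σ (Grassmann O R)) : VanishTo d (g * f) := fun m hm => by
  classical
  rw [coeff_mul]
  refine Finset.sum_eq_zero fun a ha => ?_
  rw [hf a.2, mul_zero]
  rw [Finset.HasAntidiagonal.mem_antidiagonal] at ha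
  rw [← ha, map_add] at hm
  omega

/-- The coefficient of the monomial with even exponents `m` and odd factors `S` vanishes if its
total degree is less than `k`. -/
def HasOrderS (k : ℕ) (f : MvPowerSeries σ (Grassmann O R)) : Prop :=
  ∀ m : σ →₀ ℕ, HasOrder (k - m.degree) (coeff m f)

theorem HasOrderS.mul {k l : ℕ} {f g : MvPowerSeries σ (Grassmann O R)} (hf : HasOrderS k f)
    (hg : HasOrderS l g) : HasOrderS (k + l) (f * g) := fun m => by
  classical
  rw [coeff_mul]
  refine HasOrder.sum fun a ha => ((hf a.1).mul (hg a.2)).mono ?_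
  rw [Finset.HasAntidiagonal.mem_antidiagonal] at ha
  rw [← ha, map_add]
  omega

theorem HasOrderS.pow {f : MvPowerSeries σ (Grassmann O R)} (hf : HasOrderS 1 f) (n : ℕ) :
    HasOrderS n (f ^ n) := by
  induction n with
  | zero => intro m; rw [Nat.zero_sub]; exact hasOrder_zero _
  | succ n ih => rw [pow_succ]; exact ih.mul hf

theorem hasOrderS_one {f : MvPowerSeries σ (Grassmann O R)} (h : body (coeff 0 f) = 0) :
    HasOrderS 1 f := fun m => by
  rcases eq_or_ne m 0 with rfl | hm
  · exact hasOrder_one_iff.2 h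
  · have : m.degree ≠ 0 := by rwa [Ne, Finsupp.degree_eq_zero_iff]
    rw [show 1 - m.degree = 0 by omega]
    exact hasOrder_zero _

/-- A monomial in the odd generators has degree at most their number. High total order therefore
forces high degree in the even variables. -/
theorem HasOrderS.vanishTo [Fintype O] {k d : ℕ} {f : MvPowerSeries σ (Grassmann O R)}
    (hf : HasOrderS k f) (h : d + Fintype.card O < k) : VanishTo d f := fun m hm =>
  (hf m).eq_zero (by omega)

end Basic

/-! ### Derivations -/

section Derivation

variable {σ O R : Type*} [LinearOrder O] [CommRing R] [Algebra ℂ R]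

/-- A left derivation of parity `p`, which lowers degrees by at most one. -/
structure IsLeftDer (p : ZMod 2)
    (D : MvPowerSeries σ (Grassmann O R) → MvPowerSeries σ (Grassmann O R)) : Prop where
  add : ∀ f g, D (f + g) = D f + D g
  smul : ∀ (c : ℂ) f, D (c • f) = c • D f
  mul : ∀ f g, D (f * g) = D f * g + sigS p f * D g
  parity : ∀ q f, HasParityS q f → HasParityS (q + p) (D f)
  vanishTo : ∀ d f, VanishTo (d + 1) f → VanishTo d (D f)

namespace IsLeftDer

variable {p : ZMod 2} {D : MvPowerSeries σ (Grassmann O R) → MvPowerSeries σ (Grassmann O R)}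
  (h : IsLeftDer p D)

include h

theorem zero : D 0 = 0 := by
  have := h.add 0 0
  rw [add_zero] at this
  exact left_eq_add.1 this

theorem one : D 1 = 0 := by
  have := h.mul 1 1
  rw [mul_one, map_one, one_mul, mul_one] at this
  exact left_eq_add.1 this

/-- A left derivation as an additive homomorphism. -/
def hom : MvPowerSeries σ (Grassmann O R) →+ MvPowerSeries σ (Grassmann O R) :=
  ⟨⟨D, h.zero⟩, h.add⟩

theorem sub (f g) : D (f - g) = D f - D g := map_sub h.hom f g

theorem zsmul (c : ℤ) (f) : D (c • f) = c • D f := map_zsmul h.hom c f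

theorem sum {ι : Type*} (s : Finset ι) (f : ι → MvPowerSeries σ (Grassmann O R)) :
    D (∑ i ∈ s, f i) = ∑ i ∈ s, D (f i) := map_sum h.hom f s

theorem mul_even {f : MvPowerSeries σ (Grassmann O R)} (hf : HasParityS 0 f)
    (g : MvPowerSeries σ (Grassmann O R)) : D (f * g) = D f * g + f * D g := by
  rw [h.mul, hf.sigS, mul_zero, sg_zero, one_smul]

theorem mul_parity {q : ZMod 2} {f : MvPowerSeries σ (Grassmann O R)} (hf : HasParityS q f)
    (g : MvPowerSeries σ (Grassmann O R)) : D (f * g) = D f * g + sg (p * q) • (f * D g) := by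
  rw [h.mul, hf.sigS, smul_mul_assoc]

theorem pow_succ {f : MvPowerSeries σ (Grassmann O R)} (hf : HasParityS 0 f) (n : ℕ) :
    D (f ^ (n + 1)) = ((n : ℂ) + 1) • (f ^ n * D f) := by
  induction n with
  | zero => simp
  | succ n ih =>
    rw [_root_.pow_succ' f (n + 1), h.mul_even hf, ih, mul_smul_comm, ← mul_assoc, ← _root_.pow_succ']
    rw [← ((hf.pow (n + 1)).commute (D f)).eq]
    push_cast
    module

end IsLeftDer

/-- The exponential of `C (const β) + ν`, where `b` is the exponential of `β`. -/
def expS (K : ℕ) (b : R) (ν : MvPowerSeries σ (Grassmann O R)) : MvPowerSeries σ (Grassmann O R) :=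
  fun m => ∑ n ∈ Finset.range (m.degree + K), ((n.factorial : ℂ)⁻¹) •
    (const b * coeff m (ν ^ n))

/-- The partial sums of the exponential series. -/
def expSum (b : R) (ν : MvPowerSeries σ (Grassmann O R)) (n : ℕ) :
    MvPowerSeries σ (Grassmann O R) :=
  C (const b) * ∑ n ∈ Finset.range n, ((n.factorial : ℂ)⁻¹) • ν ^ n

/-- The truncation inside `expS` depends on the coefficient, so derivations cannot be applied to it
directly. In degrees up to `d` it agrees with every sufficiently long partial sum, because high
powers of a series without body have no coefficients there. Partial sums are ordinary algebraic
expressions and can be differentiated. -/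
theorem expS_sub_expSum [Fintype O] {K d L : ℕ} {b : R} {ν : MvPowerSeries σ (Grassmann O R)}
    (hν : body (coeff 0 ν) = 0) (hK : Fintype.card O < K) (hL : d + Fintype.card O < L) :
    VanishTo d (expS K b ν - expSum b ν L) := fun m hm => by
  have hv : ∀ n, m.degree + Fintype.card O < n → coeff m (ν ^ n) = 0 := fun n hn =>
    ((hasOrderS_one hν).pow n).vanishTo hn m le_rfl
  have h1 : ∀ L', m.degree + Fintype.card O < L' →
      ∑ n ∈ Finset.range L', ((n.factorial : ℂ)⁻¹) • (const b * coeff m (ν ^ n)) =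
      ∑ n ∈ Finset.range (m.degree + Fintype.card O + 1),
        ((n.factorial : ℂ)⁻¹) • (const b * coeff m (ν ^ n)) := fun L' hL' => by
    symm
    refine Finset.sum_subset (Finset.range_subset_range.2 hL') fun n _ hn => ?_
    rw [hv n (by simpa using hn), mul_zero, smul_zero]
  have h2 : coeff m (expSum b ν L) =
      ∑ n ∈ Finset.range L, ((n.factorial : ℂ)⁻¹) • (const b * coeff m (ν ^ n)) := by
    rw [expSum, coeff_C_mul, coeff_sum, Finset.mul_sum]
    refine Finset.sum_congr rfl fun n _ => ?_
    rw [coeff_smul', mul_smul_comm]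
  have h3 : coeff m (expS K b ν) = ∑ n ∈ Finset.range (m.degree + K),
      ((n.factorial : ℂ)⁻¹) • (const b * coeff m (ν ^ n)) := rfl
  rw [coeff_sub, h2, h3, h1 L (by omega), h1 _ (by omega), sub_self]

theorem hasParityS_expSum {b : R} {ν : MvPowerSeries σ (Grassmann O R)} (hν : HasParityS 0 ν)
    (n : ℕ) : HasParityS 0 (expSum b ν n) :=
  (HasParityS.C (HasParity.const b)).mul (HasParityS.sum fun _ _ => (hν.pow _).smul _)

theorem hasParityS_expS {K : ℕ} {b : R} {ν : MvPowerSeries σ (Grassmann O R)}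
    (hν : HasParityS 0 ν) : HasParityS 0 (expS K b ν) := fun m => by
  have h : coeff m (expS K b ν) = ∑ n ∈ Finset.range (m.degree + K),
      ((n.factorial : ℂ)⁻¹) • (const b * coeff m (ν ^ n)) := rfl
  rw [h]
  exact HasParity.sum fun n _ => ((HasParity.const b).mul (hν.pow n m)).smul _

theorem IsLeftDer.map_expSum {p : ZMod 2}
    {D : MvPowerSeries σ (Grassmann O R) → MvPowerSeries σ (Grassmann O R)} (h : IsLeftDer p D)
    {b : R} {ν c : MvPowerSeries σ (Grassmann O R)} (hν : HasParityS 0 ν)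
    (hb : D (C (const b)) = D c * C (const b)) (n : ℕ) :
    D (expSum b ν (n + 1)) = D c * expSum b ν (n + 1) + D ν * expSum b ν n := by
  have hs : D (∑ k ∈ Finset.range (n + 1), ((k.factorial : ℂ)⁻¹) • ν ^ k) =
      (∑ k ∈ Finset.range n, ((k.factorial : ℂ)⁻¹) • ν ^ k) * D ν := by
    rw [Finset.sum_range_succ', h.add, h.sum, Finset.sum_mul, h.smul, pow_zero, h.one, smul_zero,
      add_zero]
    refine Finset.sum_congr rfl fun k _ => ?_
    rw [h.smul, h.pow_succ hν, smul_smul, smul_mul_assoc]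
    congr 1
    rw [Nat.factorial_succ]
    push_cast
    have : (k : ℂ) + 1 ≠ 0 := by exact_mod_cast k.succ_ne_zero
    field_simp
  rw [expSum, h.mul_even (HasParityS.C (HasParity.const b)), hb, hs, mul_assoc, ← mul_assoc,
    ← mul_assoc, ← ((hasParityS_expSum hν n).commute (D ν)).eq, mul_assoc]
  rfl

/-- The derivative of the exponential of `c + ν`, where `c = C (const β)`. -/
theorem IsLeftDer.map_expS [Fintype O] {p : ZMod 2}
    {D : MvPowerSeries σ (Grassmann O R) → MvPowerSeries σ (Grassmann O R)} (h : IsLeftDer p D)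
    {K : ℕ} {b : R} {ν c : MvPowerSeries σ (Grassmann O R)} (hν : HasParityS 0 ν)
    (hb : D (C (const b)) = D c * C (const b)) (hν₀ : body (coeff 0 ν) = 0)
    (hK : Fintype.card O < K) :
    D (expS K b ν) = D (c + ν) * expS K b ν := by
  rw [← sub_eq_zero]
  ext1 m
  -- A derivation may lower degrees by one, so agreement is needed up to degree `m.degree + 1`.
  -- Differentiation shortens a partial sum by one term, which is why the lengths `L` and `L + 1`
  -- both occur.
  set L := m.degree + 1 + Fintype.card O + 1 with hL
  have h1 := expS_sub_expSum (d := m.degree + 1) (L := L) (b := b) hν₀ hK (by omega)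
  have h2 := expS_sub_expSum (d := m.degree + 1) (L := L + 1) (b := b) hν₀ hK (by omega)
  have h3 := h.vanishTo _ _ h2
  have h4 : D (expS K b ν) - D (c + ν) * expS K b ν = D (expS K b ν - expSum b ν (L + 1)) -
      (D c * (expS K b ν - expSum b ν (L + 1)) + D ν * (expS K b ν - expSum b ν L)) := by
    rw [h.sub, h.map_expSum hν hb, h.add, add_mul, mul_sub, mul_sub]
    abel
  rw [h4, coeff_sub, coeff_add, h3 m le_rfl, (h2.mul_left _) m (by omega),
    (h1.mul_left _) m (by omega), add_zero, sub_zero, map_zero]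

theorem body_coeff_zero_expS {K : ℕ} (hK : 0 < K) {b : R}
    {ν : MvPowerSeries σ (Grassmann O R)} (hν₀ : body (coeff 0 ν) = 0) :
    body (coeff 0 (expS K b ν)) = b := by
  have h : coeff 0 (expS K b ν) = ∑ n ∈ Finset.range ((0 : σ →₀ ℕ).degree + K),
      ((n.factorial : ℂ)⁻¹) • (const b * coeff (0 : σ →₀ ℕ) (ν ^ n)) := rfl
  rw [map_zero] at h
  have hp : ∀ n, coeff (0 : σ →₀ ℕ) (ν ^ n) = (coeff 0 ν) ^ n := fun n =>
    map_pow (constantCoeff (σ := σ) (R := Grassmann O R)) ν n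
  rw [h, body_sum, Finset.sum_eq_single_of_mem 0 (by simpa using hK)]
  · rw [hp, pow_zero, mul_one, Nat.factorial_zero, Nat.cast_one, inv_one, one_smul, body_const]
  · intro n _ hn
    have : body ((const b : Grassmann O R) * coeff (0 : σ →₀ ℕ) (ν ^ n)) = 0 := by
      rw [body_mul, hp, show body ((coeff 0 ν) ^ n) = (body (coeff 0 ν)) ^ n from
        map_pow (bodyHom O R) _ n, hν₀, zero_pow hn, mul_zero]
    exact (congrArg (fun x => ((n.factorial : ℂ)⁻¹) • x) this).trans (smul_zero _)

end Derivation

end Series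
end
end SuperBV

set_option linter.unusedSectionVars false
namespace SuperBV
noncomputable section
open SuperBV.Grassmann hiding coeff

namespace Series

open MvPowerSeries

/-! ### Coefficientwise derivations and derivatives in the even variables -/

section Concrete

variable {σ O R : Type*} [LinearOrder O] [CommRing R] [Algebra ℂ R]

theorem mul_zsmul' (n : ℤ) (f g : MvPowerSeries σ (Grassmann O R)) : f * (n • g) = n • (f * g) :=
  map_zsmul (AddMonoidHom.mulLeft f) n g

theorem zsmul_mul' (n : ℤ) (f g : MvPowerSeries σ (Grassmann O R)) : (n • f) * g = n • (f * g) :=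
  map_zsmul (AddMonoidHom.mulRight g) n f

/-- Apply a map to all coefficients of a power series. -/
def coeffwise (δ : Grassmann O R → Grassmann O R) (f : MvPowerSeries σ (Grassmann O R)) :
    MvPowerSeries σ (Grassmann O R) := fun m => δ (coeff m f)

theorem coeff_coeffwise (δ : Grassmann O R → Grassmann O R) (m : σ →₀ ℕ)
    (f : MvPowerSeries σ (Grassmann O R)) : coeff m (coeffwise δ f) = δ (coeff m f) := rfl

theorem isLeftDer_coeffwise {p : ZMod 2} {δ : Grassmann O R → Grassmann O R}
    (add : ∀ f g, δ (f + g) = δ f + δ g) (smul : ∀ (c : ℂ) f, δ (c • f) = c • δ f)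
    (mul : ∀ f g, δ (f * g) = δ f * g + sig p f * δ g)
    (parity : ∀ q f, HasParity q f → HasParity (q + p) (δ f)) :
    IsLeftDer p (coeffwise (σ := σ) δ) := by
  have zero : δ 0 = 0 := by
    have := add 0 0
    rw [add_zero] at this
    exact left_eq_add.1 this
  refine ⟨fun f g => ?_, fun c f => ?_, fun f g => ?_, fun q f hf m => parity q _ (hf m),
    fun d f hf m hm => ?_⟩
  · ext1 m; exact add _ _
  · ext1 m; exact smul c _
  · classical
    ext1 m
    rw [coeff_coeffwise, coeff_add, coeff_mul, coeff_mul, coeff_mul,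
      ← Finset.sum_add_distrib]
    rw [show δ (∑ a ∈ Finset.HasAntidiagonal.antidiagonal m, coeff a.1 f * coeff a.2 g) =
      ∑ a ∈ Finset.HasAntidiagonal.antidiagonal m, δ (coeff a.1 f * coeff a.2 g) from
      map_sum (⟨⟨δ, zero⟩, add⟩ : Grassmann O R →+ Grassmann O R) _ _]
    refine Finset.sum_congr rfl fun a _ => ?_
    rw [mul, coeff_coeffwise, coeff_coeffwise, sigS, coeff_map]
  · rw [coeff_coeffwise, hf m (hm.trans (Nat.le_succ d)), zero]

/-- The derivative of a power series with respect to one of the variables. -/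
def evenD (α : σ) (f : MvPowerSeries σ (Grassmann O R)) : MvPowerSeries σ (Grassmann O R) :=
  fun m => (m α + 1) • coeff (m + Finsupp.single α 1) f

theorem coeff_evenD (α : σ) (f : MvPowerSeries σ (Grassmann O R)) (m : σ →₀ ℕ) :
    coeff m (evenD α f) = (m α + 1) • coeff (m + Finsupp.single α 1) f := rfl

/-- The terms with exponent zero at `α` carry the factor zero, and the others are reindexed by
removing one power of the variable. This is one half of the Leibniz rule for `evenD`, and the other
half follows by exchanging the factors. -/
theorem sum_antidiagonal_single [DecidableEq σ] {M : Type*} [AddCommMonoid M] (α : σ) (m : σ →₀ ℕ)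
    (u : (σ →₀ ℕ) → (σ →₀ ℕ) → M) :
    ∑ a ∈ Finset.HasAntidiagonal.antidiagonal (m + Finsupp.single α 1),
        (a.1 : σ →₀ ℕ) α • u a.1 a.2 =
      ∑ a ∈ Finset.HasAntidiagonal.antidiagonal m, ((a.1 : σ →₀ ℕ) α + 1) • u (a.1 + Finsupp.single α 1) a.2 := by
  rw [← Finset.sum_filter_of_ne (s := Finset.HasAntidiagonal.antidiagonal (m + Finsupp.single α 1))
    (p := fun a : (σ →₀ ℕ) × (σ →₀ ℕ) => a.1 α ≠ 0) (fun a _ h h' => h (by rw [h', zero_smul]))]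
  have hs : ∀ x : σ →₀ ℕ, x α ≠ 0 → x - Finsupp.single α 1 + Finsupp.single α 1 = x := fun x hx =>
    tsub_add_cancel_of_le (Finsupp.single_le_iff.2 (Nat.one_le_iff_ne_zero.2 hx))
  refine Finset.sum_nbij' (fun a => (a.1 - Finsupp.single α 1, a.2))
    (fun a => (a.1 + Finsupp.single α 1, a.2)) ?_ ?_ ?_ ?_ ?_
  · intro a ha
    rw [Finset.mem_filter, Finset.HasAntidiagonal.mem_antidiagonal] at ha
    rw [Finset.HasAntidiagonal.mem_antidiagonal]
    refine add_right_cancel (b := Finsupp.single α 1) ?_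
    rw [add_right_comm, hs _ ha.2, ha.1]
  · intro a ha
    rw [Finset.HasAntidiagonal.mem_antidiagonal] at ha
    rw [Finset.mem_filter, Finset.HasAntidiagonal.mem_antidiagonal, add_right_comm, ha]
    simp
  · intro a ha
    rw [Finset.mem_filter] at ha
    simp only [hs _ ha.2]
  · intro a _
    simp
  · intro a ha
    rw [Finset.mem_filter] at ha
    simp only [hs _ ha.2]
    congr 1
    have := DFunLike.congr_fun (hs _ ha.2) α
    simpa using this.symm

theorem isLeftDer_evenD (α : σ) :
    IsLeftDer 0 (evenD (O := O) (R := R) α) := by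
  refine ⟨fun f g => ?_, fun c f => ?_, fun f g => ?_, fun q f hf m => ?_, fun d f hf m hm => ?_⟩
  · ext1 m; rw [coeff_add]; simp only [coeff_evenD, coeff_add, smul_add]
  · ext1 m; rw [coeff_smul']; simp only [coeff_evenD, coeff_smul']; rw [smul_comm]
  · classical
    have h0 : sigS 0 f = f := by ext1 m; rw [sigS, coeff_map]; rfl
    rw [h0]
    ext1 m
    rw [coeff_evenD, coeff_add, coeff_mul, coeff_mul, coeff_mul]
    have h1 : ∀ a ∈ Finset.HasAntidiagonal.antidiagonal (m + Finsupp.single α 1),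
        (m α + 1) • (coeff a.1 f * coeff a.2 g) =
          a.1 α • (coeff a.1 f * coeff a.2 g) + a.2 α • (coeff a.1 f * coeff a.2 g) := by
      intro a ha
      rw [Finset.HasAntidiagonal.mem_antidiagonal] at ha
      rw [← add_smul]
      have := DFunLike.congr_fun ha α
      simp only [Finsupp.add_apply, Finsupp.single_eq_same] at this
      rw [this]
    have h2 : ∑ a ∈ Finset.HasAntidiagonal.antidiagonal (m + Finsupp.single α 1),
        (a.2 : σ →₀ ℕ) α • (coeff a.1 f * coeff a.2 g) = ∑ a ∈ Finset.HasAntidiagonal.antidiagonal m,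
          (a.2 α + 1) • (coeff a.1 f * coeff (a.2 + Finsupp.single α 1) g) := by
      have := sum_antidiagonal_single α m (fun x y => coeff y f * coeff x g)
      have hsw : ∀ m : σ →₀ ℕ, Finset.HasAntidiagonal.antidiagonal m =
          (Finset.HasAntidiagonal.antidiagonal m).map ⟨Prod.swap, Prod.swap_injective⟩ := fun m =>
        Finset.HasAntidiagonal.map_swap_antidiagonal.symm
      conv_lhs => rw [hsw, Finset.sum_map]
      conv_rhs => rw [hsw, Finset.sum_map]
      exact this
    rw [Finset.smul_sum, Finset.sum_congr rfl h1, Finset.sum_add_distrib, h2,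
      sum_antidiagonal_single α m (fun x y => coeff x f * coeff y g)]
    congr 1
    · exact Finset.sum_congr rfl fun a _ => (smul_mul_assoc _ _ _).symm
    · exact Finset.sum_congr rfl fun a _ => (mul_smul_comm _ _ _).symm
  · rw [coeff_evenD, add_zero, ← Nat.cast_smul_eq_nsmul ℂ]
    exact (hf _).smul _
  · rw [coeff_evenD, hf, smul_zero]
    rw [map_add, Finsupp.degree_single]
    omega

theorem evenD_coeffwise {δ : Grassmann O R → Grassmann O R} (smul : ∀ (c : ℂ) f, δ (c • f) = c • δ f)
    (α : σ) (f : MvPowerSeries σ (Grassmann O R)) :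
    evenD α (coeffwise δ f) = coeffwise δ (evenD α f) := by
  ext1 m
  rw [coeff_evenD, coeff_coeffwise, coeff_coeffwise, coeff_evenD, ← Nat.cast_smul_eq_nsmul ℂ,
    ← Nat.cast_smul_eq_nsmul ℂ, smul]

theorem evenD_C (α : σ) (x : Grassmann O R) : evenD α (C x) = 0 := by
  ext1 m
  rw [coeff_evenD, coeff_C_of_ne_zero, smul_zero]
  · rfl
  · intro h
    have := DFunLike.congr_fun h α
    simp at this

theorem evenD_X [DecidableEq σ] (α β : σ) :
    evenD (O := O) (R := R) α (X β) = if α = β then 1 else 0 := by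
  ext1 m
  rw [coeff_evenD, coeff_X]
  by_cases h : α = β
  · subst h
    rw [if_pos rfl, coeff_one]
    by_cases hm : m = 0
    · simp [hm]
    · simp [hm]
  · rw [if_neg h, if_neg, smul_zero, map_zero]
    intro h'
    have := DFunLike.congr_fun h' α
    simp [Ne.symm h] at this

theorem coeffwise_C {δ : Grassmann O R → Grassmann O R} (h0 : δ 0 = 0) (x : Grassmann O R) :
    coeffwise δ (C (σ := σ) x) = C (σ := σ) (δ x) := by
  classical
  ext1 m
  rw [coeff_coeffwise, coeff_C, coeff_C, apply_ite δ, h0]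

theorem coeffwise_X {δ : Grassmann O R → Grassmann O R} (h0 : δ 0 = 0) (h1 : δ 1 = 0) (β : σ) :
    coeffwise δ (X β) = 0 := by
  classical
  ext1 m
  rw [coeff_coeffwise, coeff_X, apply_ite δ, h0, h1, ite_self, map_zero]

end Concrete

/-! ### The odd Laplacian on power series -/

section Laplacian

variable {σ O R O' R' ι : Type*} [LinearOrder O] [CommRing R] [Algebra ℂ R] [LinearOrder O']
  [CommRing R'] [Algebra ℂ R'] [Fintype ι] {π : ι → ZMod 2}
  {emb : Grassmann O' R' → MvPowerSeries σ (Grassmann O R)}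
  {d₁ : ι → MvPowerSeries σ (Grassmann O R) → MvPowerSeries σ (Grassmann O R)}
  {E : Matrix ι ι (Grassmann O' R')} {ρ : Grassmann O' R'}

/-- The odd Laplacian acting on power series. -/
def lapS (π : ι → ZMod 2) (emb : Grassmann O' R' → MvPowerSeries σ (Grassmann O R))
    (d₁ : ι → MvPowerSeries σ (Grassmann O R) → MvPowerSeries σ (Grassmann O R))
    (E : Matrix ι ι (Grassmann O' R')) (ρ : Grassmann O' R') (f : MvPowerSeries σ (Grassmann O R)) :
    MvPowerSeries σ (Grassmann O R) :=
  (2⁻¹ : ℂ) • ∑ A, ∑ B, sg (π A) • (emb (Ring.inverse ρ) * d₁ A (emb (ρ * E A B) * d₁ B f))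

theorem map_lapS {d : ι → Grassmann O' R' → Grassmann O' R'}
    {ev : MvPowerSeries σ (Grassmann O R) →+* Grassmann O' R'}
    (ev_smul : ∀ (c : ℂ) f, ev (c • f) = c • ev f) (ev_emb : ∀ x, ev (emb x) = x)
    (ev_d : ∀ A f, ev (d₁ A f) = d A (ev f)) (f : MvPowerSeries σ (Grassmann O R)) :
    ev (lapS π emb d₁ E ρ f) = laplacian π d E ρ (ev f) := by
  simp only [lapS, laplacian, ev_smul, map_sum, map_zsmul, map_mul, ev_emb, ev_d]

/-- A derivation that annihilates the coefficient functions and graded commutes with the coordinate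
derivatives passes through every factor of the Laplacian. The signs add up to that of moving it past
one odd operator. -/
theorem IsLeftDer.map_lapS {p : ZMod 2}
    {D : MvPowerSeries σ (Grassmann O R) → MvPowerSeries σ (Grassmann O R)} (h : IsLeftDer p D)
    (hd : ∀ A, IsLeftDer (π A) (d₁ A))
    (hc : ∀ A f, D (d₁ A f) = sg (p * π A) • d₁ A (D f)) (hD : ∀ x, D (emb x) = 0)
    (hemb : ∀ q x, HasParity q x → HasParityS q (emb x))
    (hE : ∀ A B, HasParity (π A + π B + 1) (E A B)) (hρ : HasParity 0 ρ)
    (hr : HasParity 0 (Ring.inverse ρ)) (f : MvPowerSeries σ (Grassmann O R)) :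
    D (lapS π emb d₁ E ρ f) = sg p • lapS π emb d₁ E ρ (D f) := by
  have h1 : ∀ A B, D (emb (Ring.inverse ρ) * d₁ A (emb (ρ * E A B) * d₁ B f)) =
      sg p • (emb (Ring.inverse ρ) * d₁ A (emb (ρ * E A B) * d₁ B (D f))) := by
    intro A B
    rw [h.mul_even (hemb 0 _ hr), hD, zero_mul, zero_add, hc, h.mul_parity (hemb _ _ (hρ.mul (hE A B))),
      hD, zero_mul, zero_add, hc, mul_zsmul', mul_zsmul', smul_smul, (hd A).zsmul, mul_zsmul', smul_smul,
      ← sg_add, ← sg_add]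
    congr 2
    generalize π A = a
    generalize π B = b
    clear hc h
    revert a b p
    decide
  rw [lapS, lapS, h.smul, smul_comm (sg p), h.sum]
  refine congrArg _ ?_
  rw [Finset.smul_sum]
  refine Finset.sum_congr rfl fun A _ => ?_
  rw [h.sum, Finset.smul_sum]
  refine Finset.sum_congr rfl fun B _ => ?_
  rw [h.zsmul, h1, smul_comm]

end Laplacian

end Series
end
end SuperBV

set_option linter.unusedSectionVars false
namespace SuperBV
noncomputable section
open SuperBV.Grassmann hiding coeff

namespace Series

open MvPowerSeries

/-! ### Differentiating the master equation -/

section Master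

variable {σ O R O' R' ι κ : Type*} [LinearOrder O] [CommRing R] [Algebra ℂ R] [LinearOrder O']
  [CommRing R'] [Algebra ℂ R'] [Fintype ι] [DecidableEq ι] [Fintype κ]
  {π : ι → ZMod 2} {ε : κ → ZMod 2}
  {d : ι → Grassmann O' R' → Grassmann O' R'} {E : Matrix ι ι (Grassmann O' R')}
  {ρ h : Grassmann O' R'}
  {D Ds : κ → MvPowerSeries σ (Grassmann O R) → MvPowerSeries σ (Grassmann O R)}
  {L : MvPowerSeries σ (Grassmann O R) → MvPowerSeries σ (Grassmann O R)}
  {ev : MvPowerSeries σ (Grassmann O R) →+* Grassmann O' R'}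
  {e f : MvPowerSeries σ (Grassmann O R)}

/-- The lowest order consequences of the master equation `Δ_[1] e = 0` for an exponential `e` of
an even series `f`. -/
theorem master_equation (hD : ∀ α, IsLeftDer (ε α) (D α)) (hDs : ∀ α, IsLeftDer (ε α + 1) (Ds α))
    (hf : HasParityS 0 f) (De : ∀ α, D α e = D α f * e) (Dse : ∀ α, Ds α e = Ds α f * e)
    (hL : ∀ β x, D β (L x) = sg (ε β) • L (D β x))
    (evL : ∀ x, ev (L x) = laplacian π d E ρ (ev x))
    (evp : ∀ p x, HasParityS p x → HasParity p (ev x))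
    (qme : L e + ∑ α, sg (ε α) • D α (Ds α e) = 0)
    (v2 : ∀ β γ, ev (D γ (D β f)) = 0) (v3 : ∀ α β γ, ev (D γ (D β (D α f))) = 0)
    (v4 : ∀ α β γ, ev (D γ (D β (D α (Ds α f)))) = 0)
    (Dat : IsExpData π d E ρ h (ev e)) (hsmul : ∀ A (c : ℂ) x, d A (c • x) = c • d A x)
    {G : κ → Grassmann O' R'} (hG : ∀ β, HasParity (ε β) (G β))
    (hfG : ∀ β, ev (D β f) = (Complex.I * (sg (ε β) : ℂ)) • G β)
    {V : κ → κ → Grassmann O' R'} (hV : ∀ α β, ev (D β (Ds α f)) = -sig (ε β) (V α β))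
    {Y : κ → κ → κ → Grassmann O' R'}
    (hY : ∀ γ α β, Y γ α β = (Complex.I * (sg (ε α + ε α * ε β + ε γ * (ε α + ε β)) : ℂ)) •
      ev (D β (D α (Ds γ f)))) :
    ((∀ α β, bracket π d E (G α) (G β) = ∑ γ, G γ * Y γ α β) ∧
    (∀ β, laplacian π d E ρ (G β) - bracket π d E h (G β) - ∑ α, sg (ε α) • Y α α β =
      ∑ α, G α * V α β) ∧
    ∀ α β, HasParity (ε α + 1 + ε β) (V α β)) ∧
    ∀ γ α β, HasParity (ε γ + ε α + ε β + 1) (Y γ α β) := by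
  set T := ∑ α, sg (ε α) • (D α (Ds α f) + Ds α f * D α f) with hTdef
  have hDf : ∀ α, HasParityS (ε α) (D α f) := fun α => by
    have := (hD α).parity 0 f hf
    rwa [zero_add] at this
  have hDsf : ∀ α, HasParityS (ε α + 1) (Ds α f) := fun α => by
    have := (hDs α).parity 0 f hf
    rwa [zero_add] at this
  have hTp : HasParityS 1 T := HasParityS.sum fun α _ => HasParityS.zsmul (HasParityS.add
    (by
      have := (hD α).parity _ _ (hDsf α)
      have k : ∀ a : ZMod 2, a + 1 + a = 1 := by decide
      rwa [k] at this)
    (by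
      have := (hDsf α).mul (hDf α)
      have k : ∀ a : ZMod 2, a + 1 + a = 1 := by decide
      rwa [k] at this)) _
  -- On an exponential the `λ, λ*` part of the Laplacian acts as multiplication by `T`. No sign
  -- survives, since the product of the parities `ε α` and `ε α + 1` is zero.
  have hSe : ∑ α, sg (ε α) • D α (Ds α e) = T * e := by
    rw [hTdef, Finset.sum_mul]
    refine Finset.sum_congr rfl fun α _ => ?_
    rw [zsmul_mul', Dse, (hD α).mul_parity (hDsf α), De]
    have k : ∀ a : ZMod 2, a * (a + 1) = 0 := by decide
    rw [k, sg_zero, one_smul, add_mul, mul_assoc]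
  rw [hSe] at qme
  -- The equation is differentiated as an identity of power series, once here and a second time in
  -- `q2`. It is evaluated at the origin only afterwards, as the value at the origin no longer knows
  -- the `λ` derivatives.
  have q1 : ∀ β, sg (ε β) • L (D β f * e) + (D β T * e + sg (ε β) • (T * (D β f * e))) = 0 := by
    intro β
    have := congrArg (D β) qme
    rwa [(hD β).add, (hD β).zero, hL, De, (hD β).mul_parity hTp, De, mul_one] at this
  have hDTp : ∀ β, HasParityS (ε β + 1) (D β T) := fun β => by
    rw [add_comm]; exact (hD β).parity _ _ hTp
  have q2 : ∀ β γ, sg (ε β) • (sg (ε γ) • L (D γ (D β f) * e +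
        sg (ε γ * ε β) • (D β f * (D γ f * e)))) +
      (D γ (D β T) * e + sg (ε γ * (ε β + 1)) • (D β T * (D γ f * e)) +
      sg (ε β) • (D γ T * (D β f * e) + sg (ε γ) • (T * (D γ (D β f) * e +
        sg (ε γ * ε β) • (D β f * (D γ f * e)))))) = 0 := by
    intro β γ
    have := congrArg (D γ) (q1 β)
    have k : D γ (D β f * e) = D γ (D β f) * e + sg (ε γ * ε β) • (D β f * (D γ f * e)) := by
      rw [(hD γ).mul_parity (hDf β), De]
    rwa [(hD γ).add, (hD γ).zero, (hD γ).zsmul, hL, (hD γ).add, (hD γ).zsmul,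
      (hD γ).mul_parity (hDTp β), De, (hD γ).mul_parity hTp, k, mul_one] at this
  have hev : ∀ (n : ℤ) x, ev (n • x) = n • ev x := fun n x => map_zsmul ev n x
  have hB : ∀ α β γ, HasParity (ε α + ε β + ε γ + 1) (ev (D β (D γ (Ds α f)))) := fun α β γ => by
    have := evp _ _ ((hD β).parity _ _ ((hD γ).parity _ _ (hDsf α)))
    have k : ∀ a b c : ZMod 2, a + 1 + c + b = a + b + c + 1 := by decide
    rwa [k] at this
  refine ⟨Dat.involution (f := fun β => ev (D β f)) (T := fun β => ev (D β T)) (T₀ := ev T)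
    (T₂ := fun γ β => ev (D γ (D β T))) (B := fun α γ β => ev (D γ (D β (Ds α f))))
    (C := fun α β => ev (D β (Ds α f))) (ε := ε) hsmul hG hfG (evp _ _ hTp) hB
    (fun α β => evp _ _ ((hD β).parity _ _ (hDsf α))) hV ?_ ?_ ?_ ?_ ?_ hY, fun γ α β => ?_⟩
  · have := congrArg ev qme
    rwa [map_add, map_zero, map_mul, evL] at this
  · intro β
    rw [hTdef, (hD β).sum, map_sum]
    refine Finset.sum_congr rfl fun α _ => ?_
    rw [(hD β).zsmul, hev, (hD β).add, (hD β).mul_parity (hDsf α), map_add, map_add, map_mul, hev,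
      map_mul, v2, mul_zero, smul_zero, add_zero]
  · intro γ β
    rw [hTdef, (hD β).sum, (hD γ).sum, map_sum]
    refine Finset.sum_congr rfl fun α _ => ?_
    rw [(hD β).zsmul, (hD γ).zsmul, hev, (hD β).add, (hD γ).add, (hD β).mul_parity (hDsf α),
      (hD γ).add, (hD γ).mul_parity ((hD β).parity _ _ (hDsf α)), (hD γ).zsmul,
      (hD γ).mul_parity (hDsf α), map_add, v4, zero_add, map_add, map_add, map_mul, hev, map_mul,
      v2, hev, map_add, map_mul, v2, hev, map_mul, v3]
    simp only [mul_zero, smul_zero, add_zero]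
  · intro β
    have := congrArg ev (q1 β)
    rw [map_add, map_add, hev, hev, evL] at this
    simp only [map_mul, map_zero] at this
    rw [add_mul, smul_mul_assoc, mul_assoc]
    exact this
  · intro β γ
    have := congrArg ev (q2 β γ)
    simp only [map_add, map_mul, map_zero, hev, evL, v2, zero_mul, zero_add] at this
    rw [laplacian_zsmul Dat.der] at this
    simp only [smul_add, smul_smul, mul_smul_comm, ← sg_add, ← mul_assoc] at this
    have k1 : ε β + (ε γ + ε γ * ε β) = ε γ + ε β + ε γ * ε β := by ring
    have k2 : ε γ * (ε β + 1) = (ε β + 1) * ε γ := by ring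
    rw [k1, k2] at this
    rw [← this]
    generalize sg ((ε β + 1) * ε γ) = s₁
    generalize sg (ε γ + ε β + ε γ * ε β) = s₂
    simp only [add_mul, smul_mul_assoc, ← mul_assoc]
    abel
  · rw [hY]
    have := (hB γ β α).smul (Complex.I * (sg (ε α + ε α * ε β + ε γ * (ε α + ε β)) : ℂ))
    rwa [add_right_comm (ε γ)] at this

end Master

end Series
end
end SuperBV

set_option linter.unusedSectionVars false
namespace SuperBV
noncomputable section
open SuperBV.Grassmann hiding coeff

namespace Series

open MvPowerSeries

/-! ### Evaluating the lowest order terms of the action -/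

section Expansion

variable {σ O R O' R' κ : Type*} [LinearOrder O] [CommRing R] [Algebra ℂ R] [LinearOrder O']
  [CommRing R'] [Algebra ℂ R'] [Fintype κ] [DecidableEq κ] {ε : κ → ZMod 2}
  {D Ds : κ → MvPowerSeries σ (Grassmann O R) → MvPowerSeries σ (Grassmann O R)}
  {ev : MvPowerSeries σ (Grassmann O R) →+* Grassmann O' R'}
  {emb : Grassmann O' R' → MvPowerSeries σ (Grassmann O R)}
  {l s : κ → MvPowerSeries σ (Grassmann O R)}

/-- The variables `l = λ`, `s = λ*` with their derivatives, and the evaluation at zero. -/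
structure IsLamData (ε : κ → ZMod 2)
    (D Ds : κ → MvPowerSeries σ (Grassmann O R) → MvPowerSeries σ (Grassmann O R))
    (ev : MvPowerSeries σ (Grassmann O R) →+* Grassmann O' R')
    (emb : Grassmann O' R' → MvPowerSeries σ (Grassmann O R))
    (l s : κ → MvPowerSeries σ (Grassmann O R)) : Prop where
  hD : ∀ α, IsLeftDer (ε α) (D α)
  hDs : ∀ α, IsLeftDer (ε α + 1) (Ds α)
  D_emb : ∀ α x, D α (emb x) = 0
  Ds_emb : ∀ α x, Ds α (emb x) = 0
  sig_emb : ∀ p x, sigS p (emb x) = emb (sig p x)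
  D_l : ∀ α β, D α (l β) = if α = β then 1 else 0
  D_s : ∀ α β, D α (s β) = 0
  Ds_l : ∀ α β, Ds α (l β) = 0
  Ds_s : ∀ α β, Ds α (s β) = if α = β then 1 else 0
  parity_l : ∀ α, HasParityS (ε α) (l α)
  parity_s : ∀ α, HasParityS (ε α + 1) (s α)
  ev_emb : ∀ x, ev (emb x) = x
  ev_l : ∀ α, ev (l α) = 0
  ev_s : ∀ α, ev (s α) = 0
  ev_smul : ∀ (c : ℂ) x, ev (c • x) = c • ev x

/-- Polynomials of degree at most `n` in the variables `λ`. -/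
def DegLe (D : κ → MvPowerSeries σ (Grassmann O R) → MvPowerSeries σ (Grassmann O R)) :
    ℕ → MvPowerSeries σ (Grassmann O R) → Prop
  | 0, x => ∀ α, D α x = 0
  | n + 1, x => ∀ α, DegLe D n (D α x)

/-- The terms of the action linear in the antifields, without the antifield. -/
def starCoeff (ε : κ → ZMod 2) (emb : Grassmann O' R' → MvPowerSeries σ (Grassmann O R))
    (l : κ → MvPowerSeries σ (Grassmann O R)) (u v w : ℂ) (Us : κ → κ → Grassmann O' R')
    (Vs : κ → Grassmann O' R') (Gt : Grassmann O' R') : MvPowerSeries σ (Grassmann O R) :=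
  u • ∑ β, ∑ γ, sg (ε β + 1) • (emb (Us β γ) * l γ * l β) + v • ∑ β, emb (Vs β) * l β + w • emb Gt

namespace IsLamData

variable (h : IsLamData ε D Ds ev emb l s)

include h

theorem degLe_add : ∀ {n : ℕ} {x y : MvPowerSeries σ (Grassmann O R)}, DegLe D n x → DegLe D n y →
    DegLe D n (x + y)
  | 0, x, y, hx, hy => fun α => by rw [(h.hD α).add, hx, hy, add_zero]
  | n + 1, x, y, hx, hy => fun α => by rw [(h.hD α).add]; exact degLe_add (hx α) (hy α)

theorem degLe_zero : ∀ n, DegLe D n 0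
  | 0 => fun α => (h.hD α).zero
  | n + 1 => fun α => by rw [(h.hD α).zero]; exact degLe_zero n

theorem degLe_smul (c : ℂ) : ∀ {n : ℕ} {x : MvPowerSeries σ (Grassmann O R)}, DegLe D n x →
    DegLe D n (c • x)
  | 0, x, hx => fun α => by rw [(h.hD α).smul, hx, smul_zero]
  | n + 1, x, hx => fun α => by rw [(h.hD α).smul]; exact degLe_smul c (hx α)

theorem degLe_zsmul (c : ℤ) {n : ℕ} {x : MvPowerSeries σ (Grassmann O R)} (hx : DegLe D n x) :
    DegLe D n (c • x) := by
  rw [← Int.cast_smul_eq_zsmul ℂ]; exact h.degLe_smul _ hx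

theorem degLe_sum {ι : Type*} {n : ℕ} (t : Finset ι) {x : ι → MvPowerSeries σ (Grassmann O R)}
    (hx : ∀ i, DegLe D n (x i)) : DegLe D n (∑ i ∈ t, x i) := by
  classical
  induction t using Finset.induction_on with
  | empty => rw [Finset.sum_empty]; exact h.degLe_zero n
  | insert a t ha ih => rw [Finset.sum_insert ha]; exact h.degLe_add (hx a) ih

theorem D_emb_mul (α : κ) (x : Grassmann O' R') (y : MvPowerSeries σ (Grassmann O R)) :
    D α (emb x * y) = emb (sig (ε α) x) * D α y := by
  rw [(h.hD α).mul, h.D_emb, zero_mul, zero_add, h.sig_emb]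

theorem degLe_emb_mul : ∀ {n : ℕ} {y : MvPowerSeries σ (Grassmann O R)} (x : Grassmann O' R'),
    DegLe D n y → DegLe D n (emb x * y)
  | 0, y, x, hy => fun α => by rw [h.D_emb_mul, hy, mul_zero]
  | n + 1, y, x, hy => fun α => by rw [h.D_emb_mul]; exact degLe_emb_mul _ (hy α)

theorem degLe_succ : ∀ {n : ℕ} {x : MvPowerSeries σ (Grassmann O R)}, DegLe D n x → DegLe D (n + 1) x
  | 0, x, hx => fun α => by rw [hx α]; exact h.degLe_zero 0
  | n + 1, x, hx => fun α => degLe_succ (hx α)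

theorem degLe_emb (x : Grassmann O' R') : DegLe D 0 (emb x) := fun α => h.D_emb α x

theorem degLe_ite (p : Prop) [Decidable p] : DegLe D 0 (if p then 1 else 0) := fun α => by
  split
  · exact (h.hD α).one
  · exact (h.hD α).zero

theorem degLe_l (β : κ) : DegLe D 1 (l β) := fun α => by rw [h.D_l]; exact h.degLe_ite _

theorem D_l_mul_l (α β γ : κ) : D α (l γ * l β) =
    (if α = γ then 1 else 0) * l β + sg (ε α * ε γ) • (l γ * if α = β then 1 else 0) := by
  rw [(h.hD α).mul_parity (h.parity_l γ), h.D_l, h.D_l]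

theorem degLe_l_mul_l (β γ : κ) : DegLe D 2 (l γ * l β) := fun α => by
  rw [h.D_l_mul_l]
  refine h.degLe_add ?_ (h.degLe_zsmul _ ?_)
  · rw [ite_mul, one_mul, zero_mul]
    split
    · exact h.degLe_l β
    · exact h.degLe_zero 1
  · rw [mul_ite, mul_one, mul_zero]
    split
    · exact h.degLe_l γ
    · exact h.degLe_zero 1

variable (u v w : ℂ) (Us : κ → κ → Grassmann O' R') (Vs : κ → Grassmann O' R') (Gt : Grassmann O' R')

theorem degLe_starCoeff : DegLe D 2 (starCoeff ε emb l u v w Us Vs Gt) := by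
  refine h.degLe_add (h.degLe_add (h.degLe_smul _ (h.degLe_sum _ fun β => h.degLe_sum _ fun γ =>
    h.degLe_zsmul _ ?_)) (h.degLe_smul _ (h.degLe_sum _ fun β => ?_))) (h.degLe_smul _ ?_)
  · rw [mul_assoc]; exact h.degLe_emb_mul _ (h.degLe_l_mul_l β γ)
  · exact h.degLe_succ (h.degLe_emb_mul _ (h.degLe_l β))
  · exact h.degLe_succ (h.degLe_succ (h.degLe_emb Gt))

theorem degLe_starCoeff_of_eq_zero (hU : ∀ β γ, emb (Us β γ) = 0) :
    DegLe D 1 (starCoeff ε emb l u v w Us Vs Gt) := by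
  refine h.degLe_add (h.degLe_add (h.degLe_smul _ (h.degLe_sum _ fun β => h.degLe_sum _ fun γ =>
    h.degLe_zsmul _ ?_)) (h.degLe_smul _ (h.degLe_sum _ fun β => ?_))) (h.degLe_smul _ ?_)
  · rw [hU, zero_mul, zero_mul]; exact h.degLe_zero 1
  · exact h.degLe_emb_mul _ (h.degLe_l β)
  · exact h.degLe_succ (h.degLe_emb Gt)

theorem ev_D_starCoeff (β : κ) :
    ev (D β (starCoeff ε emb l u v w Us Vs Gt)) = v • sig (ε β) (Vs β) := by
  have h1 : ∀ β' γ, ev (D β (emb (Us β' γ) * l γ * l β')) = 0 := fun β' γ => by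
    rw [mul_assoc, h.D_emb_mul, map_mul, h.D_l_mul_l, map_add, map_mul, map_zsmul, map_mul,
      h.ev_l, h.ev_l, mul_zero, zero_mul, smul_zero, add_zero, mul_zero]
  have h2 : ∀ β', ev (D β (emb (Vs β') * l β')) = if β = β' then sig (ε β) (Vs β') else 0 :=
    fun β' => by
    rw [h.D_emb_mul, map_mul, h.ev_emb, h.D_l, apply_ite ev, map_one, map_zero, mul_ite, mul_one,
      mul_zero]
  rw [starCoeff, (h.hD β).add, (h.hD β).add, (h.hD β).smul, (h.hD β).smul, (h.hD β).smul, h.D_emb,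
    (h.hD β).sum, (h.hD β).sum, smul_zero, add_zero, map_add, h.ev_smul, h.ev_smul, map_sum,
    map_sum]
  simp only [(h.hD β).sum, (h.hD β).zsmul, map_sum, map_zsmul, h1, h2, smul_zero,
    Finset.sum_const_zero, zero_add, Finset.sum_ite_eq, Finset.mem_univ, if_true]

theorem Ds_starCoeff (α : κ) : Ds α (starCoeff ε emb l u v w Us Vs Gt) = 0 := by
  have h0 : ∀ x y, Ds α y = 0 → Ds α (emb x * y) = 0 := fun x y hy => by
    rw [(h.hDs α).mul, h.Ds_emb, hy, zero_mul, mul_zero, add_zero]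
  have h1 : ∀ β γ, Ds α (emb (Us β γ) * l γ * l β) = 0 := fun β γ => by
    rw [mul_assoc, h0]
    rw [(h.hDs α).mul, h.Ds_l, h.Ds_l, zero_mul, mul_zero, add_zero]
  rw [starCoeff, (h.hDs α).add, (h.hDs α).add, (h.hDs α).smul, (h.hDs α).smul, (h.hDs α).smul,
    h.Ds_emb, (h.hDs α).sum, (h.hDs α).sum]
  simp only [(h.hDs α).sum, (h.hDs α).zsmul, h1, h0 _ _ (h.Ds_l α _), smul_zero,
    Finset.sum_const_zero, add_zero]

variable {Q : κ → MvPowerSeries σ (Grassmann O R)} (G : κ → Grassmann O' R') (y : Grassmann O' R')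

theorem Ds_expansion (hQ : ∀ α β, Ds α (Q β) = 0) (α : κ) (c : ℂ) :
    Ds α (∑ β, emb (G β) * l β + c • emb y + ∑ β, s β * Q β) = Q α := by
  have h1 : ∀ β, Ds α (emb (G β) * l β) = 0 := fun β => by
    rw [(h.hDs α).mul, h.Ds_emb, h.Ds_l, zero_mul, mul_zero, add_zero]
  have h2 : ∀ β, Ds α (s β * Q β) = if α = β then Q β else 0 := fun β => by
    rw [(h.hDs α).mul, hQ, h.Ds_s, mul_zero, add_zero, ite_mul, one_mul, zero_mul]
  rw [(h.hDs α).add, (h.hDs α).add, (h.hDs α).smul, h.Ds_emb, (h.hDs α).sum, (h.hDs α).sum]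
  simp only [h1, h2, smul_zero, Finset.sum_const_zero, zero_add, Finset.sum_ite_eq,
    Finset.mem_univ, if_true]

theorem D_s_mul (α β : κ) (x : MvPowerSeries σ (Grassmann O R)) :
    D α (s β * x) = s β * (sg (ε α * (ε β + 1)) • D α x) := by
  rw [(h.hD α).mul_parity (h.parity_s β), h.D_s, zero_mul, zero_add, mul_zsmul']

theorem D_expansion (α : κ) (c : ℂ) :
    D α (∑ β, emb (G β) * l β + c • emb y + ∑ β, s β * Q β) =
      emb (sig (ε α) (G α)) + ∑ β, s β * (sg (ε α * (ε β + 1)) • D α (Q β)) := by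
  rw [(h.hD α).add, (h.hD α).add, (h.hD α).smul, h.D_emb, (h.hD α).sum, (h.hD α).sum]
  simp only [h.D_s_mul, h.D_emb_mul, h.D_l, smul_zero, add_zero, mul_ite, mul_one, mul_zero,
    Finset.sum_ite_eq, Finset.mem_univ, if_true]

/-- The factor `λ*` survives differentiation in `λ`. However many such derivatives are taken, sums
of this shape vanish on evaluation at the origin. -/
theorem D_sum_s_mul (α : κ) (x : κ → MvPowerSeries σ (Grassmann O R)) :
    D α (∑ β, s β * x β) = ∑ β, s β * (sg (ε α * (ε β + 1)) • D α (x β)) := by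
  rw [(h.hD α).sum]
  simp only [h.D_s_mul]

theorem ev_sum_s_mul (x : κ → MvPowerSeries σ (Grassmann O R)) : ev (∑ β, s β * x β) = 0 := by
  rw [map_sum]
  refine Finset.sum_eq_zero fun β _ => ?_
  rw [map_mul, h.ev_s, zero_mul]

theorem ev_expansion (c : ℂ) :
    ev (∑ β, emb (G β) * l β + c • emb y + ∑ β, s β * Q β) = c • y := by
  rw [map_add, map_add, h.ev_sum_s_mul, h.ev_smul, h.ev_emb, map_sum, add_zero]
  simp only [map_mul, h.ev_l, mul_zero, Finset.sum_const_zero, zero_add]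

end IsLamData

end Expansion

end Series
end
end SuperBV

set_option linter.unusedSectionVars false
namespace SuperBV
noncomputable section
open Grassmann

/-! ### The superdomain as an instance of the general framework -/

section Specialise

variable {N : ℕ} {U : TopologicalSpace.Opens (Fin N → ℝ)}

theorem isSuperDer_dl : IsSuperDer par (dl (U := U)) where
  add := dl_add
  mul := dl_mul
  parity A _ _ hf := hf.dl A
  comm := dl_comm
  map_sig := dl_sig

theorem rd_dl (A : Idx N) (f : SuperFun U) : rd par dl A f = dr A f := (dr_eq A f).symm

theorem bracket_dl (E : Matrix (Idx N) (Idx N) (SuperFun U)) (f g : SuperFun U) :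
    bracket par dl E f g = antibracket E f g := by
  simp only [bracket, antibracket, rd_dl]

theorem jacobian_dl (Γ' : Idx N → SuperFun U) : jacobian par dl Γ' = jacobianMatrix Γ' := by
  ext1 A B
  exact rd_dl B (Γ' A)

theorem laplacian_dl (E : Matrix (Idx N) (Idx N) (SuperFun U)) (ρ f : SuperFun U) :
    laplacian par dl E ρ f = oddLaplacian id dl E ρ f := rfl

end Specialise

/-! ### Setting some odd variables to zero -/

namespace Grassmann

section Projection

variable {O₀ O₁ R : Type*} [LinearOrder O₀] [LinearOrder O₁] [CommRing R]

theorem inlₗ_injective : Function.Injective (Sum.inlₗ : O₀ → O₀ ⊕ₗ O₁) :=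
  toLex.injective.comp Sum.inl_injective

theorem inv_image_inlₗ (S T : Finset O₀) :
    inv (S.image (Sum.inlₗ : O₀ → O₀ ⊕ₗ O₁)) (T.image Sum.inlₗ) = inv S T := by
  unfold inv
  rw [← Finset.card_image_of_injective (f := Prod.map (Sum.inlₗ : O₀ → O₀ ⊕ₗ O₁) Sum.inlₗ)
    ((S ×ˢ T).filter fun p => p.2 < p.1) 
    ((inlₗ_injective (O₁ := O₁)).prodMap (inlₗ_injective (O₁ := O₁)))]
  congr 1
  ext ⟨a, b⟩
  simp only [Finset.mem_filter, Finset.mem_product, Finset.mem_image, Prod.exists, Prod.map_apply,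
    Prod.mk.injEq]
  constructor
  · rintro ⟨⟨⟨a, ha, rfl⟩, ⟨b, hb, rfl⟩⟩, h⟩
    exact ⟨a, b, ⟨⟨ha, hb⟩, Sum.Lex.inl_lt_inl_iff.1 h⟩, rfl, rfl⟩
  · rintro ⟨a, b, ⟨⟨ha, hb⟩, h⟩, rfl, rfl⟩
    exact ⟨⟨⟨a, ha, rfl⟩, ⟨b, hb, rfl⟩⟩, Sum.Lex.inl_lt_inl_iff.2 h⟩

/-- The homomorphism that sets the generators in the second summand to zero. -/
def projHom (O₀ O₁ R : Type*) [LinearOrder O₀] [LinearOrder O₁] [CommRing R] :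
    Grassmann (O₀ ⊕ₗ O₁) R →+* Grassmann O₀ R where
  toFun f := ⟨fun S => f.coeff (S.image Sum.inlₗ)⟩
  map_one' := by ext S; simp [one_coeff, Finset.image_eq_empty]
  map_zero' := rfl
  map_add' _ _ := rfl
  map_mul' f g := by
    ext S
    simp only [mul_coeff]
    rw [Finset.powerset_image, Finset.sum_image
      (fun A _ B _ h => Finset.image_injective (inlₗ_injective (O₁ := O₁)) h)]
    refine Finset.sum_congr rfl fun T _ => ?_
    unfold sgn
    rw [← inv_image_inlₗ (O₁ := O₁) T (S \ T),
      Finset.image_sdiff S T (inlₗ_injective : Function.Injective (Sum.inlₗ : O₀ → O₀ ⊕ₗ O₁))]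
    congr!

theorem projHom_coeff (f : Grassmann (O₀ ⊕ₗ O₁) R) (S : Finset O₀) :
    (projHom O₀ O₁ R f).coeff S = f.coeff (S.image Sum.inlₗ) := rfl

theorem HasParity.projHom {p : ZMod 2} {f : Grassmann (O₀ ⊕ₗ O₁) R} (hf : HasParity p f) :
    HasParity p (projHom O₀ O₁ R f) := fun S hS => by
  rw [projHom_coeff, hf]
  rwa [Finset.card_image_of_injective _ inlₗ_injective]

theorem projHom_leftD (i : O₀) (f : Grassmann (O₀ ⊕ₗ O₁) R) :
    projHom O₀ O₁ R (leftD (Sum.inlₗ i) f) = leftD i (projHom O₀ O₁ R f) := by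
  ext S
  rw [projHom_coeff]
  simp only [leftD, projHom_coeff, Finset.image_insert]
  have h1 : Sum.inlₗ i ∈ S.image (Sum.inlₗ : O₀ → O₀ ⊕ₗ O₁) ↔ i ∈ S := by
    simp
  have h2 : ((S.image (Sum.inlₗ : O₀ → O₀ ⊕ₗ O₁)).filter (· < Sum.inlₗ i)).card =
      (S.filter (· < i)).card := by
    rw [← Finset.card_image_of_injective (S.filter (· < i))
      (inlₗ_injective : Function.Injective (Sum.inlₗ : O₀ → O₀ ⊕ₗ O₁))]
    congr 1
    ext a
    simp only [Finset.mem_filter, Finset.mem_image]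
    constructor
    · rintro ⟨⟨a, ha, rfl⟩, h⟩
      exact ⟨a, ⟨ha, Sum.Lex.inl_lt_inl_iff.1 h⟩, rfl⟩
    · rintro ⟨a, ⟨ha, h⟩, rfl⟩
      exact ⟨⟨a, ha, rfl⟩, Sum.Lex.inl_lt_inl_iff.2 h⟩
  simp only [h1, h2]
  congr!

theorem projHom_gen_inrₗ (j : O₁) : projHom O₀ O₁ R (gen (Sum.inrₗ j)) = 0 := by
  ext S
  rw [projHom_coeff, zero_coeff]
  refine if_neg fun h => ?_
  have : Sum.inrₗ j ∈ S.image (Sum.inlₗ : O₀ → O₀ ⊕ₗ O₁) := by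
    rw [h]; exact Finset.mem_singleton_self _
  obtain ⟨a, _, ha⟩ := Finset.mem_image.1 this
  exact absurd (toLex.injective ha) Sum.inl_ne_inr

variable [Fintype O₀]

/-- The inclusion of the Grassmann algebra on fewer generators. -/
def inc (f : Grassmann O₀ R) : Grassmann (O₀ ⊕ₗ O₁) R :=
  ⟨fun T => ∑ S : Finset O₀, if T = S.image Sum.inlₗ then f.coeff S else 0⟩

theorem inc_coeff_image (f : Grassmann O₀ R) (S : Finset O₀) :
    (inc f : Grassmann (O₀ ⊕ₗ O₁) R).coeff (S.image Sum.inlₗ) = f.coeff S := by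
  rw [inc]
  simp only [(Finset.image_injective (inlₗ_injective (O₁ := O₁))).eq_iff]
  simp

theorem inc_coeff_eq_zero (f : Grassmann O₀ R) {T : Finset (O₀ ⊕ₗ O₁)} {j : O₁}
    (hj : Sum.inrₗ j ∈ T) : (inc f : Grassmann (O₀ ⊕ₗ O₁) R).coeff T = 0 := by
  refine Finset.sum_eq_zero fun S _ => if_neg ?_
  rintro rfl
  obtain ⟨a, _, ha⟩ := Finset.mem_image.1 hj
  exact absurd (toLex.injective ha) Sum.inl_ne_inr

theorem projHom_inc (f : Grassmann O₀ R) : projHom O₀ O₁ R (inc f) = f := by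
  ext S
  rw [projHom_coeff, inc_coeff_image]

theorem leftD_inc (j : O₁) (f : Grassmann O₀ R) :
    leftD (Sum.inrₗ j) (inc f : Grassmann (O₀ ⊕ₗ O₁) R) = 0 := by
  ext T
  simp only [leftD]
  split
  · rfl
  · refine (congrArg _ (inc_coeff_eq_zero f (j := j) ?_)).trans (mul_zero _)
    exact @Finset.mem_insert_self _ _ _ _

theorem tau_inc (f : Grassmann O₀ R) :
    tau (inc f : Grassmann (O₀ ⊕ₗ O₁) R) = inc (tau f) := by
  ext T
  rw [tau_coeff, inc, inc]
  simp only [Finset.mul_sum]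
  refine Finset.sum_congr rfl fun S _ => ?_
  split
  · next h => rw [h, Finset.card_image_of_injective _ inlₗ_injective, tau_coeff]
  · rw [mul_zero]

theorem sig_inc (p : ZMod 2) (f : Grassmann O₀ R) :
    sig p (inc f : Grassmann (O₀ ⊕ₗ O₁) R) = inc (sig p f) := by
  rcases zmod_two_cases p with rfl | rfl
  · rfl
  · exact tau_inc f

theorem inc_zero : (inc (0 : Grassmann O₀ R) : Grassmann (O₀ ⊕ₗ O₁) R) = 0 := by
  ext T
  refine Finset.sum_eq_zero fun S _ => ?_
  rw [zero_coeff, ite_self]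

theorem HasParity.inc {p : ZMod 2} {f : Grassmann O₀ R} (hf : HasParity p f) :
    HasParity p (Grassmann.inc f : Grassmann (O₀ ⊕ₗ O₁) R) := fun T hT => by
  refine Finset.sum_eq_zero fun S _ => ?_
  split
  · next h => rw [h, Finset.card_image_of_injective _ inlₗ_injective] at hT; exact hf S hT
  · rfl

end Projection

end Grassmann
end
end SuperBV

set_option linter.unusedSectionVars false
namespace SuperBV
noncomputable section
open SuperBV.Grassmann hiding coeff
open MvPowerSeries Series

/-! ### Derivatives in the multipliers and antifields -/

section FirstLevelDerivations

variable {N : ℕ} {U : TopologicalSpace.Opens (Fin N → ℝ)} {ε : Fin N → ZMod 2}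

theorem emb_eq (f : SuperFun U) : emb f = C (σ := Fin N) (inc f) := rfl

theorem isLeftDer_leftD {O R : Type*} [LinearOrder O] [Fintype O] [CommRing R] [Algebra ℂ R]
    (σ : Type*) (o : O) : IsLeftDer (σ := σ) 1 (coeffwise (R := R) (leftD o)) :=
  isLeftDer_coeffwise (leftD_add o) (fun c f => leftD_smul o c f) (fun f g => leftD_mul o f g)
    (fun _ _ hf => hf.leftD o)

theorem isLeftDer_pd (i : Fin N) :
    IsLeftDer (σ := Fin N) 0 (coeffwise (mapCoeff (O := Fin N ⊕ₗ Fin N) (Smooth.pd (U := U) i))) :=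
  isLeftDer_coeffwise (mapCoeff_pd_add i) (mapCoeff_pd_smul i) (fun f g => mapCoeff_pd_mul i f g)
    (fun _ _ hf => by rw [add_zero]; exact hasParity_mapCoeff_pd hf i)

theorem isLeftDer_dl₁ (A : Idx N) : IsLeftDer (par A) (dl₁ (U := U) A) := by
  rcases A with i | i
  · exact isLeftDer_pd i
  · exact isLeftDer_leftD (Fin N) (Sum.inlₗ i)

theorem dLam_of_eq {α : Fin N} (h : ε α = 0) : dLam (U := U) ε α = evenD α := by
  funext f; exact if_pos h

theorem dLam_of_ne {α : Fin N} (h : ε α = 1) :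
    dLam (U := U) ε α = coeffwise (leftD (Sum.inrₗ α)) := by
  funext f; exact if_neg (by rw [h]; decide)

theorem dLamStar_of_eq {α : Fin N} (h : ε α = 0) :
    dLamStar (U := U) ε α = coeffwise (leftD (Sum.inrₗ α)) := by
  funext f; exact if_pos h

theorem dLamStar_of_ne {α : Fin N} (h : ε α = 1) : dLamStar (U := U) ε α = evenD α := by
  funext f; exact if_neg (by rw [h]; decide)

theorem isLeftDer_dLam (α : Fin N) : IsLeftDer (ε α) (dLam (U := U) ε α) := by
  rcases zmod_two_cases (ε α) with h | h
  · rw [dLam_of_eq h, h]; exact isLeftDer_evenD α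
  · rw [dLam_of_ne h, h]; exact isLeftDer_leftD _ _

theorem isLeftDer_dLamStar (α : Fin N) : IsLeftDer (ε α + 1) (dLamStar (U := U) ε α) := by
  rcases zmod_two_cases (ε α) with h | h
  · rw [dLamStar_of_eq h, h]; exact isLeftDer_leftD _ _
  · rw [dLamStar_of_ne h, h]; exact isLeftDer_evenD α

theorem leftD_gen {O R : Type*} [LinearOrder O] [CommRing R] (o a : O) :
    leftD o (gen a : Grassmann O R) = if o = a then 1 else 0 := by
  have h := leftD_gen_mul o a (1 : Grassmann O R)
  have h1 : leftD o (1 : Grassmann O R) = 0 := by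
    rw [← const_one]; exact leftD_const o 1
  rw [h1, mul_zero, sub_zero, mul_one] at h
  rw [h]
  exact if_congr eq_comm rfl rfl

theorem leftD_one {O R : Type*} [LinearOrder O] [CommRing R] (o : O) :
    leftD o (1 : Grassmann O R) = 0 := by
  rw [← const_one]; exact leftD_const o 1

/-- The value at `λ = λ* = 0`. -/
def ev₀ (U : TopologicalSpace.Opens (Fin N → ℝ)) : FirstLevel U →+* SuperFun U :=
  (projHom (Fin N) (Fin N) (Smooth U)).comp (constantCoeff (σ := Fin N))

theorem ev₀_apply (f : FirstLevel U) :
    ev₀ U f = projHom (Fin N) (Fin N) (Smooth U) (coeff 0 f) := rfl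

theorem ev₀_dl₁ (A : Idx N) (f : FirstLevel U) : ev₀ U (dl₁ A f) = dl A (ev₀ U f) := by
  rcases A with i | i
  · rfl
  · exact projHom_leftD i (coeff 0 f)

theorem hasParity_ev₀ (p : ZMod 2) (x : FirstLevel U) (hx : HasParityS p x) :
    HasParity p (ev₀ U x) := (hx 0).projHom

theorem gen_inrₗ_coeff_parity (α : Fin N) :
    HasParityS 1 (C (σ := Fin N) (gen (Sum.inrₗ α) : Grassmann (Fin N ⊕ₗ Fin N) (Smooth U))) :=
  HasParityS.C (HasParity.gen _)

theorem hasParityS_X (α : Fin N) :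
    HasParityS 0 (X α : MvPowerSeries (Fin N) (Grassmann (Fin N ⊕ₗ Fin N) (Smooth U))) := by
  intro m
  rw [coeff_X]
  split
  · exact HasParity.one
  · exact HasParity.zero 0

/-- For each index one of `λ`, `λ*` is a power series variable and the other an odd generator. Hence
the four parity cases: variables and derivatives of the same kind pair to a Kronecker delta, and
those of different kinds pair to zero. A variable and the derivative in its partner are always of
different kinds when their indices agree. -/
theorem isLamData : IsLamData ε (dLam (U := U) ε) (dLamStar ε) (ev₀ U) emb (lam ε) (lamStar ε) := by
  have hE0 : ∀ (α : Fin N) (x : SuperFun U), evenD α (emb x) = 0 := fun α x => evenD_C α _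
  have hO0 : ∀ (α : Fin N) (x : SuperFun U), coeffwise (leftD (Sum.inrₗ α)) (emb x) = 0 :=
    fun α x => by rw [emb_eq, coeffwise_C (leftD_zero _), leftD_inc, map_zero]
  have hEX : ∀ α β : Fin N, evenD α (X β : FirstLevel U) = if α = β then 1 else 0 := fun α β =>
    evenD_X α β
  have hEC : ∀ α β : Fin N, evenD α (C (σ := Fin N) (gen (Sum.inrₗ β)) : FirstLevel U) = 0 :=
    fun α β => evenD_C α _
  have hOX : ∀ α β : Fin N, coeffwise (leftD (Sum.inrₗ α)) (X β : FirstLevel U) = 0 := fun α β =>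
    coeffwise_X (leftD_zero _) (leftD_one _) β
  have hOC : ∀ α β : Fin N, coeffwise (leftD (Sum.inrₗ α))
      (C (σ := Fin N) (gen (Sum.inrₗ β)) : FirstLevel U) = if α = β then 1 else 0 := fun α β => by
    rw [coeffwise_C (leftD_zero _), leftD_gen]
    by_cases h : α = β
    · rw [if_pos h, if_pos (by rw [h]), map_one]
    · rw [if_neg h, if_neg, map_zero]
      intro h'
      exact h (Sum.inr_injective (toLex.injective h'))
  have hX0 : ∀ β : Fin N, ev₀ U (X β) = 0 := fun β => by
    rw [ev₀, RingHom.comp_apply, constantCoeff_X, map_zero]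
  have hC0 : ∀ β : Fin N, ev₀ U (C (σ := Fin N) (gen (Sum.inrₗ β))) = 0 := fun β => by
    rw [ev₀, RingHom.comp_apply, constantCoeff_C, projHom_gen_inrₗ]
  have e10 : ¬ (1 : ZMod 2) = 0 := by decide
  refine ⟨isLeftDer_dLam, isLeftDer_dLamStar, fun α x => ?_, fun α x => ?_, fun p x => ?_,
    fun α β => ?_, fun α β => ?_, fun α β => ?_, fun α β => ?_, fun α => ?_, fun α => ?_,
    fun x => ?_, fun α => ?_, fun α => ?_, fun c x => ?_⟩
  · rcases zmod_two_cases (ε α) with h | h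
    · rw [dLam_of_eq h, hE0]
    · rw [dLam_of_ne h, hO0]
  · rcases zmod_two_cases (ε α) with h | h
    · rw [dLamStar_of_eq h, hO0]
    · rw [dLamStar_of_ne h, hE0]
  · rw [emb_eq, sigS_C, sig_inc, emb_eq]
  · rcases zmod_two_cases (ε α) with h | h <;> rcases zmod_two_cases (ε β) with h' | h' <;>
      simp only [dLam_of_eq, dLam_of_ne, h, lam, h', e10, if_true, if_false, hEX, hEC, hOX, hOC]
    · rw [if_neg]; rintro rfl; rw [h] at h'; exact e10 h'.symm
    · rw [if_neg]; rintro rfl; rw [h] at h'; exact e10 h'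
  · rcases zmod_two_cases (ε α) with h | h <;> rcases zmod_two_cases (ε β) with h' | h' <;>
      simp only [dLam_of_eq, dLam_of_ne, h, lamStar, h', e10, if_true, if_false, hEX, hEC, hOX, hOC]
    · rw [if_neg]; rintro rfl; rw [h] at h'; exact e10 h'.symm
    · rw [if_neg]; rintro rfl; rw [h] at h'; exact e10 h'
  · rcases zmod_two_cases (ε α) with h | h <;> rcases zmod_two_cases (ε β) with h' | h' <;>
      simp only [dLamStar_of_eq, dLamStar_of_ne, h, lam, h', e10, if_true, if_false, hEX, hEC, hOX, hOC]
    · rw [if_neg]; rintro rfl; rw [h] at h'; exact e10 h'.symm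
    · rw [if_neg]; rintro rfl; rw [h] at h'; exact e10 h'
  · rcases zmod_two_cases (ε α) with h | h <;> rcases zmod_two_cases (ε β) with h' | h' <;>
      simp only [dLamStar_of_eq, dLamStar_of_ne, h, lamStar, h', e10, if_true, if_false, hEX, hEC, hOX, hOC]
    · rw [if_neg]; rintro rfl; rw [h] at h'; exact e10 h'.symm
    · rw [if_neg]; rintro rfl; rw [h] at h'; exact e10 h'
  · rcases zmod_two_cases (ε α) with h | h <;>
      simp only [h, lam, e10, if_true, if_false]
    · exact hasParityS_X α
    · exact gen_inrₗ_coeff_parity α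
  · rcases zmod_two_cases (ε α) with h | h <;>
      simp only [h, lamStar, e10, if_true, if_false]
    · exact gen_inrₗ_coeff_parity α
    · exact hasParityS_X α
  · rw [emb_eq, ev₀, RingHom.comp_apply, constantCoeff_C, projHom_inc]
  · unfold lam; split
    · exact hX0 α
    · exact hC0 α
  · unfold lamStar; split
    · exact hC0 α
    · exact hX0 α
  · rfl

end FirstLevelDerivations
end
end SuperBV

set_option linter.unusedSectionVars false
namespace SuperBV
noncomputable section
open SuperBV.Grassmann hiding coeff
open MvPowerSeries Series

theorem Grassmann.complex_smul_zero {O R : Type*} [CommRing R] [Module ℂ R] (c : ℂ) :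
    c • (0 : Grassmann O R) = 0 := smul_zero c

/-! ### The consequences of the Quantum Master Equation -/

section QME

variable {N : ℕ} {U : TopologicalSpace.Opens (Fin N → ℝ)} {ε : Fin N → ZMod 2}

theorem coeffwise_anticomm {O R σ : Type*} [LinearOrder O] [Fintype O] [CommRing R] (o a : O)
    (f : MvPowerSeries σ (Grassmann O R)) :
    coeffwise (leftD o) (coeffwise (leftD a) f) = -coeffwise (leftD a) (coeffwise (leftD o) f) := by
  ext1 m; exact leftD_leftD o a (coeff m f)

theorem dLam_dl₁ (β : Fin N) (A : Idx N) (f : FirstLevel U) :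
    dLam ε β (dl₁ A f) = sg (ε β * par A) • dl₁ A (dLam ε β f) := by
  rcases zmod_two_cases (ε β) with h | h
  · rw [dLam_of_eq h, h, zero_mul, sg_zero, one_zsmul]
    rcases A with i | i
    · exact evenD_coeffwise (mapCoeff_pd_smul i) β f
    · exact evenD_coeffwise (fun c f => leftD_smul (Sum.inlₗ i) c f) β f
  · rw [dLam_of_ne h, h, one_mul]
    rcases A with i | i
    · rw [par_inl, sg_zero, one_zsmul]
      ext1 m
      exact (mapCoeff_pd_leftD i (Sum.inrₗ β) (coeff m f)).symm
    · rw [par_inr, sg_one, neg_one_zsmul]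
      exact coeffwise_anticomm _ _ f

theorem exp₁_eq (f : FirstLevel U) :
    exp₁ f = expS (2 * N + 1) (Smooth.exp (body₁ f)) (f - C (σ := Fin N) (const (body₁ f))) := rfl

theorem card_lex : Fintype.card (Fin N ⊕ₗ Fin N) < 2 * N + 1 := by
  have : Fintype.card (Fin N ⊕ₗ Fin N) = Fintype.card (Fin N ⊕ Fin N) := rfl
  rw [this, Fintype.card_sum, Fintype.card_fin]
  omega

theorem body_coeff_zero_sub (f : FirstLevel U) :
    body (coeff 0 (f - C (σ := Fin N) (const (body₁ f)))) = 0 := by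
  rw [Series.coeff_sub, body_sub, coeff_zero_C, body_const]
  exact sub_self (body₁ f)

theorem hasParityS_sub_const {f : FirstLevel U} (hf : HasParityS 0 f) :
    HasParityS 0 (f - C (σ := Fin N) (const (body₁ f))) :=
  hf.sub (HasParityS.C (HasParity.const _))

theorem hasParityS_exp₁ {f : FirstLevel U} (hf : HasParityS 0 f) : HasParityS 0 (exp₁ f) :=
  exp₁_eq f ▸ hasParityS_expS (hasParityS_sub_const hf)

theorem body_ev₀_exp₁ (f : FirstLevel U) : body (ev₀ U (exp₁ f)) = Smooth.exp (body₁ f) :=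
  body_coeff_zero_expS (Nat.succ_pos _) (body_coeff_zero_sub f)

theorem map_exp₁ {p : ZMod 2} {D : FirstLevel U → FirstLevel U} (h : IsLeftDer p D)
    {f : FirstLevel U} (hf : HasParityS 0 f)
    (hb : D (C (σ := Fin N) (const (Smooth.exp (body₁ f)))) =
      D (C (σ := Fin N) (const (body₁ f))) * C (σ := Fin N) (const (Smooth.exp (body₁ f)))) :
    D (exp₁ f) = D f * exp₁ f := by
  have := h.map_expS (c := C (σ := Fin N) (const (body₁ f))) (hasParityS_sub_const hf) hb
    (body_coeff_zero_sub f) card_lex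
  rwa [add_sub_cancel] at this

theorem evenD_exp₁ (α : Fin N) {f : FirstLevel U} (hf : HasParityS 0 f) :
    evenD α (exp₁ f) = evenD α f * exp₁ f :=
  map_exp₁ (isLeftDer_evenD α) hf (by rw [evenD_C, evenD_C, zero_mul])

theorem coeffwise_leftD_exp₁ (o : Fin N ⊕ₗ Fin N) {f : FirstLevel U} (hf : HasParityS 0 f) :
    coeffwise (leftD o) (exp₁ f) = coeffwise (leftD o) f * exp₁ f :=
  map_exp₁ (isLeftDer_leftD _ o) hf (by
    rw [coeffwise_C (leftD_zero _), coeffwise_C (leftD_zero _), leftD_const, leftD_const, map_zero,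
      zero_mul])

theorem dl₁_exp₁ (A : Idx N) {f : FirstLevel U} (hf : HasParityS 0 f) :
    dl₁ A (exp₁ f) = dl₁ A f * exp₁ f := by
  rcases A with i | i
  · have hz : mapCoeff (O := Fin N ⊕ₗ Fin N) (Smooth.pd (U := U) i) 0 = 0 := by
      ext1; funext S; exact Smooth.pd_zero i
    refine map_exp₁ (isLeftDer_pd i) hf ?_
    rw [coeffwise_C hz, coeffwise_C hz, mapCoeff_pd_const, mapCoeff_pd_const, Smooth.pd_exp,
      const_mul, map_mul]
  · exact coeffwise_leftD_exp₁ _ hf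

theorem dLam_exp₁ (α : Fin N) {f : FirstLevel U} (hf : HasParityS 0 f) :
    dLam ε α (exp₁ f) = dLam ε α f * exp₁ f := by
  rcases zmod_two_cases (ε α) with h | h
  · rw [dLam_of_eq h]; exact evenD_exp₁ α hf
  · rw [dLam_of_ne h]; exact coeffwise_leftD_exp₁ _ hf

theorem dLamStar_exp₁ (α : Fin N) {f : FirstLevel U} (hf : HasParityS 0 f) :
    dLamStar ε α (exp₁ f) = dLamStar ε α f * exp₁ f := by
  rcases zmod_two_cases (ε α) with h | h
  · rw [dLamStar_of_eq h]; exact coeffwise_leftD_exp₁ _ hf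
  · rw [dLamStar_of_ne h]; exact evenD_exp₁ α hf

theorem oddLaplacian_emb (E : Matrix (Idx N) (Idx N) (SuperFun U)) (ρ : SuperFun U)
    (f : FirstLevel U) : oddLaplacian emb dl₁ E ρ f = lapS par emb dl₁ E ρ f := rfl

theorem hasParityS_emb (q : ZMod 2) (x : SuperFun U) (hx : HasParity q x) :
    HasParityS q (emb x) := HasParityS.C hx.inc

/-! ### The order in the antifields -/

/-- All monomials of `f` have degree at least `k` in the `λ*`. -/
def HasStarOrder (ε : Fin N → ZMod 2) (k : ℕ) (f : FirstLevel U) : Prop :=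
  ∀ m T, lamStarDeg ε m T < k → (coeff m f).coeff T = 0

theorem leftD_coeff_eq_zero {O R : Type*} [LinearOrder O] [CommRing R] {o : O} {f : Grassmann O R}
    {T : Finset O} (h : f.coeff (insert o T) = 0) : (leftD o f).coeff T = 0 := by
  simp only [leftD, h, mul_zero, ite_self]

theorem evenD_coeff_eq_zero {f : FirstLevel U} {α : Fin N} {m : Fin N →₀ ℕ}
    {T : Finset (Fin N ⊕ₗ Fin N)} (h : (coeff (m + Finsupp.single α 1) f).coeff T = 0) :
    (coeff m (evenD α f)).coeff T = 0 := by
  rw [coeff_evenD, ← Nat.cast_smul_eq_nsmul ℂ]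
  exact (congrArg (((m α + 1 : ℕ) : ℂ) • ·) h).trans (smul_zero _)

theorem mem_insert_inrₗ {_ : DecidableEq (Fin N ⊕ₗ Fin N)} {α β : Fin N} (T : Finset (Fin N ⊕ₗ Fin N)) (h : β ≠ α) :
    Sum.inrₗ β ∈ insert (Sum.inrₗ α) T ↔ Sum.inrₗ β ∈ T := by
  rw [Finset.mem_insert]
  refine or_iff_right fun h' => h (Sum.inr_injective (toLex.injective h'))

/-- A `λ` derivative reads off a coefficient whose monomial differs only in the `λ`, so the degree
in the `λ*` is the same. -/
theorem HasStarOrder.dLam {k : ℕ} {f : FirstLevel U} (hf : HasStarOrder ε k f) (α : Fin N) :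
    HasStarOrder ε k (dLam ε α f) := by
  intro m T hT
  rcases zmod_two_cases (ε α) with h | h
  · rw [dLam_of_eq h]
    refine evenD_coeff_eq_zero (hf _ _ (lt_of_eq_of_lt ?_ hT))
    refine Finset.sum_congr rfl fun β _ => ?_
    split
    · rfl
    · next h' =>
      have : β ≠ α := by rintro rfl; exact h' h
      simp [Ne.symm this]
  · rw [dLam_of_ne h]
    refine leftD_coeff_eq_zero (hf _ _ (lt_of_eq_of_lt ?_ hT))
    refine Finset.sum_congr rfl fun β _ => ?_
    split
    · next h' =>
      have : β ≠ α := by rintro rfl; rw [h] at h'; exact absurd h' (by decide)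
      simp only [mem_insert_inrₗ T this]
    · rfl

/-- The coefficient that is read off has degree in the `λ*` larger by at most one. It is not larger
if the odd factor was already present, in which case the derivative is zero anyway. -/
theorem HasStarOrder.dLamStar {k : ℕ} {f : FirstLevel U} (hf : HasStarOrder ε (k + 1) f)
    (α : Fin N) : HasStarOrder ε k (dLamStar ε α f) := by
  intro m T hT
  have hs : lamStarDeg ε m T + 1 = ∑ β, ((if ε β = 0 then (if Sum.inrₗ β ∈ T then 1 else 0) else m β)
      + if β = α then 1 else 0) := by
    rw [Finset.sum_add_distrib, Finset.sum_ite_eq' Finset.univ α, if_pos (Finset.mem_univ α)]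
    rfl
  rcases zmod_two_cases (ε α) with h | h
  · rw [dLamStar_of_eq h]
    refine leftD_coeff_eq_zero (hf _ _ (lt_of_le_of_lt ?_ (Nat.succ_lt_succ hT)))
    rw [Nat.succ_eq_add_one, hs]
    refine Finset.sum_le_sum fun β _ => ?_
    by_cases hb : β = α
    · subst hb
      simp only [h, if_true]
      split <;> omega
    · simp only [mem_insert_inrₗ T hb, if_neg hb, add_zero, le_refl]
  · rw [dLamStar_of_ne h]
    refine evenD_coeff_eq_zero (hf _ _ (lt_of_le_of_lt ?_ (Nat.succ_lt_succ hT)))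
    rw [Nat.succ_eq_add_one, hs]
    refine Finset.sum_le_sum fun β _ => ?_
    by_cases hb : β = α
    · subst hb
      simp [h]
    · simp [hb]

theorem HasStarOrder.ev₀ {f : FirstLevel U} (hf : HasStarOrder ε 1 f) : ev₀ U f = 0 := by
  ext1
  funext S
  rw [ev₀_apply, projHom_coeff]
  refine (hf 0 _ ?_)
  rw [Nat.lt_one_iff]
  refine Finset.sum_eq_zero fun β _ => ?_
  split
  · rw [if_neg]
    intro h
    obtain ⟨a, _, ha⟩ := Finset.mem_image.1 h
    exact absurd (toLex.injective ha) Sum.inl_ne_inr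
  · rfl

theorem HasStarOrder.mono {k l : ℕ} {f : FirstLevel U} (hf : HasStarOrder ε k f) (h : l ≤ k) :
    HasStarOrder ε l f := fun m T hT => hf m T (hT.trans_le h)

theorem hasParityS_action {X : ℕ → FirstLevel U} (hX : IsEvenAction X) (ħ : ℝ) :
    HasParityS 0 (action ε X ħ) := fun m T hT => by
  change ∑ k ∈ Finset.range (lamStarDeg ε m T + 2),
    ((Complex.I * (ħ : ℂ)) ^ k) • (coeff m (X k)).coeff T = 0
  refine Finset.sum_eq_zero fun k _ => ?_
  refine (congrArg (((Complex.I * (ħ : ℂ)) ^ k) • ·) (hX k m T hT)).trans (smul_zero _)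

theorem isExpData {E : Matrix (Idx N) (Idx N) (SuperFun U)} (hE : IsAntisymplectic E)
    {ρ : SuperFun U} (hρ : HasParity 0 ρ) (hu : IsUnit ρ) {f : FirstLevel U} (hf : HasParityS 0 f)
    {H : SuperFun U} (hH : ev₀ U f = -H) : IsExpData par dl E ρ H (ev₀ U (exp₁ f)) where
  der := isSuperDer_dl
  parityE := hE.parity
  skew := hE.skew
  parity_ρ := hρ
  parity_inv := hρ.ringInverse hu
  inverse_mul := Ring.inverse_mul_cancel _ hu
  parity_h := by
    have := (hasParity_ev₀ 0 f hf).neg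
    rwa [hH, neg_neg] at this
  d_e A := by
    rw [← ev₀_dl₁, dl₁_exp₁ A hf, map_mul, ev₀_dl₁, hH, dl_neg]
  isUnit := isUnit_of_body (by
    rw [body_ev₀_exp₁]
    exact Smooth.isUnit_of_ne_zero fun x => Complex.exp_ne_zero _)

/-- The consequences of the master equation for the lowest order terms of the action. -/
theorem first_level {E : Matrix (Idx N) (Idx N) (SuperFun U)} (hE : IsAntisymplectic E)
    {ρ : SuperFun U} (hρ : HasParity 0 ρ) (hu : IsUnit ρ)
    {X : ℕ → FirstLevel U} (hX : IsEvenAction X) (hQME : QuantumMasterEquation ε E ρ X)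
    {G : Fin N → SuperFun U} {H : SuperFun U} {Us : Fin N → Fin N → Fin N → SuperFun U}
    {Vs : Fin N → Fin N → SuperFun U} {Gt : Fin N → SuperFun U}
    (hexp : HasExpansion ε X G H Us Vs Gt) (hG : ∀ α, HasParity (ε α) (G α)) :
    HasParity 0 H ∧ (∀ α β, HasParity (ε α + 1 + ε β) (Vs α β)) ∧
    ∃ Y : Fin N → Fin N → Fin N → SuperFun U,
      (∀ γ α β, HasParity (ε γ + ε α + ε β + 1) (Y γ α β)) ∧
      (∀ α β, bracket par dl E (G α) (G β) = ∑ γ, G γ * Y γ α β) ∧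
      (∀ β, laplacian par dl E ρ (G β) - bracket par dl E H (G β) - ∑ α, sg (ε α) • Y α α β =
        ∑ α, G α * Vs α β) ∧
      ((∀ α β γ, Us α β γ = 0) → ∀ γ α β, Y γ α β = 0) := by
  have L := isLamData (U := U) (ε := ε)
  -- The single value `ħ = 1` suffices. There `f = iX`, and the term `iħH` of the action becomes
  -- `-H`, so `-H` is the value of `f` at the origin.
  set i1 : ℂ := Complex.I * ((1 : ℝ) : ℂ) with hi1
  have hi : i1 = Complex.I := by rw [hi1, Complex.ofReal_one, mul_one]
  set Q : Fin N → FirstLevel U := fun α =>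
    starCoeff ε emb (lam ε) 2⁻¹ i1 (i1 ^ 2) (Us α) (Vs α) (Gt α) with hQ
  set P : FirstLevel U := ∑ α, emb (G α) * lam ε α + i1 • emb H + ∑ α, lamStar ε α * Q α with hP
  -- Before evaluation at most one `λ*` derivative is taken, and `λ` derivatives do not lower the
  -- order in the `λ*`. The terms beyond the displayed ones therefore never contribute.
  have hPg : HasStarOrder ε 2 (action ε X 1 - P) := fun m T hT => by
    rw [Series.coeff_sub, sub_coeff]
    exact sub_eq_zero.2 (hexp 1 m T (Nat.lt_succ_iff.1 hT))
  set g := action ε X 1 - P with hg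
  set f : FirstLevel U := (Complex.I / ((1 : ℝ) : ℂ)) • action ε X 1 with hf
  have hfp : HasParityS 0 f := (hasParityS_action hX 1).smul _
  have hfe : f = Complex.I • P + Complex.I • g := by
    rw [hf, ← smul_add, hg, add_sub_cancel, Complex.ofReal_one, div_one]
  have hs : ∀ {x : FirstLevel U}, HasStarOrder ε 1 x → ev₀ U (Complex.I • x) = 0 := fun {x} hx => by
    rw [L.ev_smul, hx.ev₀]; exact complex_smul_zero _
  have hII : ∀ x : SuperFun U, Complex.I • Complex.I • x = -x := fun x => by
    rw [smul_smul, Complex.I_mul_I]; exact neg_one_smul ℂ x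
  have hDf : ∀ α, dLam ε α f = Complex.I • dLam ε α P + Complex.I • dLam ε α g := fun α => by
    rw [hfe, (L.hD α).add, (L.hD α).smul, (L.hD α).smul]
  have hDsf : ∀ α, dLamStar ε α f = Complex.I • Q α + Complex.I • dLamStar ε α g := fun α => by
    rw [hfe, (L.hDs α).add, (L.hDs α).smul, (L.hDs α).smul, hP,
      L.Ds_expansion G H (fun α β => L.Ds_starCoeff _ _ _ _ _ _ α)]
  have hDP := fun α => L.D_expansion (Q := Q) G H α i1
  have ev_f : ev₀ U f = -H := by
    rw [hfe, map_add, hs (hPg.mono (by norm_num)), add_zero, L.ev_smul, hP, L.ev_expansion, hi, hII]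
  have hgD : ∀ β, HasStarOrder ε 1 (dLam ε β g) := fun β =>
    (hPg.mono (by norm_num)).dLam β
  have ev_Df : ∀ β, ev₀ U (dLam ε β f) = (Complex.I * (sg (ε β) : ℂ)) • G β := fun β => by
    rw [hDf, map_add, hs (hgD β), add_zero, L.ev_smul, hP, hDP, map_add, L.ev_emb, L.ev_sum_s_mul,
      add_zero, (hG β).sig, mul_smul, Int.cast_smul_eq_zsmul]
    congr 2
    generalize ε β = b
    revert b; decide
  have hDDf : ∀ β γ, dLam ε γ (dLam ε β f) = Complex.I • dLam ε γ (dLam ε β P) +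
      Complex.I • dLam ε γ (dLam ε β g) := fun β γ => by
    rw [hDf, (L.hD γ).add, (L.hD γ).smul, (L.hD γ).smul]
  have ev_I : ∀ {x : FirstLevel U}, ev₀ U x = 0 → ev₀ U (Complex.I • x) = 0 := fun {x} hx => by
    rw [L.ev_smul, hx]; exact complex_smul_zero _
  have v2 : ∀ β γ, ev₀ U (dLam ε γ (dLam ε β f)) = 0 := fun β γ => by
    rw [hDDf, map_add, hs ((hgD β).dLam γ), add_zero, ev_I]
    rw [hP, hDP, (L.hD γ).add, L.D_emb, zero_add, L.D_sum_s_mul, L.ev_sum_s_mul]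
  have v3 : ∀ α β γ, ev₀ U (dLam ε γ (dLam ε β (dLam ε α f))) = 0 := fun α β γ => by
    rw [hDDf, (L.hD γ).add, (L.hD γ).smul, (L.hD γ).smul, map_add, hs (((hgD α).dLam β).dLam γ),
      add_zero, ev_I]
    rw [hP, hDP, (L.hD β).add, L.D_emb, zero_add, L.D_sum_s_mul, L.D_sum_s_mul, L.ev_sum_s_mul]
  have hgs : ∀ α, HasStarOrder ε 1 (dLamStar ε α g) := fun α => HasStarOrder.dLamStar hPg α
  have hDDs : ∀ α β, dLam ε β (dLamStar ε α f) = Complex.I • dLam ε β (Q α) +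
      Complex.I • dLam ε β (dLamStar ε α g) := fun α β => by
    rw [hDsf, (L.hD β).add, (L.hD β).smul, (L.hD β).smul]
  have hDDDs : ∀ α β γ, dLam ε γ (dLam ε β (dLamStar ε α f)) =
      Complex.I • dLam ε γ (dLam ε β (Q α)) +
      Complex.I • dLam ε γ (dLam ε β (dLamStar ε α g)) := fun α β γ => by
    rw [hDDs, (L.hD γ).add, (L.hD γ).smul, (L.hD γ).smul]
  have v4 : ∀ α β γ, ev₀ U (dLam ε γ (dLam ε β (dLam ε α (dLamStar ε α f)))) = 0 :=
    fun α β γ => by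
    rw [hDDDs, (L.hD γ).add, (L.hD γ).smul, (L.hD γ).smul, map_add,
      hs ((((hgs α).dLam α).dLam β).dLam γ), add_zero, ev_I]
    rw [L.degLe_starCoeff 2⁻¹ i1 (i1 ^ 2) (Us α) (Vs α) (Gt α) α β γ, map_zero]
  have hV : ∀ α β, ev₀ U (dLam ε β (dLamStar ε α f)) = -sig (ε β) (Vs α β) := fun α β => by
    rw [hDDs, map_add, hs ((hgs α).dLam β), add_zero, L.ev_smul, L.ev_D_starCoeff, hi, hII]
  have qme : lapS par emb dl₁ E ρ (exp₁ f) +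
      ∑ α, sg (ε α) • dLam ε α (dLamStar ε α (exp₁ f)) = 0 := hQME 1 one_ne_zero
  have key := master_equation L.hD L.hDs hfp (fun α => dLam_exp₁ α hfp) (fun α => dLamStar_exp₁ α hfp)
    (fun β x => (L.hD β).map_lapS (E := E) (ρ := ρ) isLeftDer_dl₁ (dLam_dl₁ β) (L.D_emb β) hasParityS_emb hE.parity hρ
      (hρ.ringInverse hu) x)
    (fun x => map_lapS L.ev_smul L.ev_emb ev₀_dl₁ x) hasParity_ev₀ qme v2 v3 v4
    (isExpData hE hρ hu hfp ev_f) dl_smul hG ev_Df hV (fun γ α β => rfl)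
  refine ⟨(isExpData hE hρ hu hfp ev_f).parity_h, key.1.2.2, _, key.2, key.1.1, key.1.2.1,
    fun hU γ α β => ?_⟩
  -- Without `U` the coefficient of an antifield is of degree at most one in the `λ`, and its second
  -- derivatives, which define `Y`, vanish.
  have h0 : ev₀ U (dLam ε β (dLam ε α (dLamStar ε γ f))) = 0 := by
    rw [hDDDs, map_add, hs (((hgs γ).dLam α).dLam β), add_zero, ev_I]
    rw [L.degLe_starCoeff_of_eq_zero 2⁻¹ i1 (i1 ^ 2) (Us γ) (Vs γ) (Gt γ) (fun β' γ' => by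
      rw [hU, emb_eq, inc_zero, map_zero]) α β, map_zero]
  rw [h0]
  exact complex_smul_zero _

end QME
end
end SuperBV

set_option linter.unusedSectionVars false
namespace SuperBV
noncomputable section
open SuperBV.Grassmann hiding coeff
open MvPowerSeries Series

/-! ### Adding a constant to the action -/

theorem Series.lapS_smul {σ O R O' R' ι : Type*} [LinearOrder O] [CommRing R] [Algebra ℂ R]
    [LinearOrder O'] [CommRing R'] [Algebra ℂ R'] [Fintype ι] {π : ι → ZMod 2}
    {emb : Grassmann O' R' → MvPowerSeries σ (Grassmann O R)}
    {d₁ : ι → MvPowerSeries σ (Grassmann O R) → MvPowerSeries σ (Grassmann O R)}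
    {E : Matrix ι ι (Grassmann O' R')} {ρ : Grassmann O' R'}
    (hd : ∀ A, IsLeftDer (π A) (d₁ A)) (c : ℂ) (f : MvPowerSeries σ (Grassmann O R)) :
    lapS π emb d₁ E ρ (c • f) = c • lapS π emb d₁ E ρ f := by
  simp only [lapS, (hd _).smul, mul_smul_comm]
  rw [smul_comm c]
  refine congrArg _ ?_
  rw [Finset.smul_sum]
  refine Finset.sum_congr rfl fun A _ => ?_
  rw [Finset.smul_sum]
  exact Finset.sum_congr rfl fun B _ => smul_comm _ _ _

section Shift

variable {N : ℕ} {U : TopologicalSpace.Opens (Fin N → ℝ)} {ε : Fin N → ZMod 2}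

theorem action_shiftH (X : ℕ → FirstLevel U) (c : ℂ) (ħ : ℝ) :
    action ε (shiftH X c) ħ = action ε X ħ + (Complex.I * (ħ : ℂ) * c) • (1 : FirstLevel U) := by
  ext1 m
  ext1
  funext T
  have h : ∀ k, (coeff m (shiftH X c k)).coeff T =
      (coeff m (X k)).coeff T + if k = 1 then c • (coeff m (1 : FirstLevel U)).coeff T else 0 := by
    intro k
    unfold shiftH
    split <;> rfl
  have h1 : (coeff m (action ε (shiftH X c) ħ)).coeff T =
      ∑ k ∈ Finset.range (lamStarDeg ε m T + 2),
        ((Complex.I * (ħ : ℂ)) ^ k) • (coeff m (shiftH X c k)).coeff T := rfl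
  rw [h1]
  simp only [h, smul_add, Finset.sum_add_distrib]
  refine congrArg₂ (· + ·) rfl ?_
  -- The term `k = 1` always lies in the summation range, whose length is at least two.
  rw [Finset.sum_eq_single_of_mem 1 (by simp), if_pos rfl, pow_one, smul_smul]
  · rfl
  · intro k _ hk
    rw [if_neg hk, smul_zero]

/-- The constant is absorbed by the body, so that the part without body is unchanged and only the
numerical prefactor changes. As the master equation is linear in the exponential, a shift of `H` by
a constant costs nothing. -/
theorem exp₁_add_const (f : FirstLevel U) (a : ℂ) :
    exp₁ (f + a • (1 : FirstLevel U)) = Complex.exp a • exp₁ f := by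
  have hb : body₁ (f + a • (1 : FirstLevel U)) = body₁ f + a • 1 := by
    have : body₁ (a • (1 : FirstLevel U)) = a • (1 : Smooth U) := by
      change a • body (coeff 0 (1 : FirstLevel U)) = _
      rw [coeff_zero_one]; rfl
    rw [← this]; rfl
  have hc : C (σ := Fin N) (const (O := Fin N ⊕ₗ Fin N) (a • (1 : Smooth U))) =
      a • (1 : FirstLevel U) := by
    ext1 m
    rw [coeff_C, Series.coeff_smul', coeff_one]
    split
    · ext1; funext S
      change (if S = ∅ then a • (1 : Smooth U) else 0) = a • if S = ∅ then 1 else 0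
      split
      · rfl
      · exact (smul_zero a).symm
    · exact (complex_smul_zero a).symm
  have hν : f + a • (1 : FirstLevel U) - C (σ := Fin N) (const (body₁ (f + a • (1 : FirstLevel U)))) =
      f - C (σ := Fin N) (const (body₁ f)) := by
    rw [hb, const_add, map_add, hc, add_sub_add_right_eq_sub]
  have he : Smooth.exp (body₁ f + a • 1) = Complex.exp a • Smooth.exp (body₁ f) := by
    apply Smooth.ext
    intro x
    change Complex.exp ((body₁ f).1 x + a * 1) = Complex.exp a * Complex.exp ((body₁ f).1 x)
    rw [mul_one, Complex.exp_add, mul_comm]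
  have hcm : ∀ (b : Smooth U) (x : Grassmann (Fin N ⊕ₗ Fin N) (Smooth U)),
      const (Complex.exp a • b) * x = Complex.exp a • (const b * x) := by
    intro b x
    ext1; funext S
    rw [const_mul_coeff, smul_coeff, const_mul_coeff]
    exact smul_mul_assoc _ _ _
  rw [exp₁_eq, exp₁_eq, hν, hb, he]
  ext1 m
  have h1 : ∀ b, coeff m (expS (2 * N + 1) b (f - C (σ := Fin N) (const (body₁ f)))) =
      ∑ n ∈ Finset.range (m.degree + (2 * N + 1)), ((n.factorial : ℂ)⁻¹) •
        (const b * coeff m ((f - C (σ := Fin N) (const (body₁ f))) ^ n)) := fun b => rfl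
  rw [Series.coeff_smul', h1, h1, Finset.smul_sum]
  refine Finset.sum_congr rfl fun n _ => ?_
  rw [hcm]
  exact smul_comm _ _ _

theorem laplacian₁_smul (E : Matrix (Idx N) (Idx N) (SuperFun U)) (ρ : SuperFun U) (c : ℂ)
    (f : FirstLevel U) : laplacian₁ ε E ρ (c • f) = c • laplacian₁ ε E ρ f := by
  unfold laplacian₁
  rw [oddLaplacian_emb, oddLaplacian_emb, lapS_smul isLeftDer_dl₁, smul_add, Finset.smul_sum]
  congr 1
  refine Finset.sum_congr rfl fun α _ => ?_
  rw [(isLeftDer_dLamStar α).smul, (isLeftDer_dLam α).smul]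
  exact smul_comm _ _ _

theorem quantumMasterEquation_shiftH {E : Matrix (Idx N) (Idx N) (SuperFun U)} {ρ : SuperFun U}
    {X : ℕ → FirstLevel U} (h : QuantumMasterEquation ε E ρ X) (c : ℂ) :
    QuantumMasterEquation ε E ρ (shiftH X c) := by
  intro ħ hħ
  rw [action_shiftH, smul_add, smul_smul, exp₁_add_const, laplacian₁_smul, h ħ hħ, smul_zero]

end Shift
end
end SuperBV

set_option linter.unusedSectionVars false
namespace SuperBV
noncomputable section
open Grassmann

/-! ### The exponential of superfunctions -/

namespace Grassmann

section NilExp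

variable {O R : Type*} [LinearOrder O] [Fintype O] [CommRing R] [Algebra ℂ R]

/-- The exponential of an element without body. -/
def nexp (ν : Grassmann O R) : Grassmann O R :=
  ∑ n ∈ Finset.range (Fintype.card O + 2), ((n.factorial : ℂ)⁻¹) • ν ^ n

theorem nexp_eq {ν : Grassmann O R} (h : body ν = 0) {K : ℕ} (hK : Fintype.card O < K) :
    nexp ν = ∑ n ∈ Finset.range K, ((n.factorial : ℂ)⁻¹) • ν ^ n := by
  have h1 : ∀ K', Fintype.card O < K' → ∑ n ∈ Finset.range K', ((n.factorial : ℂ)⁻¹) • ν ^ n =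
      ∑ n ∈ Finset.range (Fintype.card O + 1), ((n.factorial : ℂ)⁻¹) • ν ^ n := fun K' hK' => by
    symm
    refine Finset.sum_subset (Finset.range_subset_range.2 hK') fun n _ hn => ?_
    rw [pow_eq_zero_of_body_eq_zero h (by simpa using hn), smul_zero]
  rw [nexp, h1 _ (by omega), h1 K hK]

theorem HasParity.nexp {ν : Grassmann O R} (h : HasParity 0 ν) : HasParity 0 (Grassmann.nexp ν) :=
  HasParity.sum fun n _ => (h.pow n).smul _

/-- Elements without body are nilpotent, so `nexp` agrees with `IsNilpotent.exp`. The rational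
scalars which that definition needs are obtained by restriction from `ℂ`. -/
theorem nexp_add {μ ν : Grassmann O R} (hμ : body μ = 0) (hν : body ν = 0) (h : Commute μ ν) :
    nexp (μ + ν) = nexp μ * nexp ν := by
  let _ : Module ℚ (Grassmann O R) := Module.compHom (Grassmann O R) (algebraMap ℚ ℂ)
  have h0 : body (μ + ν) = 0 := (congrArg₂ (· + ·) hμ hν).trans (add_zero 0)
  have key : ∀ x : Grassmann O R, body x = 0 → nexp x = IsNilpotent.exp x := fun x hx => by
    rw [IsNilpotent.exp_eq_sum (k := Fintype.card O + 2) (pow_eq_zero_of_body_eq_zero hx (by omega))]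
    refine Finset.sum_congr rfl fun n _ => ?_
    change _ = (algebraMap ℚ ℂ ((n.factorial : ℚ)⁻¹)) • x ^ n
    rw [map_inv₀, map_natCast]
  have hn : ∀ x : Grassmann O R, body x = 0 → IsNilpotent x := fun x hx =>
    ⟨_, pow_eq_zero_of_body_eq_zero hx (Nat.lt_succ_self _)⟩
  rw [key _ h0, key _ hμ, key _ hν, IsNilpotent.exp_add_of_commute h (hn _ hμ) (hn _ hν)]

theorem nexp_zero : nexp (0 : Grassmann O R) = 1 := by
  rw [nexp_eq (K := Fintype.card O + 1) rfl (by omega), Finset.sum_eq_single_of_mem 0 (by simp)]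
  · simp
  · intro n _ hn
    rw [zero_pow hn, smul_zero]

theorem hasOrder_nexp_sub {k : ℕ} {ν : Grassmann O R} (h : HasOrder k ν) :
    HasOrder (2 * k) (nexp ν - 1 - ν) := by
  -- The range in `nexp` has length `Fintype.card O + 2`, so the constant and linear terms can be
  -- split off even if there are no generators.
  have : nexp ν = 1 + ν + ∑ n ∈ Finset.range (Fintype.card O), (((n + 2).factorial : ℂ)⁻¹) • ν ^ (n + 2) := by
    rw [nexp, Finset.sum_range_succ', Finset.sum_range_succ']
    simp only [zero_add, Nat.factorial_zero, Nat.factorial_one, Nat.cast_one, inv_one, pow_zero,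
      pow_one, one_smul]
    abel
  rw [this, show 1 + ν + (∑ n ∈ Finset.range (Fintype.card O), (((n + 2).factorial : ℂ)⁻¹) • ν ^ (n + 2)) - 1 - ν =
    ∑ n ∈ Finset.range (Fintype.card O), (((n + 2).factorial : ℂ)⁻¹) • ν ^ (n + 2) by abel]
  exact HasOrder.sum fun n _ => ((h.pow _).smul _).mono (Nat.mul_le_mul_right k (by omega))

theorem map_nexp {D : Grassmann O R → Grassmann O R} (add : ∀ f g, D (f + g) = D f + D g)
    (smul : ∀ (c : ℂ) f, D (c • f) = c • D f)
    (mul : ∀ f g, HasParity 0 f → D (f * g) = D f * g + f * D g) {ν : Grassmann O R}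
    (h : body ν = 0) (hp : HasParity 0 ν) : D (nexp ν) = nexp ν * D ν := by
  have h0 : D 0 = 0 := by
    have := add 0 0
    rw [add_zero] at this
    exact left_eq_add.1 this
  have h1 : D 1 = 0 := by
    have := mul 1 1 HasParity.one
    rw [mul_one, one_mul, mul_one] at this
    exact left_eq_add.1 this
  have hpow : ∀ n : ℕ, D (ν ^ (n + 1)) = ((n : ℂ) + 1) • (ν ^ n * D ν) := by
    intro n
    induction n with
    | zero => simp
    | succ n ih =>
      have hc : ν ^ (n + 1) * D ν = D ν * ν ^ (n + 1) := (hp.pow (n + 1)).commute (D ν)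
      rw [pow_succ' ν (n + 1), mul _ _ hp, ih, mul_smul_comm, ← mul_assoc, ← pow_succ', ← hc]
      push_cast
      module
  conv_lhs => rw [nexp]
  rw [nexp_eq h (Nat.lt_succ_self _), Finset.sum_range_succ', add,
    show D (∑ n ∈ Finset.range (Fintype.card O + 1), (((n + 1).factorial : ℂ)⁻¹) • ν ^ (n + 1)) =
      ∑ n ∈ Finset.range (Fintype.card O + 1), D ((((n + 1).factorial : ℂ)⁻¹) • ν ^ (n + 1)) from
      map_sum (⟨⟨D, h0⟩, add⟩ : Grassmann O R →+ Grassmann O R) _ _, smul, pow_zero, h1, smul_zero,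
    add_zero, Finset.sum_mul]
  refine Finset.sum_congr rfl fun n _ => ?_
  rw [smul, hpow, smul_smul, smul_mul_assoc]
  congr 1
  rw [Nat.factorial_succ]
  push_cast
  have : (n : ℂ) + 1 ≠ 0 := by exact_mod_cast n.succ_ne_zero
  field_simp

/-- Every even element with body `1` is an exponential. -/
theorem exists_nexp_eq {K : Grassmann O R} (hK : HasParity 0 K) (hb : body K = 1) :
    ∃ ℓ, HasParity 0 ℓ ∧ body ℓ = 0 ∧ nexp ℓ = K := by
  -- Newton iteration for the logarithm. If `e^{-ℓ} K = 1 + y`, then `ℓ` is corrected by `y`, and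
  -- `e^{-y}(1 + y)` differs from `1` only in terms at least quadratic in `y`. The order grows until
  -- it exceeds the number of generators.
  have step : ∀ k : ℕ, ∃ ℓ, HasParity 0 ℓ ∧ body ℓ = 0 ∧ HasOrder (k + 1) (nexp (-ℓ) * K - 1) := by
    intro k
    induction k with
    | zero =>
      refine ⟨0, HasParity.zero 0, rfl, ?_⟩
      rw [neg_zero, nexp_zero, one_mul, zero_add, hasOrder_one_iff, body_sub, hb, body_one, sub_self]
    | succ k ih =>
      obtain ⟨ℓ, hp, hℓ, ho⟩ := ih
      set y := nexp (-ℓ) * K - 1 with hy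
      have hyp : HasParity 0 y := by
        have := (hp.neg.nexp.mul hK).sub (HasParity.one (O := O) (R := R))
        rwa [add_zero] at this
      have hyb : body y = 0 := hasOrder_one_iff.1 (ho.mono (by omega))
      have hneg : ∀ x : Grassmann O R, body x = 0 → body (-x) = 0 := fun x hx =>
        (congrArg Neg.neg hx).trans neg_zero
      refine ⟨ℓ + y, hp.add hyp, (congrArg₂ (· + ·) hℓ hyb).trans (add_zero 0), ?_⟩
      have h1 : nexp (-(ℓ + y)) * K = nexp (-y) * (1 + y) := by
        rw [neg_add_rev, nexp_add (hneg _ hyb) (hneg _ hℓ) (hyp.neg.commute _), mul_assoc, hy]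
        congr 1
        abel
      have h2 := (hasOrder_nexp_sub ho.neg).mul_right (1 + y)
      have h3 : nexp (-(ℓ + y)) * K - 1 = (nexp (-y) - 1 - -y) * (1 + y) - y * y := by
        rw [h1]; noncomm_ring
      rw [h3]
      exact (h2.mono (by omega)).sub ((ho.mul ho).mono (by omega))
  obtain ⟨ℓ, hp, hℓ, ho⟩ := step (Fintype.card O)
  refine ⟨ℓ, hp, hℓ, ?_⟩
  have h1 : nexp (-ℓ) * K = 1 := sub_eq_zero.1 (ho.eq_zero (Nat.lt_succ_self _))
  have hℓ' : body (-ℓ) = 0 := (congrArg Neg.neg hℓ).trans neg_zero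
  have h2 : nexp ℓ * nexp (-ℓ) = 1 := by
    rw [← nexp_add hℓ hℓ' (hp.commute _), add_neg_cancel, nexp_zero]
  rw [← mul_one (nexp ℓ), ← h1, ← mul_assoc, h2, one_mul]

end NilExp

end Grassmann

section SuperExp

variable {N : ℕ} {U : TopologicalSpace.Opens (Fin N → ℝ)}

theorem superExp_eq (f : SuperFun U) :
    superExp f = const (Smooth.exp (body f)) * nexp (f - const (body f)) := by
  rw [nexp_eq (K := N + 1) _ (by rw [Fintype.card_fin]; omega)]
  · rfl
  · exact hasOrder_one_iff.1 (hasOrder_sub_const f)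

theorem body_sub_const {O R : Type*} [LinearOrder O] [CommRing R] (f : Grassmann O R) :
    body (f - const (body f)) = 0 := hasOrder_one_iff.1 (hasOrder_sub_const f)

theorem HasParity.sub_const {O R : Type*} [LinearOrder O] [CommRing R] {f : Grassmann O R}
    (h : HasParity 0 f) : HasParity 0 (f - const (body f)) := h.sub (HasParity.const _)

theorem HasParity.superExp {f : SuperFun U} (h : HasParity 0 f) : HasParity 0 (superExp f) := by
  rw [superExp_eq]
  exact (HasParity.const _).mul (HasParity.sub_const h).nexp

theorem superExp_add {f g : SuperFun U} (hf : HasParity 0 f) :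
    superExp (f + g) = superExp f * superExp g := by
  have hb : body (f + g) = body f + body g := rfl
  have e1 : f + g - const (body (f + g)) = (f - const (body f)) + (g - const (body g)) := by
    rw [hb, const_add, add_sub_add_comm]
  rw [superExp_eq, superExp_eq f, superExp_eq g, e1, hb, Smooth.exp_add, const_mul,
    nexp_add (body_sub_const f) (body_sub_const g) ((HasParity.sub_const hf).commute _), mul_assoc,
    mul_assoc, ← mul_assoc (const (Smooth.exp (body g))), const_mul_comm (Smooth.exp (body g)),
    mul_assoc]

theorem superExp_zero : superExp (0 : SuperFun U) = 1 := by
  have hb : body (0 : SuperFun U) = 0 := rfl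
  rw [superExp_eq, hb, Smooth.exp_zero, const_one, const_zero, sub_zero, nexp_zero, one_mul]

theorem isUnit_superExp {f : SuperFun U} (hf : HasParity 0 f) : IsUnit (superExp f) := by
  have h1 : superExp f * superExp (-f) = 1 := by
    rw [← superExp_add hf, add_neg_cancel, superExp_zero]
  have h2 : superExp (-f) * superExp f = 1 := by
    rw [← superExp_add hf.neg, neg_add_cancel, superExp_zero]
  exact ⟨⟨_, _, h1, h2⟩, rfl⟩

theorem dl_mul_even {f : SuperFun U} (hf : HasParity 0 f) (A : Idx N) (g : SuperFun U) :
    dl A (f * g) = dl A f * g + f * dl A g := by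
  rw [dl_mul, hf.sig, mul_zero, sg_zero]
  exact congrArg (dl A f * g + · * dl A g) (one_zsmul f)

theorem dl_const_exp (A : Idx N) (β : Smooth U) :
    dl A (const (Smooth.exp β) : SuperFun U) = const (Smooth.exp β) * dl A (const β) := by
  rcases A with i | i
  · rw [dl_inl, dl_inl, mapCoeff_pd_const, mapCoeff_pd_const, Smooth.pd_exp, mul_comm, const_mul]
  · rw [dl_inr, dl_inr, leftD_const, leftD_const]
    exact (mul_zero (const (Smooth.exp β) : Grassmann (Fin N) (Smooth U))).symm

theorem dl_superExp {f : SuperFun U} (hf : HasParity 0 f) (A : Idx N) :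
    dl A (superExp f) = superExp f * dl A f := by
  have hn := map_nexp (dl_add A) (dl_smul A) (fun f g hf => dl_mul_even hf A g)
    (body_sub_const f) (HasParity.sub_const hf)
  have hc : dl A f = dl A (const (body f)) + dl A (f - const (body f)) := by
    rw [← dl_add, add_sub_cancel]
  have h2 : nexp (f - const (body f)) * dl A (const (body f)) =
      dl A (const (body f)) * nexp (f - const (body f)) :=
    (HasParity.sub_const hf).nexp.commute (dl A (const (body f)))
  rw [superExp_eq, dl_mul_even (HasParity.const _), dl_const_exp, hn, hc, mul_add, mul_assoc,
    mul_assoc, mul_assoc, h2]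

/-- The body is the only obstruction to a logarithm. Dividing by the exponential of `β` normalises
the body to `1`, where `exists_nexp_eq` applies. -/
theorem exists_superExp_eq {K : SuperFun U} (hK : HasParity 0 K) {β : Smooth U}
    (hβ : Smooth.exp β = body K) : ∃ ℓ : SuperFun U, HasParity 0 ℓ ∧ superExp ℓ = K := by
  have h1 : Smooth.exp (-β) * body K = 1 := by
    rw [← hβ, ← Smooth.exp_add, neg_add_cancel, Smooth.exp_zero]
  obtain ⟨ℓ, hp, hb, he⟩ := exists_nexp_eq (K := const (Smooth.exp (-β)) * K)
    (by have := (HasParity.const (O := Fin N) (Smooth.exp (-β))).mul hK; rwa [add_zero] at this)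
    (by rw [body_mul, body_const, h1])
  refine ⟨const β + ℓ, (HasParity.const β).add hp, ?_⟩
  have hb' : body (const β + ℓ : SuperFun U) = β := by
    have : body (const β + ℓ : SuperFun U) = body (const β : SuperFun U) + body ℓ := rfl
    rw [this, hb, body_const, add_zero]
  rw [superExp_eq, hb', add_sub_cancel_left, he, ← mul_assoc, ← const_mul, ← Smooth.exp_add,
    add_neg_cancel, Smooth.exp_zero, const_one, one_mul]

end SuperExp
end
end SuperBV

set_option linter.unusedSectionVars false
namespace SuperBV
noncomputable section
open Grassmann

theorem map_ringInverse {A B : Type*} [Ring A] [Ring B] (φ : A →+* B) {a : A} (h : IsUnit a) :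
    φ (Ring.inverse a) = Ring.inverse (φ a) := by
  obtain ⟨u, rfl⟩ := h
  rw [Ring.inverse_unit]
  exact (Ring.inverse_unit (Units.map (φ : A →* B) u)).symm

/-! ### Functoriality in the coefficient ring -/

namespace Grassmann

variable {O R R' : Type*} [LinearOrder O] [CommRing R] [CommRing R']

theorem mapHom_coeff (φ : R →+* R') (f : Grassmann O R) (S : Finset O) :
    (mapHom φ f).coeff S = φ (f.coeff S) := rfl

theorem HasParity.mapHom {p : ZMod 2} {f : Grassmann O R} (h : HasParity p f) (φ : R →+* R') :
    HasParity p (Grassmann.mapHom φ f) := fun S hS => by rw [mapHom_coeff, h S hS, map_zero]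

theorem mapHom_tau (φ : R →+* R') (f : Grassmann O R) : mapHom φ (tau f) = tau (mapHom φ f) := by
  ext S
  rw [mapHom_coeff, tau_coeff, tau_coeff, mapHom_coeff, map_mul, map_pow, map_neg, map_one]

theorem mapHom_sig (φ : R →+* R') (p : ZMod 2) (f : Grassmann O R) :
    mapHom φ (sig p f) = sig p (mapHom φ f) := by
  rcases zmod_two_cases p with rfl | rfl
  · rfl
  · exact mapHom_tau φ f

theorem mapHom_leftD (φ : R →+* R') (o : O) (f : Grassmann O R) :
    mapHom φ (leftD o f) = leftD o (mapHom φ f) := by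
  ext S
  simp only [mapHom_coeff, leftD]
  split
  · exact map_zero φ
  · rw [map_mul, map_pow, map_neg, map_one]

/-- The homomorphism of even subrings induced by one of the coefficients. -/
def evenMapHom (φ : R →+* R') : evenSubring O R →+* evenSubring O R' :=
  ((mapHom φ).comp (evenSubring O R).subtype).codRestrict (evenSubring O R') fun f =>
    mem_evenSubring_iff.2 ((hasParity_coe f).mapHom φ)

theorem evenMapHom_coe (φ : R →+* R') (f : evenSubring O R) :
    (evenMapHom φ f : Grassmann O R') = mapHom φ (f : Grassmann O R) := rfl

theorem evenMapHom_evenPart (φ : R →+* R') (f : Grassmann O R) :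
    evenMapHom φ (evenPart f) = evenPart (mapHom φ f) := by
  apply Subtype.ext
  ext S
  change φ (if Odd S.card then 0 else f.coeff S) = if Odd S.card then 0 else φ (f.coeff S)
  rw [apply_ite φ, map_zero]

/-- Invertibility of the supermatrix makes its odd-odd block invertible. A homomorphism respects
`Ring.inverse` and the matrix inverse on units, whereas the default values taken elsewhere need not
be preserved. -/
theorem mapHom_sdet [Fintype O] {ι : Type*} [Fintype ι] [DecidableEq ι] {p : ι → ZMod 2}
    {M : Matrix ι ι (Grassmann O R)} (hM : ∀ i j, HasParity (p i + p j) (M i j)) (hu : IsUnit M)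
    (φ : R →+* R') : mapHom φ (sdet p M) = sdet p (M.map (mapHom φ)) := by
  have hD := isUnit_odd_block hM hu
  simp only [sdet]
  set a : {i // p i = 0} → ι := Subtype.val
  set b : {i // p i = 1} → ι := Subtype.val
  set D := (M.submatrix b b).map evenPart with hDdef
  have hDmap : ((M.map (mapHom φ)).submatrix b b).map evenPart = D.map (evenMapHom φ) := by
    ext1 i j
    exact (evenMapHom_evenPart φ _).symm
  have hDinv : (D.map (evenMapHom φ))⁻¹ = D⁻¹.map (evenMapHom φ) := by
    refine Matrix.inv_eq_right_inv ?_
    rw [← Matrix.map_mul, Matrix.mul_nonsing_inv _ hD, Matrix.map_one _ (map_zero _) (map_one _)]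
  rw [hDmap, hDinv, ← evenMapHom_coe, map_mul, map_ringInverse _ hD, RingHom.map_det,
    RingHom.map_det]
  refine congrArg (fun x : evenSubring O R' => (x : Grassmann O R')) ?_
  refine congrArg₂ (· * ·) (congrArg Matrix.det ?_) rfl
  ext1 i j
  refine (evenMapHom_evenPart φ _).trans (congrArg evenPart ?_)
  rw [Matrix.sub_apply, map_sub, Matrix.mul_apply, Matrix.sub_apply, Matrix.mul_apply, map_sum]
  refine congrArg₂ (· - ·) rfl (Finset.sum_congr rfl fun k _ => ?_)
  rw [map_mul, Matrix.mul_apply, Matrix.mul_apply, map_sum]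
  refine congrArg₂ (· * ·) (Finset.sum_congr rfl fun l _ => ?_) rfl
  rw [map_mul]
  rfl

end Grassmann

/-! ### Restriction -/

section Restrict

variable {N : ℕ} {U W : TopologicalSpace.Opens (Fin N → ℝ)} (h : W ≤ U)

/-- Restriction of superfunctions as a homomorphism. -/
def restrictHom : SuperFun U →+* SuperFun W := mapHom (Smooth.restrictHom h)

theorem restrictHom_apply (f : SuperFun U) : restrictHom h f = restrict h f := rfl

theorem restrict_smul (c : ℂ) (f : SuperFun U) : restrict h (c • f) = c • restrict h f := rfl

theorem dl_restrict (A : Idx N) (f : SuperFun U) :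
    dl A (restrictHom h f) = restrictHom h (dl A f) := by
  rcases A with i | i
  · ext1; funext S
    exact Smooth.pd_restrict h i _
  · exact (mapHom_leftD _ i f).symm

theorem dr_restrict (A : Idx N) (f : SuperFun U) :
    dr A (restrictHom h f) = restrictHom h (dr A f) := by
  rw [dr_eq, dr_eq, dl_restrict]
  exact (mapHom_sig _ _ _).symm

theorem superExp_restrict (f : SuperFun U) :
    superExp (restrictHom h f) = restrictHom h (superExp f) := by
  have hb : restrictHom h (const (body f)) = const (body (restrictHom h f)) := by
    ext1; funext S
    change Smooth.restrictHom h (if S = ∅ then body f else 0) = if S = ∅ then _ else 0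
    rw [apply_ite (Smooth.restrictHom h), map_zero]
    rfl
  have he : restrictHom h (const (Smooth.exp (body f))) =
      const (Smooth.exp (body (restrictHom h f))) := by
    ext1; funext S
    change Smooth.restrictHom h (if S = ∅ then Smooth.exp (body f) else 0) = if S = ∅ then _ else 0
    rw [apply_ite (Smooth.restrictHom h), map_zero]
    rfl
  rw [superExp, superExp, map_mul, he, map_sum]
  refine congrArg _ (Finset.sum_congr rfl fun n _ => ?_)
  rw [← hb, ← map_sub, ← map_pow]
  rfl

theorem isUnit_map_restrict {ι : Type*} [Fintype ι] [DecidableEq ι]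
    {M : Matrix ι ι (SuperFun U)} (hu : IsUnit M) : IsUnit (M.map (restrictHom h)) :=
  hu.map (restrictHom h).mapMatrix

theorem inverse_map_restrict {ι : Type*} [Fintype ι] [DecidableEq ι]
    {M : Matrix ι ι (SuperFun U)} (hu : IsUnit M) :
    Ring.inverse (M.map (restrictHom h)) = (Ring.inverse M).map (restrictHom h) :=
  (map_ringInverse (restrictHom h).mapMatrix hu).symm

theorem bracket_restrict (E : Matrix (Idx N) (Idx N) (SuperFun U)) (f g : SuperFun U) :
    bracket par dl (E.map (restrictHom h)) (restrictHom h f) (restrictHom h g) =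
      restrictHom h (bracket par dl E f g) := by
  simp only [bracket, map_sum, map_mul, rd_dl, dr_restrict, dl_restrict, Matrix.map_apply]

theorem laplacian_restrict (E : Matrix (Idx N) (Idx N) (SuperFun U)) {ρ : SuperFun U}
    (hu : IsUnit ρ) (f : SuperFun U) :
    laplacian par dl (E.map (restrictHom h)) (restrictHom h ρ) (restrictHom h f) =
      restrictHom h (laplacian par dl E ρ f) := by
  rw [laplacian, laplacian, restrictHom_apply h ((2⁻¹ : ℂ) • _), restrict_smul,
    ← restrictHom_apply]
  simp only [map_sum, map_mul, map_zsmul, Matrix.map_apply, map_ringInverse _ hu,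
    ← dl_restrict]

theorem jacobian_restrict (Γ' : Idx N → SuperFun U) :
    jacobian par dl (fun A => restrictHom h (Γ' A)) = (jacobian par dl Γ').map (restrictHom h) := by
  ext1 A B
  change rd par dl B (restrictHom h (Γ' A)) = restrictHom h (rd par dl B (Γ' A))
  rw [rd_dl, rd_dl, dr_restrict]

theorem drNew_restrict {Γ' : Idx N → SuperFun U} (hu : IsUnit (jacobian par dl Γ')) (A : Idx N)
    (g : SuperFun U) : drNew par dl (fun A => restrictHom h (Γ' A)) A (restrictHom h g) =
      restrictHom h (drNew par dl Γ' A g) := by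
  rw [drNew, drNew, jacobian_restrict, inverse_map_restrict h hu, map_sum]
  refine Finset.sum_congr rfl fun B _ => ?_
  rw [rd_dl, rd_dl, dr_restrict, map_mul]
  rfl

theorem barGamma_restrict (ε : Fin N → ZMod 2) (F G : Fin N → SuperFun U) (A : Idx N) :
    barGamma ε (fun α => restrict h (F α)) (fun α => restrict h (G α)) A =
      restrictHom h (barGamma ε F G A) := by
  rcases A with α | α <;> simp only [barGamma, Sum.elim_inl, Sum.elim_inr] <;> split <;> rfl

theorem IsCoordinateSystem.restrict {Γ' : Idx N → SuperFun U} (hΓ : IsCoordinateSystem Γ') :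
    IsCoordinateSystem (fun A => restrictHom h (Γ' A)) where
  parity A := (hΓ.parity A).mapHom _
  real i x := hΓ.real i ⟨x, h x.2⟩
  injective x y hxy := by
    have := hΓ.injective (a₁ := ⟨x, h x.2⟩) (a₂ := ⟨y, h y.2⟩) hxy
    exact Subtype.ext (Subtype.mk.inj this)
  jacobian := by
    have := isUnit_map_restrict h hΓ.jacobian
    rwa [← jacobian_dl, ← jacobian_restrict, jacobian_dl] at this

theorem lambdaMatrix_restrict (E : Matrix (Idx N) (Idx N) (SuperFun U)) (F G : Fin N → SuperFun U) :
    lambdaMatrix (E.map (restrict h)) (fun α => restrict h (F α)) (fun α => restrict h (G α)) =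
      (lambdaMatrix E F G).map (restrictHom h) := by
  ext1 α β
  change antibracket (E.map (restrictHom h)) (restrictHom h (F α)) (restrictHom h (G β)) =
    restrictHom h (antibracket E (F α) (G β))
  rw [← bracket_dl, ← bracket_dl, bracket_restrict]

end Restrict
end
end SuperBV

set_option linter.unusedSectionVars false
namespace SuperBV
noncomputable section
open Grassmann

/-! ### The coordinates `{F; G}` of an involutive system -/

namespace Grassmann

variable {O R κ : Type*} [LinearOrder O] [CommRing R] [Fintype κ] {ε : κ → ZMod 2}

/-- The ideal generated by homogeneous elements `G_α`. -/
def idealG (G : κ → Grassmann O R) : AddSubgroup (Grassmann O R) where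
  carrier := {x | ∃ B : κ → Grassmann O R, x = ∑ α, G α * B α}
  zero_mem' := ⟨0, by simp⟩
  add_mem' := by
    rintro _ _ ⟨B, rfl⟩ ⟨C, rfl⟩
    exact ⟨B + C, by simp [mul_add, Finset.sum_add_distrib]⟩
  neg_mem' := by
    rintro _ ⟨B, rfl⟩
    exact ⟨-B, by simp⟩

theorem mem_idealG [DecidableEq κ] (G : κ → Grassmann O R) (α : κ) : G α ∈ idealG G :=
  ⟨Pi.single α 1, by simp [Pi.single_apply]⟩

theorem idealG_mul_right (G : κ → Grassmann O R) (x : Grassmann O R) :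
    ∀ y ∈ idealG G, y * x ∈ idealG G := by
  rintro _ ⟨B, rfl⟩
  exact ⟨fun α => B α * x, by simp [Finset.sum_mul, mul_assoc]⟩

theorem idealG_mul_left {G : κ → Grassmann O R} (hG : ∀ α, HasParity (ε α) (G α))
    (x : Grassmann O R) : ∀ y ∈ idealG G, x * y ∈ idealG G := by
  rintro _ ⟨B, rfl⟩
  refine ⟨fun α => sig (ε α) x * B α, ?_⟩
  rw [Finset.mul_sum]
  exact Finset.sum_congr rfl fun α _ => by rw [← mul_assoc, (hG α).mul_eq_mul_sig, mul_assoc]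

theorem mapHom_mem_idealG {R' : Type*} [CommRing R'] (φ : R →+* R') {G : κ → Grassmann O R}
    {x : Grassmann O R} (h : x ∈ idealG G) : mapHom φ x ∈ idealG (fun α => mapHom φ (G α)) := by
  obtain ⟨B, rfl⟩ := h
  exact ⟨fun α => mapHom φ (B α), by rw [map_sum]; simp only [map_mul]⟩

end Grassmann

section Coordinates

variable {N : ℕ} {U : TopologicalSpace.Opens (Fin N → ℝ)} {ε : Fin N → ZMod 2}

/-- The position of `G_α` among the coordinates `{F^α; G_α}`. -/
def idxG (ε : Fin N → ZMod 2) (α : Fin N) : Idx N := if ε α = 0 then Sum.inl α else Sum.inr α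

/-- The labelling of the coordinates `{F; G}`. -/
def coordEquiv (ε : Fin N → ZMod 2) : Fin N ⊕ Fin N ≃ Idx N where
  toFun := Sum.elim (idxF ε) (idxG ε)
  invFun := Sum.elim (idxF ε) (idxG ε)
  left_inv A := by rcases A with α | α <;> by_cases h : ε α = 0 <;> simp [idxF, idxG, h]
  right_inv A := by rcases A with α | α <;> by_cases h : ε α = 0 <;> simp [idxF, idxG, h]

theorem coordEquiv_inl (α : Fin N) : coordEquiv ε (Sum.inl α) = idxF ε α := rfl

theorem coordEquiv_inr (α : Fin N) : coordEquiv ε (Sum.inr α) = idxG ε α := rfl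

theorem par_idxF (α : Fin N) : par (idxF ε α) = ε α + 1 := by
  rcases zmod_two_cases (ε α) with h | h <;> simp [idxF, h, par_inl, par_inr]; rfl

theorem par_idxG (α : Fin N) : par (idxG ε α) = ε α := by
  rcases zmod_two_cases (ε α) with h | h <;> simp [idxG, h, par_inl, par_inr]

theorem barGamma_idxF (F G : Fin N → SuperFun U) (α : Fin N) :
    barGamma ε F G (idxF ε α) = F α := by
  by_cases h : ε α = 0 <;> simp [idxF, barGamma, h]

theorem barGamma_idxG (F G : Fin N → SuperFun U) (α : Fin N) :
    barGamma ε F G (idxG ε α) = G α := by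
  by_cases h : ε α = 0 <;> simp [idxG, barGamma, h]

theorem sum_idx {M : Type*} [AddCommMonoid M] (ε : Fin N → ZMod 2) (f : Idx N → M) :
    ∑ A, f A = ∑ α, f (idxF ε α) + ∑ α, f (idxG ε α) := by
  rw [← (coordEquiv ε).sum_comp, Fintype.sum_sum_type]
  rfl

/-- Evaluation of the body at a point. -/
def evalBody (x : U) : SuperFun U →+* ℂ := (Smooth.evalHom x).comp (bodyHom (Fin N) (Smooth U))

theorem evalBody_apply (x : U) (f : SuperFun U) : evalBody x f = (body f).1 x := rfl

/-- At the point `x` the matrix `P` of all brackets of the coordinates `{F; G}` is the congruence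
transform of the invertible `E` by the Jacobian matrix, so it is invertible. Its `GG` block vanishes
by assumption. A vector in the kernel of the `FG` block, extended by zero, would then lie in the
kernel of `P`. -/
theorem det_lambdaMatrix_ne_zero {E : Matrix (Idx N) (Idx N) (SuperFun U)} (hE : IsUnit E)
    {F G : Fin N → SuperFun U} (hFG : IsCoordinateSystem (barGamma ε F G)) {x : U}
    (hx : ∀ α β, evalBody x (antibracket E (G α) (G β)) = 0) :
    ((lambdaMatrix E F G).map (evalBody x)).det ≠ 0 := by
  set Γ := barGamma ε F G with hΓ
  set P : Matrix (Idx N) (Idx N) ℂ :=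
    Matrix.of fun A B => evalBody x (antibracket E (Γ A) (Γ B)) with hP
  have hM := hFG.jacobian.map (evalBody x).mapMatrix
  have hE' := hE.map (evalBody x).mapMatrix
  have hPM : P = (evalBody x).mapMatrix (jacobianMatrix Γ) * (evalBody x).mapMatrix E *
      ((evalBody x).mapMatrix (jacobianMatrix Γ)).transpose := by
    ext A B
    rw [Matrix.mul_apply, hP, Matrix.of_apply, antibracket, map_sum, Finset.sum_congr rfl
      fun _ _ => map_sum _ _ _, Finset.sum_comm]
    refine Finset.sum_congr rfl fun D _ => ?_
    rw [Matrix.mul_apply, Finset.sum_mul]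
    refine Finset.sum_congr rfl fun C _ => ?_
    rw [map_mul, map_mul]
    refine congrArg₂ (· * ·) rfl ?_
    -- Left and right derivatives differ by the parity involution, which does not affect the body.
    -- This is why the transposed Jacobian matrix appears on the right.
    change evalBody x (dl D (Γ B)) = evalBody x (dr D (Γ B))
    rw [evalBody_apply, evalBody_apply, dr_eq, body_sig]
  have hdet : IsUnit P.det := by
    rw [hPM, Matrix.det_mul, Matrix.det_mul, Matrix.det_transpose]
    have h1 := (Matrix.isUnit_iff_isUnit_det _).1 hM
    exact (h1.mul ((Matrix.isUnit_iff_isUnit_det _).1 hE')).mul h1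
  intro h0
  obtain ⟨v, hv, hΛ⟩ := Matrix.exists_mulVec_eq_zero_iff.2 h0
  refine hdet.ne_zero (Matrix.exists_mulVec_eq_zero_iff.1
    ⟨fun A => Sum.elim (fun _ => 0) v ((coordEquiv ε).symm A), fun hw => hv ?_, ?_⟩)
  · funext α
    have := congrFun hw (coordEquiv ε (Sum.inr α))
    simpa using this
  · have key : ∀ A, P.mulVec (fun A => Sum.elim (fun _ => 0) v ((coordEquiv ε).symm A)) A =
        ∑ α, P A (idxG ε α) * v α := fun A => by
      rw [Matrix.mulVec, dotProduct, ← (coordEquiv ε).sum_comp, Fintype.sum_sum_type]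
      simp only [Equiv.symm_apply_apply, Sum.elim_inl, Sum.elim_inr, mul_zero,
        Finset.sum_const_zero, zero_add]
      rfl
    funext A
    obtain ⟨B, rfl⟩ := (coordEquiv ε).surjective A
    rw [key]
    rcases B with γ | γ
    · have := congrFun hΛ γ
      rw [Matrix.mulVec, dotProduct] at this
      refine Eq.trans (Finset.sum_congr rfl fun α _ => ?_) this
      rw [hP, Matrix.of_apply, coordEquiv_inl, hΓ, barGamma_idxF, barGamma_idxG]
      rfl
    · refine Finset.sum_eq_zero fun α _ => ?_
      rw [hP, Matrix.of_apply, coordEquiv_inr, hΓ, barGamma_idxG, barGamma_idxG, hx, zero_mul]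

theorem isUnit_lambdaMatrix {E : Matrix (Idx N) (Idx N) (SuperFun U)} {F G : Fin N → SuperFun U}
    (h : ∀ x : U, ((lambdaMatrix E F G).map (evalBody x)).det ≠ 0) :
    IsUnit (lambdaMatrix E F G) := by
  refine isUnit_matrix_of_body ((Matrix.isUnit_iff_isUnit_det _).2
    (Smooth.isUnit_of_ne_zero fun x => ?_))
  have := h x
  rwa [show (lambdaMatrix E F G).map (evalBody x) =
    (Smooth.evalHom x).mapMatrix ((lambdaMatrix E F G).map body) from rfl,
    ← RingHom.map_det] at this

/-- The equations that the Quantum Master Equation imposes on the lowest order terms of the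
action, together with a coordinate system `{F; G}`. -/
structure IsGaugeSystem (ε : Fin N → ZMod 2) (E : Matrix (Idx N) (Idx N) (SuperFun U))
    (ρ : SuperFun U) (F G : Fin N → SuperFun U) (H : SuperFun U) (Vs : Fin N → Fin N → SuperFun U)
    (Y : Fin N → Fin N → Fin N → SuperFun U) : Prop where
  parityE : ∀ A B, HasParity (par A + par B + 1) (E A B)
  parityρ : HasParity 0 ρ
  isUnit : IsUnit ρ
  coord : IsCoordinateSystem (barGamma ε F G)
  parityH : HasParity 0 H
  parityY : ∀ γ α β, HasParity (ε γ + ε α + ε β + 1) (Y γ α β)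
  involution : ∀ α β, bracket par dl E (G α) (G β) = ∑ γ, G γ * Y γ α β
  jacobi : ∀ α γ β, bracket par dl E (bracket par dl E (F α) (G γ)) (G β) =
    bracket par dl E (F α) (bracket par dl E (G γ) (G β)) +
      sg ((ε γ + 1) * (ε β + 1)) • bracket par dl E (bracket par dl E (F α) (G β)) (G γ)
  equation : ∀ β, laplacian par dl E ρ (G β) - bracket par dl E H (G β) -
    ∑ α, sg (ε α) • Y α α β = ∑ α, G α * Vs α β

namespace IsGaugeSystem

variable {E : Matrix (Idx N) (Idx N) (SuperFun U)} {ρ : SuperFun U} {F G : Fin N → SuperFun U}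
  {H : SuperFun U} {Vs : Fin N → Fin N → SuperFun U} {Y : Fin N → Fin N → Fin N → SuperFun U}
  (h : IsGaugeSystem ε E ρ F G H Vs Y)

include h

theorem parityG (α : Fin N) : HasParity (ε α) (G α) := by
  have := h.coord.parity (idxG ε α)
  rwa [barGamma_idxG, par_idxG] at this

theorem isInvolutive {J : AddSubgroup (SuperFun U)} (hl : ∀ x, ∀ y ∈ J, x * y ∈ J)
    (hr : ∀ x, ∀ y ∈ J, y * x ∈ J) (hm : (∀ α, G α ∈ J) ∨ ∀ γ α β, Y γ α β = 0) :
    IsInvolutive par dl E (barGamma ε F G) ε F G Y (coordEquiv ε) J where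
  der := isSuperDer_dl
  parityE := h.parityE
  parity := h.coord.parity
  isUnit := by rw [jacobian_dl]; exact h.coord.jacobian
  π_inl := par_idxF
  π_inr := par_idxG
  eq_F := barGamma_idxF F G
  eq_G := barGamma_idxG F G
  involution := h.involution
  parityY := h.parityY
  jacobi := h.jacobi
  mul_left_mem := hl
  mul_right_mem := hr
  mem := hm

/-- The choice of `J` for the on-shell statement: everything is computed modulo the ideal of the
constraints. -/
theorem isInvolutive_idealG :
    IsInvolutive par dl E (barGamma ε F G) ε F G Y (coordEquiv ε) (idealG G) :=
  h.isInvolutive (idealG_mul_left h.parityG) (idealG_mul_right G) (Or.inl (mem_idealG G))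

/-- The choice of `J` for the Abelian case: with `Y = 0` nothing has to be discarded, and the
congruences become equalities. -/
theorem isInvolutive_bot (hY : ∀ γ α β, Y γ α β = 0) :
    IsInvolutive par dl E (barGamma ε F G) ε F G Y (coordEquiv ε) ⊥ :=
  h.isInvolutive (by rintro x _ rfl; exact mul_zero x) (by rintro x _ rfl; exact zero_mul x)
    (Or.inr hY)

theorem restrictTo {W : TopologicalSpace.Opens (Fin N → ℝ)} (hW : W ≤ U) :
    IsGaugeSystem ε (E.map (restrictHom hW)) (restrictHom hW ρ) (fun α => restrictHom hW (F α))
      (fun α => restrictHom hW (G α)) (restrictHom hW H) (fun α β => restrictHom hW (Vs α β))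
      (fun γ α β => restrictHom hW (Y γ α β)) where
  parityE A B := (h.parityE A B).mapHom _
  parityρ := h.parityρ.mapHom _
  isUnit := h.isUnit.map _
  coord := by
    have := h.coord.restrict hW
    rwa [show (fun A => restrictHom hW (barGamma ε F G A)) = _ from
      funext fun A => (barGamma_restrict hW ε F G A).symm] at this
  parityH := h.parityH.mapHom _
  parityY γ α β := (h.parityY γ α β).mapHom _
  involution α β := by rw [bracket_restrict, h.involution, map_sum]; simp only [map_mul]
  jacobi α γ β := by
    simp only [bracket_restrict]
    rw [h.jacobi, map_add, map_zsmul]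
  equation β := by
    rw [laplacian_restrict hW E h.isUnit, bracket_restrict]
    simp only [← map_zsmul, ← map_sum, ← map_sub, ← map_mul, h.equation]

end IsGaugeSystem

theorem bracket_superExp (E : Matrix (Idx N) (Idx N) (SuperFun U)) {f : SuperFun U}
    (hf : HasParity 0 f) (g : SuperFun U) :
    bracket par dl E (superExp f) g = superExp f * bracket par dl E f g := by
  rw [bracket_eq, bracket_eq, Finset.mul_sum]
  refine Finset.sum_congr rfl fun A _ => ?_
  rw [rd, rd, dl_superExp hf, map_mul, (HasParity.superExp hf).sig, mul_zero, sg_zero, ← mul_assoc]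
  exact congrArg (· * _ * _) (one_zsmul _)

theorem drNew_superExp (Γ' : Idx N → SuperFun U) {f : SuperFun U} (hf : HasParity 0 f)
    (A : Idx N) :
    drNew par dl Γ' A (superExp f) = superExp f * drNew par dl Γ' A f := by
  rw [drNew, drNew, Finset.mul_sum]
  refine Finset.sum_congr rfl fun B _ => ?_
  rw [rd, rd, dl_superExp hf, map_mul, (HasParity.superExp hf).sig, mul_zero, sg_zero, ← mul_assoc]
  exact congrArg (· * _ * _) (one_zsmul _)

end Coordinates

/-! ### Derivatives along the `F` from brackets with the `G` -/

section DrNew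

variable {O R ι κ : Type*} [LinearOrder O] [CommRing R] [Fintype O] [Fintype ι] [DecidableEq ι]
  [Fintype κ] [DecidableEq κ] {π : ι → ZMod 2} {d : ι → Grassmann O R → Grassmann O R}
  {E : Matrix ι ι (Grassmann O R)} {Γ' : ι → Grassmann O R} {ε : κ → ZMod 2}
  {F G : κ → Grassmann O R} {Y : κ → κ → κ → Grassmann O R} {J : AddSubgroup (Grassmann O R)}
  {e : κ ⊕ κ ≃ ι}

/-- By `bracket_sub_mem` the brackets with the `G_γ` are, modulo `J`, the derivatives along the
`F^η` contracted with `Λ`. Contraction with `Λ⁻¹` solves for the derivatives. -/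
theorem IsInvolutive.drNew_sub_mem (h : IsInvolutive π d E Γ' ε F G Y e J)
    (hΛ : IsUnit (Matrix.of fun α β => bracket π d E (F α) (G β))) (f : Grassmann O R) (δ : κ) :
    drNew π d Γ' (e (Sum.inl δ)) f - ∑ γ, bracket π d E f (G γ) *
      Ring.inverse (Matrix.of fun α β => bracket π d E (F α) (G β)) γ δ ∈ J := by
  set Λ : Matrix κ κ (Grassmann O R) := Matrix.of fun α β => bracket π d E (F α) (G β) with hΛdef
  have h1 : ∀ η, ∑ γ, bracket π d E (F η) (G γ) * Ring.inverse Λ γ δ = if η = δ then 1 else 0 :=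
    fun η => by
      have := congrFun (congrFun (Ring.mul_inverse_cancel Λ hΛ) η) δ
      rwa [Matrix.mul_apply, Matrix.one_apply] at this
  have h2 : drNew π d Γ' (e (Sum.inl δ)) f =
      ∑ γ, (∑ η, drNew π d Γ' (e (Sum.inl η)) f * bracket π d E (F η) (G γ)) *
        Ring.inverse Λ γ δ := by
    simp only [Finset.sum_mul, mul_assoc]
    rw [Finset.sum_comm]
    simp only [← Finset.mul_sum, h1, mul_ite, mul_one, mul_zero, Finset.sum_ite_eq',
      Finset.mem_univ, if_true]
  rw [h2, ← Finset.sum_sub_distrib]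
  refine J.sum_mem fun γ _ => ?_
  rw [← sub_mul, ← neg_sub, neg_mul]
  exact J.neg_mem (h.mul_right_mem _ _ (h.bracket_sub_mem f γ))

end DrNew
end
end SuperBV

set_option linter.unusedSectionVars false
namespace SuperBV
noncomputable section
open Grassmann

/-! ### The logarithmic derivative of the radicand -/

namespace Grassmann

variable {O R : Type*} [LinearOrder O] [CommRing R] [Algebra ℂ R]

theorem complex_two_smul (f : Grassmann O R) : (2 : ℂ) • f = f + f := two_smul ℂ f

theorem log_derivative_identity {e : Grassmann O R} (hx : ∀ x, x * e = e * x)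
    (a b y l q : Grassmann O R) : q * (e * ((2 : ℂ) • b)) + a * e =
      (a - q * ((2 : ℤ) • y - (2 : ℂ) • l)) * e - q * e * ((2 : ℂ) • (l - b - y)) := by
  rw [sub_mul, mul_assoc q ((2 : ℤ) • y - (2 : ℂ) • l) e, hx ((2 : ℤ) • y - (2 : ℂ) • l),
    complex_two_smul, complex_two_smul, complex_two_smul, two_smul ℤ]
  noncomm_ring

theorem eq_neg_of_unit_mul {κ : Type*} [Fintype κ] {s : κ → ℤ} {b l : Grassmann O R}
    {u : Grassmann O R} (hu : IsUnit u)
    (hx : u * ((2 : ℂ) • b) - u * ((2 : ℤ) • ∑ α, s α • (0 : Grassmann O R) - (2 : ℂ) • l) = 0) :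
    b = -l := by
  simp only [smul_zero, Finset.sum_const_zero, zero_sub] at hx
  rw [← mul_sub] at hx
  have h8 := hu.mul_right_eq_zero.1 hx
  have h9 : (2 : ℂ) • (b + l) = 0 := by rw [smul_add, ← h8]; abel
  exact eq_neg_of_add_eq_zero_left 
    ((isUnit_iff_ne_zero.2 (two_ne_zero (α := ℂ))).smul_eq_zero.1 h9)

theorem laplacian_cancel {κ : Type*} [Fintype κ] {s : κ → ℤ} (b l : Grassmann O R) :
    b + -l = -(l - b - ∑ α, s α • (0 : Grassmann O R)) := by
  simp only [smul_zero, Finset.sum_const_zero]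
  abel

theorem sum_neg_mul {κ : Type*} [Fintype κ] (x : κ → κ → Grassmann O R) (y : κ → Grassmann O R) :
    ∑ γ, (-∑ α, x α γ) * y γ = -∑ α, ∑ γ, x α γ * y γ := by
  rw [Finset.sum_comm, ← Finset.sum_neg_distrib]
  exact Finset.sum_congr rfl fun γ _ => by rw [neg_mul, Finset.sum_mul]

end Grassmann

section LogDerivative

variable {N : ℕ} {U : TopologicalSpace.Opens (Fin N → ℝ)} {ε : Fin N → ZMod 2}
  {E : Matrix (Idx N) (Idx N) (SuperFun U)} {ρ : SuperFun U} {F G : Fin N → SuperFun U}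
  {H : SuperFun U} {Vs : Fin N → Fin N → SuperFun U} {Y : Fin N → Fin N → Fin N → SuperFun U}

theorem lambdaMatrix_eq (E : Matrix (Idx N) (Idx N) (SuperFun U)) (F G : Fin N → SuperFun U) :
    lambdaMatrix E F G = Matrix.of fun α β => bracket par dl E (F α) (G β) := by
  ext1 α β
  exact (bracket_dl E _ _).symm

theorem bracket_two_smul (E : Matrix (Idx N) (Idx N) (SuperFun U)) (f g : SuperFun U) :
    bracket par dl E ((2 : ℂ) • f) g = (2 : ℂ) • bracket par dl E f g := by
  rw [complex_two_smul, bracket_add_left isSuperDer_dl, complex_two_smul]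

namespace IsGaugeSystem

variable (h : IsGaugeSystem ε E ρ F G H Vs Y)

include h

theorem hasParity_radicand : HasParity 0 (radicand ε E ρ F G) := by
  have := ((hasParity_sdet (p := par) (jacobianMatrix (barGamma ε F G))).mul
    (hasParity_sdet (p := ε) (lambdaMatrix E F G))).mul (h.parityρ.ringInverse h.isUnit)
  rwa [add_zero, add_zero] at this

theorem hasParity_jacobianMatrix (A B : Idx N) :
    HasParity (par A + par B) (jacobianMatrix (barGamma ε F G) A B) := by
  rw [← jacobian_dl]
  exact hasParity_jacobian isSuperDer_dl h.coord.parity A B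

theorem hasParity_lambdaMatrix (α β : Fin N) : HasParity (ε α + ε β) (lambdaMatrix E F G α β) := by
  rw [lambdaMatrix_eq]
  exact h.isInvolutive_idealG.parityΛ α β

theorem isUnit_radicand (hΛ : IsUnit (lambdaMatrix E F G)) : IsUnit (radicand ε E ρ F G) := by
  have h3 : IsUnit (Ring.inverse ρ) := h.isUnit.ringInverse
  exact ((isUnit_sdet h.hasParity_jacobianMatrix h.coord.jacobian).mul
    (isUnit_sdet h.hasParity_lambdaMatrix hΛ)).mul h3

theorem radicand_restrict (hΛ : IsUnit (lambdaMatrix E F G))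
    {W : TopologicalSpace.Opens (Fin N → ℝ)} (hW : W ≤ U) :
    radicand ε (E.map (restrict hW)) (restrict hW ρ) (fun α => restrict hW (F α))
      (fun α => restrict hW (G α)) = restrict hW (radicand ε E ρ F G) := by
  rw [← restrictHom_apply hW (radicand ε E ρ F G), radicand, radicand, map_mul, map_mul,
    map_ringInverse _ h.isUnit, lambdaMatrix_restrict]
  refine congrArg₂ (· * ·) (congrArg₂ (· * ·) ?_ ?_) rfl
  · rw [restrictHom, mapHom_sdet h.hasParity_jacobianMatrix h.coord.jacobian]
    congr 1
    rw [← jacobian_dl, ← jacobian_dl, ← restrictHom, ← jacobian_restrict]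
    congr 1
    funext A
    exact barGamma_restrict hW ε F G A
  · rw [restrictHom, mapHom_sdet h.hasParity_lambdaMatrix hΛ]

/-- On shell the derivatives of `(J sdet(F, G) / ρ) e^{2H}` along the `F^α` vanish. -/
theorem drNew_radicand_mem (hΛ : IsUnit (lambdaMatrix E F G)) (δ : Fin N) :
    drNew par dl (barGamma ε F G) (idxF ε δ)
      (radicand ε E ρ F G * superExp ((2 : ℂ) • H)) ∈ idealG G := by
  have hI := h.isInvolutive_idealG
  set Q := radicand ε E ρ F G with hQ
  set e := superExp ((2 : ℂ) • H) with he
  have hH : HasParity 0 ((2 : ℂ) • H) := h.parityH.smul _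
  have hep : HasParity 0 e := HasParity.superExp hH
  have key : ∀ γ, bracket par dl E (Q * e) (G γ) ∈ idealG G := fun γ => by
    have h1 := hI.bracket_radicand_mem (by rw [← lambdaMatrix_eq]; exact hΛ) h.parityρ h.isUnit γ
    rw [← lambdaMatrix_eq, jacobian_dl] at h1
    change bracket par dl E Q (G γ) - Q * _ ∈ _ at h1
    have h2 := (isRightDer_bracket isSuperDer_dl h.parityE (h.parityG γ)).mul Q e
    have hsig : sig (ε γ + 1) e = e := by
      rw [hep.sig, mul_zero, sg_zero]; exact one_zsmul _
    -- The exponential contributes `2 (H, G_γ)` to the logarithmic derivative. The equation for `H`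
    -- cancels this against the Laplacian and the supertrace of `Y`, and leaves only `-2 G_α V^α_γ`,
    -- which is in the ideal.
    have h3 : bracket par dl E (Q * e) (G γ) =
        (bracket par dl E Q (G γ) - Q * ((2 : ℤ) • ∑ α, sg (ε α) • Y α α γ -
          (2 : ℂ) • laplacian par dl E ρ (G γ))) * e -
        Q * e * ((2 : ℂ) • ∑ α, G α * Vs α γ) := by
      rw [h2, hsig, bracket_superExp E hH, bracket_two_smul, ← h.equation γ]
      have hc : ∀ x : SuperFun U, x * e = e * x := fun x => (hep.commute x).symm
      exact log_derivative_identity hc _ _ _ _ _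
    rw [h3]
    refine (idealG G).sub_mem (idealG_mul_right G e _ h1) (idealG_mul_left h.parityG _ _ ?_)
    exact ⟨fun α => (2 : ℂ) • Vs α γ, by simp only [Finset.smul_sum, mul_smul_comm]⟩
  have h4 := hI.drNew_sub_mem (by rw [← lambdaMatrix_eq]; exact hΛ) (Q * e) δ
  have h5 : ∑ γ, bracket par dl E (Q * e) (G γ) *
      Ring.inverse (Matrix.of fun α β => bracket par dl E (F α) (G β)) γ δ ∈ idealG G :=
    (idealG G).sum_mem fun γ _ => idealG_mul_right G _ _ (key γ)
  have h6 := (idealG G).add_mem h4 h5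
  rwa [sub_add_cancel] at h6

/-- In the Abelian case the derivatives of `H + ln √(J sdet(F, G) / ρ)` along the `F^α`. -/
theorem drNew_add_logSqrt (hΛ : IsUnit (lambdaMatrix E F G)) (hY : ∀ γ α β, Y γ α β = 0)
    {L : SuperFun U} (hL : IsLogSqrt L (radicand ε E ρ F G)) (δ : Fin N) :
    drNew par dl (barGamma ε F G) (idxF ε δ) (H + L) =
      -∑ α, G α * ∑ β, Vs α β * Ring.inverse (lambdaMatrix E F G) β δ := by
  have hI := h.isInvolutive_bot hY
  have hL2 : HasParity 0 ((2 : ℂ) • L) := hL.1.smul _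
  have key : ∀ γ, bracket par dl E (H + L) (G γ) = -∑ α, G α * Vs α γ := fun γ => by
    -- Membership in the zero ideal is an equation. As the radicand is `e^{2L}`, dividing it out
    -- gives `(L, G_γ) = -Δ G_γ`.
    have h1 := hI.bracket_radicand_mem (by rw [← lambdaMatrix_eq]; exact hΛ) h.parityρ h.isUnit γ
    rw [← lambdaMatrix_eq, jacobian_dl, AddSubgroup.mem_bot] at h1
    have h2 : bracket par dl E (radicand ε E ρ F G) (G γ) - radicand ε E ρ F G *
        ((2 : ℤ) • ∑ α, sg (ε α) • Y α α γ - (2 : ℂ) • laplacian par dl E ρ (G γ)) = 0 := h1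
    have h3 := h.equation γ
    simp only [hY] at h2 h3
    rw [← hL.2, bracket_superExp E hL2, bracket_two_smul] at h2
    rw [bracket_add_left isSuperDer_dl, eq_neg_of_unit_mul (isUnit_superExp hL2) h2, ← h3]
    exact laplacian_cancel _ _
  have h4 := hI.drNew_sub_mem (by rw [← lambdaMatrix_eq]; exact hΛ) (H + L) δ
  rw [AddSubgroup.mem_bot, sub_eq_zero, ← lambdaMatrix_eq] at h4
  refine h4.trans ?_
  simp only [key, Finset.mul_sum]
  refine (sum_neg_mul _ _).trans ?_
  simp only [mul_assoc]

end IsGaugeSystem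

end LogDerivative
end
end SuperBV

set_option linter.unusedSectionVars false
namespace SuperBV
noncomputable section
open Grassmann

/-! ### The body of a coordinate system -/

section Body

variable {N : ℕ} {U V : TopologicalSpace.Opens (Fin N → ℝ)}

theorem Smooth.fderiv_apply (f : Smooth U) (x : U) (v : Fin N → ℝ) :
    fderiv ℝ (extendZero f.1) x v = ∑ j, (v j : ℂ) * (Smooth.pd j f).1 x := by
  conv_lhs => rw [show v = ∑ j, v j • (Pi.single j 1 : Fin N → ℝ) by
    ext i; simp [Pi.single_apply]]
  rw [map_sum]
  exact Finset.sum_congr rfl fun j _ => by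
    rw [map_smul, Complex.real_smul, Smooth.pd_apply]

theorem mkSmooth_apply {f : U → ℂ} (hf : IsSmooth f) (x : U) : (mkSmooth f).1 x = f x := by
  rw [mkSmooth, dif_pos hf]

theorem isSmooth_of_contDiffAt {f : U → ℂ}
    (h : ∀ x : U, ContDiffAt ℝ ∞ (extendZero f) (x : Fin N → ℝ)) : IsSmooth f :=
  fun x hx => (h ⟨x, hx⟩).contDiffWithinAt

/-- The extension by zero of the body map. -/
def bodyExt (Γ' : Idx N → SuperFun U) (x : Fin N → ℝ) : Fin N → ℝ :=
  fun i => (extendZero (body (Γ' (Sum.inl i))).1 x).re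

theorem bodyExt_apply (Γ' : Idx N → SuperFun U) (x : U) : bodyExt Γ' x = bodyMap Γ' x := by
  funext i
  rw [bodyExt, Smooth.extendZero_apply']
  rfl

theorem contDiffAt_bodyExt (Γ' : Idx N → SuperFun U) (x : U) :
    ContDiffAt ℝ ∞ (bodyExt Γ') (x : Fin N → ℝ) :=
  contDiffAt_pi.2 fun i =>
    (Complex.reCLM.contDiff.contDiffAt).comp (x : Fin N → ℝ) (Smooth.contDiffAt (body (Γ' (Sum.inl i))) x)

theorem hasFDerivAt_bodyExt (Γ' : Idx N → SuperFun U) (x : U) :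
    HasFDerivAt (bodyExt Γ') (fderiv ℝ (bodyExt Γ') x) (x : Fin N → ℝ) :=
  ((contDiffAt_bodyExt Γ' x).differentiableAt (by simp)).hasFDerivAt

theorem fderiv_bodyExt (Γ' : Idx N → SuperFun U) (x : U) (v : Fin N → ℝ) (i : Fin N) :
    fderiv ℝ (bodyExt Γ') x v i = (fderiv ℝ (extendZero (body (Γ' (Sum.inl i))).1) x v).re := by
  have h1 : HasFDerivAt (fun y => bodyExt Γ' y i)
      (Complex.reCLM.comp (fderiv ℝ (extendZero (body (Γ' (Sum.inl i))).1) x)) (x : Fin N → ℝ) :=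
    Complex.reCLM.hasFDerivAt.comp (x : Fin N → ℝ) (Smooth.differentiableAt _ x).hasFDerivAt
  have h2 := hasFDerivAt_pi'.1 (hasFDerivAt_bodyExt Γ' x) i
  have := congrArg (fun L : (Fin N → ℝ) →L[ℝ] ℝ => L v) (h2.unique h1)
  exact this

namespace IsCoordinateSystem

variable {Γ' : Idx N → SuperFun U} (hΓ : IsCoordinateSystem Γ')

include hΓ

theorem fderiv_im (x : U) (v : Fin N → ℝ) (i : Fin N) :
    (fderiv ℝ (extendZero (body (Γ' (Sum.inl i))).1) x v).im = 0 := by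
  have h1 : HasFDerivAt (fun y => (extendZero (body (Γ' (Sum.inl i))).1 y).im)
      (Complex.imCLM.comp (fderiv ℝ (extendZero (body (Γ' (Sum.inl i))).1) x)) (x : Fin N → ℝ) :=
    Complex.imCLM.hasFDerivAt.comp (x : Fin N → ℝ) (Smooth.differentiableAt _ x).hasFDerivAt
  have h2 : HasFDerivAt (fun y => (extendZero (body (Γ' (Sum.inl i))).1 y).im)
      (0 : (Fin N → ℝ) →L[ℝ] ℝ) (x : Fin N → ℝ) := by
    refine (hasFDerivAt_const (0 : ℝ) (x : Fin N → ℝ)).congr_of_eventuallyEq ?_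
    filter_upwards [U.isOpen.mem_nhds x.2] with y hy
    rw [extendZero_apply _ hy, hΓ.real]
  exact congrArg (fun L : (Fin N → ℝ) →L[ℝ] ℝ => L v) (h1.unique h2)

theorem fderiv_bodyExt_ofReal (x : U) (v : Fin N → ℝ) (i : Fin N) :
    ((fderiv ℝ (bodyExt Γ') x v i : ℝ) : ℂ) =
      ∑ j, (v j : ℂ) * (Smooth.pd j (body (Γ' (Sum.inl i)))).1 x := by
  rw [← Smooth.fderiv_apply, fderiv_bodyExt]
  exact Complex.ext rfl (hΓ.fderiv_im x v i).symm

/-- The mixed derivatives are odd and have no body. The body of the Jacobian matrix is block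
diagonal, and both of its blocks inherit invertibility. -/
theorem isUnit_body_blocks (x : U) :
    IsUnit (Matrix.of fun i j => evalBody x (dr (Sum.inl j) (Γ' (Sum.inl i))) :
      Matrix (Fin N) (Fin N) ℂ) ∧
    IsUnit (Matrix.of fun i j => evalBody x (dr (Sum.inr j) (Γ' (Sum.inr i))) :
      Matrix (Fin N) (Fin N) ℂ) := by
  set A := (Matrix.of fun i j => evalBody x (dr (Sum.inl j) (Γ' (Sum.inl i))) :
      Matrix (Fin N) (Fin N) ℂ)
  set D := (Matrix.of fun i j => evalBody x (dr (Sum.inr j) (Γ' (Sum.inr i))) :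
      Matrix (Fin N) (Fin N) ℂ)
  have h := hΓ.jacobian.map (evalBody x).mapMatrix
  have hz : ∀ {f : SuperFun U}, HasParity 1 f → evalBody x f = 0 := fun hf => by
    rw [evalBody_apply, hf.body_eq_zero]; rfl
  have hb : (evalBody x).mapMatrix (jacobianMatrix Γ') = Matrix.fromBlocks A 0 0 D := by
    ext a b
    rcases a with i | i <;> rcases b with j | j
    · rfl
    · exact hz ((hΓ.parity (Sum.inl i)).dr (Sum.inr j))
    · exact hz ((hΓ.parity (Sum.inr i)).dr (Sum.inl j))
    · rfl
  rw [hb, Matrix.isUnit_iff_isUnit_det, Matrix.det_fromBlocks_zero₂₁, IsUnit.mul_iff] at h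
  exact ⟨(Matrix.isUnit_iff_isUnit_det _).2 h.1, (Matrix.isUnit_iff_isUnit_det _).2 h.2⟩

/-- The Jacobian block is invertible over `ℂ`. Since the even coordinates have real bodies, a real
vector killed by the differential of the body map would lie in the kernel of that complex block. -/
theorem exists_equiv_fderiv (x : U) : ∃ e : (Fin N → ℝ) ≃L[ℝ] (Fin N → ℝ),
    HasFDerivAt (bodyExt Γ') (e : (Fin N → ℝ) →L[ℝ] (Fin N → ℝ)) (x : Fin N → ℝ) := by
  have hinj : Function.Injective (fderiv ℝ (bodyExt Γ') x : (Fin N → ℝ) →ₗ[ℝ] (Fin N → ℝ)) := by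
    refine (injective_iff_map_eq_zero _).2 fun v hv => ?_
    by_contra hne
    have h1 := (Matrix.isUnit_iff_isUnit_det _).1 (hΓ.isUnit_body_blocks x).1
    refine h1.ne_zero (Matrix.exists_mulVec_eq_zero_iff.1 ⟨fun j => (v j : ℂ), fun h0 => hne ?_, ?_⟩)
    · funext j
      exact Complex.ofReal_eq_zero.1 (congrFun h0 j)
    · funext i
      have h2 := hΓ.fderiv_bodyExt_ofReal x v i
      rw [show fderiv ℝ (bodyExt Γ') x v = 0 from hv] at h2
      rw [Matrix.mulVec, dotProduct]
      refine Eq.trans (Finset.sum_congr rfl fun j _ => mul_comm _ _) (h2.symm.trans ?_)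
      exact Complex.ofReal_zero
  refine ⟨(LinearEquiv.ofInjectiveEndo _ hinj).toContinuousLinearEquiv, ?_⟩
  convert! hasFDerivAt_bodyExt Γ' x using 1

/-- By the inverse function theorem the body map sends neighbourhoods of a point onto neighbourhoods
of its image. -/
theorem isOpen_range : IsOpen (Set.range (bodyMap Γ')) := by
  rw [isOpen_iff_mem_nhds]
  rintro _ ⟨x, rfl⟩
  obtain ⟨e, he⟩ := hΓ.exists_equiv_fderiv x
  have h1 := ((contDiffAt_bodyExt Γ' x).hasStrictFDerivAt' he (by simp)).map_nhds_eq_of_equiv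
  rw [← bodyExt_apply, ← h1]
  refine Filter.mem_map.2 (Filter.mem_of_superset (U.isOpen.mem_nhds x.2) fun y hy => ?_)
  exact ⟨⟨y, hy⟩, (bodyExt_apply Γ' ⟨y, hy⟩).symm⟩

/-- Smooth functions of the old coordinates are smooth functions of the new ones. -/
theorem exists_comp_bodyMap (hV : (V : Set (Fin N → ℝ)) = Set.range (bodyMap Γ')) (c : Smooth U) :
    ∃ g : Smooth V, ∀ x, extendZero g.1 (bodyMap Γ' x) = c.1 x := by
  have hmem : ∀ y : V, ∃ x : U, bodyMap Γ' x = y := fun y => by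
    have : (y : Fin N → ℝ) ∈ (V : Set (Fin N → ℝ)) := y.2
    rwa [hV] at this
  choose s hs using hmem
  have hVx : ∀ x, bodyMap Γ' x ∈ V := fun x => by
    change bodyMap Γ' x ∈ (V : Set (Fin N → ℝ))
    rw [hV]; exact ⟨x, rfl⟩
  have happ : ∀ x, extendZero (fun y => c.1 (s y)) (bodyMap Γ' x) = c.1 x := fun x => by
    rw [extendZero_apply _ (hVx x)]
    exact congrArg c.1 (hΓ.injective (hs ⟨_, hVx x⟩))
  refine ⟨⟨fun y => c.1 (s y), isSmooth_of_contDiffAt fun y => ?_⟩, happ⟩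
  obtain ⟨x, hx⟩ : ∃ x, bodyMap Γ' x = y := ⟨_, hs y⟩
  obtain ⟨e, he⟩ := hΓ.exists_equiv_fderiv x
  have hc := contDiffAt_bodyExt Γ' x
  have hst := hc.hasStrictFDerivAt' he (by simp)
  have hψ := hc.to_localInverse he (by simp)
  -- Nothing is known about the regularity of the chosen preimages `s`. Since the body map is
  -- injective, they coincide near `y` with the values of the local inverse `ψ`, which is smooth.
  set ψ := hc.localInverse he (by simp) with hψdef
  have h0 : ψ (bodyExt Γ' x) = x := hc.localInverse_apply_image he (by simp)
  rw [bodyExt_apply, hx] at h0 hψ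
  have hcomp : ContDiffAt ℝ ∞ (extendZero c.1 ∘ ψ) (y : Fin N → ℝ) := by
    refine ContDiffAt.comp (y : Fin N → ℝ) ?_ hψ
    rw [h0]
    exact Smooth.contDiffAt c x
  refine hcomp.congr_of_eventuallyEq ?_
  have hr : ∀ᶠ z in nhds (y : Fin N → ℝ), bodyExt Γ' (ψ z) = z := by
    rw [← hx, ← bodyExt_apply]
    exact hst.eventually_right_inverse
  have hU : ∀ᶠ z in nhds (y : Fin N → ℝ), ψ z ∈ U :=
    hψ.continuousAt.eventually_mem (by rw [h0]; exact U.isOpen.mem_nhds x.2)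
  filter_upwards [hr, hU] with z hz hzU
  have : z = bodyMap Γ' ⟨ψ z, hzU⟩ := by rw [← bodyExt_apply]; exact hz.symm
  conv_lhs => rw [this, happ]
  exact (extendZero_apply _ hzU).symm

end IsCoordinateSystem

/-- The composition of a smooth function with the body map. -/
def compBody (Γ' : Idx N → SuperFun U) (g : Smooth V) : Smooth U :=
  mkSmooth fun x => extendZero g.1 (bodyMap Γ' x)

theorem isSmooth_comp {Γ' : Idx N → SuperFun U} (hV : ∀ x, bodyMap Γ' x ∈ V) (g : Smooth V) :
    IsSmooth fun x => extendZero g.1 (bodyMap Γ' x) := by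
  refine isSmooth_of_contDiffOn (g := extendZero g.1 ∘ bodyExt Γ') (fun x hx => ?_) fun x => by
    rw [Function.comp_apply, bodyExt_apply]
  refine (ContDiffAt.comp x ?_ (contDiffAt_bodyExt Γ' ⟨x, hx⟩)).contDiffWithinAt
  rw [bodyExt_apply Γ' ⟨x, hx⟩]
  exact Smooth.contDiffAt g ⟨_, hV ⟨x, hx⟩⟩

theorem compBody_apply {Γ' : Idx N → SuperFun U} (hV : ∀ x, bodyMap Γ' x ∈ V) (g : Smooth V)
    (x : U) : (compBody Γ' g).1 x = g.1 ⟨bodyMap Γ' x, hV x⟩ := by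
  rw [compBody, mkSmooth_apply (isSmooth_comp hV g), extendZero_apply _ (hV x)]

theorem pd_compBody {Γ' : Idx N → SuperFun U} (hΓ : IsCoordinateSystem Γ')
    (hV : ∀ x, bodyMap Γ' x ∈ V) (i : Fin N) (g : Smooth V) :
    Smooth.pd i (compBody Γ' g) =
      ∑ j, Smooth.pd i (body (Γ' (Sum.inl j))) * compBody Γ' (Smooth.pd j g) := by
  apply Subtype.ext
  funext x
  rw [Smooth.sum_apply, Smooth.pd_eq_of_eventuallyEq (g := extendZero g.1 ∘ bodyExt Γ')
    fun y => by rw [compBody, mkSmooth_apply (isSmooth_comp hV g), Function.comp_apply, bodyExt_apply]]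
  have hb : bodyExt Γ' x = ((⟨bodyMap Γ' x, hV x⟩ : V) : Fin N → ℝ) := bodyExt_apply Γ' x
  have hg : DifferentiableAt ℝ (extendZero g.1) (bodyExt Γ' x) := by
    rw [hb]; exact Smooth.differentiableAt g _
  rw [fderiv_comp _ hg (hasFDerivAt_bodyExt Γ' x).differentiableAt, ContinuousLinearMap.comp_apply,
    hb, Smooth.fderiv_apply]
  refine Finset.sum_congr rfl fun j _ => ?_
  rw [hΓ.fderiv_bodyExt_ofReal, Smooth.mul_apply, compBody_apply hV]
  congr 1
  rw [Finset.sum_eq_single i]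
  · simp
  · intro k _ hk
    rw [Pi.single_eq_of_ne hk, Complex.ofReal_zero, zero_mul]
  · simp

end Body
end
end SuperBV

set_option linter.unusedSectionVars false
namespace SuperBV
noncomputable section
open Grassmann

/-! ### Substitution of anticommuting elements for the generators -/

namespace Grassmann

section Subst

variable {O R A : Type*} [LinearOrder O] [Fintype O] [CommRing R] [Ring A]

/-- Substitution of `η_o` for the generators and of `φ r` for the coefficients. -/
def subst (φ : R →+ A) (η : O → A) : Grassmann O R →+ A where
  toFun f := ∑ S : Finset O, φ (f.coeff S) * ((S.sort (· ≤ ·)).map η).prod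
  map_zero' := by simp [zero_coeff]
  map_add' f g := by simp [add_coeff, add_mul, Finset.sum_add_distrib]

theorem subst_apply (φ : R →+ A) (η : O → A) (f : Grassmann O R) :
    subst φ η f = ∑ S : Finset O, φ (f.coeff S) * ((S.sort (· ≤ ·)).map η).prod := rfl

theorem subst_mono (φ : R →+ A) (η : O → A) (S : Finset O) (r : R) :
    subst φ η (mono S r) = φ r * ((S.sort (· ≤ ·)).map η).prod := by
  rw [subst_apply, Finset.sum_eq_single S]
  · simp [mono]
  · intro T _ hT
    simp [mono, hT]
  · simp

theorem subst_const (φ : R →+ A) (η : O → A) (r : R) : subst φ η (const r) = φ r := by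
  have := subst_mono φ η ∅ r
  rwa [Finset.sort_empty, List.map_nil, List.prod_nil, mul_one] at this

variable {φ : R →+ A} {η : O → A} (hc : ∀ r o, φ r * η o = η o * φ r)

include hc

theorem subst_gen_mul_mono {a : O} {S : Finset O} (h : ∀ x ∈ S, a < x) (r : R) :
    subst φ η (gen a * mono S r) = η a * subst φ η (mono S r) := by
  rw [← mono_insert h, subst_mono, subst_mono,
    Finset.sort_insert (r := (· ≤ ·)) (fun b hb => (h b hb).le) (fun h' => lt_irrefl _ (h a h')),
    List.map_cons, List.prod_cons, ← mul_assoc, hc, mul_assoc]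

theorem subst_gen_mul_of_lt {a : O} {f : Grassmann O R}
    (h : ∀ T, f.coeff T ≠ 0 → ∀ x ∈ T, a < x) :
    subst φ η (gen a * f) = η a * subst φ η f := by
  conv_lhs => rw [eq_sum_mono f]
  conv_rhs => rw [eq_sum_mono f]
  rw [Finset.mul_sum, map_sum, map_sum, Finset.mul_sum]
  refine Finset.sum_congr rfl fun T _ => ?_
  by_cases hT : f.coeff T = 0
  · have : mono T (f.coeff T) = 0 := by
      rw [hT]; ext S; simp [mono, zero_coeff]
    rw [this, mul_zero, map_zero, mul_zero]
  · exact subst_gen_mul_mono hc (h T hT) _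

variable (ha : ∀ o a, η o * η a = -(η a * η o)) (hs : ∀ o, η o * η o = 0)

include ha hs

/-- Induction on monomials through their smallest index `a`. If `o < a`, the product is already
ordered. If `o = a`, both sides vanish because squares do. If `a < o`, the two factors are exchanged
with the same sign on both sides. -/
theorem subst_gen_mul (o : O) (f : Grassmann O R) :
    subst φ η (gen o * f) = η o * subst φ η f := by
  have hgg : ∀ o a : O, (gen o * gen a : Grassmann O R) = -(gen a * gen o) := fun o a => by
    rw [(HasParity.gen o).mul_comm (HasParity.gen a)]
    exact neg_one_zsmul _
  have hm : ∀ (S : Finset O) (r : R) (o : O),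
      subst φ η (gen o * mono S r) = η o * subst φ η (mono S r) := by
    intro S r
    induction S using Finset.induction_on_min with
    | empty => exact fun o => subst_gen_mul_mono hc (by simp) r
    | insert a S h ih =>
      intro o
      rcases lt_trichotomy o a with hoa | rfl | hoa
      · refine subst_gen_mul_mono hc (fun x hx => ?_) r
        rcases Finset.mem_insert.1 hx with rfl | hx
        · exact hoa
        · exact hoa.trans (h x hx)
      · have h0 : (gen o * gen o : Grassmann O R) = 0 := by
          ext T
          rw [gen_mul_coeff, zero_coeff]
          split_ifs with ho
          · have : T.erase o ≠ {o} := fun h' => by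
              have := Finset.mem_singleton_self o
              rw [← h'] at this
              exact Finset.notMem_erase _ _ this
            simp [gen, this]
          · rfl
        rw [mono_insert h, ← mul_assoc, h0, zero_mul, map_zero, subst_gen_mul_mono hc h,
          ← mul_assoc, hs, zero_mul]
      · rw [mono_insert h, ← mul_assoc, hgg, neg_mul, mul_assoc, map_neg,
          subst_gen_mul_of_lt hc (a := a), ih, subst_gen_mul_mono hc h, ← mul_assoc, ← mul_assoc,
          ha o a, neg_mul]
        -- The monomials of `gen o * mono S r` contain only `o` and indices of `S`, all of them
        -- above `a`, so that `gen a` is in its ordered position.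
        intro T hT x hx
        rw [gen_mul_coeff] at hT
        have hoT : o ∈ T := by by_contra hne; exact hT (if_neg hne)
        rw [if_pos hoT] at hT
        have hTS : T.erase o = S := by
          by_contra hne
          exact hT (by simp [mono, hne])
        rcases eq_or_ne x o with rfl | hxo
        · exact hoa
        · exact h x (hTS ▸ Finset.mem_erase.2 ⟨hxo, hx⟩)
  rw [eq_sum_mono f, Finset.mul_sum, map_sum, map_sum, Finset.mul_sum]
  exact Finset.sum_congr rfl fun S _ => hm S _ o

end Subst

end Grassmann

/-! ### Taylor expansion around the body -/

theorem derivation_pow {C M : Type*} [CommRing C] [AddCommGroup M] [Module C M] (δ : C →+ M)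
    (hδ : ∀ a b, δ (a * b) = a • δ b + b • δ a) (a : C) (n : ℕ) :
    δ (a ^ n) = n • (a ^ (n - 1) • δ a) := by
  induction n with
  | zero =>
    have := hδ 1 1
    rw [mul_one, one_smul] at this
    rw [pow_zero, left_eq_add.1 this, zero_smul]
  | succ n ih =>
    rw [pow_succ', hδ, ih, Nat.add_sub_cancel]
    rcases n with _ | n
    · simp
    · rw [Nat.add_sub_cancel, smul_comm a, smul_smul a, ← pow_succ', succ_nsmul (a ^ (n + 1) • δ a) (n + 1)]

section Taylor

variable {N : ℕ} {U V : TopologicalSpace.Opens (Fin N → ℝ)}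

theorem Smooth.pd_iterate_comm (i j : Fin N) (n : ℕ) (g : Smooth V) :
    Smooth.pd j ((Smooth.pd i)^[n] g) = (Smooth.pd i)^[n] (Smooth.pd j g) :=
  (Function.Commute.iterate_right (fun g => Smooth.pd_comm j i g : Function.Commute (Smooth.pd j) (Smooth.pd i)) n) g

theorem pd_iterPd_list (l : List (Fin N)) (k : Fin N → ℕ) (j : Fin N) (g : Smooth V) :
    Smooth.pd j (l.foldr (fun i g => (Smooth.pd i)^[k i] g) g) =
      l.foldr (fun i g => (Smooth.pd i)^[k i] g) (Smooth.pd j g) := by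
  induction l with
  | nil => rfl
  | cons a l ih => rw [List.foldr_cons, List.foldr_cons, Smooth.pd_iterate_comm, ih]

/-- Partial derivatives commute, so the additional derivative in direction `j` can be moved to the
innermost place. The list has no repetitions, hence it meets `j` at most once. -/
theorem iterPd_list_update (l : List (Fin N)) (k : Fin N → ℕ) (j : Fin N) (hn : l.Nodup)
    (g : Smooth V) :
    l.foldr (fun i g => (Smooth.pd i)^[Function.update k j (k j + 1) i] g) g =
      if j ∈ l then l.foldr (fun i g => (Smooth.pd i)^[k i] g) (Smooth.pd j g)
      else l.foldr (fun i g => (Smooth.pd i)^[k i] g) g := by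
  induction l with
  | nil => rfl
  | cons a l ih =>
    rw [List.foldr_cons, List.foldr_cons, List.foldr_cons, ih (List.nodup_cons.1 hn).2]
    by_cases ha : a = j
    · subst ha
      have : a ∉ l := (List.nodup_cons.1 hn).1
      rw [if_neg this, if_pos List.mem_cons_self, Function.update_self, Function.iterate_succ_apply,
        pd_iterPd_list]
    · rw [Function.update_of_ne ha]
      by_cases hj : j ∈ l
      · rw [if_pos hj, if_pos (List.mem_cons_of_mem _ hj)]
      · rw [if_neg hj, if_neg (by simp [hj, Ne.symm ha])]

theorem pd_iterPd (k : Fin N → ℕ) (j : Fin N) (g : Smooth V) :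
    Smooth.pd j (iterPd k g) = iterPd k (Smooth.pd j g) := pd_iterPd_list _ k j g

theorem iterPd_update (k : Fin N → ℕ) (j : Fin N) (g : Smooth V) :
    iterPd (Function.update k j (k j + 1)) g = iterPd k (Smooth.pd j g) := by
  rw [iterPd, iterPd_list_update _ _ _ (List.nodup_finRange N), if_pos (List.mem_finRange j)]
  rfl

theorem iterPd_add (k : Fin N → ℕ) (f g : Smooth V) :
    iterPd k (f + g) = iterPd k f + iterPd k g := by
  unfold iterPd
  induction List.finRange N with
  | nil => rfl
  | cons a l ih =>
    rw [List.foldr_cons, ih]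
    exact map_add (AddMonoidHom.mk' _ (fun x y => by
      have : ∀ n : ℕ, (Smooth.pd a)^[n] (x + y) = (Smooth.pd a)^[n] x + (Smooth.pd a)^[n] y := by
        intro n
        induction n with
        | zero => rfl
        | succ n ih => rw [Function.iterate_succ_apply', ih, Smooth.pd_add,
            Function.iterate_succ_apply', Function.iterate_succ_apply']
      exact this (k a)) : Smooth V →+ Smooth V) _ _

/-- The nilpotent parts of the even coordinates. -/
def nilPart (Γ' : Idx N → SuperFun U) (i : Fin N) : evenSubring (Fin N) (Smooth U) :=
  evenPart (Γ' (Sum.inl i) - const (body (Γ' (Sum.inl i))))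

/-- A term of the Taylor expansion. -/
def taylorTerm (Γ' : Idx N → SuperFun U) (k : Fin N → ℕ) (g : Smooth V) : SuperFun U :=
  const (((∏ i, (k i).factorial : ℕ) : ℂ)⁻¹ • compBody Γ' (iterPd k g)) *
    ((∏ i, nilPart Γ' i ^ k i : evenSubring (Fin N) (Smooth U)) : SuperFun U)

/-- The multi-indices in the Taylor expansion. -/
def box (N : ℕ) : Finset (Fin N → ℕ) := Fintype.piFinset fun _ => Finset.range (N + 1)

theorem hasParity_taylorTerm (Γ' : Idx N → SuperFun U) (k : Fin N → ℕ) (g : Smooth V) :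
    HasParity 0 (taylorTerm Γ' k g) := by
  have := (HasParity.const (O := Fin N) (((∏ i, (k i).factorial : ℕ) : ℂ)⁻¹ •
    compBody Γ' (iterPd k g))).mul (hasParity_coe (∏ i, nilPart Γ' i ^ k i))
  rwa [add_zero] at this

theorem sum_box {M : Type*} [AddCommMonoid M] (f : (Fin N → ℕ) → M) :
    ∑ k : Fin N → Fin (N + 1), f (fun i => (k i).1) = ∑ k ∈ box N, f k := by
  refine Finset.sum_bij (fun k _ i => (k i).1) ?_ ?_ ?_ fun _ _ => rfl
  · intro k _
    exact Fintype.mem_piFinset.2 fun i => Finset.mem_range.2 (k i).2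
  · intro k _ k' _ h
    funext i
    exact Fin.ext (congrFun h i)
  · intro k hk
    exact ⟨fun i => ⟨k i, Finset.mem_range.1 (Fintype.mem_piFinset.1 hk i)⟩, Finset.mem_univ _, rfl⟩

variable {Γ' : Idx N → SuperFun U} (hΓ : IsCoordinateSystem Γ')

include hΓ

theorem nilPart_coe (i : Fin N) :
    (nilPart Γ' i : SuperFun U) = Γ' (Sum.inl i) - const (body (Γ' (Sum.inl i))) :=
  evenPart_coe (HasParity.sub_const (hΓ.parity (Sum.inl i)))

variable (hV : ∀ x, bodyMap Γ' x ∈ V)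

include hV

theorem dl_const_compBody (B : Idx N) (c : ℂ) (h : Smooth V) :
    dl B (const (c • compBody Γ' h) : SuperFun U) =
      ∑ j, dl B (const (body (Γ' (Sum.inl j)))) * const (c • compBody Γ' (Smooth.pd j h)) := by
  rcases B with i | o
  · rw [dl_inl, mapCoeff_pd_const, Smooth.pd_smul, pd_compBody hΓ hV, Finset.smul_sum, const_sum]
    refine Finset.sum_congr rfl fun j _ => ?_
    rw [dl_inl, mapCoeff_pd_const, ← const_mul, mul_smul_comm]
  · rw [dl_inr, leftD_const]
    symm
    refine Finset.sum_eq_zero fun j _ => ?_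
    rw [dl_inr, leftD_const]
    exact zero_mul (const (c • compBody Γ' (Smooth.pd j h)) : Grassmann (Fin N) (Smooth U))

end Taylor
end
end SuperBV

set_option linter.unusedSectionVars false
namespace SuperBV
noncomputable section
open Grassmann

namespace Grassmann

section EvenDerivation

variable {O R : Type*} [LinearOrder O] [CommRing R] {D : Grassmann O R → Grassmann O R}
  (add : ∀ f g, D (f + g) = D f + D g)
  (mul : ∀ f g, HasParity 0 f → D (f * g) = D f * g + f * D g)

/-- The restriction of an even derivation to the even elements. -/
def evenDer (D : Grassmann O R → Grassmann O R) (add : ∀ f g, D (f + g) = D f + D g) :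
    evenSubring O R →+ Grassmann O R :=
  (AddMonoidHom.mk' D add).comp (evenSubring O R).subtype.toAddMonoidHom

include mul

theorem evenDer_mul (a b : evenSubring O R) :
    evenDer D add (a * b) = a • evenDer D add b + b • evenDer D add a := by
  have h := mul a b (hasParity_coe a)
  have hc : D a * (b : Grassmann O R) = b * D a := ((hasParity_coe b).commute (D a)).symm
  rw [hc, add_comm] at h
  exact h

include add

theorem map_even_pow (a : evenSubring O R) (n : ℕ) :
    D ((a ^ n : evenSubring O R) : Grassmann O R) =
      n • (((a ^ (n - 1) : evenSubring O R) : Grassmann O R) * D a) :=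
  derivation_pow (evenDer D add) (evenDer_mul add mul) a n

theorem map_even_prod_pow {ι : Type*} [Fintype ι] [DecidableEq ι] (ν : ι → evenSubring O R)
    (k : ι → ℕ) : D ((∏ i, ν i ^ k i : evenSubring O R) : Grassmann O R) =
      ∑ j, k j • ((((∏ i ∈ Finset.univ.erase j, ν i ^ k i) * ν j ^ (k j - 1) : evenSubring O R) :
        Grassmann O R) * D (ν j)) := by
  refine (derivation_prod (evenDer D add) (evenDer_mul add mul) _ _).trans
    (Finset.sum_congr rfl fun j _ => ?_)
  rw [derivation_pow (evenDer D add) (evenDer_mul add mul), smul_comm, smul_smul]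
  rfl

end EvenDerivation

end Grassmann

/-! ### The chain rule for the Taylor expansion -/

section TaylorChain

variable {N : ℕ} {U V : TopologicalSpace.Opens (Fin N → ℝ)}

theorem Grassmann.nsmul_succ_eq_zero {O R : Type*} [LinearOrder O] [CommRing R] [Algebra ℂ R]
    {n : ℕ} {x : Grassmann O R} (h : (n + 1) • x = 0) : x = 0 := by
  rw [← Nat.cast_smul_eq_nsmul ℂ] at h
  exact ((isUnit_iff_ne_zero.2 (Nat.cast_ne_zero.2 n.succ_ne_zero : ((n + 1 : ℕ) : ℂ) ≠ 0)).smul_eq_zero).1 h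

theorem Grassmann.const_mul_nsmul {O R : Type*} [LinearOrder O] [CommRing R] [Algebra ℂ R]
    (n : ℕ) (c : ℂ) (r : R) (x : Grassmann O R) :
    const (c • r) * (n • x) = const (((n : ℂ) * c) • r) * x := by
  ext S
  rw [const_mul_coeff, const_mul_coeff, ← Nat.cast_smul_eq_nsmul ℂ, smul_coeff, mul_smul,
    mul_smul_comm, smul_mul_assoc, smul_mul_assoc, smul_mul_assoc]

variable {Γ' : Idx N → SuperFun U} (hΓ : IsCoordinateSystem Γ')

include hΓ

theorem body_nilPart (j : Fin N) : body (nilPart Γ' j : SuperFun U) = 0 := by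
  rw [nilPart_coe hΓ]; exact body_sub_const _

/-- The power `N + 1` of the nilpotent part is zero; differentiate this and divide by `N + 1`. It
makes the truncation of the Taylor sum at exponent `N` compatible with derivatives. -/
theorem nilPart_pow_mul_dl (B : Idx N) (j : Fin N) :
    (nilPart Γ' j : SuperFun U) ^ N * dl B (nilPart Γ' j : SuperFun U) = 0 := by
  have h1 := map_even_pow (dl_add B) (fun f g hf => dl_mul_even hf B g) (nilPart Γ' j) (N + 1)
  have h2 : nilPart Γ' j ^ (N + 1) = 0 := by
    apply Subtype.ext
    rw [SubmonoidClass.coe_pow]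
    exact pow_eq_zero_of_body_eq_zero (body_nilPart hΓ j) (by simp)
  rw [h2, Nat.add_sub_cancel] at h1
  have h3 := nsmul_succ_eq_zero (h1.symm.trans (dl_zero B))
  rwa [SubmonoidClass.coe_pow] at h3

variable (hV : ∀ x, bodyMap Γ' x ∈ V)

include hV

/-- A term depends on the coordinates through the body at which `g` is evaluated and through the
nilpotent parts. In the latter dependence the exponent `k j` brought down by the power rule cancels
against the factorial, and the derivative of `g` is kept in the form of a term with lowered
multi-index. -/
theorem dl_taylorTerm (B : Idx N) (k : Fin N → ℕ) (g : Smooth V) :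
    dl B (taylorTerm Γ' k g) =
      ∑ j, dl B (const (body (Γ' (Sum.inl j)))) * taylorTerm Γ' k (Smooth.pd j g) +
      ∑ j, if k j = 0 then 0 else
        taylorTerm Γ' (Function.update k j (k j - 1)) (Smooth.pd j g) *
          dl B (nilPart Γ' j : SuperFun U) := by
  rw [taylorTerm, dl_mul_even (HasParity.const _), dl_const_compBody hΓ hV, Finset.sum_mul]
  congr 1
  · refine Finset.sum_congr rfl fun j _ => ?_
    rw [mul_assoc, taylorTerm, pd_iterPd]
  · rw [map_even_prod_pow (dl_add B) (fun f g hf => dl_mul_even hf B g), Finset.mul_sum]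
    refine Finset.sum_congr rfl fun j _ => ?_
    split
    · next h => rw [h, zero_nsmul]; exact mul_zero (const _ : Grassmann (Fin N) (Smooth U))
    · next h =>
      obtain ⟨m, hm⟩ := Nat.exists_eq_succ_of_ne_zero h
      have hk' : k j - 1 = m := by omega
      set k' := Function.update k j m with hk'def
      have hk'j : k' j = m := Function.update_self j m k
      have hkk : k = Function.update k' j (k' j + 1) := by
        rw [hk'j, hk'def, Function.update_idem, ← Nat.succ_eq_add_one, ← hm, Function.update_eq_self]
      have hne : ∀ i ∈ Finset.univ.erase j, k i = k' i := fun i hi =>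
        (Function.update_of_ne (Finset.ne_of_mem_erase hi) m k).symm
      have hprod : (∏ i ∈ Finset.univ.erase j, nilPart Γ' i ^ k i) * nilPart Γ' j ^ m =
          ∏ i, nilPart Γ' i ^ k' i := by
        rw [Finset.prod_congr rfl fun i hi => by rw [hne i hi], ← hk'j,
          Finset.prod_erase_mul _ _ (Finset.mem_univ j)]
      have hfac : (∏ i, (k i).factorial) = (m + 1) * ∏ i, (k' i).factorial := by
        rw [← Finset.mul_prod_erase _ _ (Finset.mem_univ j),
          ← Finset.mul_prod_erase _ (fun i => (k' i).factorial) (Finset.mem_univ j), hm, hk'j,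
          Finset.prod_congr rfl fun i hi => by rw [hne i hi], Nat.factorial_succ, mul_assoc]
      have hit : iterPd k g = iterPd k' (Smooth.pd j g) := by
        conv_lhs => rw [hkk]
        exact iterPd_update k' j g
      rw [hk', ← hk'def, hprod, const_mul_nsmul, taylorTerm, hit, mul_assoc]
      refine congrArg₂ (· * ·) ?_ rfl
      rw [hfac, hm]
      congr 2
      push_cast
      have h1 : ((m : ℂ) + 1) ≠ 0 := by exact_mod_cast m.succ_ne_zero
      rw [mul_inv, ← mul_assoc, mul_inv_cancel₀ h1, one_mul]

theorem taylorTerm_mul_dl {k : Fin N → ℕ} {j : Fin N} (hk : k j = N) (B : Idx N) (g : Smooth V) :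
    taylorTerm Γ' k g * dl B (nilPart Γ' j : SuperFun U) = 0 := by
  rw [taylorTerm, ← Finset.prod_erase_mul _ (fun i => nilPart Γ' i ^ k i) (Finset.mem_univ j), hk,
    Subring.coe_mul, SubmonoidClass.coe_pow, mul_assoc, mul_assoc, nilPart_pow_mul_dl hΓ]
  simp only [mul_zero]

/-- The Taylor expansion of `g(y)`. -/
theorem dl_sum_taylorTerm (B : Idx N) (g : Smooth V) :
    dl B (∑ k ∈ box N, taylorTerm Γ' k g) =
      ∑ j, dl B (Γ' (Sum.inl j)) * ∑ k ∈ box N, taylorTerm Γ' k (Smooth.pd j g) := by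
  have hsplit : ∀ j, dl B (Γ' (Sum.inl j)) =
      dl B (const (body (Γ' (Sum.inl j)))) + dl B (nilPart Γ' j : SuperFun U) := fun j => by
    rw [← dl_add, nilPart_coe hΓ, add_sub_cancel]
  rw [dl_sum, Finset.sum_congr rfl fun k _ => dl_taylorTerm hΓ hV B k g, Finset.sum_add_distrib,
    Finset.sum_comm, Finset.sum_comm (s := box N), ← Finset.sum_add_distrib]
  refine Finset.sum_congr rfl fun j _ => ?_
  rw [hsplit, add_mul, Finset.mul_sum, Finset.mul_sum]
  congr 1
  have hcomm : ∀ k, dl B (nilPart Γ' j : SuperFun U) * taylorTerm Γ' k (Smooth.pd j g) =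
      taylorTerm Γ' k (Smooth.pd j g) * dl B (nilPart Γ' j : SuperFun U) := fun k =>
    ((hasParity_taylorTerm Γ' k (Smooth.pd j g)).commute _).symm
  simp only [hcomm]
  -- Lowering `k j` by one matches the multi-indices with `k j ≠ 0` with those with `k j ≠ N`. The
  -- latter account for the whole sum, as the terms with `k j = N` are annihilated by the derivative
  -- of the nilpotent part.
  have hL : ∑ k ∈ box N, (if k j = 0 then 0 else
      taylorTerm Γ' (Function.update k j (k j - 1)) (Smooth.pd j g) *
          dl B (nilPart Γ' j : SuperFun U)) = ∑ k ∈ (box N).filter (fun k => ¬ k j = 0),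
        taylorTerm Γ' (Function.update k j (k j - 1)) (Smooth.pd j g) *
          dl B (nilPart Γ' j : SuperFun U) := by
    rw [Finset.sum_filter]
    exact Finset.sum_congr rfl fun k _ => by split <;> rfl
  have hR : ∑ k ∈ box N, taylorTerm Γ' k (Smooth.pd j g) * dl B (nilPart Γ' j : SuperFun U) =
      ∑ k ∈ (box N).filter (fun k => ¬ k j = N),
        taylorTerm Γ' k (Smooth.pd j g) * dl B (nilPart Γ' j : SuperFun U) := by
    rw [Finset.sum_filter]
    refine Finset.sum_congr rfl fun k _ => ?_
    split
    · rfl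
    · next h => exact taylorTerm_mul_dl hΓ hV (not_not.1 h) B _
  rw [hL, hR]
  have hbox : ∀ k : Fin N → ℕ, k ∈ box N ↔ ∀ i, k i ≤ N := fun k => by
    rw [box, Fintype.mem_piFinset]
    exact forall_congr' fun i => by rw [Finset.mem_range, Nat.lt_succ_iff]
  refine Finset.sum_bij' (fun k _ => Function.update k j (k j - 1))
    (fun k _ => Function.update k j (k j + 1)) ?_ ?_ ?_ ?_ fun _ _ => rfl
  · intro k hk
    rw [Finset.mem_filter, hbox] at hk ⊢
    refine ⟨fun i => ?_, ?_⟩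
    · rcases eq_or_ne i j with rfl | h
      · rw [Function.update_self]; have := hk.1 i; omega
      · rw [Function.update_of_ne h]; exact hk.1 i
    · rw [Function.update_self]; have := hk.1 j; have := hk.2; omega
  · intro k hk
    rw [Finset.mem_filter, hbox] at hk ⊢
    refine ⟨fun i => ?_, ?_⟩
    · rcases eq_or_ne i j with rfl | h
      · rw [Function.update_self]; have := hk.1 i; have := hk.2; omega
      · rw [Function.update_of_ne h]; exact hk.1 i
    · rw [Function.update_self]; omega
  · intro k hk
    rw [Finset.mem_filter] at hk
    have : k j - 1 + 1 = k j := by have := hk.2; omega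
    rw [Function.update_idem, Function.update_self, this, Function.update_eq_self]
  · intro k _
    rw [Function.update_idem, Function.update_self, Nat.add_sub_cancel, Function.update_eq_self]

end TaylorChain
end
end SuperBV

set_option linter.unusedSectionVars false
namespace SuperBV
noncomputable section
open Grassmann

/-! ### Substitution of coordinates -/

namespace Grassmann

variable {O R : Type*} [LinearOrder O] [CommRing R]

theorem zsmul_mul_eq (n : ℤ) (f g : Grassmann O R) : (n • f) * g = n • (f * g) :=
  smul_mul_assoc n f g

theorem mul_zsmul_eq (n : ℤ) (f g : Grassmann O R) : f * (n • g) = n • (f * g) :=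
  mul_smul_comm n f g

theorem smul_const_mul_mul [Algebra ℂ R] (c : ℂ) (r : R) (x y : Grassmann O R) :
    c • (const r * x * y) = const (c • r) * x * y := by
  have : (const (c • r) : Grassmann O R) = c • const r := by
    ext S
    rw [smul_coeff, const, const]
    simp only [smul_ite, smul_zero]
  rw [this, smul_mul_assoc, smul_mul_assoc]

/-- A set of elements without body whose derivatives are combinations of elements of the set
contains only zero. -/
theorem eq_zero_of_leftD_mem_span [Fintype O] {P : Set (Grassmann O R)}
    (hb : ∀ r ∈ P, body r = 0) (hd : ∀ r ∈ P, ∀ o, leftD o r ∈ Ideal.span P)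
    {r : Grassmann O R} (hr : r ∈ P) : r = 0 := by
  -- The coefficient of a monomial that contains `o` is, up to sign, a coefficient of `leftD o r` of
  -- degree one less. If all elements of the set have order `d`, so do their combinations, and hence
  -- the elements themselves have order `d + 1`.
  have key : ∀ d : ℕ, ∀ r ∈ P, HasOrder d r := by
    intro d
    induction d with
    | zero => exact fun r _ => hasOrder_zero r
    | succ d ih =>
      have hspan : ∀ x ∈ Ideal.span P, HasOrder d x := fun x hx => by
        refine Submodule.span_induction ih (fun _ _ => rfl) (fun _ _ _ _ => HasOrder.add)
          (fun a x _ h => h.mul_left a) hx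
      intro r hr S hS
      rcases S.eq_empty_or_nonempty with rfl | ⟨o, ho⟩
      · exact hb r hr
      · have h1 := hspan _ (hd r hr o) (S.erase o)
          (by have := Finset.card_erase_lt_of_mem ho; omega)
        simp only [leftD, Finset.notMem_erase, if_false, Finset.insert_erase ho] at h1
        rcases neg_one_pow_eq_or R ((S.erase o).filter (· < o)).card with h2 | h2
        · rwa [h2, one_mul] at h1
        · rw [h2] at h1
          simpa using h1
  exact (key (Fintype.card O + 1) r hr).eq_zero (Nat.lt_succ_self _)

theorem HasParity.mul_self [Algebra ℂ R] {f : Grassmann O R} (h : HasParity 1 f) : f * f = 0 := by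
  have h1 : f * f = -(f * f) := by
    conv_lhs => rw [h.mul_comm h]
    exact neg_one_zsmul _
  have h2 : (1 + 1) • (f * f) = 0 := by
    rw [add_smul, one_smul]; nth_rewrite 1 [h1]; exact neg_add_cancel _
  exact nsmul_succ_eq_zero h2

end Grassmann

section Pullback

variable {N : ℕ} {U V : TopologicalSpace.Opens (Fin N → ℝ)}

theorem compBody_add {Γ' : Idx N → SuperFun U} (hV : ∀ x, bodyMap Γ' x ∈ V) (f g : Smooth V) :
    compBody Γ' (f + g) = compBody Γ' f + compBody Γ' g := by
  apply Subtype.ext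
  funext x
  rw [Smooth.add_apply, compBody_apply hV, compBody_apply hV, compBody_apply hV, Smooth.add_apply]

theorem iterPd_zero (g : Smooth V) : iterPd (fun _ => 0) g = g := by
  unfold iterPd
  induction List.finRange N with
  | nil => rfl
  | cons a l ih => rw [List.foldr_cons, ih]; rfl

/-- The Taylor expansion of `g(y)` as an additive map. -/
def taylorHom (Γ' : Idx N → SuperFun U) (hV : ∀ x, bodyMap Γ' x ∈ V) :
    Smooth V →+ SuperFun U :=
  AddMonoidHom.mk' (fun g => ∑ k ∈ box N, taylorTerm Γ' k g) fun f g => by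
    rw [← Finset.sum_add_distrib]
    refine Finset.sum_congr rfl fun k _ => ?_
    rw [taylorTerm, iterPd_add, compBody_add hV, smul_add, const_add, add_mul]
    rfl

theorem taylorHom_apply (Γ' : Idx N → SuperFun U) (hV : ∀ x, bodyMap Γ' x ∈ V) (g : Smooth V) :
    taylorHom Γ' hV g = ∑ k ∈ box N, taylorTerm Γ' k g := rfl

theorem hasParity_taylorHom (Γ' : Idx N → SuperFun U) (hV : ∀ x, bodyMap Γ' x ∈ V) (g : Smooth V) :
    HasParity 0 (taylorHom Γ' hV g) := HasParity.sum fun k _ => hasParity_taylorTerm Γ' k g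

variable {Γ' : Idx N → SuperFun U} (hΓ : IsCoordinateSystem Γ') (hV : ∀ x, bodyMap Γ' x ∈ V)

include hΓ hV

/-- The substitution separates into Taylor expansion of the coefficients and replacement of the
generators. Additivity is then immediate, and properties can be proved by induction over constants
and generators. -/
theorem pullback_eq_subst (f : SuperFun V) :
    pullback Γ' f = subst (taylorHom Γ' hV) (fun o => Γ' (Sum.inr o)) f := by
  rw [pullback, subst_apply]
  refine Finset.sum_congr rfl fun S _ => ?_
  rw [taylorHom_apply, ← sum_box, Finset.sum_mul]
  refine Finset.sum_congr rfl fun k _ => ?_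
  rw [taylorTerm, Fin.prod_univ_def fun i => nilPart Γ' i ^ (k i).1,
    show ((((List.finRange N).map fun i => nilPart Γ' i ^ (k i).1).prod :
      evenSubring (Fin N) (Smooth U)) : SuperFun U) = ((List.finRange N).map fun i =>
          (Γ' (Sum.inl i) - const (body (Γ' (Sum.inl i)))) ^ (k i).1).prod from by
      rw [← Subring.subtype_apply, map_list_prod, List.map_map]
      congr 2
      funext i
      rw [Function.comp_apply, map_pow, Subring.subtype_apply, nilPart_coe hΓ]]
  exact smul_const_mul_mul _ _ _ _

theorem pullback_add (f g : SuperFun V) : pullback Γ' (f + g) = pullback Γ' f + pullback Γ' g := by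
  simp only [pullback_eq_subst hΓ hV, map_add]

/-- The pullback as an additive map. -/
def pullbackHom : SuperFun V →+ SuperFun U := AddMonoidHom.mk' (pullback Γ') (pullback_add hΓ hV)

theorem pullback_zero : pullback Γ' (0 : SuperFun V) = 0 := map_zero (pullbackHom hΓ hV)

theorem pullback_zsmul (c : ℤ) (f : SuperFun V) : pullback Γ' (c • f) = c • pullback Γ' f :=
  map_zsmul (pullbackHom hΓ hV) c f

theorem pullback_const (r : Smooth V) : pullback Γ' (const r) = taylorHom Γ' hV r := by
  rw [pullback_eq_subst hΓ hV, subst_const]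

theorem pullback_gen_mul (o : Fin N) (f : SuperFun V) :
    pullback Γ' (gen o * f) = Γ' (Sum.inr o) * pullback Γ' f := by
  have hp : ∀ o, HasParity 1 (Γ' (Sum.inr o)) := fun o => hΓ.parity (Sum.inr o)
  rw [pullback_eq_subst hΓ hV, pullback_eq_subst hΓ hV, subst_gen_mul]
  · exact fun r o => (hasParity_taylorHom Γ' hV r).commute _
  · intro o a
    rw [(hp o).mul_comm (hp a)]
    exact neg_one_zsmul _
  · exact fun o => (hp o).mul_self

theorem pullback_sig (p : ZMod 2) (f : SuperFun V) :
    pullback Γ' (sig p f) = sig p (pullback Γ' f) := by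
  induction f using Grassmann.induction with
  | hc r =>
    rw [sig_const, pullback_const hΓ hV, (hasParity_taylorHom Γ' hV r).sig, mul_zero, sg_zero]
    exact (one_zsmul _).symm
  | ha f g hf hg =>
    rw [map_add, pullback_add hΓ hV, pullback_add hΓ hV, map_add, hf, hg]
  | hg o f hf =>
    rw [map_mul, (HasParity.gen o).sig, zsmul_mul_eq, pullback_zsmul hΓ hV, pullback_gen_mul hΓ hV,
      pullback_gen_mul hΓ hV, map_mul, (hΓ.parity (Sum.inr o)).sig, hf]
    exact (zsmul_mul_eq _ _ _).symm

theorem body_taylorHom (r : Smooth V) : body (taylorHom Γ' hV r) = compBody Γ' r := by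
  rw [taylorHom_apply, body_sum, Finset.sum_eq_single (fun _ => 0)]
  · rw [taylorTerm, body_mul, body_const, iterPd_zero]
    simp only [Nat.factorial_zero, Finset.prod_const_one, Nat.cast_one, inv_one, one_smul, pow_zero]
    exact mul_one _
  · intro k _ hk
    obtain ⟨j, hj⟩ : ∃ j, k j ≠ 0 := by
      by_contra h
      push Not at h
      exact hk (funext h)
    have h0 : body ((nilPart Γ' j ^ k j : evenSubring (Fin N) (Smooth U)) : SuperFun U) = 0 := by
      obtain ⟨m, hm⟩ := Nat.exists_eq_succ_of_ne_zero hj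
      rw [hm, pow_succ, Subring.coe_mul, body_mul, body_nilPart hΓ, mul_zero]
    rw [taylorTerm, body_mul, ← Finset.prod_erase_mul _ (fun i => nilPart Γ' i ^ k i)
      (Finset.mem_univ j), Subring.coe_mul, body_mul, h0, mul_zero, mul_zero]
  · intro h
    exact absurd (Fintype.mem_piFinset.2 fun i => Finset.mem_range.2 (Nat.succ_pos N)) h

theorem body_pullback (f : SuperFun V) : body (pullback Γ' f) = compBody Γ' (body f) := by
  have hz : compBody Γ' (0 : Smooth V) = 0 := by
    have := compBody_add hV (0 : Smooth V) 0
    rw [add_zero] at this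
    exact left_eq_add.1 this
  induction f using Grassmann.induction with
  | hc r => rw [pullback_const hΓ hV, body_taylorHom hΓ hV, body_const]
  | ha f g hf hg =>
    rw [pullback_add hΓ hV, show body (f + g) = body f + body g from rfl, compBody_add hV, ← hf, ← hg]
    rfl
  | hg o f hf =>
    rw [pullback_gen_mul hΓ hV, body_mul, body_mul, body_gen, (hΓ.parity (Sum.inr o)).body_eq_zero,
      zero_mul, zero_mul, hz]

/-- The chain rule. -/
theorem dl_pullback (B : Idx N) (f : SuperFun V) :
    dl B (pullback Γ' f) = ∑ A, dl B (Γ' A) * pullback Γ' (dl A f) := by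
  induction f using Grassmann.induction with
  | hc r =>
    rw [pullback_const hΓ hV, taylorHom_apply, dl_sum_taylorTerm hΓ hV, Fintype.sum_sum_type]
    have h0 : ∀ o, dl B (Γ' (Sum.inr o)) * pullback Γ' (dl (Sum.inr o) (const r : SuperFun V)) = 0 :=
      fun o => by
        rw [dl_inr, leftD_const, pullback_zero hΓ hV]
        exact mul_zero (dl B (Γ' (Sum.inr o)) : Grassmann (Fin N) (Smooth U))
    rw [Finset.sum_eq_zero (s := Finset.univ) fun o _ => h0 o, add_zero]
    refine Finset.sum_congr rfl fun j _ => ?_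
    rw [dl_inl, mapCoeff_pd_const, pullback_const hΓ hV, taylorHom_apply]
  | ha f g hf hg =>
    rw [pullback_add hΓ hV, dl_add, hf, hg, ← Finset.sum_add_distrib]
    refine Finset.sum_congr rfl fun A _ => ?_
    rw [dl_add, pullback_add hΓ hV, mul_add]
  | hg o f hf =>
    have hA : ∀ A, pullback Γ' (dl A (gen o * f)) =
        (if A = Sum.inr o then pullback Γ' f else 0) +
          sg (par A) • (Γ' (Sum.inr o) * pullback Γ' (dl A f)) := fun A => by
      rw [dl_mul, (HasParity.gen o).sig, mul_one, pullback_add hΓ hV, zsmul_mul_eq,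
        pullback_zsmul hΓ hV, pullback_gen_mul hΓ hV]
      congr 1
      rcases A with i | a
      · rw [dl_inl, if_neg (by simp)]
        have : mapCoeff (Smooth.pd i) (gen o : SuperFun V) = 0 := by
          ext1; funext S
          change Smooth.pd i (if S = {o} then 1 else 0) = 0
          split
          · exact Smooth.pd_one i
          · exact Smooth.pd_zero i
        rw [this, zero_mul, pullback_zero hΓ hV]
      · rw [dl_inr, leftD_gen]
        by_cases h : a = o
        · rw [if_pos h, if_pos (by rw [h]), one_mul]
        · rw [if_neg h, if_neg (by simpa using h), zero_mul, pullback_zero hΓ hV]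
    have hw : ∀ A, sg (par B) • (Γ' (Sum.inr o) * (dl B (Γ' A) * pullback Γ' (dl A f))) =
        dl B (Γ' A) * sg (par A) • (Γ' (Sum.inr o) * pullback Γ' (dl A f)) := fun A => by
      rw [← mul_assoc, (hΓ.parity (Sum.inr o)).mul_comm ((hΓ.parity A).dl B), mul_zsmul_eq,
        zsmul_mul_eq, smul_smul, mul_assoc, par_inr, one_mul, ← sg_add]
      congr 2
      generalize par A = a
      generalize par B = b
      revert a b; decide
    rw [pullback_gen_mul hΓ hV, dl_mul, (hΓ.parity (Sum.inr o)).sig, par_inr, mul_one, zsmul_mul_eq, hf]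
    simp only [hA, mul_add, Finset.sum_add_distrib, ← hw]
    congr 1
    · rw [Finset.sum_eq_single (Sum.inr o)]
      · rw [if_pos rfl]
      · intro A _ hne
        rw [if_neg hne]
        exact mul_zero (dl B (Γ' A) : Grassmann (Fin N) (Smooth U))
      · exact fun h => absurd (Finset.mem_univ _) h
    · rw [Finset.mul_sum, Finset.smul_sum]

end Pullback
end
end SuperBV

set_option linter.unusedSectionVars false
namespace SuperBV
noncomputable section
open Grassmann

theorem Grassmann.sub_mul_identity {O R : Type*} [LinearOrder O] [CommRing R]
    (w p q a b s t : Grassmann O R) :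
    w * (p + q) - (w * a * b + w * s * t) = w * ((p - a * b) + (q - s * t)) := by
  noncomm_ring

theorem Grassmann.sum_mul_ite {O R κ : Type*} [LinearOrder O] [CommRing R] [Fintype κ]
    [DecidableEq κ] (f : κ → Grassmann O R) (A : κ) :
    ∑ C, f C * (if C = A then 1 else 0) = f A := by simp

/-! ### The pullback as an injective ring homomorphism -/

section PullbackRing

variable {N : ℕ} {U V : TopologicalSpace.Opens (Fin N → ℝ)}

theorem Smooth.isSmooth_coord (i : Fin N) :
    IsSmooth (fun y : V => (((y : Fin N → ℝ) i : ℝ) : ℂ)) :=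
  isSmooth_of_contDiffOn (g := fun y => ((y i : ℝ) : ℂ))
    (Complex.ofRealCLM.contDiff.comp (contDiff_apply ℝ ℝ i)).contDiffOn fun _ => rfl

/-- The coordinate functions on `V`. -/
def Smooth.coord (i : Fin N) : Smooth V := ⟨fun y => (((y : Fin N → ℝ) i : ℝ) : ℂ), isSmooth_coord i⟩

theorem Smooth.pd_coord (i j : Fin N) : pd j (coord i : Smooth V) = if i = j then 1 else 0 := by
  apply Subtype.ext
  funext y
  rw [pd_eq_of_eventuallyEq (g := fun y => ((y i : ℝ) : ℂ)) fun y => rfl]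
  have h : HasFDerivAt (fun y : Fin N → ℝ => ((y i : ℝ) : ℂ))
      (Complex.ofRealCLM.comp (ContinuousLinearMap.proj i)) (y : Fin N → ℝ) :=
    (Complex.ofRealCLM.comp (ContinuousLinearMap.proj (R := ℝ) (φ := fun _ : Fin N => ℝ) i)).hasFDerivAt
  rw [h.fderiv]
  change (((Pi.single j 1 : Fin N → ℝ) i : ℝ) : ℂ) = _
  rw [Pi.single_apply]
  split
  · exact Complex.ofReal_one
  · exact Complex.ofReal_zero

/-- The coordinates `y, η` of the superdomain with body `V`. -/
def coordFun (A : Idx N) : SuperFun V := Sum.elim (fun i => const (Smooth.coord i)) gen A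

theorem dl_coordFun (A B : Idx N) : dl B (coordFun A : SuperFun V) = if A = B then 1 else 0 := by
  rcases A with i | o <;> rcases B with j | a
  · change mapCoeff (Smooth.pd j) (const (Smooth.coord i) : SuperFun V) = _
    rw [mapCoeff_pd_const, Smooth.pd_coord]
    by_cases h : i = j
    · rw [if_pos h, if_pos (by rw [h]), const_one]
    · rw [if_neg h, if_neg (by simpa using h), const_zero]
  · change leftD a (const (Smooth.coord i) : SuperFun V) = _
    rw [leftD_const, if_neg (by simp)]
  · change mapCoeff (Smooth.pd j) (gen o : SuperFun V) = _
    rw [if_neg (by simp)]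
    ext1; funext S
    change Smooth.pd j (if S = {o} then 1 else 0) = 0
    split
    · exact Smooth.pd_one j
    · exact Smooth.pd_zero j
  · change leftD a (gen o : SuperFun V) = _
    rw [leftD_gen]
    by_cases h : a = o
    · rw [if_pos h, if_pos (by rw [h])]
    · rw [if_neg h, if_neg (by simpa using Ne.symm h)]

variable {Γ' : Idx N → SuperFun U} (hΓ : IsCoordinateSystem Γ') (hV : ∀ x, bodyMap Γ' x ∈ V)

include hΓ hV

/-- By the chain rule the odd derivatives vanish, and the body is `1`. The truncated Taylor sums
need not be examined. -/
theorem pullback_one : pullback Γ' (1 : SuperFun V) = 1 := by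
  refine sub_eq_zero.1 (eq_zero_of_leftD_mem_span (P := {pullback Γ' (1 : SuperFun V) - 1}) ?_ ?_ rfl)
  · rintro _ rfl
    rw [body_sub, body_pullback hΓ hV, body_one, body_one]
    refine sub_eq_zero.2 (Subtype.ext (funext fun x => ?_))
    rw [compBody_apply hV]
    rfl
  · rintro _ rfl o
    have h1 := dl_pullback hΓ hV (Sum.inr o) (1 : SuperFun V)
    have h0 : ∀ A, dl (Sum.inr o) (Γ' A) * pullback Γ' (dl A (1 : SuperFun V)) = 0 := fun A => by
      rw [dl_one, pullback_zero hΓ hV]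
      exact mul_zero (dl (Sum.inr o) (Γ' A) : Grassmann (Fin N) (Smooth U))
    rw [Finset.sum_eq_zero fun A _ => h0 A] at h1
    rw [leftD_sub, show leftD o (pullback Γ' (1 : SuperFun V)) = 0 from h1,
      show leftD o (1 : SuperFun U) = 0 from dl_one (Sum.inr o), sub_self]
    exact zero_mem _

theorem pullback_coordFun (A : Idx N) : pullback Γ' (coordFun A : SuperFun V) = Γ' A := by
  rcases A with i | o
  · refine sub_eq_zero.1 (eq_zero_of_leftD_mem_span
      (P := {pullback Γ' (coordFun (Sum.inl i) : SuperFun V) - Γ' (Sum.inl i)}) ?_ ?_ rfl)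
    · rintro _ rfl
      rw [body_sub, body_pullback hΓ hV]
      refine sub_eq_zero.2 (Subtype.ext (funext fun x => ?_))
      rw [compBody_apply hV, show body (coordFun (Sum.inl i) : SuperFun V) = Smooth.coord i from
        body_const _]
      exact Complex.ext rfl (hΓ.real i x).symm
    · rintro _ rfl a
      have h1 := dl_pullback hΓ hV (Sum.inr a) (coordFun (Sum.inl i) : SuperFun V)
      have h0 : ∀ A, A ≠ Sum.inl i →
          dl (Sum.inr a) (Γ' A) * pullback Γ' (dl A (coordFun (Sum.inl i) : SuperFun V)) = 0 :=
        fun A hA => by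
          rw [dl_coordFun, if_neg (Ne.symm hA), pullback_zero hΓ hV]
          exact mul_zero (dl (Sum.inr a) (Γ' A) : Grassmann (Fin N) (Smooth U))
      rw [Finset.sum_eq_single (Sum.inl i) (fun A _ hA => h0 A hA)
        (fun h => absurd (Finset.mem_univ _) h), dl_coordFun, if_pos rfl, pullback_one hΓ hV,
        mul_one] at h1
      rw [leftD_sub, show leftD a (pullback Γ' (coordFun (Sum.inl i) : SuperFun V)) = _ from h1,
        dl_inr, sub_self]
      exact zero_mem _
  · have h1 := pullback_gen_mul hΓ hV o 1
    rw [pullback_one hΓ hV] at h1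
    exact (congrArg (pullback Γ') (mul_one (gen o : SuperFun V)).symm).trans
      (h1.trans (mul_one (Γ' (Sum.inr o) : Grassmann (Fin N) (Smooth U))))

/-- The failures of multiplicativity have no body, and by the chain and product rules an odd
derivative of one of them is a combination of others. Such a family is zero by
`eq_zero_of_leftD_mem_span`, which avoids multiplying Taylor expansions. -/
theorem pullback_mul (f g : SuperFun V) :
    pullback Γ' (f * g) = pullback Γ' f * pullback Γ' g := by
  set P : Set (SuperFun U) := {r | ∃ f g : SuperFun V, r = pullback Γ' (f * g) -
    pullback Γ' f * pullback Γ' g} with hP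
  refine sub_eq_zero.1 (eq_zero_of_leftD_mem_span (P := P) ?_ ?_ ⟨f, g, rfl⟩)
  · rintro _ ⟨f, g, rfl⟩
    rw [body_sub, body_mul, body_pullback hΓ hV, body_pullback hΓ hV, body_pullback hΓ hV, body_mul]
    refine sub_eq_zero.2 (Subtype.ext (funext fun x => ?_))
    rw [Smooth.mul_apply, compBody_apply hV, compBody_apply hV, compBody_apply hV, Smooth.mul_apply]
  · rintro _ ⟨f, g, rfl⟩ o
    have hsw : ∀ A (x : SuperFun U), sig (par (Sum.inr o : Idx N)) x * dl (Sum.inr o) (Γ' A) =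
        dl (Sum.inr o) (Γ' A) * sig (par A) x := fun A x => by
      rw [((hΓ.parity A).dl (Sum.inr o)).mul_eq_mul_sig, ← sig_add']
      have k : ∀ a b : ZMod 2, a + b + b = a := by decide
      rw [k]
    have key : leftD o (pullback Γ' (f * g) - pullback Γ' f * pullback Γ' g) =
        ∑ A, dl (Sum.inr o) (Γ' A) *
          ((pullback Γ' (dl A f * g) - pullback Γ' (dl A f) * pullback Γ' g) +
            (pullback Γ' (sig (par A) f * dl A g) -
              pullback Γ' (sig (par A) f) * pullback Γ' (dl A g))) := by
      change dl (Sum.inr o) (pullback Γ' (f * g) - pullback Γ' f * pullback Γ' g) = _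
      rw [dl_sub, dl_mul, dl_pullback hΓ hV, dl_pullback hΓ hV, dl_pullback hΓ hV, Finset.sum_mul,
        Finset.mul_sum, ← Finset.sum_add_distrib, ← Finset.sum_sub_distrib]
      refine Finset.sum_congr rfl fun A _ => ?_
      rw [dl_mul, pullback_add hΓ hV, ← mul_assoc (sig _ _), hsw, pullback_sig hΓ hV]
      exact sub_mul_identity _ _ _ _ _ _ _
    rw [key]
    refine Submodule.sum_mem _ fun A _ => Ideal.mul_mem_left _ _ (Submodule.add_mem _ ?_ ?_)
    · exact Ideal.subset_span ⟨_, _, rfl⟩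
    · exact Ideal.subset_span ⟨_, _, rfl⟩

/-- The derivatives with respect to the new coordinates. -/
theorem drNew_pullback (A : Idx N) (f : SuperFun V) :
    drNew par dl Γ' A (pullback Γ' f) = pullback Γ' (dr A f) := by
  have h1 : ∀ B, rd par dl B (pullback Γ' f) =
      ∑ C, pullback Γ' (dr C f) * rd par dl B (Γ' C) := fun B => by
    rw [rd, dl_pullback hΓ hV, map_sum]
    refine Finset.sum_congr rfl fun C _ => ?_
    have h2 := (isSuperDer_dl.rd_parity (hΓ.parity C) B).mul_eq_sig_mul
      (sig (par B) (pullback Γ' (dl C f)))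
    have k : ∀ a b : ZMod 2, a + b + b = a := by decide
    rw [← sig_add', k] at h2
    rw [map_mul, dr_eq, pullback_sig hΓ hV]
    exact h2
  have hJ : IsUnit (jacobian par dl Γ') := by rw [jacobian_dl]; exact hΓ.jacobian
  rw [drNew, Finset.sum_congr rfl fun B _ => by rw [h1 B, Finset.sum_mul], Finset.sum_comm,
    ← sum_mul_ite (fun C => pullback Γ' (dr C f)) A]
  refine Finset.sum_congr rfl fun C _ => ?_
  rw [← drNew_self isSuperDer_dl hJ C A, drNew, Finset.mul_sum]
  simp only [mul_assoc]

/-- The kernel is stable under odd derivatives, because these correspond to derivatives with respect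
to the new coordinates. Its elements have no body, because the body map reaches every point of `V`.
-/
theorem pullback_injective (hr : (V : Set (Fin N → ℝ)) = Set.range (bodyMap Γ')) {f : SuperFun V}
    (hf : pullback Γ' f = 0) : f = 0 := by
  refine eq_zero_of_leftD_mem_span (P := {f : SuperFun V | pullback Γ' f = 0}) ?_ ?_ hf
  · intro f hf
    apply Subtype.ext
    funext y
    have hy : (y : Fin N → ℝ) ∈ (V : Set (Fin N → ℝ)) := y.2
    rw [hr] at hy
    obtain ⟨x, hx⟩ := hy
    have h1 := body_pullback hΓ hV f
    rw [show pullback Γ' f = 0 from hf] at h1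
    have h2 := compBody_apply hV (body f) x
    rw [← h1] at h2
    have h3 : (⟨bodyMap Γ' x, hV x⟩ : V) = y := Subtype.ext hx
    rw [h3] at h2
    exact h2.symm
  · intro f hf o
    refine Ideal.subset_span ?_
    have h1 := drNew_pullback hΓ hV (Sum.inr o) f
    rw [show pullback Γ' f = 0 from hf] at h1
    have h2 : drNew par dl Γ' (Sum.inr o) (0 : SuperFun U) = 0 :=
      (isRightDer_drNew isSuperDer_dl hΓ.parity (by rw [jacobian_dl]; exact hΓ.jacobian) _).zero
    rw [h2, dr_eq, pullback_sig hΓ hV] at h1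
    have h3 := congrArg (sig (par (Sum.inr o : Idx N))) h1
    rw [sig_sig, map_zero] at h3
    exact h3.symm

end PullbackRing
end
end SuperBV

set_option linter.unusedSectionVars false
namespace SuperBV
noncomputable section
open Grassmann

/-! ### Every superfunction is a superfunction of the new coordinates -/

namespace Grassmann

section Leading

variable {O R A : Type*} [LinearOrder O] [Fintype O] [CommRing R] [Ring A]

/-- The element `x` agrees up to terms of order more than `d` with an element of order `d` of the
image of `Φ`. -/
def IsLeading (Φ : A →+* Grassmann O R) (d : ℕ) (x : Grassmann O R) : Prop :=
  ∃ f, HasOrder d (Φ f) ∧ HasOrder (d + 1) (x - Φ f)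

variable {Φ : A →+* Grassmann O R}

theorem IsLeading.hasOrder {d : ℕ} {x : Grassmann O R} (h : IsLeading Φ d x) : HasOrder d x := by
  obtain ⟨f, h1, h2⟩ := h
  have := (h2.mono (Nat.le_succ d)).add h1
  rwa [sub_add_cancel] at this

theorem IsLeading.mul {d e : ℕ} {x y : Grassmann O R} (hx : IsLeading Φ d x)
    (hy : IsLeading Φ e y) : IsLeading Φ (d + e) (x * y) := by
  have hy' := hy.hasOrder
  obtain ⟨f, f1, f2⟩ := hx
  obtain ⟨g, g1, g2⟩ := hy
  refine ⟨f * g, by rw [map_mul]; exact f1.mul g1, ?_⟩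
  rw [map_mul, show x * y - Φ f * Φ g = (x - Φ f) * y + Φ f * (y - Φ g) by noncomm_ring]
  exact ((f2.mul hy').mono (by omega)).add ((f1.mul g2).mono (by omega))

theorem IsLeading.add {d : ℕ} {x y : Grassmann O R} (hx : IsLeading Φ d x)
    (hy : IsLeading Φ d y) : IsLeading Φ d (x + y) := by
  obtain ⟨f, f1, f2⟩ := hx
  obtain ⟨g, g1, g2⟩ := hy
  refine ⟨f + g, by rw [map_add]; exact f1.add g1, ?_⟩
  rw [map_add, add_sub_add_comm]
  exact f2.add g2

theorem IsLeading.of_hasOrder {d : ℕ} {x : Grassmann O R} (h : HasOrder (d + 1) x) :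
    IsLeading Φ d x :=
  ⟨0, by rw [map_zero]; exact fun _ _ => rfl, by rwa [map_zero, sub_zero]⟩

theorem IsLeading.congr {d : ℕ} {x y : Grassmann O R} (hx : IsLeading Φ d x)
    (h : HasOrder (d + 1) (y - x)) : IsLeading Φ d y := by
  have := hx.add (IsLeading.of_hasOrder (Φ := Φ) h)
  rwa [add_sub_cancel] at this

theorem IsLeading.sum {ι : Type*} {d : ℕ} (s : Finset ι) {x : ι → Grassmann O R}
    (h : ∀ i ∈ s, IsLeading Φ d (x i)) : IsLeading Φ d (∑ i ∈ s, x i) :=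
  Finset.sum_induction _ _ (fun _ _ => IsLeading.add)
    (IsLeading.of_hasOrder fun _ _ => rfl) h

theorem isLeading_image {d : ℕ} {f : A} (h : HasOrder d (Φ f)) : IsLeading Φ d (Φ f) :=
  ⟨f, h, by rw [sub_self]; exact fun _ _ => rfl⟩

/-- A homomorphism to a Grassmann algebra is surjective if its image contains the constants and
the generators to leading order. -/
theorem surjective_of_isLeading (hc : ∀ r, IsLeading Φ 0 (const r))
    (hg : ∀ o, IsLeading Φ 1 (gen o)) : Function.Surjective Φ := by
  have hm : ∀ (S : Finset O) (r : R), IsLeading Φ S.card (mono S r) := by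
    intro S r
    induction S using Finset.induction_on_min with
    | empty => exact hc r
    | insert a S h ih =>
      rw [mono_insert h, Finset.card_insert_of_notMem (fun h' => lt_irrefl _ (h a h')), add_comm]
      exact (hg a).mul ih
  have hstep : ∀ d (x : Grassmann O R), HasOrder d x → IsLeading Φ d x := fun d x hx => by
    rw [eq_sum_mono x]
    refine IsLeading.sum _ fun S _ => ?_
    rcases lt_trichotomy S.card d with h | h | h
    · rw [hx S h]
      refine IsLeading.of_hasOrder fun T _ => ?_
      simp [mono]
    · rw [← h]; exact hm S _
    · refine IsLeading.of_hasOrder fun T hT => ?_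
      rw [mono]
      refine if_neg ?_
      rintro rfl
      omega
  -- Successive approximation: the leading part of the error is in the image up to higher order, and
  -- subtracting it raises the order. Finitely many generators make the process terminate.
  have hall : ∀ d (x : Grassmann O R), ∃ f, HasOrder d (x - Φ f) := by
    intro d x
    induction d with
    | zero => exact ⟨0, hasOrder_zero _⟩
    | succ d ih =>
      obtain ⟨f, hf⟩ := ih
      obtain ⟨g, -, hg⟩ := hstep d _ hf
      exact ⟨f + g, by rwa [map_add, ← sub_sub]⟩
  intro x
  obtain ⟨f, hf⟩ := hall (Fintype.card O + 1) x
  exact ⟨f, (sub_eq_zero.1 (hf.eq_zero (Nat.lt_succ_self _))).symm⟩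

/-- The terms of degree one of an odd element. -/
theorem HasParity.hasOrder_one {f : Grassmann O R} (h : HasParity 1 f) : HasOrder 1 f :=
  hasOrder_one_iff.2 h.body_eq_zero

/-- To first order the odd elements `Φ (η j)` are linear in the generators, with the matrix of the
bodies of their derivatives. Its left inverse `c` recovers a generator up to terms of order two.
That constants are attained only to leading order does no harm at this accuracy. -/
theorem isLeading_gen (hc : ∀ r, IsLeading Φ 0 (const r)) {κ : Type*} [Fintype κ] (η : κ → A)
    (c : O → κ → R) (hη : ∀ j, HasParity 1 (Φ (η j)))
    (h : ∀ i k, ∑ j, c i j * body (leftD k (Φ (η j))) = if i = k then 1 else 0) (i : O) :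
    IsLeading Φ 1 (gen i) := by
  have h1 : IsLeading Φ (0 + 1) (∑ j, const (c i j) * Φ (η j)) :=
    IsLeading.sum _ fun j _ => (hc _).mul (isLeading_image (hη j).hasOrder_one)
  rw [zero_add] at h1
  refine h1.congr fun S hS => ?_
  rw [sub_coeff, sum_coeff]
  simp only [const_mul_coeff]
  rcases S.eq_empty_or_nonempty with rfl | hne
  · have h0 : ∀ j, (Φ (η j)).coeff ∅ = 0 := fun j => (hη j).body_eq_zero
    simp only [h0, mul_zero, Finset.sum_const_zero, sub_zero]
    exact body_gen i
  · obtain ⟨k, rfl⟩ := Finset.card_eq_one.1 (show S.card = 1 by have := hne.card_pos; omega)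
    have h2 : ∀ j, (Φ (η j)).coeff {k} = body (leftD k (Φ (η j))) := fun j => by
      simp [body, leftD]
    simp only [h2, h]
    rw [gen]
    simp only [Finset.singleton_inj, eq_comm, sub_self]

end Leading

end Grassmann

section Surjective

variable {N : ℕ} {U V : TopologicalSpace.Opens (Fin N → ℝ)} {Γ' : Idx N → SuperFun U}
  (hΓ : IsCoordinateSystem Γ') (hV : ∀ x, bodyMap Γ' x ∈ V)

/-- The pullback as a ring homomorphism. -/
def pullbackRingHom : SuperFun V →+* SuperFun U where
  toFun := pullback Γ'
  map_one' := pullback_one hΓ hV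
  map_mul' := pullback_mul hΓ hV
  map_zero' := pullback_zero hΓ hV
  map_add' := pullback_add hΓ hV

include hΓ hV in
-- To leading order the constants are attained because smooth functions transfer along the body map,
-- and the generators because the odd-odd block of the Jacobian matrix has invertible body.
theorem pullback_surjective (hr : (V : Set (Fin N → ℝ)) = Set.range (bodyMap Γ')) :
    Function.Surjective (pullback Γ' : SuperFun V → SuperFun U) := by
  have hc : ∀ r, IsLeading (pullbackRingHom hΓ hV) 0 (const r) := fun r => by
    obtain ⟨g, hg⟩ := hΓ.exists_comp_bodyMap hr r
    refine ⟨const g, hasOrder_zero _, hasOrder_one_iff.2 ?_⟩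
    rw [body_sub, show body (pullbackRingHom hΓ hV (const g)) = compBody Γ' (body (const g)) from
      body_pullback hΓ hV _, body_const, body_const]
    refine sub_eq_zero.2 (Subtype.ext (funext fun x => ?_))
    rw [compBody, mkSmooth_apply (isSmooth_comp hV g), hg]
  have hη : ∀ j, pullbackRingHom hΓ hV (coordFun (Sum.inr j)) = Γ' (Sum.inr j) := fun j =>
    pullback_coordFun hΓ hV (Sum.inr j)
  set D : Matrix (Fin N) (Fin N) (Smooth U) :=
    Matrix.of fun j k => body (leftD k (Γ' (Sum.inr j))) with hD
  have hdet : IsUnit D.det := Smooth.isUnit_of_ne_zero fun x => by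
    have h1 := (Matrix.isUnit_iff_isUnit_det _).1 (hΓ.isUnit_body_blocks x).2
    have h2 : (Matrix.of fun i j => evalBody x (dr (Sum.inr j) (Γ' (Sum.inr i))) :
        Matrix (Fin N) (Fin N) ℂ) = (Smooth.evalHom x).mapMatrix D := by
      ext j k
      change (body (dr (Sum.inr k) (Γ' (Sum.inr j)))).1 x = (body (dl (Sum.inr k) (Γ' (Sum.inr j)))).1 x
      rw [dr_eq, body_sig]
    rw [h2, ← RingHom.map_det] at h1
    exact h1.ne_zero
  refine surjective_of_isLeading hc (isLeading_gen hc (fun j => coordFun (Sum.inr j))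
    (fun i j => D⁻¹ i j) ?_ ?_)
  · intro j
    rw [hη]
    exact hΓ.parity (Sum.inr j)
  · intro i k
    simp only [hη]
    have := congrFun (congrFun (Matrix.nonsing_inv_mul D hdet) i) k
    rwa [Matrix.mul_apply, Matrix.one_apply] at this

end Surjective
end
end SuperBV

set_option linter.unusedSectionVars false
namespace SuperBV
noncomputable section
open Grassmann MeasureTheory

/-! ### Integration along the scaling of the coordinates `F` -/

section Scaling

variable {N : ℕ} {V : TopologicalSpace.Opens (Fin N → ℝ)} (ε : Fin N → ZMod 2)

/-- The scaling `(F; G) ↦ (tF; G)` of the even coordinates. -/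
def scaleF (t : ℝ) (y : Fin N → ℝ) : Fin N → ℝ := fun α => if ε α = 0 then y α else t * y α

theorem contDiff_scaleF : ContDiff ℝ ∞ fun p : ℝ × (Fin N → ℝ) => scaleF ε p.1 p.2 := by
  refine contDiff_pi.2 fun α => ?_
  unfold scaleF
  split
  · exact (contDiff_apply ℝ ℝ α).comp contDiff_snd
  · exact contDiff_fst.mul ((contDiff_apply ℝ ℝ α).comp contDiff_snd)

theorem scaleF_one (y : Fin N → ℝ) : scaleF ε 1 y = y := by
  funext α; simp [scaleF]

theorem continuous_scaleF (y : Fin N → ℝ) : Continuous fun t => scaleF ε t y :=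
  (contDiff_scaleF ε).continuous.comp (Continuous.prodMk continuous_id continuous_const)

/-- Smooth dependence on the parameter is obtained from convolutions: the integral over `[0, 1]` is
the convolution of an indicator function with a compactly supported kernel depending smoothly on
`y`, taken at the point zero. -/
theorem isSmooth_integral (hV : ∀ y ∈ V, ∀ t ∈ Set.Icc (0 : ℝ) 1, scaleF ε t y ∈ V) (m : ℕ)
    (g : Smooth V) :
    IsSmooth fun y : V => ∫ t in (0 : ℝ)..1, ((t : ℂ) ^ m) * extendZero g.1 (scaleF ε t y) := by
  refine isSmooth_of_contDiffAt fun y₀ => ?_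
  -- The segment over `y₀` is compact, so the scaled points remain in `V` for `y` near `y₀` and for
  -- `t` slightly beyond `[0, 1]`. This margin leaves room for a cutoff.
  obtain ⟨u, v, hu, hv, hIu, hyv, huv⟩ := generalized_tube_lemma
    (isCompact_Icc : IsCompact (Set.Icc (0 : ℝ) 1)) (isCompact_singleton : IsCompact {(y₀ : Fin N → ℝ)})
    (V.isOpen.preimage (contDiff_scaleF ε).continuous) (by
      rintro ⟨t, y⟩ ⟨ht, rfl⟩
      exact hV _ y₀.2 t ht)
  obtain ⟨δ, hδ, hδu⟩ := isCompact_Icc.exists_cthickening_subset_open hu hIu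
  have hball : Metric.closedBall (1 / 2 : ℝ) (1 / 2 + δ) ⊆ u := by
    refine Set.Subset.trans (fun t ht => ?_) hδu
    rw [Real.closedBall_eq_Icc, Set.mem_Icc] at ht
    refine Metric.mem_cthickening_of_dist_le t (max 0 (min 1 t)) δ _
      ⟨le_max_left _ _, max_le zero_le_one (min_le_left _ _)⟩ ?_
    rw [Real.dist_eq, abs_le]
    rcases le_total 1 t with h1 | h1 <;> rcases le_total 0 t with h0 | h0 <;>
      simp [h1, h0, hδ.le] <;> constructor <;> linarith
  -- The inner ball, of centre and radius one half, is `[0, 1]`. The cutoff equals one there and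
  -- vanishes outside the range of `t` in which the integrand is smooth.
  let χ : ContDiffBump (1 / 2 : ℝ) := ⟨1 / 2, 1 / 2 + δ, by norm_num, by linarith⟩
  set h : (Fin N → ℝ) → ℝ → ℂ := fun y t => ((t : ℂ) ^ m) * extendZero g.1 (scaleF ε t y) with hh
  set K : (Fin N → ℝ) → ℝ → ℂ := fun y x => (χ (-x) : ℂ) * h y (-x) with hK
  have hχ0 : ∀ t, t ∉ Metric.closedBall (1 / 2 : ℝ) (1 / 2 + δ) → χ t = 0 := fun t ht =>
    χ.zero_of_le_dist (not_le.1 fun h => ht (Metric.mem_closedBall.2 h)).le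
  have hKsmooth : ContDiffOn ℝ ∞ (Function.uncurry K) (v ×ˢ Set.univ) := by
    rintro ⟨y, x⟩ ⟨hy, -⟩
    refine ContDiffAt.contDiffWithinAt ?_
    by_cases hx : -x ∈ Metric.closedBall (1 / 2 : ℝ) (1 / 2 + δ)
    · have hmem : scaleF ε (-x) y ∈ V := huv (⟨hball hx, hy⟩ : (-x, y) ∈ u ×ˢ v)
      have h1 : ContDiffAt ℝ ∞ (fun p : (Fin N → ℝ) × ℝ => (χ (-p.2) : ℂ)) (y, x) :=
        (Complex.ofRealCLM.contDiff.comp (χ.contDiff.comp contDiff_snd.neg)).contDiffAt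
      have h2 : ContDiffAt ℝ ∞ (fun p : (Fin N → ℝ) × ℝ => ((-p.2 : ℝ) : ℂ) ^ m) (y, x) :=
        ((Complex.ofRealCLM.contDiff.comp contDiff_snd.neg).pow m).contDiffAt
      have h3 : ContDiffAt ℝ ∞ (fun p : (Fin N → ℝ) × ℝ => extendZero g.1 (scaleF ε (-p.2) p.1))
          (y, x) := ContDiffAt.comp (y, x) (g := extendZero g.1)
            (f := fun p : (Fin N → ℝ) × ℝ => scaleF ε (-p.2) p.1)
            (Smooth.contDiffAt g ⟨_, hmem⟩)
            ((contDiff_scaleF ε).comp (contDiff_snd.neg.prodMk contDiff_fst)).contDiffAt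
      exact h1.mul (h2.mul h3)
    · refine (contDiffAt_const (c := (0 : ℂ))).congr_of_eventuallyEq ?_
      have hopen : IsOpen {p : (Fin N → ℝ) × ℝ | -p.2 ∉ Metric.closedBall (1 / 2 : ℝ) (1 / 2 + δ)} :=
        (Metric.isClosed_closedBall.preimage continuous_snd.neg).isOpen_compl
      filter_upwards [hopen.mem_nhds hx] with p hp
      change (χ (-p.2) : ℂ) * h p.1 (-p.2) = 0
      rw [hχ0 _ hp, Complex.ofReal_zero, zero_mul]
  have hone : LocallyIntegrable (Set.indicator (Set.Ioc (0 : ℝ) 1) fun _ => (1 : ℂ)) volume := by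
    refine (IntegrableOn.integrable_indicator ?_ measurableSet_Ioc).locallyIntegrable
    simp [integrableOn_const_iff]
  -- Evaluated at zero, the convolution integrates the kernel at `-t`. The reflection built into `K`
  -- compensates this.
  have hconv := contDiffOn_convolution_right_with_param_comp (μ := volume) (n := ⊤)
    (f := Set.indicator (Set.Ioc (0 : ℝ) 1) fun _ => (1 : ℂ))
    (ContinuousLinearMap.mul ℝ ℂ) (v := fun _ : Fin N → ℝ => (0 : ℝ)) (s := v)
    (g := K) (k := Metric.closedBall (-(1 / 2) : ℝ) (1 / 2 + δ)) contDiffOn_const hv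
    (isCompact_closedBall _ _) (fun y x _ hx => by
      refine mul_eq_zero_of_left ?_ _
      rw [hχ0, Complex.ofReal_zero]
      intro hx'
      refine hx ?_
      rw [Metric.mem_closedBall, Real.dist_eq] at hx' ⊢
      rwa [← abs_neg, show -(x - -(1 / 2)) = -x - 1 / 2 by ring])
    hone hKsmooth
  have hy₀ : (y₀ : Fin N → ℝ) ∈ v := hyv rfl
  refine ((hconv _ hy₀).contDiffAt (hv.mem_nhds hy₀)).congr_of_eventuallyEq ?_
  filter_upwards [V.isOpen.mem_nhds y₀.2] with y hy
  rw [extendZero_apply _ hy, convolution_def, intervalIntegral.integral_of_le zero_le_one,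
    ← integral_indicator measurableSet_Ioc]
  refine integral_congr_ae (Filter.Eventually.of_forall fun t => ?_)
  by_cases ht : t ∈ Set.Ioc (0 : ℝ) 1
  · have hχ1 : χ t = 1 := χ.one_of_mem_closedBall (by
      rw [Real.closedBall_eq_Icc]
      exact ⟨by norm_num; exact ht.1.le, by norm_num; exact ht.2⟩)
    simp [ht, hK, hh, hχ1]
  · simp [ht]

end Scaling
end
end SuperBV

set_option linter.unusedSectionVars false
namespace SuperBV
noncomputable section
open Grassmann MeasureTheory

/-! ### The homotopy formula for the scaling -/

section Homotopy

variable {N : ℕ} {V : TopologicalSpace.Opens (Fin N → ℝ)} {ε : Fin N → ZMod 2}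
  (hV : ∀ y ∈ V, ∀ t ∈ Set.Icc (0 : ℝ) 1, scaleF ε t y ∈ V)

/-- The degree of a monomial in the odd ones of the scaled coordinates. -/
def weight (ε : Fin N → ZMod 2) (S : Finset (Fin N)) : ℕ := (S.filter fun α => ε α = 0).card

theorem weight_erase {S : Finset (Fin N)} {α : Fin N} (h : α ∈ S) :
    weight ε S = weight ε (S.erase α) + if ε α = 0 then 1 else 0 := by
  unfold weight
  rw [Finset.filter_erase]
  split_ifs with h0
  · rw [Finset.card_erase_add_one (Finset.mem_filter.2 ⟨h, h0⟩)]
  · rw [Finset.erase_eq_of_notMem (by simp [h0]), add_zero]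

theorem par_eq_idx (A : Idx N) : ∃ α, A = idxF ε α ∨ A = idxG ε α := by
  obtain ⟨x, rfl⟩ := (coordEquiv ε).surjective A
  rcases x with α | α
  · exact ⟨α, Or.inl rfl⟩
  · exact ⟨α, Or.inr rfl⟩

theorem extendZero_add (f g : Smooth V) (z : Fin N → ℝ) :
    extendZero (f + g).1 z = extendZero f.1 z + extendZero g.1 z := by
  by_cases h : z ∈ V
  · rw [extendZero_apply _ h, extendZero_apply _ h, extendZero_apply _ h]; rfl
  · simp [extendZero, h]

include hV

theorem continuousOn_integrand (m : ℕ) (g : Smooth V) (y : V) :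
    ContinuousOn (fun t : ℝ => ((t : ℂ) ^ m) * extendZero g.1 (scaleF ε t y)) (Set.uIcc 0 1) := by
  rw [Set.uIcc_of_le zero_le_one]
  refine ContinuousOn.mul (by fun_prop) fun t ht => ?_
  exact (ContinuousAt.comp (g := extendZero g.1) (f := fun t => scaleF ε t y) (x := t) (Smooth.contDiffAt g ⟨_, hV y y.2 t ht⟩).continuousAt
    (continuous_scaleF ε y).continuousAt).continuousWithinAt

theorem integralScaleF_coeff (f : SuperFun V) (S : Finset (Fin N)) (y : V) :
    ((integralScaleF ε f).coeff S).1 y =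
      ∫ t in (0 : ℝ)..1, ((t : ℂ) ^ weight ε S) * extendZero (f.coeff S).1 (scaleF ε t y) :=
  mkSmooth_apply (isSmooth_integral ε hV _ (f.coeff S)) y

theorem integralScaleF_add (f g : SuperFun V) :
    integralScaleF ε (f + g) = integralScaleF ε f + integralScaleF ε g := by
  ext1; funext S
  refine Subtype.ext (funext fun y => ?_)
  change _ = ((integralScaleF ε f).coeff S).1 y + ((integralScaleF ε g).coeff S).1 y
  rw [integralScaleF_coeff hV, integralScaleF_coeff hV, integralScaleF_coeff hV,
    ← intervalIntegral.integral_add (continuousOn_integrand hV _ _ y).intervalIntegrable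
      (continuousOn_integrand hV _ _ y).intervalIntegrable]
  congr 1; funext t
  rw [add_coeff, extendZero_add, mul_add]

/-- `integralScaleF` as an additive map. -/
def integralHom : SuperFun V →+ SuperFun V :=
  AddMonoidHom.mk' (integralScaleF ε) (integralScaleF_add hV)

/-- The coordinates `G_α` are not scaled: they neither depend on `t` nor contribute to the weight,
and so come out of the integral. -/
theorem integralScaleF_coordFun_mul (α : Fin N) (f : SuperFun V) :
    integralScaleF ε (coordFun (idxG ε α) * f) = coordFun (idxG ε α) * integralScaleF ε f := by
  ext1; funext S
  refine Subtype.ext (funext fun y => ?_)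
  rw [integralScaleF_coeff hV]
  by_cases h : ε α = 0
  · rw [idxG, if_pos h]
    change _ = ((const (Smooth.coord α) * integralScaleF ε f).coeff S).1 y
    rw [const_mul_coeff, Smooth.mul_apply, integralScaleF_coeff hV,
      ← intervalIntegral.integral_const_mul]
    refine intervalIntegral.integral_congr fun t ht => ?_
    rw [Set.uIcc_of_le zero_le_one] at ht
    change _ * extendZero ((const (Smooth.coord α) * f).coeff S).1 _ = _
    have hz := hV y y.2 t ht
    rw [const_mul_coeff, extendZero_apply _ hz, extendZero_apply _ hz, Smooth.mul_apply]
    change _ * (((scaleF ε t y α : ℝ) : ℂ) * _) = ((y.1 α : ℝ) : ℂ) * _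
    rw [show scaleF ε t y α = y.1 α from if_pos h]
    ring
  · rw [idxG, if_neg h]
    change _ = ((gen α * integralScaleF ε f).coeff S).1 y
    change ∫ t in (0 : ℝ)..1, _ * extendZero ((gen α * f).coeff S).1 _ = _
    rw [gen_mul_coeff, gen_mul_coeff]
    split_ifs with hS
    · have e : ∀ (n : ℕ) (g : Smooth V) (z : V), ((-1) ^ n * g : Smooth V).1 z = (-1) ^ n * g.1 z := by
        intro n g z
        rw [Smooth.mul_apply]; rfl
      rw [e, integralScaleF_coeff hV, ← intervalIntegral.integral_const_mul, weight_erase hS,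
        if_neg h, add_zero]
      refine intervalIntegral.integral_congr fun t ht => ?_
      rw [Set.uIcc_of_le zero_le_one] at ht
      have hz := hV y y.2 t ht
      change _ * extendZero ((-1) ^ _ * f.coeff _ : Smooth V).1 _ = _
      rw [extendZero_apply _ hz, extendZero_apply _ hz, e]
      ring
    · simp [extendZero]

/-- The superfunction `f(0; G)` of the coordinates `(F; G)`. -/
def scaleZero (f : SuperFun V) : SuperFun V := ⟨fun S =>
  ⟨fun y => 0 ^ weight ε S * (f.coeff S).1 ⟨scaleF ε 0 y, hV y y.2 0 ⟨le_rfl, zero_le_one⟩⟩,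
    isSmooth_of_contDiffOn (g := fun y => 0 ^ weight ε S * extendZero (f.coeff S).1 (scaleF ε 0 y))
      (fun y hy => (contDiffAt_const.mul (ContDiffAt.comp y (g := extendZero (f.coeff S).1)
        (Smooth.contDiffAt (f.coeff S) ⟨_, hV y hy 0 ⟨le_rfl, zero_le_one⟩⟩)
        ((contDiff_scaleF ε).comp (contDiff_const.prodMk contDiff_id)).contDiffAt)).contDiffWithinAt)
      fun y => by rw [extendZero_apply]⟩⟩

/-- `scaleZero` as an additive map. -/
def scaleZeroHom : SuperFun V →+ SuperFun V :=
  AddMonoidHom.mk' (scaleZero hV) fun f g => by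
    ext1; funext S
    exact Subtype.ext (funext fun y => mul_add _ _ _)

/-- At `t = 0` the even scaled coordinates are projected away by the linear map `Λ`, and the factor
`0 ^ weight ε S` removes every monomial with an odd scaled coordinate. The remaining directions are
untouched. -/
theorem dr_scaleZero (f : SuperFun V) (α : Fin N) :
    dr (idxF ε α) (scaleZero hV f) = 0 ∧
      dr (idxG ε α) (scaleZero hV f) = scaleZero hV (dr (idxG ε α) f) := by
  have heven : dr (Sum.inl α) (scaleZero hV f) =
      if ε α = 0 then scaleZero hV (dr (Sum.inl α) f) else 0 := by
    ext1; funext S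
    refine Subtype.ext (funext fun y => ?_)
    have hz := hV y y.2 0 ⟨le_rfl, zero_le_one⟩
    let Λ : (Fin N → ℝ) →L[ℝ] (Fin N → ℝ) := ContinuousLinearMap.pi fun β =>
      if ε β = 0 then ContinuousLinearMap.proj β else 0
    have hΛ : ∀ v, scaleF ε 0 v = Λ v := fun v => by
      funext β
      by_cases h : ε β = 0 <;> simp [scaleF, Λ, h]
    change (Smooth.pd α ((scaleZero hV f).coeff S)).1 y = _
    rw [Smooth.pd_eq_of_eventuallyEq
      (g := fun y => 0 ^ weight ε S * extendZero (f.coeff S).1 (Λ y))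
      fun y => by rw [← hΛ, extendZero_apply _ (hV y y.2 0 ⟨le_rfl, zero_le_one⟩)]; rfl]
    have hd : HasFDerivAt (fun y => 0 ^ weight ε S * extendZero (f.coeff S).1 (Λ y)) _ (y : Fin N → ℝ) :=
      ((HasFDerivAt.comp (y : Fin N → ℝ) (g := extendZero (f.coeff S).1) (f := Λ)
        (by rw [← hΛ]; exact (Smooth.differentiableAt (f.coeff S) ⟨_, hz⟩).hasFDerivAt)
        Λ.hasFDerivAt).const_mul _)
    rw [hd.fderiv]
    change 0 ^ weight ε S * fderiv ℝ (extendZero (f.coeff S).1) (scaleF ε 0 y) (Λ (Pi.single α 1)) = _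
    have hs : Λ (Pi.single α 1) = if ε α = 0 then Pi.single α 1 else 0 := by
      rw [← hΛ]; funext β
      by_cases hβ : β = α
      · subst hβ; by_cases h : ε β = 0 <;> simp [scaleF, h]
      · by_cases h : ε α = 0 <;> simp [scaleF, h, hβ]
    rw [hs]
    split_ifs with h
    · rfl
    · rw [map_zero, mul_zero]; rfl
  have hodd : dr (Sum.inr α) (scaleZero hV f) =
      if ε α = 0 then 0 else scaleZero hV (dr (Sum.inr α) f) := by
    ext1; funext S
    refine Subtype.ext (funext fun y => ?_)
    change ((rightD α (scaleZero hV f)).coeff S).1 y = _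
    by_cases hS : α ∈ S
    · have : (rightD α (scaleZero hV f)).coeff S = 0 := if_pos hS
      rw [this]
      split_ifs with h
      · rfl
      · change _ = 0 ^ weight ε S * ((rightD α f).coeff S).1 _
        rw [show (rightD α f).coeff S = 0 from if_pos hS, Smooth.zero_apply, Smooth.zero_apply, mul_zero]
    · have e : ∀ g : SuperFun V, (rightD α g).coeff S =
        (-1) ^ (S.filter (α < ·)).card * g.coeff (insert α S) := fun g => if_neg hS
      have hw := weight_erase (ε := ε) (Finset.mem_insert_self α S)
      rw [Finset.erase_insert hS] at hw
      rw [e, Smooth.mul_apply]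
      change _ * (0 ^ weight ε (insert α S) * _) = _
      split_ifs with h
      · rw [hw, if_pos h, pow_succ, mul_zero, zero_mul, mul_zero]; rfl
      · change _ = 0 ^ weight ε S * ((rightD α f).coeff S).1 _
        rw [e, Smooth.mul_apply, hw, if_neg h, add_zero, mul_left_comm]; rfl
  unfold idxF idxG
  by_cases h : ε α = 0
  · rw [if_pos h, if_pos h]; exact ⟨by rw [hodd, if_pos h], by rw [heven, if_pos h]⟩
  · rw [if_neg h, if_neg h]; exact ⟨by rw [heven, if_neg h], by rw [hodd, if_neg h]⟩

theorem scaleZero_coordFun_mul (α : Fin N) (f : SuperFun V) :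
    scaleZero hV (coordFun (idxF ε α) * f) = 0 := by
  ext1; funext S
  refine Subtype.ext (funext fun y => ?_)
  change 0 ^ weight ε S * ((coordFun (idxF ε α) * f).coeff S).1 _ = 0
  unfold idxF
  split_ifs with h
  · change _ * ((gen α * f).coeff S).1 _ = _
    rw [gen_mul_coeff]
    split_ifs with hS
    · rw [weight_erase hS, if_pos h, pow_succ, mul_zero, zero_mul]
    · exact mul_zero _
  · change _ * ((const (Smooth.coord α) * f).coeff S).1 _ = _
    rw [const_mul_coeff, Smooth.mul_apply]
    change _ * (((scaleF ε 0 y α : ℝ) : ℂ) * _) = _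
    rw [show scaleF ε 0 y α = 0 * y.1 α from if_neg h, zero_mul, Complex.ofReal_zero, zero_mul, mul_zero]

/-- The fundamental theorem of calculus for `t ↦ f(tF; G)`, coefficient by coefficient. The `t`
derivative has one contribution for each scaled coordinate: an even one gives its partial derivative
times its value, and an odd one that occurs in the monomial gives one unit of the weight. Using
right derivatives puts the coordinate on the right. -/
theorem eq_scaleZero_add (f : SuperFun V) :
    f = scaleZero hV f +
      ∑ γ, integralScaleF ε (dr (idxF ε γ) f) * coordFun (idxF ε γ) := by
  ext1; funext S
  refine Subtype.ext (funext fun y => ?_)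
  -- The truncated subtraction `weight ε S - 1` is harmless, as it occurs only when `S` contains the
  -- odd scaled coordinate `γ` and the weight is positive.
  let term : Fin N → ℝ → ℂ := fun γ t =>
    if ε γ = 0 then (if γ ∈ S then (t : ℂ) ^ (weight ε S - 1) * extendZero (f.coeff S).1 (scaleF ε t y)
      else 0)
    else (t : ℂ) ^ weight ε S * extendZero (Smooth.pd γ (f.coeff S)).1 (scaleF ε t y) * (y.1 γ : ℂ)
  have hcont : ∀ γ, ContinuousOn (term γ) (Set.uIcc 0 1) := fun γ => by
    simp only [term]
    split_ifs
    · exact continuousOn_integrand hV _ _ y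
    · exact continuousOn_const
    · exact (continuousOn_integrand hV _ _ y).mul continuousOn_const
  have hterm : ∀ γ, ((integralScaleF ε (dr (idxF ε γ) f) * coordFun (idxF ε γ)).coeff S).1 y =
      ∫ t in (0 : ℝ)..1, term γ t := fun γ => by
    simp only [idxF, term]
    split_ifs with h hS
    · change ((integralScaleF ε (rightD γ f) * gen γ).coeff S).1 y = _
      rw [mul_gen_coeff, if_pos hS, Smooth.mul_apply, integralScaleF_coeff hV,
        ← intervalIntegral.integral_const_mul]
      refine intervalIntegral.integral_congr fun t ht => ?_
      rw [Set.uIcc_of_le zero_le_one] at ht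
      have hz := hV y y.2 t ht
      have e : (rightD γ f).coeff (S.erase γ) =
          (-1) ^ ((S.erase γ).filter (γ < ·)).card * f.coeff (insert γ (S.erase γ)) :=
        if_neg (Finset.notMem_erase γ S)
      have hc : (S.erase γ).filter (γ < ·) = S.filter (γ < ·) := by
        ext a; simp only [Finset.mem_filter, Finset.mem_erase]
        exact ⟨fun h => ⟨h.1.2, h.2⟩, fun h => ⟨⟨h.2.ne', h.1⟩, h.2⟩⟩
      have e1 : ∀ (n : ℕ) (z : V), ((-1) ^ n : Smooth V).1 z = (-1) ^ n := fun n z => rfl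
      have e2 : ((-1 : ℂ) ^ (S.filter (γ < ·)).card) * (-1) ^ (S.filter (γ < ·)).card = 1 := by
        rw [← pow_add, Even.neg_one_pow ⟨_, rfl⟩]
      change _ * (_ * extendZero ((rightD γ f).coeff (S.erase γ)).1 _) = _
      rw [e, Finset.insert_erase hS, hc, extendZero_apply _ hz, Smooth.mul_apply, e1, e1,
        weight_erase hS, if_pos h, Nat.add_sub_cancel]
      rw [extendZero_apply _ hz]
      linear_combination (t : ℂ) ^ weight ε (S.erase γ) * (f.coeff S).1 ⟨_, hz⟩ * e2
    · change ((integralScaleF ε (rightD γ f) * gen γ).coeff S).1 y = _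
      rw [mul_gen_coeff, if_neg hS, intervalIntegral.integral_zero]; rfl
    · change ((integralScaleF ε (dr (Sum.inl γ) f) * const (Smooth.coord γ)).coeff S).1 y = _
      rw [mul_const_coeff, Smooth.mul_apply, integralScaleF_coeff hV,
        intervalIntegral.integral_mul_const]
      rfl
  have hderiv : ∀ t ∈ Set.uIcc (0 : ℝ) 1, HasDerivAt
      (fun t : ℝ => (t : ℂ) ^ weight ε S * extendZero (f.coeff S).1 (scaleF ε t y))
      (∑ γ, term γ t) t := fun t ht => by
    rw [Set.uIcc_of_le zero_le_one] at ht
    have hz := hV y y.2 t ht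
    have h1 : HasDerivAt (fun t => scaleF ε t y) (fun γ => if ε γ = 0 then 0 else y.1 γ) t := by
      refine hasDerivAt_pi.2 fun γ => ?_
      simp only [scaleF]
      split_ifs
      · exact hasDerivAt_const _ _
      · simpa using (hasDerivAt_id t).mul_const (y.1 γ)
    have h2 := HasFDerivAt.comp_hasDerivAt t (l := extendZero (f.coeff S).1)
      (Smooth.differentiableAt (f.coeff S) ⟨_, hz⟩).hasFDerivAt h1
    have h3 : HasDerivAt (fun t : ℝ => (t : ℂ) ^ weight ε S)
        ((weight ε S : ℂ) * (t : ℂ) ^ (weight ε S - 1)) t := by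
      simpa using (hasDerivAt_pow (weight ε S) (t : ℂ)).comp_ofReal
    refine (h3.mul h2).congr_deriv ?_
    rw [Smooth.fderiv_apply (f.coeff S) ⟨_, hz⟩, Function.comp_apply, Finset.mul_sum,
      show (weight ε S : ℂ) = ∑ γ, if ε γ = 0 then (if γ ∈ S then 1 else 0) else 0 by
        rw [weight, show S.filter (fun γ => ε γ = 0) = Finset.univ.filter fun γ => ε γ = 0 ∧ γ ∈ S by
          ext; simp [and_comm], Finset.card_filter, Nat.cast_sum]
        exact Finset.sum_congr rfl fun γ _ => by split_ifs <;> simp_all,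
      Finset.sum_mul, Finset.sum_mul, ← Finset.sum_add_distrib]
    refine Finset.sum_congr rfl fun γ _ => ?_
    simp only [term]
    split_ifs
    · simp
    · simp
    · rw [extendZero_apply _ hz, extendZero_apply _ hz]; ring
  have hint := intervalIntegral.integral_eq_sub_of_hasDerivAt hderiv
    (continuousOn_finsetSum _ fun γ _ => hcont γ).intervalIntegrable
  rw [intervalIntegral.integral_finsetSum fun γ _ => (hcont γ).intervalIntegrable] at hint
  rw [add_coeff, Smooth.add_apply, sum_coeff, Smooth.sum_apply, Finset.sum_congr rfl fun γ _ => hterm γ,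
    hint]
  have hz := hV y y.2 0 ⟨le_rfl, zero_le_one⟩
  change _ = 0 ^ weight ε S * (f.coeff S).1 ⟨_, hz⟩ + _
  rw [scaleF_one, extendZero_apply _ hz, extendZero_apply _ y.2]
  simp

end Homotopy
end
end SuperBV

set_option linter.unusedSectionVars false
namespace SuperBV
noncomputable section
open Grassmann

/-! ### The Abelian case -/

section Abelian

variable {N : ℕ} {U V : TopologicalSpace.Opens (Fin N → ℝ)} {ε : Fin N → ZMod 2}

theorem dl_eq_zero_of_dr {A : Idx N} {f : SuperFun V} (h : dr A f = 0) : dl A f = 0 := by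
  rcases A with i | o
  · exact h
  · change rightD o f = 0 at h
    change leftD o f = 0
    rw [← tau_tau (leftD o f), ← rightD_eq, h, map_zero]

variable {E : Matrix (Idx N) (Idx N) (SuperFun U)} {ρ : SuperFun U} {F G : Fin N → SuperFun U}
  {H : SuperFun U} {Vs : Fin N → Fin N → SuperFun U} {Y : Fin N → Fin N → Fin N → SuperFun U}

/-- The square root formula off shell. -/
theorem IsGaugeSystem.abelian (h : IsGaugeSystem ε E ρ F G H Vs Y) (hY : ∀ γ α β, Y γ α β = 0)
    (hE : IsUnit E) (hr : (V : Set (Fin N → ℝ)) = Set.range (bodyMap (barGamma ε F G)))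
    (hV : ∀ y ∈ V, ∀ t ∈ Set.Icc (0 : ℝ) 1, scaleF ε t y ∈ V) :
    IsUnit (lambdaMatrix E F G) ∧
      ∀ L : SuperFun U, IsLogSqrt L (radicand ε E ρ F G) →
        ∃ M : Fin N → Fin N → SuperFun V,
          (∀ α γ, pullback (barGamma ε F G) (M α γ) =
            ∑ β, Vs α β * Ring.inverse (lambdaMatrix E F G) β γ) ∧
          ∃ H₀ : SuperFun U,
            H₀ = -L - ∑ α, ∑ γ,
              G α * pullback (barGamma ε F G) (integralScaleF ε (M α γ)) * F γ ∧
            (∃ k : SuperFun V, (∀ α, dl (idxF ε α) k = 0) ∧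
              H = H₀ + pullback (barGamma ε F G) k) ∧
            (∀ β, oddLaplacian id dl E ρ (G β) - antibracket E H₀ (G β) =
              ∑ α, G α * Vs α β) := by
  have hGG : ∀ α β, bracket par dl E (G α) (G β) = 0 := fun α β => by
    rw [h.involution]
    exact Finset.sum_eq_zero fun γ _ => by
      rw [hY]; exact mul_zero (G γ : Grassmann (Fin N) (Smooth U))
  -- With `Y = 0` the brackets of the `G_α` vanish at every point, not only on the constrained
  -- surface, so invertibility holds on all of `U`.
  have hΛ : IsUnit (lambdaMatrix E F G) := isUnit_lambdaMatrix fun x =>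
    det_lambdaMatrix_ne_zero hE h.coord fun α β => by rw [← bracket_dl, hGG, map_zero]
  refine ⟨hΛ, fun L hL => ?_⟩
  have hΓ := h.coord
  have hVm : ∀ x, bodyMap (barGamma ε F G) x ∈ V := fun x => hr.symm.subset ⟨x, rfl⟩
  have hsurj := pullback_surjective hΓ hVm hr
  let pb := pullbackRingHom hΓ hVm
  have hpbG : ∀ α, pb (coordFun (idxG ε α)) = G α := fun α =>
    (pullback_coordFun hΓ hVm _).trans (barGamma_idxG F G α)
  have hpbF : ∀ α, pb (coordFun (idxF ε α)) = F α := fun α =>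
    (pullback_coordFun hΓ hVm _).trans (barGamma_idxF F G α)
  choose M hM using fun α γ =>
    hsurj (∑ β, Vs α β * Ring.inverse (lambdaMatrix E F G) β γ)
  obtain ⟨K, hK⟩ := hsurj (H + L)
  -- The formula for the `F` derivatives of `H + L`, rewritten on the superdomain with coordinates
  -- `{F; G}`. Injectivity of the pullback permits the comparison there.
  have hdK : ∀ γ, dr (idxF ε γ) K = -∑ α, coordFun (idxG ε α) * M α γ := fun γ => by
    refine sub_eq_zero.1 (pullback_injective hΓ hVm hr ?_)
    change pb _ = 0
    rw [map_sub, map_neg, map_sum, sub_eq_zero]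
    change pullback (barGamma ε F G) (dr (idxF ε γ) K) = _
    rw [← drNew_pullback hΓ hVm, hK, h.drNew_add_logSqrt hΛ hY hL]
    exact congrArg _ (Finset.sum_congr rfl fun α _ => by
      rw [map_mul, hpbG, ← hM]; rfl)
  have hI : ∀ γ, integralScaleF ε (dr (idxF ε γ) K) =
      -∑ α, coordFun (idxG ε α) * integralScaleF ε (M α γ) := fun γ => by
    change integralHom hV _ = _
    rw [hdK, map_neg, map_sum]
    exact congrArg _ (Finset.sum_congr rfl fun α _ => integralScaleF_coordFun_mul hV α _)
  -- The integration constant is the value of `H + L` at `F = 0`.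
  set k := scaleZero hV K with hk
  have hHL : H + L = pb k - ∑ α, ∑ γ,
      G α * pullback (barGamma ε F G) (integralScaleF ε (M α γ)) * F γ := by
    rw [← hK]
    change pb K = _
    conv_lhs => rw [eq_scaleZero_add hV K]
    rw [map_add, map_sum, sub_eq_add_neg, ← sum_neg_mul]
    refine congrArg _ (Finset.sum_congr rfl fun γ _ => ?_)
    rw [map_mul, hI, hpbF, map_neg, map_sum]
    refine congrArg (-· * _) (Finset.sum_congr rfl fun α _ => ?_)
    rw [map_mul, hpbG]; rfl
  set H₀ := -L - ∑ α, ∑ γ, G α * pullback (barGamma ε F G) (integralScaleF ε (M α γ)) * F γ with hH₀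
  have hH : H = H₀ + pb k := by
    rw [← add_sub_cancel_right H L, hHL, hH₀]
    abel
  refine ⟨M, hM, H₀, rfl, ⟨k, fun α => dl_eq_zero_of_dr (dr_scaleZero hV K α).1, hH⟩, fun β => ?_⟩
  -- The bracket expands into derivatives of `k` along the `F`, which vanish, and derivatives along
  -- the `G` times `(G_α, G_β)`, which also vanish. Removing `k` from `H` therefore leaves the
  -- equation intact.
  have hk0 : bracket par dl E (pb k) (G β) = 0 := by
    rw [bracket_eq_sum_drNew isSuperDer_dl (by rw [jacobian_dl]; exact hΓ.jacobian) (Γ' := barGamma ε F G),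
      sum_idx ε]
    have z1 : ∀ α, drNew par dl (barGamma ε F G) (idxF ε α) (pb k) = 0 := fun α => by
      change drNew par dl (barGamma ε F G) (idxF ε α) (pullback (barGamma ε F G) k) = 0
      rw [drNew_pullback hΓ hVm, (dr_scaleZero hV K α).1]
      exact map_zero pb
    rw [Finset.sum_eq_zero fun α _ => by rw [z1]; exact zero_mul _,
      Finset.sum_eq_zero fun α _ => by rw [barGamma_idxG, hGG]; exact mul_zero _, add_zero]
  have heq := h.equation β
  simp only [hY] at heq
  rw [hH, bracket_add_left isSuperDer_dl, hk0, add_zero] at heq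
  rw [← heq, ← laplacian_dl, bracket_dl]
  exact (sub_eq_self.2 (Finset.sum_eq_zero fun α _ => smul_zero _)).symm

end Abelian
end
end SuperBV

set_option linter.unusedSectionVars false
namespace SuperBV
noncomputable section
open Grassmann

/-! ### Superfunctions that are constant on the constrained surface -/

section Constant

variable {N : ℕ} {U : TopologicalSpace.Opens (Fin N → ℝ)} {ε : Fin N → ZMod 2}

theorem eq_const_body_of_dl_eq_zero {g : SuperFun U} (h : ∀ A, dl A g = 0) : g = const (body g) := by
  ext1; funext S
  change g.coeff S = if S = ∅ then g.coeff ∅ else 0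
  split_ifs with hS
  · rw [hS]
  · obtain ⟨o, ho⟩ := Finset.nonempty_iff_ne_empty.2 hS
    have h1 : (leftD o g).coeff (S.erase o) = 0 :=
      congrArg (fun f : SuperFun U => f.coeff (S.erase o)) (h (Sum.inr o))
    have h2 : (leftD o g).coeff (S.erase o) =
        (-1) ^ ((S.erase o).filter (· < o)).card * g.coeff (insert o (S.erase o)) :=
      if_neg (Finset.notMem_erase o S)
    rw [h1, Finset.insert_erase ho] at h2
    exact ((isUnit_one.neg.pow _).mul_right_eq_zero.1 h2.symm)

theorem isLocallyConstant_body {g : SuperFun U} (h : ∀ A, dl A g = 0) :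
    IsLocallyConstant (body g).1 := by
  refine IsLocallyConstant.iff_isOpen_fiber.2 fun z => ?_
  have ho := U.isOpen.isOpen_inter_preimage_of_fderiv_eq_zero (𝕜 := ℝ) (f := extendZero (body g).1)
    (fun x hx => (Smooth.differentiableAt (body g) ⟨x, hx⟩).differentiableWithinAt) (fun x hx => by
      ext v
      rw [Smooth.fderiv_apply (body g) ⟨x, hx⟩]
      refine Finset.sum_eq_zero fun j _ => ?_
      rw [show Smooth.pd j (body g) = 0 from
        congrArg (fun f : SuperFun U => f.coeff ∅) (h (Sum.inl j)), Smooth.zero_apply, mul_zero]) {z}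
  convert ho.preimage continuous_subtype_val using 1
  ext x
  simp [Smooth.extendZero_apply']

theorem continuous_bodyMap (Γ' : Idx N → SuperFun U) : Continuous (bodyMap Γ') := by
  refine continuous_iff_continuousAt.2 fun x => ?_
  have := (contDiffAt_bodyExt Γ' x).continuousAt.comp continuous_subtype_val.continuousAt
  exact this.congr (Filter.Eventually.of_forall fun y => bodyExt_apply Γ' y)

/-- The tube lemma for the compact range of the scaling parameter. -/
theorem isOpen_scaleF (ε : Fin N → ZMod 2) {V : Set (Fin N → ℝ)} (hV : IsOpen V) :
    IsOpen {y | ∀ t ∈ Set.Icc (0 : ℝ) 1, scaleF ε t y ∈ V} := by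
  refine isOpen_iff_mem_nhds.2 fun y hy => ?_
  obtain ⟨u, v, -, hv, hu, hyv, huv⟩ := generalized_tube_lemma
    (isCompact_Icc : IsCompact (Set.Icc (0 : ℝ) 1)) (isCompact_singleton : IsCompact {y})
    (hV.preimage (contDiff_scaleF ε).continuous) (by
      rintro ⟨t, y⟩ ⟨ht, rfl⟩
      exact hy t ht)
  filter_upwards [hv.mem_nhds (hyv rfl)] with z hz t ht
  exact huv (⟨hu ht, hz⟩ : (t, z) ∈ u ×ˢ v)

theorem scaleF_scaleF (s t : ℝ) (y : Fin N → ℝ) : scaleF ε s (scaleF ε t y) = scaleF ε (s * t) y := by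
  funext α
  by_cases h : ε α = 0 <;> simp [scaleF, h, mul_assoc]

variable {F G : Fin N → SuperFun U}

/-- With shifted parities the scaling contracts the `G` and fixes the `F`. The points whose whole
segment stays in the image form an open set that is itself stable under scaling. It contains the
image of the constrained surface, where the even `G_α` are zero and scaling does nothing. -/
theorem IsCoordinateSystem.exists_star (hΓ : IsCoordinateSystem (barGamma ε F G)) :
    ∃ (W : TopologicalSpace.Opens (Fin N → ℝ)) (hW : W ≤ U)
      (O : TopologicalSpace.Opens (Fin N → ℝ)),
      constraintSurface ε G ⊆ W ∧
      (O : Set (Fin N → ℝ)) = Set.range (bodyMap fun A => restrictHom hW (barGamma ε F G A)) ∧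
      ∀ y ∈ O, ∀ t ∈ Set.Icc (0 : ℝ) 1, scaleF (fun α => ε α + 1) t y ∈ O := by
  set O : Set (Fin N → ℝ) := {y | ∀ t ∈ Set.Icc (0 : ℝ) 1,
    scaleF (fun α => ε α + 1) t y ∈ Set.range (bodyMap (barGamma ε F G))} with hO
  have hOo : IsOpen O := isOpen_scaleF _ hΓ.isOpen_range
  have hOr : ∀ y ∈ O, y ∈ Set.range (bodyMap (barGamma ε F G)) := fun y hy => by
    have := hy 1 ⟨zero_le_one, le_rfl⟩
    rwa [scaleF_one] at this
  refine ⟨⟨Subtype.val '' (bodyMap (barGamma ε F G) ⁻¹' O), U.isOpen.isOpenMap_subtype_val _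
    (hOo.preimage (continuous_bodyMap _))⟩, ?_, ⟨O, hOo⟩, ?_, ?_, ?_⟩
  · rintro _ ⟨x, -, rfl⟩
    exact x.2
  · rintro x ⟨hx, hs⟩
    refine ⟨⟨x, hx⟩, fun t _ => ⟨⟨x, hx⟩, ?_⟩, rfl⟩
    funext α
    by_cases h : ε α = 0
    · have : bodyMap (barGamma ε F G) ⟨x, hx⟩ α = 0 := by
        simp [bodyMap, barGamma, h, hs α h]
      simp [scaleF, this]
    · have : ε α + 1 = 0 := by
        rcases zmod_two_cases (ε α) with h' | h'
        · exact absurd h' h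
        · rw [h']; rfl
      simp [scaleF, this]
  · ext y
    constructor
    · intro hy
      obtain ⟨x, rfl⟩ := hOr y hy
      exact ⟨⟨x, x, hy, rfl⟩, rfl⟩
    · rintro ⟨⟨_, x, hx, rfl⟩, rfl⟩
      exact hx
  · intro y hy t ht s hs
    rw [scaleF_scaleF]
    exact hy _ ⟨mul_nonneg hs.1 ht.1, mul_le_one₀ hs.2 ht.1 ht.2⟩

/-- Shifting all parities exchanges the roles of the `F` and the `G`, so the homotopy along the `F`
also serves for contracting the `G`. -/
theorem idxF_add_one (α : Fin N) : idxF (fun α => ε α + 1) α = idxG ε α := by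
  have : ∀ a : ZMod 2, (a + 1 = 0) = ¬ a = 0 := by decide
  simp only [idxF, idxG, this, ite_not]

theorem idxG_add_one (α : Fin N) : idxG (fun α => ε α + 1) α = idxF ε α := by
  have : ∀ a : ZMod 2, (a + 1 = 0) = ¬ a = 0 := by decide
  simp only [idxF, idxG, this, ite_not]

/-- A superfunction with derivatives along the `F` vanishing on the constrained surface is constant
there. -/
theorem IsCoordinateSystem.exists_const_add_ideal (hΓ : IsCoordinateSystem (barGamma ε F G))
    (hc : IsPreconnected (constraintSurface ε G)) {f : SuperFun U}
    (hf : ∀ δ, drNew par dl (barGamma ε F G) (idxF ε δ) f ∈ idealG G) :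
    ∃ (W : TopologicalSpace.Opens (Fin N → ℝ)) (hW : W ≤ U), constraintSurface ε G ⊆ W ∧
      ∃ c : ℂ, restrictHom hW f - c • 1 ∈ idealG fun α => restrictHom hW (G α) := by
  obtain ⟨W, hW, O, hsW, hr, hO⟩ := hΓ.exists_star
  refine ⟨W, hW, hsW, ?_⟩
  set Γ' : Idx N → SuperFun W := fun A => restrictHom hW (barGamma ε F G A) with hΓ'def
  set ε' : Fin N → ZMod 2 := fun α => ε α + 1 with hε'
  have hΓ' : IsCoordinateSystem Γ' := hΓ.restrict hW
  have hVm : ∀ x, bodyMap Γ' x ∈ O := fun x => hr.symm.subset ⟨x, rfl⟩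
  let pb := pullbackRingHom hΓ' hVm
  have hpbG : ∀ α, pb (coordFun (idxG ε α)) = restrictHom hW (G α) := fun α =>
    (pullback_coordFun hΓ' hVm _).trans (congrArg (restrictHom hW) (barGamma_idxG F G α))
  obtain ⟨k, hk⟩ := pullback_surjective hΓ' hVm hr (restrictHom hW f)
  have hdk : ∀ δ, ∃ B : Fin N → SuperFun O,
      dr (idxF ε δ) k = ∑ α, coordFun (idxG ε α) * B α := fun δ => by
    have h1 : pb (dr (idxF ε δ) k) ∈ idealG fun α => restrictHom hW (G α) := by
      change pullback Γ' _ ∈ _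
      rw [← drNew_pullback hΓ' hVm, hk, drNew_restrict hW (by rw [jacobian_dl]; exact hΓ.jacobian)]
      exact mapHom_mem_idealG _ (hf δ)
    obtain ⟨B, hB⟩ := h1
    choose B' hB' using fun α => pullback_surjective hΓ' hVm hr (B α)
    refine ⟨B', sub_eq_zero.1 (pullback_injective hΓ' hVm hr ?_)⟩
    change pb _ = 0
    rw [map_sub, map_sum, hB, sub_eq_zero]
    exact Finset.sum_congr rfl fun α _ => by rw [map_mul, hpbG, ← hB']; rfl
  -- This is `k` at `G = 0`. Its `G` derivatives vanish by construction. Its `F` derivatives are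
  -- those of `k` taken at `G = 0`, and they vanish because those of `k` are combinations of the
  -- `G_α`.
  set r := scaleZero hO k with hrdef
  have hdr : ∀ A, dr A r = 0 := fun A => by
    obtain ⟨α, rfl | rfl⟩ := par_eq_idx (ε := ε') A
    · exact (dr_scaleZero hO k α).1
    · rw [(dr_scaleZero hO k α).2, idxG_add_one]
      obtain ⟨B, hB⟩ := hdk α
      rw [hB]
      change scaleZeroHom hO _ = 0
      rw [map_sum]
      exact Finset.sum_eq_zero fun β _ => by
        rw [← idxF_add_one]; exact scaleZero_coordFun_mul hO β _
  have hdg : ∀ A, dl A (pb r) = 0 := fun B => by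
    change dl B (pullback Γ' r) = 0
    rw [dl_pullback hΓ' hVm]
    exact Finset.sum_eq_zero fun A _ => by
      rw [dl_eq_zero_of_dr (hdr A), pullback_zero hΓ' hVm]; exact mul_zero _
  have hbody : ∀ x, (body (pb r)).1 x =
      (body k).1 ⟨scaleF ε' 0 (bodyMap Γ' x), hO _ (hVm x) 0 ⟨le_rfl, zero_le_one⟩⟩ := fun x => by
    rw [show body (pb r) = compBody Γ' (body r) from body_pullback hΓ' hVm r, compBody_apply hVm]
    exact one_mul _
  -- The neighbourhood `W` itself may fail to be connected. Each value of the locally constant body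
  -- is however attained on the surface, at the end point of the contracting segment, and there
  -- connectedness applies.
  have hsurf : ∀ x : W, ∃ x' : W, (x' : Fin N → ℝ) ∈ constraintSurface ε G ∧
      (body (pb r)).1 x = (body (pb r)).1 x' := fun x => by
    have hm := hO _ (hVm x) 0 ⟨le_rfl, zero_le_one⟩
    obtain ⟨x', hx'⟩ := hr.subset hm
    refine ⟨x', ⟨hW x'.2, fun α hα => ?_⟩, ?_⟩
    · have h1 : ((body (restrictHom hW (G α))).1 x').re = 0 := by
        have := congrFun hx' α
        simpa [bodyMap, hΓ'def, barGamma, hα, scaleF, hε'] using this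
      have h2 : ((body (restrictHom hW (G α))).1 x').im = 0 := by
        have := hΓ'.real α x'
        simpa [hΓ'def, barGamma, hα] using this
      exact Complex.ext h1 h2
    · rw [hbody, hbody]
      refine congrArg _ (Subtype.ext ?_)
      change _ = scaleF ε' 0 (bodyMap Γ' x')
      rw [hx', scaleF_scaleF, zero_mul]
  obtain ⟨c, hc⟩ : ∃ c : ℂ, ∀ x, (body (pb r)).1 x = c := by
    by_cases hne : Nonempty W
    · obtain ⟨x₀⟩ := hne
      refine ⟨(body (pb r)).1 x₀, fun x => ?_⟩
      obtain ⟨x', hx', e⟩ := hsurf x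
      obtain ⟨x₁, hx₁, e₁⟩ := hsurf x₀
      rw [e, e₁]
      have hp : IsPreconnected ((Subtype.val : W → _) ⁻¹' constraintSurface ε G) := by
        refine Topology.IsInducing.subtypeVal.isPreconnected_image.1 ?_
        convert hc using 1
        exact Set.image_preimage_eq_of_subset fun x hx => ⟨⟨x, hsW hx⟩, rfl⟩
      exact (isLocallyConstant_body hdg).apply_eq_of_isPreconnected hp hx' hx₁
    · exact ⟨0, fun x => absurd ⟨x⟩ hne⟩
  refine ⟨c, ?_⟩
  have h1 : pb r = c • 1 := by
    rw [eq_const_body_of_dl_eq_zero hdg]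
    ext1; funext S
    refine Subtype.ext (funext fun x => ?_)
    change (if S = ∅ then body (pb r) else 0 : Smooth W).1 x =
      c * (if S = ∅ then 1 else 0 : Smooth W).1 x
    split_ifs
    · rw [hc, Smooth.one_apply, mul_one]
    · rw [Smooth.zero_apply, mul_zero]
  -- The remainder of the homotopy formula contains the `G_γ` as right factors. As they are
  -- homogeneous, the ideal they generate is two-sided.
  have h2 : restrictHom hW f - c • 1 =
      ∑ γ, pb (integralScaleF ε' (dr (idxF ε' γ) k)) * restrictHom hW (G γ) := by
    rw [← h1, ← hk, sub_eq_iff_eq_add']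
    change pb k = _
    conv_lhs => rw [eq_scaleZero_add hO k]
    rw [map_add, map_sum]
    exact congrArg _ (Finset.sum_congr rfl fun γ _ => by rw [map_mul, idxF_add_one, hpbG])
  rw [h2]
  refine sum_mem fun γ _ => idealG_mul_left (ε := ε) (fun α => ?_) _ _ (mem_idealG _ γ)
  rw [← hpbG, ← par_idxG (ε := ε) α, show pb (coordFun (idxG ε α)) = Γ' (idxG ε α) from
    pullback_coordFun hΓ' hVm _]
  exact hΓ'.parity _

end Constant
end
end SuperBV

set_option linter.unusedSectionVars false
namespace SuperBV
noncomputable section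
open Grassmann

/-! ### The square root formula on the constrained surface -/

section OnShell

variable {N : ℕ} {U : TopologicalSpace.Opens (Fin N → ℝ)} {ε : Fin N → ZMod 2}

theorem Smooth.continuous (g : Smooth U) : Continuous g.1 :=
  continuous_iff_continuousAt.2 fun x =>
    ((Smooth.contDiffAt g x).continuousAt.comp continuous_subtype_val.continuousAt).congr
      (Filter.Eventually.of_forall fun y => Smooth.extendZero_apply' g y)

/-- The open set of the points at which a smooth function has values in an open set. -/
def Smooth.preimage (g : Smooth U) {s : Set ℂ} (hs : IsOpen s) : TopologicalSpace.Opens (Fin N → ℝ) :=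
  ⟨Subtype.val '' (g.1 ⁻¹' s), U.isOpen.isOpenMap_subtype_val _ (hs.preimage (Smooth.continuous g))⟩

theorem Smooth.preimage_le (g : Smooth U) {s : Set ℂ} (hs : IsOpen s) : Smooth.preimage g hs ≤ U := by
  rintro _ ⟨x, -, rfl⟩
  exact x.2

theorem Smooth.apply_mem_of_mem_preimage (g : Smooth U) {s : Set ℂ} (hs : IsOpen s)
    (x : Smooth.preimage g hs) : g.1 ⟨x, Smooth.preimage_le g hs x.2⟩ ∈ s := by
  obtain ⟨_, y, hy, rfl⟩ := x
  exact hy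

/-- The square root formula on a neighbourhood of the constrained surface. -/
def HasOnShellFormula (ε : Fin N → ZMod 2) (E : Matrix (Idx N) (Idx N) (SuperFun U)) (ρ : SuperFun U)
    (F G : Fin N → SuperFun U) (H : SuperFun U) : Prop :=
  ∃ (W : TopologicalSpace.Opens (Fin N → ℝ)) (hW : W ≤ U), constraintSurface ε G ⊆ W ∧
    IsUnit (lambdaMatrix (E.map (restrict hW)) (fun α => restrict hW (F α))
      (fun α => restrict hW (G α))) ∧
    ∃ (L : SuperFun W) (A : Fin N → SuperFun W) (c : ℂ),
      IsLogSqrt L (radicand ε (E.map (restrict hW)) (restrict hW ρ)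
        (fun α => restrict hW (F α)) (fun α => restrict hW (G α))) ∧
      restrict hW H = -L + ∑ α, restrict hW (G α) * A α + c • (1 : SuperFun W)

theorem constraintSurface_restrict {G : Fin N → SuperFun U} {W : TopologicalSpace.Opens (Fin N → ℝ)}
    (hW : W ≤ U) (hs : constraintSurface ε G ⊆ W) :
    constraintSurface ε (fun α => restrictHom hW (G α)) = constraintSurface ε G := by
  ext x
  exact ⟨fun ⟨hx, h⟩ => ⟨hW hx, h⟩, fun hx => ⟨hs hx, hx.2⟩⟩

theorem HasOnShellFormula.of_restrict {E : Matrix (Idx N) (Idx N) (SuperFun U)} {ρ : SuperFun U}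
    {F G : Fin N → SuperFun U} {H : SuperFun U} {W : TopologicalSpace.Opens (Fin N → ℝ)}
    (hW : W ≤ U) (hs : constraintSurface ε G ⊆ W)
    (h : HasOnShellFormula ε (E.map (restrictHom hW)) (restrictHom hW ρ)
      (fun α => restrictHom hW (F α)) (fun α => restrictHom hW (G α)) (restrictHom hW H)) :
    HasOnShellFormula ε E ρ F G H := by
  obtain ⟨W', hW', hs', h⟩ := h
  rw [constraintSurface_restrict hW hs] at hs'
  exact ⟨W', hW'.trans hW, hs', h⟩

theorem half_log_identity {O R κ : Type*} [LinearOrder O] [CommRing R] [Algebra ℂ R] [Fintype κ]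
    {x l : Grassmann O R} {c : ℂ} {G A : κ → Grassmann O R} (h : l - c • 1 = ∑ α, G α * A α) :
    x = -((2⁻¹ : ℂ) • l - x) + ∑ α, G α * ((2⁻¹ : ℂ) • A α) + (2⁻¹ * c) • 1 := by
  have e : ∑ α, G α * ((2⁻¹ : ℂ) • A α) = (2⁻¹ : ℂ) • (l - c • 1) := by
    rw [h, Finset.smul_sum]
    refine Finset.sum_congr rfl fun α _ => ?_
    ext S
    rw [smul_coeff, mul_coeff, mul_coeff, Finset.smul_sum]
    refine Finset.sum_congr rfl fun T _ => ?_
    rw [smul_coeff, mul_smul_comm, mul_smul_comm]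
  rw [e, mul_smul, smul_sub]
  abel

theorem half_smul_identity {O R : Type*} [LinearOrder O] [CommRing R] [Algebra ℂ R]
    (x l : Grassmann O R) :
    (2 : ℂ) • ((2⁻¹ : ℂ) • l - x) + (2 : ℂ) • x = l := by
  rw [smul_sub, sub_add_cancel, smul_smul, mul_inv_cancel₀ two_ne_zero, one_smul]

namespace IsGaugeSystem

variable {E : Matrix (Idx N) (Idx N) (SuperFun U)} {ρ : SuperFun U} {F G : Fin N → SuperFun U}
  {H : SuperFun U} {Vs : Fin N → Fin N → SuperFun U} {Y : Fin N → Fin N → Fin N → SuperFun U}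
  (h : IsGaugeSystem ε E ρ F G H Vs Y)

include h

/-- If `Q e^{2H} = e^l`, the unit `e^l` can be divided out of its `F` derivatives, so those of `l`
lie in the ideal and `l` is constant on shell modulo the ideal. Then `L = l/2 - H` satisfies `e^{2L}
= Q`, and `H = -L + l/2` is the formula. -/
theorem hasOnShellFormula_of_superExp (hΛ : IsUnit (lambdaMatrix E F G))
    (hc : IsPreconnected (constraintSurface ε G)) {l : SuperFun U} (hl : HasParity 0 l)
    (he : superExp l = radicand ε E ρ F G * superExp ((2 : ℂ) • H)) :
    HasOnShellFormula ε E ρ F G H := by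
  have hmem : ∀ δ, drNew par dl (barGamma ε F G) (idxF ε δ) l ∈ idealG G := fun δ => by
    have h1 := h.drNew_radicand_mem hΛ δ
    rw [← he, drNew_superExp _ hl] at h1
    have h2 := idealG_mul_left h.parityG (Ring.inverse (superExp l)) _ h1
    rwa [← mul_assoc, Ring.inverse_mul_cancel _ (isUnit_superExp hl), one_mul] at h2
  obtain ⟨W, hW, hs, c, A, hA⟩ := h.coord.exists_const_add_ideal hc hmem
  refine ⟨W, hW, hs, ?_, (2⁻¹ : ℂ) • restrictHom hW l - restrictHom hW H,
    fun α => (2⁻¹ : ℂ) • A α, 2⁻¹ * c, ⟨?_, ?_⟩, half_log_identity hA⟩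
  · have := isUnit_map_restrict hW hΛ
    rwa [← lambdaMatrix_restrict] at this
  · exact ((hl.mapHom _).smul _).sub (h.parityH.mapHom _)
  · rw [h.radicand_restrict hΛ hW]
    have hp : HasParity 0 ((2 : ℂ) • restrictHom hW H) := (h.parityH.mapHom _).smul _
    have hLp : HasParity 0 ((2 : ℂ) • ((2⁻¹ : ℂ) • restrictHom hW l - restrictHom hW H)) :=
      (((hl.mapHom _).smul _).sub (h.parityH.mapHom _)).smul _
    have h1 : superExp ((2 : ℂ) • ((2⁻¹ : ℂ) • restrictHom hW l - restrictHom hW H)) *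
        superExp ((2 : ℂ) • restrictHom hW H) =
        restrictHom hW (radicand ε E ρ F G) * superExp ((2 : ℂ) • restrictHom hW H) := by
      rw [← superExp_add hLp,
        half_smul_identity, superExp_restrict, he, map_mul, ← superExp_restrict]
      rfl
    exact (isUnit_superExp hp).mul_right_cancel h1

theorem evalBody_eq_zero {x : U} (hx : (x : Fin N → ℝ) ∈ constraintSurface ε G) (α : Fin N) :
    evalBody x (G α) = 0 := by
  by_cases hα : ε α = 0
  · exact hx.2 α hα
  · have hp := h.parityG α
    rw [(zmod_two_cases (ε α)).resolve_left hα] at hp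
    rw [evalBody_apply, hp.body_eq_zero]; rfl

/-- The body of `Q e^{2H}` differs from a constant by terms with a factor `G_α`, whose body vanishes
on the surface. The constant is nonzero as a value of a unit; for an empty surface any nonzero
number will do. -/
theorem exists_const_on_surface (hΛ : IsUnit (lambdaMatrix E F G))
    (hc : IsPreconnected (constraintSurface ε G)) :
    ∃ c : ℂ, c ≠ 0 ∧ ∀ x : U, (x : Fin N → ℝ) ∈ constraintSurface ε G →
      (body (radicand ε E ρ F G * superExp ((2 : ℂ) • H))).1 x = c := by
  have hu : IsUnit (radicand ε E ρ F G * superExp ((2 : ℂ) • H)) :=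
    (h.isUnit_radicand hΛ).mul (isUnit_superExp (h.parityH.smul _))
  obtain ⟨W, hW, hs, c, A, hA⟩ := h.coord.exists_const_add_ideal hc (h.drNew_radicand_mem hΛ)
  have hx : ∀ x : U, (x : Fin N → ℝ) ∈ constraintSurface ε G →
      (body (radicand ε E ρ F G * superExp ((2 : ℂ) • H))).1 x = c := fun x hx => by
    have h1 := congrArg (evalBody ⟨x, hs hx⟩) hA
    rw [map_sub, map_sum, Finset.sum_eq_zero fun α _ => ?_, sub_eq_zero] at h1
    · exact h1.trans (mul_one c)
    · rw [map_mul]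
      exact mul_eq_zero_of_left (h.evalBody_eq_zero hx α) _
  by_cases hne : ∃ x : U, (x : Fin N → ℝ) ∈ constraintSurface ε G
  · obtain ⟨x, hm⟩ := hne
    refine ⟨c, ?_, hx⟩
    rw [← hx x hm]
    exact (hu.map (evalBody x)).ne_zero
  · exact ⟨1, one_ne_zero, fun x hm => absurd ⟨x, hm⟩ hne⟩

/-- A logarithm of `Q e^{2H}` need not exist on all of `U`. Divided by its constant value on the
surface, its body equals `1` there and remains in the slit plane on a neighbourhood, where the
principal branch is smooth. -/
theorem hasOnShellFormula_of_isUnit (hΛ : IsUnit (lambdaMatrix E F G))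
    (hc : IsPreconnected (constraintSurface ε G)) : HasOnShellFormula ε E ρ F G H := by
  obtain ⟨c, hc0, hK⟩ := h.exists_const_on_surface hΛ hc
  set K := radicand ε E ρ F G * superExp ((2 : ℂ) • H) with hKdef
  set g : Smooth U := c⁻¹ • body K with hg
  have hWU := Smooth.preimage_le g Complex.isOpen_slitPlane
  set W := Smooth.preimage g Complex.isOpen_slitPlane
  have hs : constraintSurface ε G ⊆ W := fun x hx => by
    refine ⟨⟨x, hx.1⟩, ?_, rfl⟩
    change c⁻¹ * (body K).1 ⟨x, hx.1⟩ ∈ Complex.slitPlane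
    rw [hK ⟨x, hx.1⟩ hx, inv_mul_cancel₀ hc0]
    exact Complex.one_mem_slitPlane
  refine HasOnShellFormula.of_restrict hWU hs ?_
  have hslit : ∀ x : W, (Smooth.restrict hWU g).1 x ∈ Complex.slitPlane :=
    Smooth.apply_mem_of_mem_preimage g Complex.isOpen_slitPlane
  let β : Smooth W := ⟨fun x => Complex.log ((Smooth.restrict hWU g).1 x) + Complex.log c,
    isSmooth_of_contDiffOn
      (g := fun x => Complex.log (extendZero (Smooth.restrict hWU g).1 x) + Complex.log c)
      (fun x hx => ((ContDiffAt.comp x (g := Complex.log) (f := extendZero (Smooth.restrict hWU g).1)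
        ((Complex.contDiffAt_log (by
          rw [extendZero_apply _ hx]; exact hslit ⟨x, hx⟩)).restrict_scalars ℝ)
        (Smooth.contDiffAt (Smooth.restrict hWU g) ⟨x, hx⟩)).add contDiffAt_const).contDiffWithinAt)
      fun x => by rw [Smooth.extendZero_apply']⟩
  have hKp : HasParity 0 K := by
    have := h.hasParity_radicand.mul (HasParity.superExp (h.parityH.smul (2 : ℂ)))
    rwa [add_zero] at this
  have hβ : Smooth.exp β = body (restrictHom hWU K) := by
    refine Subtype.ext (funext fun x => ?_)
    change Complex.exp (Complex.log ((Smooth.restrict hWU g).1 x) + Complex.log c) = _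
    rw [Complex.exp_add, Complex.exp_log (Complex.slitPlane_ne_zero (hslit x)), Complex.exp_log hc0]
    change c⁻¹ * (body K).1 ⟨x, hWU x.2⟩ * c = (body K).1 ⟨x, hWU x.2⟩
    field_simp
  obtain ⟨l, hl, he⟩ := exists_superExp_eq (hKp.mapHom _) hβ
  have hc' := hc
  rw [← constraintSurface_restrict hWU hs] at hc'
  refine (h.restrictTo hWU).hasOnShellFormula_of_superExp ?_ hc' hl ?_
  · have := isUnit_map_restrict hWU hΛ
    rwa [← lambdaMatrix_restrict] at this
  · refine he.trans ?_
    change restrictHom hWU K = _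
    rw [hKdef, map_mul, ← superExp_restrict]
    exact congrArg (· * _) (h.radicand_restrict hΛ hWU).symm

/-- The involution makes the brackets of the `G_α` vanish in body on the surface, so `Λ` is
invertible there and, by continuity of its body determinant, on a neighbourhood, to which everything
is restricted. -/
theorem hasOnShellFormula (hE : IsUnit E) (hc : IsPreconnected (constraintSurface ε G)) :
    HasOnShellFormula ε E ρ F G H := by
  set g : Smooth U := ((lambdaMatrix E F G).map (bodyHom (Fin N) (Smooth U))).det
  have hg : ∀ x, g.1 x = ((lambdaMatrix E F G).map (evalBody x)).det := fun x => by
    change Smooth.evalHom x g = _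
    rw [RingHom.map_det]; rfl
  have hWU := Smooth.preimage_le g (isOpen_compl_singleton (x := (0 : ℂ)))
  have hs : constraintSurface ε G ⊆ Smooth.preimage g (isOpen_compl_singleton (x := (0 : ℂ))) := fun x hx => by
    refine ⟨⟨x, hx.1⟩, ?_, rfl⟩
    change g.1 _ ≠ 0
    rw [hg]
    refine det_lambdaMatrix_ne_zero hE h.coord fun α β => ?_
    rw [← bracket_dl, h.involution, map_sum]
    refine Finset.sum_eq_zero fun γ _ => ?_
    rw [map_mul]
    exact mul_eq_zero_of_left (h.evalBody_eq_zero (x := ⟨x, hx.1⟩) hx γ) _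
  refine HasOnShellFormula.of_restrict hWU hs ?_
  have hc' := hc
  rw [← constraintSurface_restrict hWU hs] at hc'
  refine (h.restrictTo hWU).hasOnShellFormula_of_isUnit (isUnit_lambdaMatrix fun x => ?_) hc'
  have := Smooth.apply_mem_of_mem_preimage g (isOpen_compl_singleton (x := (0 : ℂ))) x
  change g.1 _ ≠ 0 at this
  rw [hg] at this
  convert this using 2
  exact congrArg (Matrix.map · (evalBody x)) (lambdaMatrix_restrict hWU E F G)

end IsGaugeSystem

end OnShell
end
end SuperBV

/-! ### From the Quantum Master Equation to the theorem -/

namespace SuperBV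
open Grassmann

theorem exists_isGaugeSystem {N : ℕ} {U : TopologicalSpace.Opens (Fin N → ℝ)} {ε : Fin N → ZMod 2}
    {E : Matrix (Idx N) (Idx N) (SuperFun U)} (hE : IsAntisymplectic E)
    {ρ : SuperFun U} (hρ : HasParity 0 ρ) (hu : IsUnit ρ)
    {X : ℕ → FirstLevel U} (hX : IsEvenAction X) (hQME : QuantumMasterEquation ε E ρ X)
    {G : Fin N → SuperFun U} {H : SuperFun U} {Us : Fin N → Fin N → Fin N → SuperFun U}
    {Vs : Fin N → Fin N → SuperFun U} {Gt : Fin N → SuperFun U}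
    (hexp : HasExpansion ε X G H Us Vs Gt) {F : Fin N → SuperFun U}
    (hFG : IsCoordinateSystem (barGamma ε F G)) :
    ∃ Y, IsGaugeSystem ε E ρ F G H Vs Y ∧ ((∀ α β γ, Us α β γ = 0) → ∀ γ α β, Y γ α β = 0) := by
  have hG : ∀ α, HasParity (ε α) (G α) := fun α => by
    have := hFG.parity (idxG ε α)
    rwa [barGamma_idxG, par_idxG] at this
  have hF : ∀ α, HasParity (ε α + 1) (F α) := fun α => by
    have := hFG.parity (idxF ε α)
    rwa [barGamma_idxF, par_idxF] at this
  obtain ⟨hH, -, Y, hY, h1, h2, h3⟩ := first_level hE hρ hu hX hQME hexp hG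
  refine ⟨Y, ⟨hE.parity, hρ, hu, hFG, hH, hY, h1, fun α γ β => ?_, h2⟩, h3⟩
  exact bracket_bracket isSuperDer_dl hE.parity hE.skew (fun a b c f g k => by
    simp only [bracket_dl]; exact hE.jacobi a b c f g k) (hF α) (hG γ) (hG β)

end SuperBV


theorem mainTheorem1 {N : ℕ} (U : TopologicalSpace.Opens (Fin N → ℝ)) (ε : Fin N → ZMod 2)
    (E : Matrix (Idx N) (Idx N) (SuperFun U)) (hE : IsAntisymplectic E)
    (ρ : SuperFun U) (hρ : Grassmann.HasParity 0 ρ) (hρ_unit : IsUnit ρ)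
    (X : ℕ → FirstLevel U) (hX : IsEvenAction X) (hPl : PlanckConserving ε X)
    (hQME : QuantumMasterEquation ε E ρ X)
    (G : Fin N → SuperFun U) (H : SuperFun U) (Us : Fin N → Fin N → Fin N → SuperFun U)
    (Vs : Fin N → Fin N → SuperFun U) (Gt : Fin N → SuperFun U)
    (hexp : HasExpansion ε X G H Us Vs Gt)
    (F : Fin N → SuperFun U) (hFG : IsCoordinateSystem (barGamma ε F G)) :
    -- on-shell square root formula, in a neighbourhood `W` of the constrained surface
    (IsPreconnected (constraintSurface ε G) →
      ∃ (W : TopologicalSpace.Opens (Fin N → ℝ)) (hW : W ≤ U),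
        constraintSurface ε G ⊆ W ∧
        IsUnit (lambdaMatrix (E.map (restrict hW)) (fun α => restrict hW (F α))
          (fun α => restrict hW (G α))) ∧
        ∃ (L : SuperFun W) (A : Fin N → SuperFun W) (c : ℂ),
          IsLogSqrt L (radicand ε (E.map (restrict hW)) (restrict hW ρ)
            (fun α => restrict hW (F α)) (fun α => restrict hW (G α))) ∧
          restrict hW H = -L + ∑ α, restrict hW (G α) * A α + c • (1 : SuperFun W)) ∧
    -- the constant may be discarded
    (∀ c : ℂ, QuantumMasterEquation ε E ρ (shiftH X c)) ∧
    -- off-shell formula in the Abelian case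
    ((∀ α β γ, Us α β γ = 0) →
      ∀ V : TopologicalSpace.Opens (Fin N → ℝ),
        (V : Set (Fin N → ℝ)) = Set.range (bodyMap (barGamma ε F G)) →
        (∀ y ∈ V, ∀ t ∈ Set.Icc (0 : ℝ) 1, (fun α => if ε α = 0 then y α else t * y α) ∈ V) →
        IsUnit (lambdaMatrix E F G) ∧
        ∀ L : SuperFun U, IsLogSqrt L (radicand ε E ρ F G) →
          ∃ M : Fin N → Fin N → SuperFun V,
            (∀ α γ, pullback (barGamma ε F G) (M α γ) =
              ∑ β, Vs α β * Ring.inverse (lambdaMatrix E F G) β γ) ∧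
            ∃ H₀ : SuperFun U,
              H₀ = -L - ∑ α, ∑ γ,
                G α * pullback (barGamma ε F G) (integralScaleF ε (M α γ)) * F γ ∧
              (∃ k : SuperFun V, (∀ α, dl (idxF ε α) k = 0) ∧
                H = H₀ + pullback (barGamma ε F G) k) ∧
              (∀ β, oddLaplacian id dl E ρ (G β) - antibracket E H₀ (G β) =
                ∑ α, G α * Vs α β)) := by
  obtain ⟨Y, h, hY⟩ := exists_isGaugeSystem hE hρ hρ_unit hX hQME hexp hFG
  exact ⟨h.hasOnShellFormula hE.nondegenerate, quantumMasterEquation_shiftH hQME,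
    fun hU _ hr hV => h.abelian (hY hU) hE.nondegenerate hr hV⟩
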